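/- **Setting.** Let $N\ge 1$. For $k=1,\dots,N$ the $k$-th reservoir has one-particle space $\mathfrak K_k$ and positive self-adjoint Hamiltonian $h_{0,k}$ of one of two kinds: either $\mathfrak K_k=L^2(\mathbb R^{d})$ with $d\ge 3$ ($d$ may depend on $k$) and $h_{0,k}$ is multiplication by $|p|^2/2$; or $\mathfrak K_k=\ell^2(VG_k)$ and $h_{0,k}=\|A_{G_k}\|\mathbf 1-A_{G_k}$, where $A_{G_k}$ is the adjacency operator of a connected undirected simple graph $G_k$ with countably infinitely many vertices and bounded degree. Let $v_k$ be a Perron–Frobenius weight: in the first case $\langle v_k,\psi\rangle=\psi(0)$ on the domain $\mathcal D(v_k)$ of those $\psi\in L^2$ that agree almost everywhere with a function continuous at $0$; in the second case a strictly positive function on $VG_k$ with $\sum_{y\sim x}v_k(y)=\mathrm{spr}(A_{G_k})v_k(x)$ for all $x$, $\mathcal D(v_k)=\{\psi:\sum_x v_k(x)|\psi(x)|<\infty\}$ and $\langle v_k,\psi\rangle=\sum_x v_k(x)\psi(x)$. Let $E_k$ be the spectral measure and $\sigma_k$ the spectrum of $h_{0,k}$. Let $\Omega,\lambda>0$, $\beta_k>0$,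 $\mu_k\le 0$, let $g_k\in\mathfrak K_k$ lie in the domain of $h_{0,k}$, and let $\Theta_k:\mathbb C\to\mathbb R$ be real linear with $\Theta_k=0$ if $\mu_k<0$. On $\mathcal K=\mathbb C\oplus\bigoplus_k\mathfrak K_k$ let $$h(c,\psi_1,\dots,\psi_N)=\Bigl(\Omega c+\lambda\sum_k\langle g_k,\psi_k\rangle,\;(h_{0,k}\psi_k+\lambda c\,g_k)_k\Bigr).$$ Write $(c)=(c,0,\dots,0)$ and $(\psi_l)$ for the vector whose only non-zero entry is $\psi_l$ in the $l$-th reservoir. Let $W(f)=e^{i\Psi(f)}$, with $W(f)W(f')=e^{-\frac i2\operatorname{Im}\langle f,f'\rangle}W(f+f')$, be the Weyl operators over the space $\mathcal D$ of all $f=(c,\psi)$ with $\psi_k\in\mathcal D(v_k)\cap\mathcal D((e^{\beta_kh_{0,k}}-1)^{-1/2})$ for all $k$; let $\alpha_t(W(f))=W(e^{ith}f)$, and let $\omega_0$ be the product state $$\omega_0(W(f))=\chi(c)\prod_{k}\exp\Bigl(-\tfrac12\langle\psi_k,(\mathcal N_k(h_{0,k})+\tfrac12)\psi_k\rangle+i\Theta_k(\langle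 v_k,\psi_k\rangle)\Bigr),\qquad \mathcal N_k(x)=\frac1{e^{\beta_k(x-\mu_k)}-1},$$ where $\chi(c)=\omega_0(W((c)))$ is given by a regular state of the Weyl algebra over $\mathbb C$ (that is, $\chi$ is continuous). A *NESS* is a weak-$*$ limit point $\omega_+$, as $T\to\infty$, of $\frac1T\int_0^T\omega_0\circ\alpha_t\,dt$. Assume: * (A) $\sup_{\nu\in\mathbb R,\varepsilon>0}|\langle g_k,(\nu-h_{0,k}\pm i\varepsilon)^{-1}g_k\rangle|<\infty$ for every $k$; * (B) with $\eta(z)=z-\Omega-\lambda^2\sum_k\int\frac{1}{z-\nu}\,d\langle g_k,E_k(\nu)g_k\rangle$, the limits $\eta_\pm(x)=\lim_{\varepsilon\downarrow0}\eta(x\pm i\varepsilon)$ exist for almost every $x\in\mathbb R$ and $1/\eta_+\in L^\infty(\mathbb R)$; * (D) $g_k\in\mathcal D(v_k)\cap\mathcal D((e^{\beta_kh_{0,k}}-1)^{-1/2})$ for every $k$. With $a(f)=\frac1{\sqrt2}(\Psi(f)+i\Psi(if))$ and $a^\dagger(f)=\frac1{\sqrt2}(\Psi(f)-i\Psi(if))$,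 the particle and energy currents are $$J_l=i\lambda a((1))a^\dagger((g_l))-i\lambda a((g_l))a^\dagger((1)),\qquad E_l=i\lambda a((1))a^\dagger((h_{0,l}g_l))-i\lambda a((h_{0,l}g_l))a^\dagger((1)),$$ and the mean entropy production rate is $Ep(\omega_+)=\omega_+(\sigma)$, $\sigma=-\sum_l\beta_l(E_l-\mu_lJ_l)$, where $\omega_+(\Psi(f)\Psi(f'))=-\partial_s\partial_t\,\omega_+(W(sf)W(tf'))|_{s=t=0}$. The channel $k\to l$ is *open* if $$\Bigl\{\nu\in\sigma_k\cap\sigma_l:\ \frac1{|\eta_-(\nu)|^2}\,\frac{d\langle g_k,E_k(\nu)g_k\rangle}{d\nu}\,\frac{d\langle g_l,E_l(\nu)g_l\rangle}{d\nu}>0\Bigr\}$$ has positive Lebesgue measure. **Theorem.** Let $\omega_+$ be a NESS. If for some $k,l\in\{1,\dots,N\}$ the channel $k\to l$ is open and $\beta_k\ne\beta_l$ or $\mu_k\ne\mu_l$, then $Ep(\omega_+)$ exists and $Ep(\omega_+)>0$. -/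

import Mathlib

open MeasureTheory Filter Topology ComplexConjugate
open scoped ENNReal

noncomputable section

namespace Josephson

/-! ### Unbounded operators, resolvents, unitary groups -/

section Operators

variable {H : Type*} [NormedAddCommGroup H] [InnerProductSpace ℂ H]

/-- The real part of the spectrum of a (possibly unbounded) operator `h`: the real `ν` for which
`ν - h` has no bounded everywhere defined two-sided inverse. For a self-adjoint `h` this is the
whole spectrum. -/
def realSpectrum (h : H →ₗ.[ℂ] H) : Set ℝ :=
  {ν | ¬ ∃ B : H →L[ℂ] H,
    (∀ x : h.domain, B ((ν : ℂ) • (x : H) - h x) = x) ∧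
    ∀ y : H, ∃ x : h.domain, (x : H) = B y ∧ (ν : ℂ) • (x : H) - h x = y}

/-- `sup |⟪ψ, (ν - h ± iε)⁻¹ ξ⟫| < ∞`, the supremum over `ν ∈ ℝ`, `ε > 0` and both signs. With
`z = ν ± iε`, the vector `(z - h)⁻¹ ξ` is the `x` in the domain of `h` with `z x - h x = ξ`. -/
def HasAbs (h : H →ₗ.[ℂ] H) (ψ ξ : H) : Prop :=
  ∃ C : ℝ, ∀ z : ℂ, z.im ≠ 0 → ∀ x : h.domain, z • (x : H) - h x = ξ → ‖inner ℂ ψ (x : H)‖ ≤ C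

/-- `U t = exp(i t h)`: a strongly continuous one-parameter unitary group whose generator
extends `i h`. For a self-adjoint `h` there is exactly one such `U`. -/
structure IsUnitaryGroupOf (h : H →ₗ.[ℂ] H) (U : ℝ → H →L[ℂ] H) : Prop where
  zero : U 0 = ContinuousLinearMap.id ℂ H
  add : ∀ s t, U (s + t) = (U s).comp (U t)
  norm_map : ∀ t x, ‖U t x‖ = ‖x‖
  continuous : ∀ x, Continuous fun t => U t x
  hasDerivAt : ∀ x : h.domain, HasDerivAt (fun t => U t (x : H)) (Complex.I • h x) 0

/-- For a bounded self-adjoint `T`, the positive functional `u ↦ ⟪ψ, u(T) ψ⟫` on `C_c(ℝ)`. -/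
def spectralFunctional [CompleteSpace H] (T : H →L[ℂ] H) (ψ : H) :
    CompactlySupportedContinuousMap ℝ ℝ →ₚ[ℝ] ℝ :=
  PositiveLinearMap.mk₀
    { toFun := fun u => (inner ℂ ψ (cfc (u : ℝ → ℝ) T ψ)).re
      map_add' := by
        intro u w
        have : cfc (fun x => u x + w x) T = cfc (u : ℝ → ℝ) T + cfc (w : ℝ → ℝ) T :=
          cfc_add T (u : ℝ → ℝ) (w : ℝ → ℝ) u.continuous.continuousOn w.continuous.continuousOn
        change (inner ℂ ψ (cfc (fun x => u x + w x) T ψ)).re = _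
        rw [this, add_apply, inner_add_right, Complex.add_re]
      map_smul' := by
        intro c u
        have : cfc (fun x => c • u x) T = c • cfc (u : ℝ → ℝ) T :=
          cfc_smul c (u : ℝ → ℝ) T u.continuous.continuousOn
        change (inner ℂ ψ (cfc (fun x => c • u x) T ψ)).re = _
        rw [this, smul_apply, inner_smul_right_eq_smul, Complex.smul_re]
        rfl }
    (by
      intro u hu
      have : 0 ≤ cfc (u : ℝ → ℝ) T := cfc_nonneg fun x _ => hu x
      rw [ContinuousLinearMap.nonneg_iff_isPositive] at this
      exact this.re_inner_nonneg_right ψ)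

end Operators

/-! ### Weyl algebra: states through their generating functionals -/

section Weyl

variable {H : Type*} [NormedAddCommGroup H] [InnerProductSpace ℂ H]

/-- Given `ω(f) = ω(W(f))`, this is `ω(W(f) W(g)) = e^{-iσ(f,g)/2} ω(W(f + g))`,
`σ(f,g) = Im ⟪f, g⟫`. -/
def weylPair (ω : H → ℂ) (f g : H) : ℂ :=
  Complex.exp (-(Complex.I * ((inner ℂ f g : ℂ).im : ℂ) / 2)) * ω (f + g)

/-- `f ↦ ω(W(f))` is the generating functional of a state of the Weyl CCR algebra over `H`:
`ω(1) = 1` and `ω(Q* Q) ≥ 0` for every `Q = ∑ c_i W(f_i)`. -/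
def IsWeylState (ω : H → ℂ) : Prop :=
  ω 0 = 1 ∧ ∀ (n : ℕ) (c : Fin n → ℂ) (f : Fin n → H),
    ∃ r : ℝ, 0 ≤ r ∧ ∑ i, ∑ j, conj (c i) * c j * weylPair ω (-f i) (f j) = (r : ℂ)

/-- `ω(Ψ(f) Ψ(g)) = A`, where `W(f) = exp(i Ψ(f))`, i.e.
`∂_s ∂_t ω(W(s f) W(t g)) = -A` at `s = t = 0` (the derivatives exist). -/
def HasFieldCorrelation (ω : H → ℂ) (f g : H) (A : ℂ) : Prop :=
  ∃ d : ℝ → ℂ,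
    (∀ s : ℝ, HasDerivAt (fun t : ℝ => weylPair ω ((s : ℂ) • f) ((t : ℂ) • g)) (d s) 0) ∧
    HasDerivAt d (-A) 0

/-- `ω(a(f) a†(g)) = A`, where `a(f) = (Ψ(f) + iΨ(if))/√2` and `a†(g) = (Ψ(g) - iΨ(ig))/√2`. -/
def HasAnnihilationCreation (ω : H → ℂ) (f g : H) (A : ℂ) : Prop :=
  ∃ A₁ A₂ A₃ A₄ : ℂ,
    HasFieldCorrelation ω f g A₁ ∧
    HasFieldCorrelation ω f (Complex.I • g) A₂ ∧
    HasFieldCorrelation ω (Complex.I • f) g A₃ ∧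
    HasFieldCorrelation ω (Complex.I • f) (Complex.I • g) A₄ ∧
    A = (A₁ - Complex.I * A₂ + Complex.I * A₃ + A₄) / 2

end Weyl

/-! ### Reservoirs on `ℝ^d` -/

section Euclidean

/-- `L²(ℝ^d)` in the momentum variable. -/
abbrev L2 (d : ℕ) : Type := Lp ℂ 2 (volume : Measure (EuclideanSpace ℝ (Fin d)))

/-- The maximal domain of the multiplication by `|p|²/2`. -/
def kineticDomain (d : ℕ) : Submodule ℂ (L2 d) where
  carrier := {ψ | MemLp (fun p => ((‖p‖ ^ 2 / 2 : ℝ) : ℂ) * ψ p) 2 volume}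
  zero_mem' := by
    refine (memLp_congr_ae ?_).2 (MemLp.zero (ε := ℂ))
    filter_upwards [Lp.coeFn_zero ℂ 2 (volume : Measure (EuclideanSpace ℝ (Fin d)))] with p hp
    rw [hp, Pi.zero_apply, mul_zero]
  add_mem' := by
    intro a b ha hb
    refine (memLp_congr_ae ?_).2 (MemLp.add ha hb)
    filter_upwards [Lp.coeFn_add a b] with p hp
    simp only [hp, Pi.add_apply, mul_add]
  smul_mem' := by
    intro c a ha
    refine (memLp_congr_ae ?_).2 (MemLp.const_smul ha c)
    filter_upwards [Lp.coeFn_smul c a] with p hp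
    simp only [hp, Pi.smul_apply, smul_eq_mul]
    ring

theorem kineticDomain_memLp {d : ℕ} (ψ : kineticDomain d) :
    MemLp (fun p => ((‖p‖ ^ 2 / 2 : ℝ) : ℂ) * (ψ : L2 d) p) 2 volume := ψ.2

/-- Multiplication by `|p|²/2` on its maximal domain. -/
def kinetic (d : ℕ) : L2 d →ₗ.[ℂ] L2 d where
  domain := kineticDomain d
  toFun :=
    { toFun := fun ψ => (kineticDomain_memLp ψ).toLp
      map_add' := by
        intro a b
        rw [← MemLp.toLp_add, MemLp.toLp_eq_toLp_iff]
        filter_upwards [Lp.coeFn_add (a : L2 d) (b : L2 d)] with p hp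
        rw [Submodule.coe_add, hp, Pi.add_apply, Pi.add_apply, mul_add]
      map_smul' := by
        intro c a
        rw [RingHom.id_apply, ← MemLp.toLp_const_smul, MemLp.toLp_eq_toLp_iff]
        filter_upwards [Lp.coeFn_smul c (a : L2 d)] with p hp
        rw [Submodule.coe_smul, hp, Pi.smul_apply, Pi.smul_apply, smul_eq_mul, smul_eq_mul]
        ring }

/-- The measure `⟪ψ, E(·) ψ⟫` of the multiplication operator by `|p|²/2`. -/
def kineticMeasure (d : ℕ) (ψ : L2 d) : Measure ℝ :=
  ((volume : Measure (EuclideanSpace ℝ (Fin d))).withDensity fun p => ‖ψ p‖ₑ ^ 2).map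
    fun p => ‖p‖ ^ 2 / 2

end Euclidean

/-! ### Reservoirs on graphs -/

section Graph

/-- `ℓ²(V)`. -/
abbrev ell2 (V : Type) : Type := lp (fun _ : V => ℂ) 2

variable {V : Type}

theorem adjacency_sum_le (G : SimpleGraph V) [G.LocallyFinite] {D : ℕ}
    (hD : ∀ x, G.degree x ≤ D) (ψ : ell2 V) (s : Finset V) :
    ∑ x ∈ s, ‖∑ y ∈ G.neighborFinset x, ψ y‖ ^ (2 : ℝ≥0∞).toReal
      ≤ (D * ‖ψ‖) ^ (2 : ℝ≥0∞).toReal := by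
  classical
  simp only [ENNReal.toReal_ofNat, Real.rpow_ofNat]
  have h1 : ∀ x, ‖∑ y ∈ G.neighborFinset x, ψ y‖ ^ 2
      ≤ D * ∑ y ∈ G.neighborFinset x, ‖ψ y‖ ^ 2 := by
    intro x
    calc ‖∑ y ∈ G.neighborFinset x, ψ y‖ ^ 2
        ≤ (∑ y ∈ G.neighborFinset x, ‖ψ y‖) ^ 2 := by gcongr; exact norm_sum_le _ _
      _ ≤ (G.neighborFinset x).card * ∑ y ∈ G.neighborFinset x, ‖ψ y‖ ^ 2 :=
          sq_sum_le_card_mul_sum_sq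
      _ ≤ D * ∑ y ∈ G.neighborFinset x, ‖ψ y‖ ^ 2 := by
          gcongr
          exact_mod_cast hD x
  have h2 : ∑ x ∈ s, ∑ y ∈ G.neighborFinset x, ‖ψ y‖ ^ 2 ≤ D * ‖ψ‖ ^ 2 := by
    have hcomm : ∑ x ∈ s, ∑ y ∈ G.neighborFinset x, ‖ψ y‖ ^ 2
        = ∑ y ∈ s.biUnion (fun x => G.neighborFinset x),
            ∑ x ∈ s.filter (fun x => G.Adj y x), ‖ψ y‖ ^ 2 := by
      refine Finset.sum_comm' ?_
      intro x y
      simp only [SimpleGraph.mem_neighborFinset, Finset.mem_filter, Finset.mem_biUnion]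
      constructor
      · rintro ⟨hx, hxy⟩
        exact ⟨⟨hx, hxy.symm⟩, x, hx, hxy⟩
      · rintro ⟨⟨hx, hxy⟩, -⟩
        exact ⟨hx, hxy.symm⟩
    rw [hcomm]
    calc ∑ y ∈ s.biUnion (fun x => G.neighborFinset x),
            ∑ x ∈ s.filter (fun x => G.Adj y x), ‖ψ y‖ ^ 2
        ≤ ∑ y ∈ s.biUnion (fun x => G.neighborFinset x), D * ‖ψ y‖ ^ 2 := by
          refine Finset.sum_le_sum fun y _ => ?_
          rw [Finset.sum_const, nsmul_eq_mul]
          gcongr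
          refine le_trans (Finset.card_le_card ?_) (hD y)
          intro x hx
          simpa using (Finset.mem_filter.1 hx).2
      _ = D * ∑ y ∈ s.biUnion (fun x => G.neighborFinset x), ‖ψ y‖ ^ 2 := by
          rw [Finset.mul_sum]
      _ ≤ D * ‖ψ‖ ^ 2 := by
          gcongr
          have := lp.sum_rpow_le_norm_rpow (p := 2) (by norm_num) ψ
            (s.biUnion (fun x => G.neighborFinset x))
          simpa using this
  calc ∑ x ∈ s, ‖∑ y ∈ G.neighborFinset x, ψ y‖ ^ 2
      ≤ ∑ x ∈ s, D * ∑ y ∈ G.neighborFinset x, ‖ψ y‖ ^ 2 := Finset.sum_le_sum fun x _ => h1 x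
    _ = D * ∑ x ∈ s, ∑ y ∈ G.neighborFinset x, ‖ψ y‖ ^ 2 := by rw [Finset.mul_sum]
    _ ≤ D * (D * ‖ψ‖ ^ 2) := by gcongr
    _ = (D * ‖ψ‖) ^ 2 := by ring

/-- The adjacency operator `(A_G ψ)(x) = ∑_{y ∼ x} ψ(y)` of a graph with bounded degree. -/
def adjacencyOp (G : SimpleGraph V) [G.LocallyFinite] (hG : ∃ D : ℕ, ∀ x, G.degree x ≤ D) :
    ell2 V →L[ℂ] ell2 V :=
  LinearMap.mkContinuousOfExistsBound
    { toFun := fun ψ => ⟨fun x => ∑ y ∈ G.neighborFinset x, ψ y,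
        memℓp_gen' (adjacency_sum_le G hG.choose_spec ψ)⟩
      map_add' := by
        intro a b
        ext x
        exact Finset.sum_add_distrib
      map_smul' := by
        intro c a
        ext x
        simp [Finset.mul_sum] }
    ⟨(hG.choose : ℝ), fun ψ => lp.norm_le_of_forall_sum_le (by norm_num) (by positivity)
      (adjacency_sum_le G hG.choose_spec ψ)⟩

end Graph

/-- A graph carrying a reservoir: undirected, connected, simple, with countably infinitely many
vertices and bounded degree, together with a Perron-Frobenius weight for its adjacency operator. -/
structure GraphData where
  V : Type
  [countable : Countable V]
  [infinite : Infinite V]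
  G : SimpleGraph V
  [locallyFinite : G.LocallyFinite]
  connected : G.Connected
  bounded_degree : ∃ D : ℕ, ∀ x, G.degree x ≤ D
  v : V → ℝ
  v_pos : ∀ x, 0 < v x
  v_eigen : ∀ x, ∑ y ∈ G.neighborFinset x, v y
    = (spectralRadius ℂ (adjacencyOp G bounded_degree)).toReal * v x

namespace GraphData

attribute [instance] GraphData.locallyFinite

/-- The adjacency operator `A_G`. -/
def adj (X : GraphData) : ell2 X.V →L[ℂ] ell2 X.V := adjacencyOp X.G X.bounded_degree

/-- `‖A_G‖ 1 - A_G`. -/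
def ham (X : GraphData) : ell2 X.V →L[ℂ] ell2 X.V :=
  (‖X.adj‖ : ℂ) • ContinuousLinearMap.id ℂ (ell2 X.V) - X.adj

end GraphData

/-- The reservoirs of the model: free bosons on `ℝ^d`, `d ≥ 3`, or on a graph. -/
inductive Reservoir : Type 1
  | euclidean (d : ℕ) (hd : 3 ≤ d) : Reservoir
  | graph (X : GraphData) : Reservoir

namespace Reservoir

/-- The one-particle Hilbert space. -/
def Space : Reservoir → Type
  | euclidean d _ => L2 d
  | graph X => ell2 X.V

instance instNormedAddCommGroup : (R : Reservoir) → NormedAddCommGroup R.Space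
  | euclidean d _ => inferInstanceAs (NormedAddCommGroup (L2 d))
  | graph X => inferInstanceAs (NormedAddCommGroup (ell2 X.V))

instance instInnerProductSpace : (R : Reservoir) → InnerProductSpace ℂ R.Space
  | euclidean d _ => inferInstanceAs (InnerProductSpace ℂ (L2 d))
  | graph X => inferInstanceAs (InnerProductSpace ℂ (ell2 X.V))

instance instCompleteSpace : (R : Reservoir) → CompleteSpace R.Space
  | euclidean d _ => inferInstanceAs (CompleteSpace (L2 d))
  | graph X => inferInstanceAs (CompleteSpace (ell2 X.V))

/-- The one-particle Hamiltonian. -/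
def ham : (R : Reservoir) → R.Space →ₗ.[ℂ] R.Space
  | euclidean d _ => kinetic d
  | graph X => (X.ham : ell2 X.V →ₗ[ℂ] ell2 X.V).toPMap ⊤

/-- The measure `⟪ψ, E(·) ψ⟫`, with `E` the spectral measure of the one-particle Hamiltonian.
In the graph case it represents `u ↦ ⟪ψ, u(h) ψ⟫` on `C_c(ℝ)`. -/
def specMeasure : (R : Reservoir) → R.Space → Measure ℝ
  | euclidean d _ => kineticMeasure d
  | graph X => fun ψ => RealRMK.rieszMeasure (spectralFunctional X.ham ψ)

/-- The domain of the PF weight. For the Dirac delta on `L²(ℝ^d)`: the `ψ` that have an (essential)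
limit at the origin, i.e. agree almost everywhere with a function continuous at `0`. -/
def weightDomain : (R : Reservoir) → Set R.Space
  | euclidean d _ => {ψ : L2 d | ∃ a : ℂ, Tendsto (fun p => ψ p) (𝓝 0 ⊓ ae volume) (𝓝 a)}
  | graph X => {ψ : ell2 X.V | Summable fun x => X.v x * ‖ψ x‖}

/-- The pairing `⟪v, ψ⟫` with the PF weight: `ψ(0)` on `L²(ℝ^d)`, `∑ v(x) ψ(x)` on a graph. -/
def weight : (R : Reservoir) → R.Space → ℂ
  | euclidean d _ => fun ψ : L2 d => limUnder (𝓝 0 ⊓ ae volume) fun p => ψ p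
  | graph X => fun ψ : ell2 X.V => ∑' x, (X.v x : ℂ) * ψ x

/-- The domain of `(e^{β h} - 1)^{-1/2}`. (The integrand is `∞` at `ν = 0`, so an atom of the
measure at `0` is excluded.) -/
def boseDomain (R : Reservoir) (β : ℝ) : Set R.Space :=
  {ψ | ∫⁻ ν, (ENNReal.ofReal (Real.exp (β * ν) - 1))⁻¹ ∂(R.specMeasure ψ) < ∞}

end Reservoir

/-- The Planck distribution `(e^{β(x - μ)} - 1)⁻¹`. -/
def planck (β μ x : ℝ) : ℝ := (Real.exp (β * (x - μ)) - 1)⁻¹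

/-- The data of the coupled model: a quantum particle and `N` bosonic reservoirs. -/
structure Model (N : ℕ) where
  /-- the reservoirs -/
  res : Fin N → Reservoir
  /-- the energy of the particle -/
  Ω : ℝ
  Ω_pos : 0 < Ω
  /-- the coupling constant -/
  coupling : ℝ
  coupling_pos : 0 < coupling
  /-- the form factors; they lie in the domains of the Hamiltonians, so that the energy
  currents are meaningful -/
  g : (k : Fin N) → (res k).Space
  g_mem : ∀ k, g k ∈ (res k).ham.domain
  /-- inverse temperatures -/
  β : Fin N → ℝ
  β_pos : ∀ k, 0 < β k
  /-- chemical potentials -/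
  μ : Fin N → ℝ
  μ_nonpos : ∀ k, μ k ≤ 0
  /-- the phases of the condensates -/
  Θ : Fin N → (ℂ →ₗ[ℝ] ℝ)
  Θ_eq_zero : ∀ k, μ k < 0 → Θ k = 0
  /-- `c ↦ ω₀(W((c)))`, the initial state of the particle -/
  χ : ℂ → ℂ
  χ_state : IsWeylState χ
  χ_regular : Continuous χ

namespace Model

variable {N : ℕ} (M : Model N)

/-- `𝒦 = ℂ ⊕ ⨁ 𝔎_k`. -/
abbrev Space : Type := WithLp 2 (ℂ × PiLp 2 fun k => (M.res k).Space)

/-- The vector `ᵗ(c, ψ_1, …, ψ_N)`. -/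
def vec (c : ℂ) (ψ : (k : Fin N) → (M.res k).Space) : M.Space :=
  WithLp.toLp 2 (c, WithLp.toLp 2 ψ)

/-- The component in `ℂ`. -/
def fst (f : M.Space) : ℂ := (WithLp.ofLp f).1

/-- The component in the `k`-th reservoir. -/
def comp (f : M.Space) (k : Fin N) : (M.res k).Space := (WithLp.ofLp f).2 k

/-- `(c) = ᵗ(c, 0, …, 0)`. -/
def atom (c : ℂ) : M.Space := M.vec c 0

/-- `(ψ_l) = ᵗ(0, …, 0, ψ_l, 0, …, 0)`. -/
def single (l : Fin N) (ψ : (M.res l).Space) : M.Space := M.vec 0 (Pi.single l ψ)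

/-- The coupled one-particle Hamiltonian
`h ᵗ(c, ψ) = ᵗ(Ω c + λ ∑ ⟪g_k, ψ_k⟫, h_{0,k} ψ_k + λ c g_k)`. -/
def ham : M.Space →ₗ.[ℂ] M.Space where
  domain :=
    { carrier := {f | ∀ k, M.comp f k ∈ (M.res k).ham.domain}
      zero_mem' := fun k => (M.res k).ham.domain.zero_mem
      add_mem' := fun ha hb k => (M.res k).ham.domain.add_mem (ha k) (hb k)
      smul_mem' := fun c _ ha k => (M.res k).ham.domain.smul_mem c (ha k) }
  toFun :=
    { toFun := fun f => M.vec
        (M.Ω * M.fst f + M.coupling * ∑ k, inner ℂ (M.g k) (M.comp f k))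
        (fun k => (M.res k).ham ⟨M.comp f k, f.2 k⟩ + ((M.coupling : ℂ) * M.fst f) • M.g k)
      map_add' := by
        rintro ⟨a, ha⟩ ⟨b, hb⟩
        have hc : ∀ k, M.comp (a + b) k = M.comp a k + M.comp b k := fun k => rfl
        have hf : M.fst (a + b) = M.fst a + M.fst b := rfl
        have hh : ∀ k (hab : M.comp (a + b) k ∈ (M.res k).ham.domain),
            (M.res k).ham ⟨M.comp (a + b) k, hab⟩
              = (M.res k).ham ⟨M.comp a k, ha k⟩ + (M.res k).ham ⟨M.comp b k, hb k⟩ :=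
          fun k _ => (M.res k).ham.map_add ⟨M.comp a k, ha k⟩ ⟨M.comp b k, hb k⟩
        have hv : ∀ c c' ψ ψ', M.vec c ψ + M.vec c' ψ' = M.vec (c + c') (ψ + ψ') :=
          fun _ _ _ _ => rfl
        rw [hv]
        congr 1
        · simp only [AddMemClass.mk_add_mk, hc, hf, inner_add_right,
            Finset.sum_add_distrib]
          ring
        · funext k
          simp only [AddMemClass.mk_add_mk, hf, Pi.add_apply]
          rw [hh, mul_add, add_smul]
          abel
      map_smul' := by
        rintro c ⟨a, ha⟩
        have hc : ∀ k, M.comp (c • a) k = c • M.comp a k := fun k => rfl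
        have hf : M.fst (c • a) = c * M.fst a := rfl
        have hh : ∀ k (hab : M.comp (c • a) k ∈ (M.res k).ham.domain),
            (M.res k).ham ⟨M.comp (c • a) k, hab⟩ = c • (M.res k).ham ⟨M.comp a k, ha k⟩ :=
          fun k _ => (M.res k).ham.map_smul c ⟨M.comp a k, ha k⟩
        have hv : ∀ d ψ, c • M.vec d ψ = M.vec (c * d) (c • ψ) := fun _ _ => rfl
        rw [RingHom.id_apply, hv]
        congr 1
        · simp only [SetLike.mk_smul_mk, hc, hf, inner_smul_right, ← Finset.mul_sum]
          ring
        · funext k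
          simp only [SetLike.mk_smul_mk, hf, Pi.smul_apply]
          rw [hh, smul_add, smul_smul]
          congr 2
          ring }

/-- The measure `⟪g_k, E_k(·) g_k⟫`. -/
def formMeasure (k : Fin N) : Measure ℝ := (M.res k).specMeasure (M.g k)

/-- `η(z) = z - Ω - λ² ∫ (z - ν)⁻¹ d⟪g, E_0(ν) g⟫`; the measure is `∑_k ⟪g_k, E_k(·) g_k⟫`. -/
def eta (z : ℂ) : ℂ :=
  z - M.Ω - (M.coupling : ℂ) ^ 2 * ∑ k, ∫ ν, (z - (ν : ℂ))⁻¹ ∂(M.formMeasure k)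

/-- `η_-(x) = lim_{ε ↓ 0} η(x - iε)`. -/
def etaMinus (x : ℝ) : ℂ := limUnder (𝓝[>] (0 : ℝ)) fun ε => M.eta (x - ε * Complex.I)

/-- The density `d⟪g_k, E_k(ν) g_k⟫ / dν`. -/
def formDensity (k : Fin N) (ν : ℝ) : ℝ := ((M.formMeasure k).rnDeriv volume ν).toReal

/-- The form factor `(g, g)` has condition (Abs). -/
def CondA : Prop := ∀ k, HasAbs (M.res k).ham (M.g k) (M.g k)

/-- `1 / η_+ ∈ L^∞(ℝ)`: for almost every `x`, the limit `η_+(x) = lim_{ε ↓ 0} η(x + iε)` exists and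
is bounded away from zero, uniformly in `x`. -/
def CondB : Prop := ∃ c : ℝ, 0 < c ∧ ∀ᵐ x : ℝ, ∃ w : ℂ,
  Tendsto (fun ε : ℝ => M.eta (x + ε * Complex.I)) (𝓝[>] 0) (𝓝 w) ∧ c ≤ ‖w‖

/-- The form factors lie in the domains of the PF weights and of `(e^{β_k h_{0,k}} - 1)^{-1/2}`. -/
def CondD : Prop :=
  ∀ k, M.g k ∈ (M.res k).weightDomain ∩ (M.res k).boseDomain (M.β k)

/-- The vectors `f` whose Weyl operators generate the algebra of observables. -/
def testSpace : Set M.Space :=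
  {f | ∀ k, M.comp f k ∈ (M.res k).weightDomain ∩ (M.res k).boseDomain (M.β k)}

/-- The initial state `ω₀(W(f))`, a product of a state of the particle and of equilibrium states
`exp(-⟪ψ_k, (𝒩_k(h_{0,k}) + 1/2) ψ_k⟫ / 2) e^{iΘ_k(⟪v_k, ψ_k⟫)}` of the reservoirs. -/
def initialState (f : M.Space) : ℂ :=
  M.χ (M.fst f) * ∏ k,
    (Complex.exp (-(1 / 2 : ℂ) *
        ((∫ ν, (planck (M.β k) (M.μ k) ν + 1 / 2) ∂((M.res k).specMeasure (M.comp f k)) : ℝ) : ℂ)) *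
      Complex.exp (Complex.I * (M.Θ k ((M.res k).weight (M.comp f k)) : ℝ)))

/-- `ω` is a NESS: a weak-* limit point, as `T → ∞`, of `T⁻¹ ∫_0^T ω₀ ∘ α_t dt`, where
`α_t(W(f)) = W(U t f)` with `U t = e^{ith}`. -/
def IsNESS (U : ℝ → M.Space →L[ℂ] M.Space) (ω : M.Space → ℂ) : Prop :=
  ∃ F : Filter ℝ, F.NeBot ∧ F ≤ atTop ∧ ∀ f ∈ M.testSpace,
    Tendsto (fun T : ℝ => (T : ℂ)⁻¹ * ∫ t in (0 : ℝ)..T, M.initialState (U t f)) F (𝓝 (ω f))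

/-- The expectation in `ω` of `iλ a((1)) a†((ξ)) - iλ a((ξ)) a†((1))`, `ξ` in the `l`-th
reservoir, exists and equals `j`. -/
def HasCurrent (ω : M.Space → ℂ) (l : Fin N) (ξ : (M.res l).Space) (j : ℂ) : Prop :=
  ∃ A B : ℂ, HasAnnihilationCreation ω (M.atom 1) (M.single l ξ) A ∧
    HasAnnihilationCreation ω (M.single l ξ) (M.atom 1) B ∧
    j = Complex.I * M.coupling * A - Complex.I * M.coupling * B

/-- `Ep(ω) = ω(σ) = e`, where `σ = -∑ β_l (E_l - μ_l J_l)`, with the particle current `J_l`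
(`ξ = g_l`) and the energy current `E_l` (`ξ = h_{0,l} g_l`) out of the `l`-th reservoir. -/
def HasEntropyProduction (ω : M.Space → ℂ) (e : ℝ) : Prop :=
  ∃ J E : Fin N → ℂ,
    (∀ l, M.HasCurrent ω l (M.g l) (J l)) ∧
    (∀ l, M.HasCurrent ω l ((M.res l).ham ⟨M.g l, M.g_mem l⟩) (E l)) ∧
    (e : ℂ) = -∑ l, (M.β l : ℂ) * (E l - M.μ l * J l)

/-- The channel `k → l` is open. -/
def OpenChannel (k l : Fin N) : Prop :=
  0 < volume {ν : ℝ | ν ∈ realSpectrum (M.res k).ham ∩ realSpectrum (M.res l).ham ∧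
    0 < 1 / ‖M.etaMinus ν‖ ^ 2 * M.formDensity k ν * M.formDensity l ν}

end Model

end Josephson

end

/-! For vectors f = (c, (a_k g_k + b_k h_{0,k} g_k)_k) the orbit e^{ith}f is explicit up to one
scalar function, the particle amplitude c(t). In the spectral representation generated by g_k the
k-th component is e^{itν}(a_k + b_k ν + iλ∫_0^t c(s)e^{-isν}ds). Hence ω₀(W(e^{ith}f)) is χ(c(t))
times a Gaussian in the L² norms of these functions for the measures (𝒩_k + 1/2) d⟨g_k, E_k g_k⟩,
times a condensate phase that sees only the value at ν = 0 (`initialState_orbit`). The Laplace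
transform of c is an affine expression in the Stieltjes transforms of the form measures, divided by
η (`lap_fst`).

Large times. Condition (A) bounds the Stieltjes transforms, so the form measures are absolutely
continuous (`eq_withDensity_of_stieltjes`). Condition (B) and a maximum principle give |η(z)| ≥
const (1 + |z|) off the axis (`exists_mul_le_norm_eta`). The Laplace transform of c is then bounded,
and bounded in L² along horizontal lines. So c lies in L²(0,∞), χ(c(t)) tends to 1 in the mean, and
the truncated Fourier integrals tend to the boundary values of the Laplace transform. Plain L²
convergence is not enough for two reasons: the Bose weight is only integrable, and the condensate
needs the single point ν = 0. Both are settled by an Abel-Plancherel estimate, which bounds the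
quadratic time mean over (0,T] at each fixed ν by the Laplace transform at height 1/T
(`meanZero_lintegral_partialFt_sub`, `meanZero_partialFt_sub`). At ν = 0 the nontangential limit
exists because (D) makes ν⁻¹ integrable. So every NESS takes the same Gaussian value on these
vectors (`ness_testVec`), and differentiation gives all the two-point functions required.

Entropy. The condensate drops out of the entropy production: its coefficients at zero energy are
real, it carries no energy, and μ_k vanishes wherever Θ_k does not (`im_condensate`). In the
remaining part, Im η = -λ² ∑ Im G_k (where G_k is the boundary value of the k-th Stieltjes
transform) turns the fluxes into differences (`im_flux`). After symmetrization over pairs of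
reservoirs the rate is a positive multiple of ∫ |η|⁻² ∑ Im G_l Im G_k (x_l - x_k)(n_k - n_l) dν,
with x_k = β_k(ν - μ_k) and n_k = 1/(e^{x_k} - 1). Since n decreases in x every term is nonnegative.
On an open channel joining reservoirs with different parameters one term is positive for almost
every ν, because x_k = x_l for at most one ν (`integral_entropyDensity_pos`). -/

noncomputable section

namespace Josephson

/-! ### Plancherel's theorem for the kernel e^{-isν} -/

section Fourier

open FourierTransform SchwartzMap

/-- On `L¹ ∩ L²` the `L²` Fourier transform is given by the Fourier integral. -/
theorem fourier_toLp_ae_eq {a : ℝ → ℂ} (h1 : Integrable a) (h2 : MemLp a 2) :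
    ((𝓕 (h2.toLp a) : Lp ℂ 2 (volume : Measure ℝ)) : ℝ → ℂ) =ᵐ[volume] 𝓕 a := by
  -- Both functions are compared as distributions. The L² transform agrees with the transform of
  -- tempered distributions, and the Fourier integral can be moved onto the test function by Fubini.
  apply ae_eq_of_integral_contDiff_smul_eq
  · exact (Lp.memLp _).locallyIntegrable (by norm_num)
  · have : Continuous (𝓕 a) :=
      VectorFourier.fourierIntegral_continuous Real.continuous_fourierChar
        (L := innerₗ ℝ) continuous_inner h1
    exact this.locallyIntegrable
  · intro φ hφ hc
    have hg₁ : HasCompactSupport (Complex.ofRealCLM ∘ φ) := hc.comp_left rfl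
    have hg₂ : ContDiff ℝ ((⊤ : ℕ∞) : WithTop ℕ∞) (Complex.ofRealCLM ∘ φ) := by fun_prop
    set Φ : 𝓢(ℝ, ℂ) := hg₁.toSchwartzMap hg₂ with hΦ
    have hval : ∀ x, Φ x = (φ x : ℂ) := fun x => rfl
    have e1 := congrArg (fun T : 𝓢'(ℝ, ℂ) => T Φ)
      (Lp.fourier_toTemperedDistribution_eq (h2.toLp a))
    simp only [TemperedDistribution.fourier_apply, Lp.toTemperedDistribution_apply] at e1
    have e2 : ∫ ξ, Φ ξ • (𝓕 a) ξ = ∫ x, (𝓕 Φ) x • a x := by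
      have := VectorFourier.integral_fourierIntegral_smul_eq_flip (μ := volume) (ν := volume)
        (L := innerₗ ℝ) Real.continuous_fourierChar continuous_inner Φ.integrable h1
      rw [SchwartzMap.fourier_coe]
      simpa using! this.symm
    have e3 : ∫ x, (𝓕 Φ) x • a x = ∫ x, (𝓕 Φ) x • (h2.toLp a) x := by
      apply integral_congr_ae
      filter_upwards [h2.coeFn_toLp] with x hx
      rw [hx]
    have e4 : ∀ F : ℝ → ℂ, ∫ x, φ x • F x = ∫ x, Φ x • F x := by
      intro F; rfl
    rw [e4, e4, e2, e3, e1]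

end Fourier

/-- The Fourier integral `∫ a(s) e^{-isν} ds`. -/
def ft (a : ℝ → ℂ) (ν : ℝ) : ℂ := ∫ s, a s * Complex.exp (-(Complex.I * s * ν))

open FourierTransform in
theorem ft_eq_fourier (a : ℝ → ℂ) (ν : ℝ) : ft a ν = 𝓕 a ((2 * Real.pi)⁻¹ * ν) := by
  rw [Real.fourier_real_eq_integral_exp_smul, ft]
  congr 1
  ext s
  rw [smul_eq_mul, mul_comm]
  congr 2
  push_cast
  field_simp

theorem lintegral_enorm_sq_eq {f : ℝ → ℂ} (hf : MemLp f 2) :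
    ∫⁻ x, ‖f x‖ₑ ^ 2 = ‖hf.toLp f‖ₑ ^ 2 := by
  rw [Lp.enorm_toLp, eLpNorm_eq_lintegral_rpow_enorm_toReal (by norm_num) (by norm_num)]
  rw [← ENNReal.rpow_natCast, ← ENNReal.rpow_mul]
  simp

open FourierTransform in
/-- The Fourier transform `u` of a square integrable `F`, with Plancherel's theorem for `u`. -/
theorem exists_ft_L2 {F : ℝ → ℂ} (hF : MemLp F 2) :
    ∃ u : ℝ → ℂ, StronglyMeasurable u ∧ ∀ a : ℝ → ℂ, Integrable a → MemLp a 2 →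
      ∫⁻ ν, ‖ft a ν - u ν‖ₑ ^ 2 = ENNReal.ofReal (2 * Real.pi) * ∫⁻ s, ‖a s - F s‖ₑ ^ 2 := by
  set v : Lp ℂ 2 (volume : Measure ℝ) := 𝓕 (hF.toLp F) with hv
  refine ⟨fun ν => v ((2 * Real.pi)⁻¹ * ν),
    (Lp.stronglyMeasurable v).comp_measurable (measurable_const_mul _), fun a h1 h2 => ?_⟩
  simp only [ft_eq_fourier]
  have hsc := lintegral_map (μ := (volume : Measure ℝ))
    (f := fun x => ‖𝓕 a x - v x‖ₑ ^ 2) (g := fun ν : ℝ => (2 * Real.pi)⁻¹ * ν)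
    (by
      have : Continuous (𝓕 a) :=
        VectorFourier.fourierIntegral_continuous Real.continuous_fourierChar
          (L := innerₗ ℝ) continuous_inner h1
      exact ((this.measurable.sub (Lp.stronglyMeasurable v).measurable).enorm).pow_const 2)
    (measurable_const_mul _)
  -- The dilation ν ↦ ν/(2π) between the two normalizations produces the factor 2π.
  rw [← hsc, Real.map_volume_mul_left (by positivity), lintegral_smul_measure]
  have hpi : |((2 * Real.pi)⁻¹)⁻¹| = 2 * Real.pi := by
    rw [inv_inv, abs_of_pos (by positivity)]
  rw [hpi, smul_eq_mul]
  congr 1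
  have h3 : MemLp (fun s => a s - F s) 2 := h2.sub hF
  have hae : ∀ᵐ x : ℝ, 𝓕 a x - v x = (𝓕 (h3.toLp _) : Lp ℂ 2 (volume : Measure ℝ)) x := by
    have : (𝓕 (h3.toLp _) : Lp ℂ 2 (volume : Measure ℝ)) = 𝓕 (h2.toLp a) - v := by
      exact (Lp.fourierTransformₗᵢ ℝ ℂ).map_sub (h2.toLp a) (hF.toLp F)
    rw [this]
    filter_upwards [fourier_toLp_ae_eq h1 h2, Lp.coeFn_sub (𝓕 (h2.toLp a)) v] with x hx hx'
    rw [hx', Pi.sub_apply, hx]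
  rw [lintegral_congr_ae (hae.mono fun x hx => by rw [hx]), lintegral_enorm_sq_eq h3]
  have h4 := lintegral_enorm_sq_eq (Lp.memLp (𝓕 (h3.toLp _) : Lp ℂ 2 (volume : Measure ℝ)))
  rw [h4, Lp.toLp_coeFn, ← ofReal_norm, ← ofReal_norm, Lp.norm_fourier_eq]

/-- For F = 0 the function `u` is known only through its Plancherel relation; testing that relation
with a = 0 shows that `u` vanishes almost everywhere. -/
theorem plancherel_ft {a : ℝ → ℂ} (h1 : Integrable a) (h2 : MemLp a 2) :
    ∫⁻ ν, ‖ft a ν‖ₑ ^ 2 = ENNReal.ofReal (2 * Real.pi) * ∫⁻ s, ‖a s‖ₑ ^ 2 := by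
  obtain ⟨u, hu, h⟩ := exists_ft_L2 (F := fun _ => 0) (MemLp.zero (ε := ℂ))
  have h0 := h (fun _ => 0) (integrable_zero _ _ _) (MemLp.zero (ε := ℂ))
  have hft : ∀ ν, ft (fun _ => 0) ν = 0 := fun ν => by simp [ft]
  simp only [hft, zero_sub, enorm_neg, sub_self, enorm_zero] at h0
  simp only [ne_eq, OfNat.ofNat_ne_zero, not_false_eq_true, zero_pow, lintegral_zero, mul_zero]
    at h0
  rw [lintegral_eq_zero_iff (hu.measurable.enorm.pow_const 2)] at h0
  have := h a h1 h2
  simp only [sub_zero] at this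
  rw [← this]
  apply lintegral_congr_ae
  filter_upwards [h0] with ν hν
  have : u ν = 0 := by simpa using hν
  rw [this, sub_zero]

/-! ### Convergence to zero in the mean -/

/-- `T⁻¹ ∫_0^T q(t) dt → 0` as `T → ∞`. -/
def MeanZero (q : ℝ → ℝ≥0∞) : Prop :=
  Tendsto (fun T : ℝ => (ENNReal.ofReal T)⁻¹ * ∫⁻ t in Set.Ioc 0 T, q t) atTop (𝓝 0)

theorem ofReal_two_pi_ne_zero : ENNReal.ofReal (2 * Real.pi) ≠ 0 := by
  rw [ne_eq, ENNReal.ofReal_eq_zero, not_le]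
  positivity

theorem MeanZero.mono {q r : ℝ → ℝ≥0∞} (hr : MeanZero r) (h : ∀ t, 0 < t → q t ≤ r t) :
    MeanZero q := by
  refine tendsto_of_tendsto_of_tendsto_of_le_of_le tendsto_const_nhds hr (fun _ => zero_le)
    fun T => ?_
  dsimp only
  refine mul_le_mul' le_rfl ?_
  exact setLIntegral_mono_ae' measurableSet_Ioc (Eventually.of_forall fun t ht => h t ht.1)

theorem MeanZero.add {q r : ℝ → ℝ≥0∞} (hq : MeanZero q) (hr : MeanZero r) (hm : Measurable q) :
    MeanZero fun t => q t + r t := by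
  have := Tendsto.add hq hr
  rw [add_zero] at this
  refine this.congr fun T => ?_
  rw [lintegral_add_left hm, mul_add]

theorem MeanZero.sum {ι : Type*} (s : Finset ι) {q : ι → ℝ → ℝ≥0∞} (hq : ∀ i ∈ s, MeanZero (q i))
    (hm : ∀ i, Measurable (q i)) : MeanZero fun t => ∑ i ∈ s, q i t := by
  classical
  induction s using Finset.induction_on with
  | empty =>
    simp [MeanZero]
  | insert i s hi ih =>
    simp only [Finset.sum_insert hi]
    exact (hq i (Finset.mem_insert_self i s)).add
      (ih fun j hj => hq j (Finset.mem_insert_of_mem hj)) (hm i)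

theorem MeanZero.const_mul {q : ℝ → ℝ≥0∞} (hq : MeanZero q) {a : ℝ≥0∞} (ha : a ≠ ∞) :
    MeanZero fun t => a * q t := by
  have := ENNReal.Tendsto.const_mul hq (Or.inr ha)
  rw [mul_zero] at this
  refine this.congr fun T => ?_
  rw [lintegral_const_mul' _ _ ha]
  ring

/-- The form in which most mean limits are proved: a part tending to zero in the mean, plus a
remainder whose mean is small for every T. Measurability of `r` alone suffices to split the lower
integral. -/
theorem meanZero_of_forall_pos {q : ℝ → ℝ≥0∞}
    (h : ∀ δ : ℝ≥0∞, 0 < δ → ∃ r s : ℝ → ℝ≥0∞, Measurable r ∧ (∀ t, 0 < t → q t ≤ r t + s t) ∧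
      MeanZero r ∧ ∀ T : ℝ, 0 < T → (ENNReal.ofReal T)⁻¹ * ∫⁻ t in Set.Ioc 0 T, s t ≤ δ) :
    MeanZero q := by
  rw [MeanZero, ENNReal.tendsto_nhds_zero]
  intro δ hδ
  obtain ⟨r, s, hrm, hle, hr, hs⟩ := h (δ / 2) (ENNReal.half_pos hδ.ne')
  rw [MeanZero, ENNReal.tendsto_nhds_zero] at hr
  filter_upwards [hr (δ / 2) (ENNReal.half_pos hδ.ne'), eventually_gt_atTop 0] with T hT hT0
  calc (ENNReal.ofReal T)⁻¹ * ∫⁻ t in Set.Ioc 0 T, q t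
      ≤ (ENNReal.ofReal T)⁻¹ * ∫⁻ t in Set.Ioc 0 T, (r t + s t) := by
        refine mul_le_mul' le_rfl ?_
        exact setLIntegral_mono_ae' measurableSet_Ioc (Eventually.of_forall fun t ht => hle t ht.1)
    _ = (ENNReal.ofReal T)⁻¹ * (∫⁻ t in Set.Ioc 0 T, r t)
        + (ENNReal.ofReal T)⁻¹ * (∫⁻ t in Set.Ioc 0 T, s t) := by
        rw [lintegral_add_left hrm, mul_add]
    _ ≤ δ / 2 + δ / 2 := add_le_add hT (hs T hT0)
    _ = δ := ENNReal.add_halves δ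

theorem mean_const_le {T : ℝ} (hT : 0 < T) (a : ℝ≥0∞) :
    (ENNReal.ofReal T)⁻¹ * ∫⁻ _ in Set.Ioc 0 T, a ≤ a := by
  rw [setLIntegral_const, Real.volume_Ioc, sub_zero, mul_comm a, ← mul_assoc,
    ENNReal.inv_mul_cancel (by simpa using hT) ENNReal.ofReal_ne_top, one_mul]

theorem meanZero_of_tendsto {q : ℝ → ℝ≥0∞} {B : ℝ≥0∞} (hB : B ≠ ∞)
    (hqB : ∀ t, q t ≤ B) (hq : Tendsto q atTop (𝓝 0)) : MeanZero q := by
  refine meanZero_of_forall_pos fun δ hδ => ?_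
  rw [ENNReal.tendsto_nhds_zero] at hq
  obtain ⟨T₀, hT₀⟩ := eventually_atTop.1 (hq δ hδ)
  refine ⟨(Set.Iic T₀).indicator fun _ => B, fun _ => δ,
    measurable_const.indicator measurableSet_Iic, fun t _ => ?_, ?_, fun T hT => mean_const_le hT δ⟩
  · by_cases ht : t ≤ T₀
    · rw [Set.indicator_of_mem (by exact ht)]
      exact (hqB t).trans le_self_add
    · exact (hT₀ t (not_le.1 ht).le).trans le_add_self
  · have hlim : Tendsto (fun T : ℝ => (ENNReal.ofReal T)⁻¹ * (B * volume (Set.Ioc 0 T₀))) atTop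
        (𝓝 (0 * (B * volume (Set.Ioc 0 T₀)))) := by
      refine ENNReal.Tendsto.mul_const ?_ (Or.inr ?_)
      · rw [← ENNReal.inv_top]
        exact (tendsto_inv_iff (G := ℝ≥0∞)).2 ENNReal.tendsto_ofReal_atTop
      · exact ENNReal.mul_ne_top hB (by simp)
    rw [zero_mul] at hlim
    refine tendsto_of_tendsto_of_tendsto_of_le_of_le tendsto_const_nhds hlim (fun _ => zero_le)
      fun T => ?_
    dsimp only
    refine mul_le_mul' le_rfl ?_
    rw [setLIntegral_indicator measurableSet_Iic, setLIntegral_const]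
    gcongr
    rintro x ⟨h1, h2⟩
    exact ⟨h2.1, h1⟩

/-! ### The Laplace transform on the half line -/

/-- The Laplace transform `∫_0^∞ c(s) e^{-isz} ds`, `Im z < 0`. -/
def lap (c : ℝ → ℂ) (z : ℂ) : ℂ := ∫ s in Set.Ioi 0, c s * Complex.exp (-(Complex.I * s * z))

/-- The truncated Fourier integral `∫_0^t c(s) e^{-isν} ds`. -/
def partialFt (c : ℝ → ℂ) (t ν : ℝ) : ℂ :=
  ∫ s in (0 : ℝ)..t, c s * Complex.exp (-(Complex.I * s * ν))

theorem norm_exp_neg_I_mul (s : ℝ) (z : ℂ) :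
    ‖Complex.exp (-(Complex.I * s * z))‖ = Real.exp (s * z.im) := by
  rw [Complex.norm_exp]
  congr 1
  simp

theorem continuous_partialFt {c : ℝ → ℂ} (hc : Continuous c) :
    Continuous fun p : ℝ × ℝ => partialFt c p.1 p.2 := by
  unfold partialFt
  apply intervalIntegral.continuous_parametric_intervalIntegral_of_continuous
    (f := fun (p : ℝ × ℝ) (s : ℝ) => c s * Complex.exp (-(Complex.I * s * (p.2 : ℂ))))
  · fun_prop
  · fun_prop

theorem integrableOn_lap {c : ℝ → ℂ} (hc : Continuous c) {B : ℝ} (hB : ∀ s, ‖c s‖ ≤ B) {z : ℂ}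
    (hz : z.im < 0) :
    IntegrableOn (fun s : ℝ => c s * Complex.exp (-(Complex.I * s * z))) (Set.Ioi 0) := by
  have h1 : IntegrableOn (fun s : ℝ => B * Real.exp (z.im * s)) (Set.Ioi 0) :=
    (integrableOn_exp_mul_Ioi hz 0).const_mul B
  refine Integrable.mono' h1 (by fun_prop) (Eventually.of_forall fun s => ?_)
  rw [norm_mul, norm_exp_neg_I_mul, mul_comm s]
  gcongr
  exact hB s

/-- The function whose Fourier transform is `ν ↦ lap c (ν - iε)`. -/
def damped (c : ℝ → ℂ) (ε : ℝ) : ℝ → ℂ :=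
  (Set.Ioi (0 : ℝ)).indicator fun s => c s * Real.exp (-(ε * s))

theorem lap_eq_ft (c : ℝ → ℂ) (ν ε : ℝ) : lap c (ν - ε * Complex.I) = ft (damped c ε) ν := by
  rw [lap, ft, ← integral_indicator measurableSet_Ioi]
  congr 1
  ext s
  unfold damped
  by_cases hs : s ∈ Set.Ioi (0 : ℝ)
  · rw [Set.indicator_of_mem hs, Set.indicator_of_mem hs, mul_assoc (c s), Complex.ofReal_exp,
      ← Complex.exp_add]
    congr 2
    push_cast
    linear_combination (s * ε : ℂ) * Complex.I_mul_I
  · rw [Set.indicator_of_notMem hs, Set.indicator_of_notMem hs, zero_mul]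

theorem partialFt_eq_ft (c : ℝ → ℂ) {t : ℝ} (ht : 0 ≤ t) (ν : ℝ) :
    partialFt c t ν = ft ((Set.Ioc 0 t).indicator c) ν := by
  rw [partialFt, ft, intervalIntegral.integral_of_le ht, ← integral_indicator measurableSet_Ioc]
  congr 1
  ext s
  by_cases hs : s ∈ Set.Ioc 0 t
  · rw [Set.indicator_of_mem hs, Set.indicator_of_mem hs]
  · rw [Set.indicator_of_notMem hs, Set.indicator_of_notMem hs, zero_mul]

theorem memLp_two_of_integrable_of_bounded {a : ℝ → ℂ} (ha : Integrable a) {B : ℝ}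
    (hB : ∀ s, ‖a s‖ ≤ B) : MemLp a 2 := by
  rw [memLp_two_iff_integrable_sq_norm ha.1]
  refine Integrable.mono' (ha.norm.const_mul B) (ha.1.norm.pow 2) (Eventually.of_forall fun s => ?_)
  rw [Real.norm_of_nonneg (by positivity), sq]
  gcongr
  exact hB s

theorem integrable_damped {c : ℝ → ℂ} (hc : Continuous c) {B : ℝ} (hB : ∀ s, ‖c s‖ ≤ B) {ε : ℝ}
    (hε : 0 < ε) : Integrable (damped c ε) := by
  rw [damped, integrable_indicator_iff measurableSet_Ioi]
  have h1 : IntegrableOn (fun s : ℝ => B * Real.exp (-ε * s)) (Set.Ioi 0) :=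
    (integrableOn_exp_mul_Ioi (by linarith) 0).const_mul B
  refine Integrable.mono' h1 (by fun_prop) (Eventually.of_forall fun s => ?_)
  rw [norm_mul, Complex.norm_real, Real.norm_of_nonneg (Real.exp_pos _).le, neg_mul]
  gcongr
  exact hB s

theorem norm_damped_le {c : ℝ → ℂ} {B : ℝ} (hB : ∀ s, ‖c s‖ ≤ B) {ε : ℝ} (hε : 0 < ε) (s : ℝ) :
    ‖damped c ε s‖ ≤ B := by
  have hB0 : 0 ≤ B := (norm_nonneg _).trans (hB 0)
  unfold damped
  by_cases hs : s ∈ Set.Ioi (0 : ℝ)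
  · rw [Set.indicator_of_mem hs, norm_mul, Complex.norm_real,
      Real.norm_of_nonneg (Real.exp_pos _).le]
    have : Real.exp (-(ε * s)) ≤ 1 := by
      rw [Real.exp_le_one_iff]
      have : 0 < ε * s := mul_pos hε hs
      linarith
    calc ‖c s‖ * Real.exp (-(ε * s)) ≤ B * 1 := by gcongr; exact hB s
      _ = B := mul_one B
  · rw [Set.indicator_of_notMem hs, norm_zero]
    exact hB0

theorem memLp_damped {c : ℝ → ℂ} (hc : Continuous c) {B : ℝ} (hB : ∀ s, ‖c s‖ ≤ B) {ε : ℝ}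
    (hε : 0 < ε) : MemLp (damped c ε) 2 :=
  memLp_two_of_integrable_of_bounded (integrable_damped hc hB hε) (norm_damped_le hB hε)

theorem tendsto_damped (c : ℝ → ℂ) (s : ℝ) :
    Tendsto (fun ε => damped c ε s) (𝓝[>] 0) (𝓝 ((Set.Ioi (0 : ℝ)).indicator c s)) := by
  unfold damped
  by_cases hs : s ∈ Set.Ioi (0 : ℝ)
  · simp only [Set.indicator_of_mem hs]
    have : Continuous fun ε : ℝ => c s * (Real.exp (-(ε * s)) : ℂ) := by fun_prop
    have h := this.tendsto 0
    simp only [zero_mul, neg_zero, Real.exp_zero, Complex.ofReal_one, mul_one] at h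
    exact h.mono_left nhdsWithin_le_nhds
  · simp only [Set.indicator_of_notMem hs]
    exact tendsto_const_nhds

/-- If the Laplace transform is bounded in `L²` along horizontal lines then `c ∈ L²(0, ∞)`. -/
theorem memLp_indicator_of_lap {c : ℝ → ℂ} (hc : Continuous c) {B : ℝ} (hB : ∀ s, ‖c s‖ ≤ B)
    {D : ℝ≥0∞} (hD : D ≠ ∞)
    (h : ∀ ε : ℝ, 0 < ε → ∫⁻ ν : ℝ, ‖lap c (ν - ε * Complex.I)‖ₑ ^ 2 ≤ D) :
    MemLp ((Set.Ioi (0 : ℝ)).indicator c) 2 := by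
  have hm : AEStronglyMeasurable ((Set.Ioi (0 : ℝ)).indicator c) :=
    hc.aestronglyMeasurable.indicator measurableSet_Ioi
  refine ⟨hm, ?_⟩
  rw [eLpNorm_lt_top_iff_lintegral_rpow_enorm_lt_top (by norm_num) (by norm_num)]
  simp only [ENNReal.toReal_ofNat, ENNReal.rpow_ofNat]
  have hseq : Tendsto (fun n : ℕ => (1 / ((n : ℝ) + 1))) atTop (𝓝[>] 0) := by
    rw [tendsto_nhdsWithin_iff]
    exact ⟨tendsto_one_div_add_atTop_nhds_zero_nat, Eventually.of_forall fun n => by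
      simp only [Set.mem_Ioi]; positivity⟩
  have hpos : ∀ n : ℕ, (0 : ℝ) < 1 / ((n : ℝ) + 1) := fun n => by positivity
  -- Fatou's lemma along ε = 1/(n+1): the damped functions converge pointwise, and Plancherel bounds
  -- their norms by the hypothesis.
  have hlim : ∀ s, ‖(Set.Ioi (0 : ℝ)).indicator c s‖ₑ ^ 2
      = liminf (fun n : ℕ => ‖damped c (1 / ((n : ℝ) + 1)) s‖ₑ ^ 2) atTop := fun s => by
    refine (Tendsto.liminf_eq ?_).symm
    exact ((ENNReal.continuous_pow 2).comp continuous_enorm).tendsto _ |>.comp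
      ((tendsto_damped c s).comp hseq)
  have hle : ∀ n : ℕ, ∫⁻ s, ‖damped c (1 / ((n : ℝ) + 1)) s‖ₑ ^ 2
      ≤ (ENNReal.ofReal (2 * Real.pi))⁻¹ * D := fun n => by
    have h2 := h _ (hpos n)
    simp only [lap_eq_ft] at h2
    rw [plancherel_ft (integrable_damped hc hB (hpos n)) (memLp_damped hc hB (hpos n))] at h2
    rw [← ENNReal.inv_mul_le_iff (ENNReal.inv_ne_zero.2 ENNReal.ofReal_ne_top)
      (ENNReal.inv_ne_top.2 ofReal_two_pi_ne_zero), inv_inv]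
    exact h2
  calc ∫⁻ s, ‖(Set.Ioi (0 : ℝ)).indicator c s‖ₑ ^ 2
      = ∫⁻ s, liminf (fun n : ℕ => ‖damped c (1 / ((n : ℝ) + 1)) s‖ₑ ^ 2) atTop :=
        lintegral_congr hlim
    _ ≤ liminf (fun n : ℕ => ∫⁻ s, ‖damped c (1 / ((n : ℝ) + 1)) s‖ₑ ^ 2) atTop :=
        lintegral_liminf_le' fun n =>
          ((integrable_damped hc hB (hpos n)).1.aemeasurable.enorm).pow_const 2
    _ ≤ (ENNReal.ofReal (2 * Real.pi))⁻¹ * D := by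
        refine liminf_le_of_frequently_le' (Frequently.of_forall hle)
    _ < ∞ := ENNReal.mul_lt_top
        (ENNReal.inv_ne_top.2 ofReal_two_pi_ne_zero).lt_top hD.lt_top

theorem tendsto_enorm_sq {ι : Type*} {l : Filter ι} {f : ι → ℂ} {a : ℂ}
    (hf : Tendsto f l (𝓝 a)) : Tendsto (fun i => ‖f i‖ₑ ^ 2) l (𝓝 (‖a‖ₑ ^ 2)) :=
  ((ENNReal.continuous_pow 2).tendsto _).comp hf.enorm

theorem tendsto_enorm_sq_zero {ι : Type*} {l : Filter ι} {f : ι → ℂ}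
    (hf : Tendsto f l (𝓝 0)) : Tendsto (fun i => ‖f i‖ₑ ^ 2) l (𝓝 0) := by
  simpa using tendsto_enorm_sq hf

theorem norm_partialFt_le {c : ℝ → ℂ} {B : ℝ} (hB : ∀ s, ‖c s‖ ≤ B) {t : ℝ}
    (ht : 0 ≤ t) (ν : ℝ) : ‖partialFt c t ν‖ ≤ B * t := by
  have := intervalIntegral.norm_integral_le_of_norm_le_const (a := 0) (b := t) (C := B)
    (f := fun s : ℝ => c s * Complex.exp (-(Complex.I * s * ν))) (fun s _ => by
      rw [norm_mul, norm_exp_neg_I_mul]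
      simpa using hB s)
  simpa [partialFt, abs_of_nonneg ht] using this

/-- The damped difference of a truncated Fourier integral and its limit. -/
def abelDiff (c : ℝ → ℂ) (ν : ℝ) (L : ℂ) : ℝ → ℂ :=
  (Set.Ioi (0 : ℝ)).indicator fun t => Real.exp (-t) * (partialFt c t ν - L)

/-- Half of the damping absorbs the linear growth of the truncated integral, through 1 + t/2 ≤
e^{t/2}; the other half keeps the function integrable. -/
theorem abelDiff_bound {c : ℝ → ℂ} {B : ℝ} (hB : ∀ s, ‖c s‖ ≤ B) (ν : ℝ) (L : ℂ) {t : ℝ}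
    (ht : 0 ≤ t) :
    ‖(Real.exp (-t) : ℂ) * (partialFt c t ν - L)‖ ≤ (2 * B + ‖L‖) * Real.exp (-(1 / 2) * t) := by
  have hB0 : 0 ≤ B := (norm_nonneg _).trans (hB 0)
  rw [norm_mul, Complex.norm_real, Real.norm_of_nonneg (Real.exp_pos _).le]
  have h1 : ‖partialFt c t ν - L‖ ≤ B * t + ‖L‖ :=
    (norm_sub_le _ _).trans (by gcongr; exact norm_partialFt_le hB ht ν)
  have h2 : 1 + t / 2 ≤ Real.exp (t / 2) := by
    have := Real.add_one_le_exp (t / 2)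
    linarith
  have h3 : Real.exp (-t) = Real.exp (-(1 / 2) * t) * (Real.exp (t / 2))⁻¹ := by
    rw [← Real.exp_neg, ← Real.exp_add]
    congr 1
    ring
  calc Real.exp (-t) * ‖partialFt c t ν - L‖ ≤ Real.exp (-t) * (B * t + ‖L‖) := by gcongr
    _ ≤ Real.exp (-t) * ((2 * B + ‖L‖) * Real.exp (t / 2)) := by
        gcongr
        have : (2 * B + ‖L‖) * (1 + t / 2) ≤ (2 * B + ‖L‖) * Real.exp (t / 2) := by gcongr
        have h4 : 0 ≤ ‖L‖ * t := by positivity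
        nlinarith
    _ = (2 * B + ‖L‖) * Real.exp (-(1 / 2) * t) := by
        rw [h3]
        field_simp

theorem integrable_abelDiff {c : ℝ → ℂ} (hc : Continuous c) {B : ℝ} (hB : ∀ s, ‖c s‖ ≤ B)
    (ν : ℝ) (L : ℂ) : Integrable (abelDiff c ν L) := by
  rw [abelDiff, integrable_indicator_iff measurableSet_Ioi]
  have h1 : IntegrableOn (fun t : ℝ => (2 * B + ‖L‖) * Real.exp (-(1 / 2) * t)) (Set.Ioi 0) :=
    (integrableOn_exp_mul_Ioi (by norm_num) 0).const_mul _
  have hcont : Continuous fun t : ℝ => (Real.exp (-t) : ℂ) * (partialFt c t ν - L) := by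
    have := (continuous_partialFt hc).comp (f := fun t : ℝ => (t, ν)) (by fun_prop)
    have h2 : Continuous fun t => partialFt c t ν := this
    fun_prop
  refine Integrable.mono' h1 hcont.aestronglyMeasurable ?_
  filter_upwards [ae_restrict_mem measurableSet_Ioi] with t ht
  exact abelDiff_bound hB ν L (le_of_lt ht)

theorem memLp_abelDiff {c : ℝ → ℂ} (hc : Continuous c) {B : ℝ} (hB : ∀ s, ‖c s‖ ≤ B)
    (ν : ℝ) (L : ℂ) : MemLp (abelDiff c ν L) 2 := by
  have hB0 : 0 ≤ B := (norm_nonneg _).trans (hB 0)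
  refine memLp_two_of_integrable_of_bounded (integrable_abelDiff hc hB ν L)
    (B := 2 * B + ‖L‖) fun t => ?_
  unfold abelDiff
  by_cases ht : t ∈ Set.Ioi (0 : ℝ)
  · rw [Set.indicator_of_mem ht]
    refine (abelDiff_bound hB ν L (le_of_lt ht)).trans ?_
    have : Real.exp (-(1 / 2) * t) ≤ 1 := by
      rw [Real.exp_le_one_iff]
      have : (0 : ℝ) < t := ht
      linarith
    calc (2 * B + ‖L‖) * Real.exp (-(1 / 2) * t) ≤ (2 * B + ‖L‖) * 1 := by gcongr
      _ = _ := mul_one _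
  · rw [Set.indicator_of_notMem ht, norm_zero]
    positivity

/-- Integration by parts. With w = 1 + iy, the derivative of e^{-wt}(∫_0^t - L) is -w times this
function plus the integrand of the Laplace transform at ν + y - i, and the value at t = 0 is -L. A
primitive in time is thus traded for a Laplace transform off the real axis and the decaying factor
1/w. -/
theorem ft_abelDiff {c : ℝ → ℂ} (hc : Continuous c) {B : ℝ} (hB : ∀ s, ‖c s‖ ≤ B)
    (ν : ℝ) (L : ℂ) (y : ℝ) :
    (1 + y * Complex.I) * ft (abelDiff c ν L) y = lap c (ν + y - Complex.I) - L := by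
  set w : ℂ := 1 + y * Complex.I with hw
  have hz : ((ν : ℂ) + y - Complex.I).im < 0 := by simp
  have hd : ∀ t ∈ Set.Ici (0 : ℝ), HasDerivAt
      (fun t : ℝ => Complex.exp (-(w * t)) * (partialFt c t ν - L))
      (-w * (Complex.exp (-(w * t)) * (partialFt c t ν - L))
        + c t * Complex.exp (-(Complex.I * t * (ν + y - Complex.I)))) t := by
    intro t _
    have h1 : HasDerivAt (fun t : ℝ => partialFt c t ν)
        (c t * Complex.exp (-(Complex.I * t * ν))) t := by
      have hcc : Continuous fun s : ℝ => c s * Complex.exp (-(Complex.I * s * ν)) := by fun_prop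
      exact intervalIntegral.integral_hasDerivAt_right (hcc.intervalIntegrable _ _)
        (hcc.stronglyMeasurableAtFilter _ _) hcc.continuousAt
    have h2 : HasDerivAt (fun t : ℝ => Complex.exp (-(w * t)))
        (Complex.exp (-(w * t)) * (-(w * 1))) t := by
      have : HasDerivAt (fun t : ℝ => -(w * (t : ℂ))) (-(w * 1)) t :=
        ((Complex.ofRealCLM.hasDerivAt (x := t)).const_mul w).neg
      exact this.cexp
    have h3 := h2.mul (h1.sub_const L)
    refine h3.congr_deriv ?_
    have : Complex.exp (-(Complex.I * t * (ν + y - Complex.I)))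
        = Complex.exp (-(w * t)) * Complex.exp (-(Complex.I * t * ν)) := by
      rw [← Complex.exp_add]
      congr 1
      rw [hw]
      linear_combination (t : ℂ) * Complex.I_mul_I
    rw [this]
    ring
  have hexp : ∀ t : ℝ, Complex.exp (-(w * t))
      = Real.exp (-t) * Complex.exp (-(Complex.I * t * y)) := by
    intro t
    rw [Complex.ofReal_exp, ← Complex.exp_add]
    congr 1
    rw [hw]
    push_cast
    ring
  have hint1 : IntegrableOn (fun t : ℝ => Complex.exp (-(w * t)) * (partialFt c t ν - L))
      (Set.Ioi 0) := by
    have h := integrable_abelDiff hc hB ν L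
    rw [abelDiff, integrable_indicator_iff measurableSet_Ioi] at h
    have hcont : Continuous fun t : ℝ => Complex.exp (-(w * t)) * (partialFt c t ν - L) := by
      have := (continuous_partialFt hc).comp (f := fun t : ℝ => (t, ν)) (by fun_prop)
      have h2 : Continuous fun t => partialFt c t ν := this
      fun_prop
    refine Integrable.mono h hcont.aestronglyMeasurable (Eventually.of_forall fun t => ?_)
    rw [hexp, norm_mul, norm_mul, norm_mul, norm_exp_neg_I_mul]
    simp
  have hint2 := integrableOn_lap hc hB hz
  have hlim : Tendsto (fun t : ℝ => Complex.exp (-(w * t)) * (partialFt c t ν - L)) atTop (𝓝 0) := by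
    rw [tendsto_zero_iff_norm_tendsto_zero]
    have h0 : Tendsto (fun t : ℝ => (2 * B + ‖L‖) * Real.exp (-(1 / 2) * t)) atTop
        (𝓝 ((2 * B + ‖L‖) * 0)) := by
      refine Tendsto.const_mul _ (Real.tendsto_exp_atBot.comp ?_)
      exact (tendsto_const_mul_atBot_of_neg (by norm_num)).2 tendsto_id
    rw [mul_zero] at h0
    refine squeeze_zero' (Eventually.of_forall fun _ => norm_nonneg _) ?_ h0
    filter_upwards [eventually_ge_atTop 0] with t ht
    refine le_trans (le_of_eq ?_) (abelDiff_bound hB ν L ht)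
    rw [hexp, norm_mul, norm_mul, norm_mul, norm_exp_neg_I_mul]
    simp
  have key := integral_Ioi_of_hasDerivAt_of_tendsto' hd
    (IntegrableOn.add (hint1.const_mul (-w)) hint2) hlim
  have hsum : ∫ t in Set.Ioi (0 : ℝ), (-w * (Complex.exp (-(w * t)) * (partialFt c t ν - L))
        + c t * Complex.exp (-(Complex.I * t * (ν + y - Complex.I))))
      = -w * (∫ t in Set.Ioi (0 : ℝ), Complex.exp (-(w * t)) * (partialFt c t ν - L))
        + lap c (ν + y - Complex.I) := by
    rw [integral_add (hint1.const_mul (-w)) hint2, integral_const_mul]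
    rfl
  have hft : ft (abelDiff c ν L) y
      = ∫ t in Set.Ioi (0 : ℝ), Complex.exp (-(w * t)) * (partialFt c t ν - L) := by
    rw [ft, ← integral_indicator measurableSet_Ioi]
    congr 1
    ext t
    unfold abelDiff
    by_cases ht : t ∈ Set.Ioi (0 : ℝ)
    · rw [Set.indicator_of_mem ht, Set.indicator_of_mem ht, hexp]
      ring
    · rw [Set.indicator_of_notMem ht, Set.indicator_of_notMem ht, zero_mul]
  rw [hsum, ← hft] at key
  have h0 : partialFt c 0 ν = 0 := by simp [partialFt]
  rw [h0] at key
  simp only [Complex.ofReal_zero, mul_zero, neg_zero, Complex.exp_zero, zero_sub, one_mul,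
    neg_neg] at key
  linear_combination -key

/-- Plancherel in the time variable for `abelDiff`: the factor 1 + y² is |1 + iy|², and removing the
damping e^{-2t} on (0,1] costs at most e². -/
theorem setLIntegral_partialFt_sub_le_one {c : ℝ → ℂ} (hc : Continuous c) {B : ℝ}
    (hB : ∀ s, ‖c s‖ ≤ B) (ν : ℝ) (L : ℂ) :
    ∫⁻ t in Set.Ioc (0 : ℝ) 1, ‖partialFt c t ν - L‖ₑ ^ 2
      ≤ ENNReal.ofReal (Real.exp 2 / (2 * Real.pi)) *
        ∫⁻ y : ℝ, ‖lap c (ν + y - Complex.I) - L‖ₑ ^ 2 * ENNReal.ofReal (1 + y ^ 2)⁻¹ := by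
  have hP := plancherel_ft (integrable_abelDiff hc hB ν L) (memLp_abelDiff hc hB ν L)
  have h1 : ∀ y : ℝ, ‖lap c (ν + y - Complex.I) - L‖ₑ ^ 2 * ENNReal.ofReal (1 + y ^ 2)⁻¹
      = ‖ft (abelDiff c ν L) y‖ₑ ^ 2 := by
    intro y
    rw [← ft_abelDiff hc hB, enorm_mul, mul_pow]
    have hw : ‖(1 + y * Complex.I : ℂ)‖ₑ ^ 2 = ENNReal.ofReal (1 + y ^ 2) := by
      rw [← ofReal_norm, ← ENNReal.ofReal_pow (norm_nonneg _), ← Complex.normSq_eq_norm_sq]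
      congr 1
      simp [Complex.normSq_apply]
      ring
    rw [hw, mul_right_comm, ← ENNReal.ofReal_mul (by positivity), mul_inv_cancel₀ (by positivity),
      ENNReal.ofReal_one, one_mul]
  simp only [h1]
  rw [hP, ← mul_assoc, ← ENNReal.ofReal_mul (by positivity),
    div_mul_cancel₀ _ (by positivity), ← lintegral_const_mul' _ _ ENNReal.ofReal_ne_top,
    ← lintegral_indicator measurableSet_Ioc]
  refine lintegral_mono fun t => ?_
  by_cases ht : t ∈ Set.Ioc (0 : ℝ) 1
  · rw [Set.indicator_of_mem ht]
    unfold abelDiff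
    rw [Set.indicator_of_mem (show t ∈ Set.Ioi (0 : ℝ) from ht.1), enorm_mul, mul_pow, ← mul_assoc]
    refine le_mul_of_one_le_left zero_le ?_
    rw [← ofReal_norm (Real.exp (-t) : ℂ), Complex.norm_real,
      Real.norm_of_nonneg (Real.exp_pos _).le, ← ENNReal.ofReal_pow (Real.exp_pos _).le,
      ← ENNReal.ofReal_mul (Real.exp_pos _).le, ENNReal.one_le_ofReal, ← Real.exp_nat_mul,
      ← Real.exp_add, Real.one_le_exp_iff]
    push_cast
    linarith [ht.2]
  · rw [Set.indicator_of_notMem ht]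
    exact zero_le

/-- The Abel-Plancherel bound for the quadratic mean of the truncated Fourier integrals. -/
theorem setLIntegral_partialFt_sub_le {c : ℝ → ℂ} (hc : Continuous c) {B : ℝ}
    (hB : ∀ s, ‖c s‖ ≤ B) (ν : ℝ) (L : ℂ) {T : ℝ} (hT : 0 < T) :
    (ENNReal.ofReal T)⁻¹ * ∫⁻ t in Set.Ioc (0 : ℝ) T, ‖partialFt c t ν - L‖ₑ ^ 2
      ≤ ENNReal.ofReal (Real.exp 2 / (2 * Real.pi)) *
        ∫⁻ y : ℝ, ‖lap c (ν + T⁻¹ * (y - Complex.I)) - L‖ₑ ^ 2 * ENNReal.ofReal (1 + y ^ 2)⁻¹ := by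
  have hTc : (T : ℂ) ≠ 0 := by exact_mod_cast hT.ne'
  -- The factor T makes the Laplace transform of c' at z equal to that of c at z/T, with no
  -- prefactor. The case of unit time then gives the general one, with height 1/T.
  set c' : ℝ → ℂ := fun s => T * c (T * s) with hc'
  have hcc' : Continuous c' := by fun_prop
  have hB' : ∀ s, ‖c' s‖ ≤ T * B := fun s => by
    rw [hc', norm_mul, Complex.norm_real, Real.norm_of_nonneg hT.le]
    gcongr
    exact hB _
  have h := setLIntegral_partialFt_sub_le_one hcc' hB' (T * ν) L
  have h1 : ∀ τ : ℝ, partialFt c' τ (T * ν) = partialFt c (T * τ) ν := by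
    intro τ
    have := intervalIntegral.smul_integral_comp_mul_left (a := 0) (b := τ)
      (fun s : ℝ => c s * Complex.exp (-(Complex.I * s * ν))) T
    rw [partialFt, partialFt, ← mul_zero T, ← this, mul_zero T,
      ← intervalIntegral.integral_smul]
    congr 1
    ext s
    rw [hc', Complex.real_smul, mul_assoc]
    congr 3
    push_cast
    ring
  have h2 : ∀ z : ℂ, lap c' z = lap c (T⁻¹ * z) := by
    intro z
    have := integral_comp_mul_left_Ioi
      (fun s : ℝ => c s * Complex.exp (-(Complex.I * s * ((T⁻¹ : ℝ) * z)))) 0 hT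
    rw [mul_zero] at this
    have h3 : lap c (T⁻¹ * z) = T • (T⁻¹ • lap c (T⁻¹ * z)) := by
      rw [smul_smul, mul_inv_cancel₀ hT.ne', one_smul]
    rw [h3, lap, lap, ← this, ← integral_smul]
    congr 1
    ext s
    rw [hc', Complex.real_smul, mul_assoc]
    congr 3
    push_cast
    field_simp
  simp only [h1, h2] at h
  have h3 : ∫⁻ t in Set.Ioc (0 : ℝ) T, ‖partialFt c t ν - L‖ₑ ^ 2
      = ENNReal.ofReal T * ∫⁻ τ in Set.Ioc (0 : ℝ) 1, ‖partialFt c (T * τ) ν - L‖ₑ ^ 2 := by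
    have hme : MeasurableEmbedding fun τ : ℝ => T * τ :=
      (Homeomorph.mulLeft₀ T hT.ne').measurableEmbedding
    have hmap := hme.lintegral_map (μ := (volume : Measure ℝ))
      ((Set.Ioc (0 : ℝ) T).indicator fun t => ‖partialFt c t ν - L‖ₑ ^ 2)
    rw [Real.map_volume_mul_left hT.ne', lintegral_smul_measure,
      lintegral_indicator measurableSet_Ioc] at hmap
    have : ∀ τ : ℝ, (Set.Ioc (0 : ℝ) T).indicator (fun t => ‖partialFt c t ν - L‖ₑ ^ 2) (T * τ)
        = (Set.Ioc (0 : ℝ) 1).indicator (fun τ => ‖partialFt c (T * τ) ν - L‖ₑ ^ 2) τ := by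
      intro τ
      have hiff : T * τ ∈ Set.Ioc (0 : ℝ) T ↔ τ ∈ Set.Ioc (0 : ℝ) 1 := by
        simp only [Set.mem_Ioc, mul_pos_iff_of_pos_left hT]
        rw [mul_le_iff_le_one_right hT]
      by_cases hτ : τ ∈ Set.Ioc (0 : ℝ) 1
      · rw [Set.indicator_of_mem hτ, Set.indicator_of_mem (hiff.2 hτ)]
      · rw [Set.indicator_of_notMem hτ, Set.indicator_of_notMem (fun h => hτ (hiff.1 h))]
    rw [← lintegral_indicator (s := Set.Ioc (0 : ℝ) 1) measurableSet_Ioc, ← lintegral_congr this,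
      ← hmap, abs_of_pos (inv_pos.2 hT), smul_eq_mul, ← mul_assoc,
      ← ENNReal.ofReal_mul hT.le, mul_inv_cancel₀ hT.ne', ENNReal.ofReal_one, one_mul]
  rw [h3, ← mul_assoc, ENNReal.inv_mul_cancel (by simpa using hT) ENNReal.ofReal_ne_top, one_mul]
  refine h.trans (le_of_eq ?_)
  congr 1
  refine lintegral_congr fun y => ?_
  congr 5
  push_cast
  field_simp
  ring

theorem lintegral_cauchy : ∫⁻ y : ℝ, ENNReal.ofReal (1 + y ^ 2)⁻¹ = ENNReal.ofReal Real.pi := by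
  rw [← ofReal_integral_eq_lintegral_ofReal integrable_inv_one_add_sq
    (Eventually.of_forall fun y => by positivity), integral_univ_inv_one_add_sq]

/-- The Abel-Plancherel bound with L = 0; the Cauchy weight has mass π, whence e²K²/2. The bound is
uniform in ν and T, and this is what later makes unbounded integrable weights harmless. -/
theorem mean_partialFt_le {c : ℝ → ℂ} (hc : Continuous c) {B : ℝ}
    (hB : ∀ s, ‖c s‖ ≤ B) {K : ℝ} (hK : ∀ z : ℂ, z.im < 0 → ‖lap c z‖ ≤ K) (ν : ℝ)
    {T : ℝ} (hT : 0 < T) :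
    (ENNReal.ofReal T)⁻¹ * ∫⁻ t in Set.Ioc (0 : ℝ) T, ‖partialFt c t ν‖ₑ ^ 2
      ≤ ENNReal.ofReal (Real.exp 2 * K ^ 2 / 2) := by
  have hK0 : 0 ≤ K := (norm_nonneg _).trans (hK (-Complex.I) (by simp))
  have h := setLIntegral_partialFt_sub_le hc hB ν 0 hT
  simp only [sub_zero] at h
  refine h.trans ?_
  calc ENNReal.ofReal (Real.exp 2 / (2 * Real.pi)) *
        ∫⁻ y : ℝ, ‖lap c (ν + T⁻¹ * (y - Complex.I))‖ₑ ^ 2 * ENNReal.ofReal (1 + y ^ 2)⁻¹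
      ≤ ENNReal.ofReal (Real.exp 2 / (2 * Real.pi)) *
        ∫⁻ y : ℝ, ENNReal.ofReal (K ^ 2) * ENNReal.ofReal (1 + y ^ 2)⁻¹ := by
        refine mul_le_mul' le_rfl (lintegral_mono fun y => mul_le_mul' ?_ le_rfl)
        rw [← ofReal_norm, ← ENNReal.ofReal_pow (norm_nonneg _)]
        gcongr
        refine hK _ ?_
        have : ((ν : ℂ) + (T⁻¹ : ℝ) * (y - Complex.I)).im = -T⁻¹ := by simp
        rw [this]
        simpa using hT
    _ = ENNReal.ofReal (Real.exp 2 * K ^ 2 / 2) := by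
        rw [lintegral_const_mul' _ _ ENNReal.ofReal_ne_top, lintegral_cauchy,
          ← ENNReal.ofReal_mul (by positivity), ← ENNReal.ofReal_mul (by positivity)]
        congr 1
        field_simp

/-- Mean convergence of the truncated Fourier integrals at a point where the Laplace transform has
a nontangential limit. -/
theorem meanZero_partialFt_sub {c : ℝ → ℂ} (hc : Continuous c) {B : ℝ}
    (hB : ∀ s, ‖c s‖ ≤ B) {K : ℝ} (hK : ∀ z : ℂ, z.im < 0 → ‖lap c z‖ ≤ K)
    (hcont : ContinuousOn (lap c) {z | z.im < 0}) (ν : ℝ) (L : ℂ)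
    (hL : ∀ y : ℝ, Tendsto (fun T : ℝ => lap c (ν + T⁻¹ * (y - Complex.I))) atTop (𝓝 L)) :
    MeanZero fun t => ‖partialFt c t ν - L‖ₑ ^ 2 := by
  have him : ∀ T : ℝ, 0 < T → ∀ y : ℝ, ((ν : ℂ) + (T⁻¹ : ℝ) * (y - Complex.I)).im < 0 := by
    intro T hT y
    have : ((ν : ℂ) + (T⁻¹ : ℝ) * (y - Complex.I)).im = -T⁻¹ := by simp
    rw [this]
    simpa using hT
  -- Dominated convergence against the Cauchy weight. For fixed y the point ν + (y - i)/T approaches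
  -- ν along a fixed ray, which is why limits along all rays are assumed.
  have hI : Tendsto (fun T : ℝ => ∫⁻ y : ℝ, ‖lap c (ν + T⁻¹ * (y - Complex.I)) - L‖ₑ ^ 2
      * ENNReal.ofReal (1 + y ^ 2)⁻¹) atTop (𝓝 (∫⁻ _ : ℝ, 0)) := by
    refine tendsto_lintegral_filter_of_dominated_convergence
      (fun y => ENNReal.ofReal ((K + ‖L‖) ^ 2) * ENNReal.ofReal (1 + y ^ 2)⁻¹) ?_ ?_ ?_ ?_
    · filter_upwards [eventually_gt_atTop 0] with T hT
      have : Continuous fun y : ℝ => lap c (ν + (T⁻¹ : ℝ) * (y - Complex.I)) :=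
        hcont.comp_continuous (by fun_prop) (him T hT)
      have h1 : Measurable fun y : ℝ => ENNReal.ofReal (1 + y ^ 2)⁻¹ :=
        ENNReal.measurable_ofReal.comp (by fun_prop)
      exact ((this.sub continuous_const).measurable.enorm.pow_const 2).mul h1
    · filter_upwards [eventually_gt_atTop 0] with T hT
      refine Eventually.of_forall fun y => mul_le_mul' ?_ le_rfl
      rw [← ofReal_norm, ← ENNReal.ofReal_pow (norm_nonneg _)]
      gcongr
      exact (norm_sub_le _ _).trans (by gcongr; exact hK _ (him T hT y))
    · rw [lintegral_const_mul' _ _ ENNReal.ofReal_ne_top, lintegral_cauchy]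
      exact ENNReal.mul_ne_top ENNReal.ofReal_ne_top ENNReal.ofReal_ne_top
    · refine Eventually.of_forall fun y => ?_
      have h1 : Tendsto (fun T : ℝ => ‖lap c (ν + T⁻¹ * (y - Complex.I)) - L‖ₑ ^ 2) atTop
          (𝓝 0) := by
        have h4 := (hL y).sub_const L
        rw [sub_self] at h4
        exact tendsto_enorm_sq_zero h4
      have h3 := ENNReal.Tendsto.mul_const (b := ENNReal.ofReal (1 + y ^ 2)⁻¹) h1
        (Or.inr ENNReal.ofReal_ne_top)
      rwa [zero_mul] at h3
  rw [lintegral_zero] at hI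
  have hI' := ENNReal.Tendsto.const_mul (a := ENNReal.ofReal (Real.exp 2 / (2 * Real.pi))) hI
    (Or.inr ENNReal.ofReal_ne_top)
  rw [mul_zero] at hI'
  refine tendsto_of_tendsto_of_tendsto_of_le_of_le' tendsto_const_nhds hI'
    (Eventually.of_forall fun _ => zero_le) ?_
  filter_upwards [eventually_gt_atTop 0] with T hT
  exact setLIntegral_partialFt_sub_le hc hB ν L hT

/-- `u` is the `L²` boundary value, on the real line from below, of the Laplace transform of `c`. -/
structure IsBoundaryValue (c : ℝ → ℂ) (u : ℝ → ℂ) : Prop where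
  stronglyMeasurable : StronglyMeasurable u
  memLp : MemLp ((Set.Ioi (0 : ℝ)).indicator c) 2
  plancherel : ∀ a : ℝ → ℂ, Integrable a → MemLp a 2 → ∫⁻ ν, ‖ft a ν - u ν‖ₑ ^ 2
    = ENNReal.ofReal (2 * Real.pi) * ∫⁻ s, ‖a s - (Set.Ioi (0 : ℝ)).indicator c s‖ₑ ^ 2

theorem exists_isBoundaryValue {c : ℝ → ℂ} (hc : Continuous c) {B : ℝ} (hB : ∀ s, ‖c s‖ ≤ B)
    {D : ℝ≥0∞} (hD : D ≠ ∞)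
    (h : ∀ ε : ℝ, 0 < ε → ∫⁻ ν : ℝ, ‖lap c (ν - ε * Complex.I)‖ₑ ^ 2 ≤ D) :
    ∃ u, IsBoundaryValue c u := by
  have hm := memLp_indicator_of_lap hc hB hD h
  obtain ⟨u, hu, hP⟩ := exists_ft_L2 hm
  exact ⟨u, hu, hm, hP⟩

theorem lintegral_enorm_sq_lt_top {f : ℝ → ℂ} (hf : MemLp f 2) : ∫⁻ x, ‖f x‖ₑ ^ 2 < ∞ := by
  rw [lintegral_enorm_sq_eq hf]
  exact ENNReal.pow_lt_top enorm_lt_top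

theorem IsBoundaryValue.tendsto_lap {c u : ℝ → ℂ} (hu : IsBoundaryValue c u) (hc : Continuous c)
    {B : ℝ} (hB : ∀ s, ‖c s‖ ≤ B) :
    Tendsto (fun ε : ℝ => ∫⁻ ν : ℝ, ‖lap c (ν - ε * Complex.I) - u ν‖ₑ ^ 2) (𝓝[>] 0) (𝓝 0) := by
  have h1 : Tendsto (fun ε : ℝ => ∫⁻ s, ‖damped c ε s - (Set.Ioi (0 : ℝ)).indicator c s‖ₑ ^ 2)
      (𝓝[>] 0) (𝓝 (∫⁻ _ : ℝ, 0)) := by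
    refine tendsto_lintegral_filter_of_dominated_convergence
      (fun s => ‖(Set.Ioi (0 : ℝ)).indicator c s‖ₑ ^ 2) ?_ ?_ ?_ ?_
    · refine Eventually.of_forall fun ε => ?_
      have h1 : Measurable (damped c ε) := by
        unfold damped
        exact Measurable.indicator (by fun_prop) measurableSet_Ioi
      exact (h1.sub (hc.measurable.indicator measurableSet_Ioi)).enorm.pow_const 2
    · filter_upwards [self_mem_nhdsWithin] with ε (hε : 0 < ε)
      refine Eventually.of_forall fun s => ?_
      gcongr ?_ ^ 2
      unfold damped
      by_cases hs : s ∈ Set.Ioi (0 : ℝ)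
      · simp only [Set.indicator_of_mem hs]
        rw [enorm_le_iff_norm_le]
        have hs' : 0 < ε * s := mul_pos hε hs
        have h2 : c s * (Real.exp (-(ε * s)) : ℂ) - c s
            = c s * ((Real.exp (-(ε * s)) - 1 : ℝ) : ℂ) := by
          push_cast
          ring
        rw [h2, norm_mul, Complex.norm_real, Real.norm_eq_abs]
        have h3 : |Real.exp (-(ε * s)) - 1| ≤ 1 := by
          rw [abs_le]
          constructor
          · linarith [Real.exp_pos (-(ε * s))]
          · have : Real.exp (-(ε * s)) ≤ 1 := by
              rw [Real.exp_le_one_iff]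
              linarith
            linarith
        exact mul_le_of_le_one_right (norm_nonneg _) h3
      · simp only [Set.indicator_of_notMem hs, sub_zero, le_refl]
    · exact (lintegral_enorm_sq_lt_top hu.memLp).ne
    · refine Eventually.of_forall fun s => ?_
      refine tendsto_enorm_sq_zero ?_
      simpa using (tendsto_damped c s).sub_const ((Set.Ioi (0 : ℝ)).indicator c s)
  rw [lintegral_zero] at h1
  have h2 := ENNReal.Tendsto.const_mul (a := ENNReal.ofReal (2 * Real.pi)) h1
    (Or.inr ENNReal.ofReal_ne_top)
  rw [mul_zero] at h2
  refine h2.congr' ?_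
  filter_upwards [self_mem_nhdsWithin] with ε (hε : 0 < ε)
  simp only [lap_eq_ft]
  rw [hu.plancherel _ (integrable_damped hc hB hε) (memLp_damped hc hB hε)]

/-- Functions converging in `L²` converge almost everywhere along a common sequence. -/
theorem exists_seq_tendsto_ae_of_lintegral {ι : Type*} [Fintype ι] {F : ι → ℝ → ℝ → ℂ}
    {u : ι → ℝ → ℂ} (hF : ∀ i, ∀ᶠ ε in 𝓝[>] (0 : ℝ), Measurable (F i ε))
    (hu : ∀ i, Measurable (u i))
    (h : ∀ i, Tendsto (fun ε : ℝ => ∫⁻ ν, ‖F i ε ν - u i ν‖ₑ ^ 2) (𝓝[>] 0) (𝓝 0)) :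
    ∃ e : ℕ → ℝ, Tendsto e atTop (𝓝[>] 0) ∧
      ∀ᵐ ν, ∀ i, Tendsto (fun n => F i (e n) ν) atTop (𝓝 (u i ν)) := by
  have hF' : ∀ᶠ ε in 𝓝[>] (0 : ℝ), ∀ i, Measurable (F i ε) := eventually_all.2 hF
  have hsum : Tendsto (fun ε : ℝ => ∑ i, ∫⁻ ν, ‖F i ε ν - u i ν‖ₑ ^ 2) (𝓝[>] 0) (𝓝 0) := by
    have := tendsto_finsetSum Finset.univ fun i _ => h i
    simpa using this
  -- Errors of at most 2⁻ⁿ, summed over the finitely many indices, are summable in n. They therefore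
  -- tend to zero almost everywhere, for all indices along the same sequence.
  have hex : ∀ n : ℕ, ∃ ε : ℝ, 0 < ε ∧ ε < 1 / ((n : ℝ) + 1) ∧ (∀ i, Measurable (F i ε)) ∧
      ∑ i, ∫⁻ ν, ‖F i ε ν - u i ν‖ₑ ^ 2 ≤ (2⁻¹ : ℝ≥0∞) ^ n := by
    intro n
    have h1 := (ENNReal.tendsto_nhds_zero.1 hsum) ((2⁻¹ : ℝ≥0∞) ^ n)
      (ENNReal.pow_pos (by simp) n)
    have h2 : ∀ᶠ ε in 𝓝[>] (0 : ℝ), ε < 1 / ((n : ℝ) + 1) :=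
      nhdsWithin_le_nhds (Iio_mem_nhds (by positivity))
    obtain ⟨ε, ⟨⟨h3, h4⟩, h5⟩, h6⟩ := (((h1.and h2).and hF').and self_mem_nhdsWithin).exists
    exact ⟨ε, h6, h4, h5, h3⟩
  choose e he0 he1 hem he using hex
  refine ⟨e, ?_, ?_⟩
  · rw [tendsto_nhdsWithin_iff]
    refine ⟨squeeze_zero (fun n => (he0 n).le) (fun n => (he1 n).le)
      tendsto_one_div_add_atTop_nhds_zero_nat, Eventually.of_forall he0⟩
  · have hmi : ∀ n i, Measurable fun ν => ‖F i (e n) ν - u i ν‖ₑ ^ 2 := fun n i =>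
      ((hem n i).sub (hu i)).enorm.pow_const 2
    have hms : ∀ n, Measurable fun ν => ∑ i, ‖F i (e n) ν - u i ν‖ₑ ^ 2 := fun n =>
      Finset.measurable_fun_sum _ fun i _ => hmi n i
    have hfin : ∫⁻ ν, ∑' n, ∑ i, ‖F i (e n) ν - u i ν‖ₑ ^ 2 ≠ ∞ := by
      rw [lintegral_tsum fun n => (hms n).aemeasurable]
      refine ne_top_of_le_ne_top (b := ∑' n : ℕ, (2⁻¹ : ℝ≥0∞) ^ n) ?_ ?_
      · rw [ENNReal.tsum_geometric]
        simp
      · refine ENNReal.tsum_le_tsum fun n => ?_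
        rw [lintegral_finsetSum _ fun i _ => hmi n i]
        exact he n
    have hae := ae_lt_top (Measurable.tsum hms) hfin
    filter_upwards [hae] with ν hν i
    have h0 : Tendsto (fun n => ∑ i, ‖F i (e n) ν - u i ν‖ₑ ^ 2) atTop (𝓝 0) :=
      ENNReal.tendsto_atTop_zero_of_tsum_ne_top hν.ne
    have h1 : Tendsto (fun n => ‖F i (e n) ν - u i ν‖ₑ ^ 2) atTop (𝓝 0) :=
      tendsto_of_tendsto_of_tendsto_of_le_of_le tendsto_const_nhds h0 (fun _ => zero_le)
        fun n => Finset.single_le_sum (f := fun i => ‖F i (e n) ν - u i ν‖ₑ ^ 2)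
          (fun _ _ => zero_le) (Finset.mem_univ i)
    have h2 : Tendsto (fun n => ‖F i (e n) ν - u i ν‖ ^ 2) atTop (𝓝 0) := by
      have := (ENNReal.tendsto_toReal ENNReal.zero_ne_top).comp h1
      simpa [Function.comp_def] using this
    have h3 : Tendsto (fun n => ‖F i (e n) ν - u i ν‖) atTop (𝓝 0) := by
      have := (Real.continuous_sqrt.tendsto 0).comp h2
      simpa [Function.comp_def, Real.sqrt_sq (norm_nonneg _)] using this
    exact tendsto_iff_norm_sub_tendsto_zero.2 h3

theorem tendsto_setLIntegral_Ioi_zero {f : ℝ → ℝ≥0∞} (hf : Measurable f)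
    (h : ∫⁻ s in Set.Ioi (0 : ℝ), f s ≠ ∞) :
    Tendsto (fun t : ℝ => ∫⁻ s in Set.Ioi t, f s) atTop (𝓝 0) := by
  have h1 : Tendsto (fun t : ℝ => ∫⁻ s, (Set.Ioi t).indicator f s) atTop (𝓝 (∫⁻ _ : ℝ, 0)) := by
    refine tendsto_lintegral_filter_of_dominated_convergence ((Set.Ioi (0 : ℝ)).indicator f)
      (Eventually.of_forall fun t => hf.indicator measurableSet_Ioi) ?_
      (by rwa [lintegral_indicator measurableSet_Ioi]) (Eventually.of_forall fun s => ?_)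
    · filter_upwards [eventually_ge_atTop 0] with t ht
      exact Eventually.of_forall fun s => Set.indicator_le_indicator_of_subset
        (Set.Ioi_subset_Ioi ht) (fun _ => zero_le) s
    · refine tendsto_const_nhds.congr' ?_
      filter_upwards [eventually_ge_atTop s] with t ht
      rw [Set.indicator_of_notMem (by simpa using ht)]
  rw [lintegral_zero] at h1
  exact h1.congr fun t => lintegral_indicator measurableSet_Ioi f

/-- The truncated integral is the transform of c restricted to (0,t], so by Plancherel the error is
the L² mass of c beyond t. -/
theorem lintegral_partialFt_sub {c u : ℝ → ℂ} (hu : IsBoundaryValue c u) (hc : Continuous c)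
    {B : ℝ} (hB : ∀ s, ‖c s‖ ≤ B) {t : ℝ} (ht : 0 ≤ t) :
    ∫⁻ ν, ‖partialFt c t ν - u ν‖ₑ ^ 2
      = ENNReal.ofReal (2 * Real.pi) * ∫⁻ s in Set.Ioi t, ‖c s‖ₑ ^ 2 := by
  have hi : Integrable ((Set.Ioc 0 t).indicator c) := by
    rw [integrable_indicator_iff measurableSet_Ioc]
    exact (hc.integrableOn_Icc).mono_set Set.Ioc_subset_Icc_self
  have hb : ∀ s, ‖(Set.Ioc 0 t).indicator c s‖ ≤ B := fun s =>
    (norm_indicator_le_norm_self c s).trans (hB s)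
  simp only [partialFt_eq_ft c ht]
  rw [hu.plancherel _ hi (memLp_two_of_integrable_of_bounded hi hb),
    ← lintegral_indicator measurableSet_Ioi]
  congr 1
  refine lintegral_congr fun s => ?_
  by_cases h1 : s ∈ Set.Ioi t
  · have h2 : s ∈ Set.Ioi (0 : ℝ) := lt_of_le_of_lt ht h1
    have h3 : s ∉ Set.Ioc 0 t := fun h => absurd h.2 (not_le.2 h1)
    rw [Set.indicator_of_mem h1, Set.indicator_of_mem h2, Set.indicator_of_notMem h3, zero_sub,
      enorm_neg]
  · rw [Set.indicator_of_notMem h1]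
    by_cases h2 : s ∈ Set.Ioi (0 : ℝ)
    · have h3 : s ∈ Set.Ioc 0 t := ⟨h2, not_lt.1 h1⟩
      rw [Set.indicator_of_mem h2, Set.indicator_of_mem h3, sub_self]
      simp
    · have h3 : s ∉ Set.Ioc 0 t := fun h => h2 h.1
      rw [Set.indicator_of_notMem h2, Set.indicator_of_notMem h3, sub_self]
      simp

theorem enorm_sub_sq_le (a b : ℂ) : ‖a - b‖ₑ ^ 2 ≤ 2 * ‖a‖ₑ ^ 2 + 2 * ‖b‖ₑ ^ 2 := by
  have h : ‖a - b‖ ^ 2 ≤ 2 * ‖a‖ ^ 2 + 2 * ‖b‖ ^ 2 := by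
    have h1 : ‖a - b‖ ≤ ‖a‖ + ‖b‖ := norm_sub_le a b
    have h2 : ‖a - b‖ ^ 2 ≤ (‖a‖ + ‖b‖) ^ 2 := by gcongr
    nlinarith [sq_nonneg (‖a‖ - ‖b‖)]
  have h2 := ENNReal.ofReal_le_ofReal h
  rw [ENNReal.ofReal_add (by positivity) (by positivity), ENNReal.ofReal_mul (by norm_num),
    ENNReal.ofReal_mul (by norm_num), ENNReal.ofReal_pow (norm_nonneg _),
    ENNReal.ofReal_pow (norm_nonneg _), ENNReal.ofReal_pow (norm_nonneg _)] at h2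
  simpa using h2

theorem exists_mean_partialFt_sub_le {c u : ℝ → ℂ} (hc : Continuous c) {B : ℝ}
    (hB : ∀ s, ‖c s‖ ≤ B) {K : ℝ} (hK : ∀ z : ℂ, z.im < 0 → ‖lap c z‖ ≤ K)
    (huK : ∀ᵐ ν, ‖u ν‖ ≤ K) :
    ∃ A : ℝ≥0∞, A ≠ ∞ ∧ ∀ T : ℝ, 0 < T → ∀ᵐ ν, (ENNReal.ofReal T)⁻¹ *
      ∫⁻ t in Set.Ioc (0 : ℝ) T, ‖partialFt c t ν - u ν‖ₑ ^ 2 ≤ A := by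
  refine ⟨2 * ENNReal.ofReal (Real.exp 2 * K ^ 2 / 2) + 2 * ENNReal.ofReal (K ^ 2),
    ENNReal.add_ne_top.2 ⟨ENNReal.mul_ne_top (by simp) ENNReal.ofReal_ne_top,
      ENNReal.mul_ne_top (by simp) ENNReal.ofReal_ne_top⟩, ?_⟩
  intro T hT
  filter_upwards [huK] with ν hν
  calc (ENNReal.ofReal T)⁻¹ * ∫⁻ t in Set.Ioc (0 : ℝ) T, ‖partialFt c t ν - u ν‖ₑ ^ 2
      ≤ (ENNReal.ofReal T)⁻¹ * ∫⁻ t in Set.Ioc (0 : ℝ) T,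
          (2 * ‖partialFt c t ν‖ₑ ^ 2 + 2 * ENNReal.ofReal (K ^ 2)) := by
        refine mul_le_mul' le_rfl (lintegral_mono fun t => (enorm_sub_sq_le _ _).trans ?_)
        refine add_le_add le_rfl (mul_le_mul' le_rfl ?_)
        rw [← ofReal_norm, ← ENNReal.ofReal_pow (norm_nonneg _)]
        gcongr
    _ = 2 * ((ENNReal.ofReal T)⁻¹ * ∫⁻ t in Set.Ioc (0 : ℝ) T, ‖partialFt c t ν‖ₑ ^ 2)
          + (ENNReal.ofReal T)⁻¹ * (∫⁻ t in Set.Ioc (0 : ℝ) T, 2 * ENNReal.ofReal (K ^ 2)) := by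
        rw [lintegral_add_right _ measurable_const, lintegral_const_mul' _ _ (by simp), mul_add]
        ring
    _ ≤ _ := add_le_add (mul_le_mul' le_rfl (mean_partialFt_le hc hB hK ν hT))
        (mean_const_le hT _)

/-- Mean convergence of the truncated Fourier integrals in a weighted `L²` space. -/
theorem meanZero_lintegral_partialFt_sub {c u : ℝ → ℂ} (hu : IsBoundaryValue c u)
    (hc : Continuous c) {B : ℝ} (hB : ∀ s, ‖c s‖ ≤ B) {K : ℝ}
    (hK : ∀ z : ℂ, z.im < 0 → ‖lap c z‖ ≤ K) (huK : ∀ᵐ ν, ‖u ν‖ ≤ K)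
    {W : ℝ → ℝ≥0∞} (hW : Measurable W) (hWi : ∫⁻ ν, W ν ≠ ∞) :
    MeanZero fun t => ∫⁻ ν, ‖partialFt c t ν - u ν‖ₑ ^ 2 ∂(volume.withDensity W) := by
  have hmeas : Measurable fun p : ℝ × ℝ => ‖partialFt c p.1 p.2 - u p.2‖ₑ ^ 2 :=
    (((continuous_partialFt hc).measurable.sub
      (hu.stronglyMeasurable.measurable.comp measurable_snd)).enorm).pow_const 2
  have hmeasν : ∀ t, Measurable fun ν => ‖partialFt c t ν - u ν‖ₑ ^ 2 := fun t =>
    Measurable.of_uncurry_left (f := fun t ν => ‖partialFt c t ν - u ν‖ₑ ^ 2) hmeas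
  have hmeast : ∀ ν, Measurable fun t => ‖partialFt c t ν - u ν‖ₑ ^ 2 := fun ν =>
    Measurable.of_uncurry_right (f := fun t ν => ‖partialFt c t ν - u ν‖ₑ ^ 2) hmeas
  obtain ⟨A, hAtop, hmean⟩ := exists_mean_partialFt_sub_le hc hB hK huK
  refine meanZero_of_forall_pos fun δ hδ => ?_
  -- The weight is split as min(W, n) + (W - n) with truncated subtraction. For the first part
  -- convergence in L² suffices; the second has small integral and is controlled by the mean bound,
  -- which is uniform in ν.
  have htail : Tendsto (fun n : ℕ => A * ∫⁻ ν, (W ν - n)) atTop (𝓝 0) := by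
    have h1 : Tendsto (fun n : ℕ => ∫⁻ ν, (W ν - n)) atTop (𝓝 (∫⁻ _ : ℝ, 0)) := by
      refine tendsto_lintegral_of_dominated_convergence' W (fun n => (hW.sub_const _).aemeasurable)
        (fun n => Eventually.of_forall fun ν => tsub_le_self) hWi ?_
      filter_upwards [ae_lt_top hW hWi] with ν hν
      refine tendsto_const_nhds.congr' ?_
      obtain ⟨m, hm⟩ := ENNReal.exists_nat_gt hν.ne
      filter_upwards [eventually_ge_atTop m] with n hn
      rw [tsub_eq_zero_of_le]
      exact hm.le.trans (by exact_mod_cast hn)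
    rw [lintegral_zero] at h1
    have := ENNReal.Tendsto.const_mul (a := A) h1 (Or.inr hAtop)
    rwa [mul_zero] at this
  obtain ⟨n, hn⟩ := ((ENNReal.tendsto_nhds_zero.1 htail) δ hδ).exists
  have hmin : Measurable fun p : ℝ × ℝ => min (W p.2) n * ‖partialFt c p.1 p.2 - u p.2‖ₑ ^ 2 :=
    ((hW.comp measurable_snd).min measurable_const).mul hmeas
  have hr : Measurable fun t => ∫⁻ ν, min (W ν) n * ‖partialFt c t ν - u ν‖ₑ ^ 2 :=
    hmin.lintegral_prod_right
  refine ⟨fun t => ∫⁻ ν, min (W ν) n * ‖partialFt c t ν - u ν‖ₑ ^ 2,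
    fun t => ∫⁻ ν, (W ν - n) * ‖partialFt c t ν - u ν‖ₑ ^ 2, hr, fun t _ => ?_, ?_, ?_⟩
  · have hmt : Measurable fun ν => min (W ν) n * ‖partialFt c t ν - u ν‖ₑ ^ 2 :=
      (hW.min measurable_const).mul (hmeasν t)
    dsimp only
    rw [lintegral_withDensity_eq_lintegral_mul _ hW (hmeasν t), ← lintegral_add_left hmt]
    refine lintegral_mono fun ν => ?_
    rw [← add_mul, Pi.mul_apply]
    refine mul_le_mul' ?_ le_rfl
    rcases le_total (W ν) n with h | h
    · rw [min_eq_left h]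
      exact le_self_add
    · rw [min_eq_right h, add_tsub_cancel_of_le h]
  · have hle : ∀ t, 0 < t → ∫⁻ ν, min (W ν) n * ‖partialFt c t ν - u ν‖ₑ ^ 2
        ≤ n * (ENNReal.ofReal (2 * Real.pi) *
          ∫⁻ s in Set.Ioi t, ‖(Set.Ioi (0 : ℝ)).indicator c s‖ₑ ^ 2) := by
      intro t ht
      have : ∫⁻ s in Set.Ioi t, ‖(Set.Ioi (0 : ℝ)).indicator c s‖ₑ ^ 2
          = ∫⁻ s in Set.Ioi t, ‖c s‖ₑ ^ 2 := by
        refine setLIntegral_congr_fun measurableSet_Ioi fun s hs => ?_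
        rw [Set.indicator_of_mem (show s ∈ Set.Ioi (0 : ℝ) from lt_trans ht hs)]
      rw [this, ← lintegral_partialFt_sub hu hc hB ht.le,
        ← lintegral_const_mul _ (hmeasν t)]
      exact lintegral_mono fun ν => mul_le_mul' (min_le_right _ _) le_rfl
    refine MeanZero.mono ?_ hle
    have hm2 : Measurable fun s => ‖(Set.Ioi (0 : ℝ)).indicator c s‖ₑ ^ 2 :=
      (hc.measurable.indicator measurableSet_Ioi).enorm.pow_const 2
    have htop := (lintegral_enorm_sq_lt_top hu.memLp).ne
    have htop' : ∫⁻ s in Set.Ioi (0 : ℝ), ‖(Set.Ioi (0 : ℝ)).indicator c s‖ₑ ^ 2 ≠ ∞ :=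
      ne_top_of_le_ne_top htop (setLIntegral_le_lintegral _ _)
    have h0 : MeanZero fun t => ∫⁻ s in Set.Ioi t, ‖(Set.Ioi (0 : ℝ)).indicator c s‖ₑ ^ 2 :=
      meanZero_of_tendsto htop (fun t => setLIntegral_le_lintegral _ _)
        (tendsto_setLIntegral_Ioi_zero hm2 htop')
    exact (h0.const_mul ENNReal.ofReal_ne_top).const_mul (ENNReal.natCast_ne_top n)
  · intro T hT
    have hm3 : Measurable fun p : ℝ × ℝ => (W p.2 - n) * ‖partialFt c p.1 p.2 - u p.2‖ₑ ^ 2 :=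
      ((hW.comp measurable_snd).sub_const _).mul hmeas
    -- The time mean has to be taken inside the ν-integral: only the mean over t, not the integrand
    -- at a given t, is bounded uniformly in ν.
    rw [lintegral_lintegral_swap hm3.aemeasurable,
      ← lintegral_const_mul' _ _ (ENNReal.inv_ne_top.2 (by simpa using hT))]
    calc ∫⁻ ν, (ENNReal.ofReal T)⁻¹ * ∫⁻ t in Set.Ioc (0 : ℝ) T,
            (W ν - n) * ‖partialFt c t ν - u ν‖ₑ ^ 2
        ≤ ∫⁻ ν, A * (W ν - n) := by
          refine lintegral_mono_ae ?_
          filter_upwards [hmean T hT] with ν hν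
          rw [lintegral_const_mul _ (hmeast ν), mul_left_comm, mul_comm A]
          exact mul_le_mul' le_rfl hν
      _ = A * ∫⁻ ν, (W ν - n) := lintegral_const_mul' _ _ hAtop
      _ ≤ δ := hn

/-! ### A maximum principle on the upper half plane -/

/-- The conformal map of the unit disc onto the upper half plane sending `0` to `x + iy`. -/
def discToHalfPlane (x y : ℝ) (w : ℂ) : ℂ := x + Complex.I * y * ((1 + w) / (1 - w))

theorem discToHalfPlane_im (x y : ℝ) {w : ℂ} (hw : w ≠ 1) :
    (discToHalfPlane x y w).im = y * (1 - ‖w‖ ^ 2) / ‖1 - w‖ ^ 2 := by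
  have h0 : Complex.normSq (1 - w) ≠ 0 := by
    rw [ne_eq, Complex.normSq_eq_zero, sub_eq_zero]
    exact fun h => hw h.symm
  have h1 : ((1 + w) / (1 - w)).re = (1 - ‖w‖ ^ 2) / ‖1 - w‖ ^ 2 := by
    rw [Complex.div_re, ← Complex.normSq_eq_norm_sq, ← Complex.normSq_eq_norm_sq, ← add_div]
    congr 1
    simp [Complex.normSq_apply]
    ring
  have h2 : (discToHalfPlane x y w).im = y * ((1 + w) / (1 - w)).re := by
    simp only [discToHalfPlane, Complex.add_im, Complex.ofReal_im, zero_add, Complex.mul_im,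
      Complex.mul_re, Complex.I_re, Complex.I_im, Complex.ofReal_re]
    ring
  rw [h2, h1]
  ring

/-- With a = (θ - π)/2 one has e^{iθ} = -(cos a + i sin a)², so (1 + w)/(1 - w) becomes -i tan a.
Leaving out the end points removes w = 1, the point sent to infinity. -/
theorem discToHalfPlane_circleMap (x y : ℝ) {θ : ℝ} (hθ : θ ∈ Set.Ioo 0 (2 * Real.pi)) :
    circleMap 0 1 θ ≠ 1 ∧
      discToHalfPlane x y (circleMap 0 1 θ)
        = ((x + y * Real.tan ((θ - Real.pi) / 2) : ℝ) : ℂ) := by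
  set a : ℝ := (θ - Real.pi) / 2 with ha
  have hcos : 0 < Real.cos a := by
    apply Real.cos_pos_of_mem_Ioo
    constructor <;> rw [ha] <;> linarith [hθ.1, hθ.2]
  have hcm : circleMap 0 1 θ = -(Real.cos a + Real.sin a * Complex.I) ^ 2 := by
    have h1 : circleMap 0 1 θ = Complex.exp (θ * Complex.I) := by simp [circleMap]
    have h2 : (θ : ℂ) * Complex.I = (a * Complex.I) + (a * Complex.I) + Real.pi * Complex.I := by
      rw [ha]
      push_cast
      ring
    rw [h1, h2, Complex.exp_add, Complex.exp_add, Complex.exp_pi_mul_I, Complex.exp_mul_I,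
      ← Complex.ofReal_cos, ← Complex.ofReal_sin]
    ring
  have hsq : (Real.cos a : ℂ) ^ 2 + (Real.sin a : ℂ) ^ 2 = 1 := by
    exact_mod_cast Real.cos_sq_add_sin_sq a
  have hden : 1 - circleMap 0 1 θ = 2 * Real.cos a * (Real.cos a + Real.sin a * Complex.I) := by
    rw [hcm]
    linear_combination (-1 : ℂ) * hsq + (Real.sin a : ℂ) ^ 2 * Complex.I_sq
  have hnum : 1 + circleMap 0 1 θ
      = -(2 * Complex.I * Real.sin a * (Real.cos a + Real.sin a * Complex.I)) := by
    rw [hcm]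
    linear_combination (-1 : ℂ) * hsq + (Real.sin a : ℂ) ^ 2 * Complex.I_sq
  have hu : (Real.cos a : ℂ) + Real.sin a * Complex.I ≠ 0 := by
    intro h
    have := congrArg Complex.re h
    rw [Complex.add_re, Complex.re_ofReal_mul, Complex.I_re, mul_zero, add_zero, Complex.ofReal_re,
      Complex.zero_re] at this
    exact hcos.ne' this
  have hcc : (Real.cos a : ℂ) ≠ 0 := by exact_mod_cast hcos.ne'
  constructor
  · intro h
    have : 1 - circleMap 0 1 θ = 0 := by rw [h, sub_self]
    rw [hden] at this
    exact mul_ne_zero (mul_ne_zero two_ne_zero hcc) hu this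
  · have hq : (1 + circleMap 0 1 θ) / (1 - circleMap 0 1 θ)
        = -(Complex.I * (Real.sin a / Real.cos a)) := by
      rw [hden, hnum, div_eq_iff (mul_ne_zero (mul_ne_zero two_ne_zero hcc) hu)]
      field_simp
    rw [discToHalfPlane, hq, Real.tan_eq_sin_div_cos, Complex.ofReal_add, Complex.ofReal_mul,
      Complex.ofReal_div]
    linear_combination (-(y : ℂ) * (Real.sin a / Real.cos a)) * Complex.I_sq

/-- The inverse boundary map s ↦ π + 2 arctan((s - x)/y) is differentiable and hence carries null
sets to null sets. -/
theorem ae_tan_comp {p : ℝ → Prop} (hp : ∀ᵐ x : ℝ, p x) (x y : ℝ) (hy : y ≠ 0) :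
    ∀ᵐ θ : ℝ, θ ∈ Set.Ioo 0 (2 * Real.pi) → p (x + y * Real.tan ((θ - Real.pi) / 2)) := by
  rw [ae_iff] at hp ⊢
  set S := {s : ℝ | ¬ p s} with hS
  refine measure_mono_null (t := (fun s : ℝ => Real.pi + 2 * Real.arctan ((s - x) / y)) '' S) ?_ ?_
  · intro θ hθ
    simp only [Set.mem_ofPred_eq, Classical.not_imp] at hθ
    refine ⟨_, hθ.2, ?_⟩
    dsimp only
    have h1 : (x + y * Real.tan ((θ - Real.pi) / 2) - x) / y = Real.tan ((θ - Real.pi) / 2) := by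
      field_simp
      ring
    rw [h1, Real.arctan_tan (by linarith [hθ.1.1]) (by linarith [hθ.1.2])]
    ring
  · refine addHaar_image_eq_zero_of_differentiableOn_of_addHaar_eq_zero volume ?_ hp
    intro s _
    apply DifferentiableAt.differentiableWithinAt
    exact (((differentiableAt_id.sub_const x).div_const y).arctan.const_mul 2).const_add _

/-- A bounded holomorphic function on the upper half plane, vanishing at infinity, is bounded by
the essential supremum of its vertical boundary values. -/
theorem norm_le_of_ae_boundary {F : ℂ → ℂ} (hd : DifferentiableOn ℂ F {z | 0 < z.im}) {B K : ℝ}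
    (hB : ∀ z : ℂ, 0 < z.im → ‖F z‖ ≤ B)
    (hinf : Tendsto F (Bornology.cobounded ℂ ⊓ 𝓟 {z | 0 < z.im}) (𝓝 0))
    (hae : ∀ᵐ x : ℝ, ∃ w : ℂ, Tendsto (fun ε : ℝ => F (x + ε * Complex.I)) (𝓝[>] 0) (𝓝 w) ∧
      ‖w‖ ≤ K) {z : ℂ} (hz : 0 < z.im) : ‖F z‖ ≤ K := by
  classical
  set x := z.re with hx
  set y := z.im with hy
  have hB0 : 0 ≤ B := (norm_nonneg _).trans (hB z hz)
  have hopen : IsOpen {z : ℂ | 0 < z.im} := isOpen_lt continuous_const Complex.continuous_im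
  -- Shifting F up by iε makes the pull-back continuous on the closed disc. At w = 1, which
  -- corresponds to infinity, the decay of F justifies the value 0.
  set Φ : ℝ → ℂ → ℂ := fun ε w =>
    if w = 1 then 0 else F (discToHalfPlane x y w + ε * Complex.I) with hΦ
  have him : ∀ w : ℂ, ‖w‖ ≤ 1 → w ≠ 1 → ∀ ε : ℝ, 0 < ε →
      0 < (discToHalfPlane x y w + ε * Complex.I).im := by
    intro w hw hw1 ε hε
    have h1 : 0 ≤ (discToHalfPlane x y w).im := by
      rw [discToHalfPlane_im x y hw1]
      have : ‖w‖ ^ 2 ≤ 1 := by nlinarith [norm_nonneg w]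
      have : 0 ≤ 1 - ‖w‖ ^ 2 := by linarith
      positivity
    simp only [Complex.add_im, Complex.mul_im, Complex.ofReal_re, Complex.I_im, mul_one,
      Complex.ofReal_im, Complex.I_re, mul_zero, add_zero]
    linarith
  have hψd : ∀ w : ℂ, w ≠ 1 → DifferentiableAt ℂ (discToHalfPlane x y) w := by
    intro w hw
    unfold discToHalfPlane
    have : (1 : ℂ) - w ≠ 0 := sub_ne_zero.2 (Ne.symm hw)
    fun_prop (disch := assumption)
  have hdiff : ∀ ε : ℝ, 0 < ε → ∀ w : ℂ, ‖w‖ ≤ 1 → w ≠ 1 → DifferentiableAt ℂ (Φ ε) w := by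
    intro ε hε w hw hw1
    have h1 : DifferentiableAt ℂ (fun w => F (discToHalfPlane x y w + ε * Complex.I)) w := by
      have h2 : DifferentiableAt ℂ F (discToHalfPlane x y w + ε * Complex.I) :=
        hd.differentiableAt (hopen.mem_nhds (him w hw hw1 ε hε))
      exact h2.comp w ((hψd w hw1).add_const _)
    refine h1.congr_of_eventuallyEq ?_
    filter_upwards [isOpen_ne.mem_nhds hw1] with v hv
    rw [hΦ]
    exact if_neg hv
  have hcob : ∀ ε : ℝ, Tendsto (fun w => discToHalfPlane x y w + ε * Complex.I) (𝓝[≠] 1)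
      (Bornology.cobounded ℂ) := by
    intro ε
    have h1 : Tendsto (fun w : ℂ => (1 - w)⁻¹) (𝓝[≠] 1) (Bornology.cobounded ℂ) := by
      refine tendsto_inv₀_nhdsNE_zero.comp ?_
      rw [tendsto_nhdsWithin_iff]
      constructor
      · have : Continuous fun w : ℂ => 1 - w := by fun_prop
        have h := this.tendsto 1
        rw [sub_self] at h
        exact h.mono_left nhdsWithin_le_nhds
      · filter_upwards [self_mem_nhdsWithin] with w hw
        exact sub_ne_zero.2 (Ne.symm hw)
    have h2 : Tendsto (fun w : ℂ => ‖Complex.I * y * (1 + w)‖) (𝓝[≠] 1) (𝓝 (2 * y)) := by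
      have : Continuous fun w : ℂ => ‖Complex.I * y * (1 + w)‖ := by fun_prop
      have h := this.tendsto 1
      have h3 : ‖Complex.I * y * (1 + 1)‖ = 2 * y := by
        rw [norm_mul, norm_mul, Complex.norm_I, Complex.norm_real, Real.norm_of_nonneg hz.le]
        norm_num
        ring
      rw [h3] at h
      exact h.mono_left nhdsWithin_le_nhds
    rw [← tendsto_norm_atTop_iff_cobounded] at h1 ⊢
    have h3 := h2.pos_mul_atTop (by positivity) h1
    have h4 : Tendsto (fun w => ‖Complex.I * y * (1 + w)‖ * ‖(1 - w)⁻¹‖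
        + (-(‖(x : ℂ)‖ + ‖(ε * Complex.I : ℂ)‖))) (𝓝[≠] 1) atTop :=
      tendsto_atTop_add_const_right _ _ h3
    refine tendsto_atTop_mono (fun w => ?_) h4
    have h5 : Complex.I * y * (1 + w) * (1 - w)⁻¹
        = (discToHalfPlane x y w + ε * Complex.I) - (x + ε * Complex.I) := by
      unfold discToHalfPlane
      rw [div_eq_mul_inv]
      ring
    rw [← norm_mul, h5]
    have h6 := norm_sub_le (discToHalfPlane x y w + ε * Complex.I) (x + ε * Complex.I)
    have h7 := norm_add_le (x : ℂ) (ε * Complex.I)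
    linarith
  have hcont : ∀ ε : ℝ, 0 < ε → ContinuousOn (Φ ε) (Metric.closedBall 0 |1|) := by
    intro ε hε w hw
    have hw' : ‖w‖ ≤ 1 := by simpa using hw
    by_cases hw1 : w = 1
    · subst hw1
      rw [← continuousWithinAt_sdiff_self]
      have h0 : Φ ε 1 = 0 := by simp [hΦ]
      rw [ContinuousWithinAt, h0]
      have h1 : Tendsto (fun w => F (discToHalfPlane x y w + ε * Complex.I))
          (𝓝[Metric.closedBall 0 |1| \ {1}] 1) (𝓝 0) := by
        refine hinf.comp (tendsto_inf.2 ⟨?_, ?_⟩)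
        · exact (hcob ε).mono_left (nhdsWithin_mono _ fun v hv => hv.2)
        · rw [tendsto_principal]
          filter_upwards [self_mem_nhdsWithin] with v hv
          exact him v (by simpa using hv.1) hv.2 ε hε
      refine h1.congr' ?_
      filter_upwards [self_mem_nhdsWithin] with v hv
      rw [hΦ]
      exact (if_neg hv.2).symm
    · exact (hdiff ε hε w hw' hw1).continuousAt.continuousWithinAt
  -- Mean value property at the centre of the disc, which the conformal map sends to z.
  have hmean : ∀ ε : ℝ, 0 < ε →
      (2 * Real.pi)⁻¹ • ∫ θ in (0 : ℝ)..2 * Real.pi, Φ ε (circleMap 0 1 θ)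
        = F (z + ε * Complex.I) := by
    intro ε hε
    have h := circleAverage_of_differentiable_on_off_countable (f := Φ ε) (c := 0) (R := 1)
      Set.countable_empty (hcont ε hε) (fun w hw => by
        have hw' : ‖w‖ < 1 := by simpa using hw.1
        refine hdiff ε hε w hw'.le ?_
        rintro rfl
        simp at hw')
    rw [Real.circleAverage_def] at h
    rw [h, hΦ]
    simp only [zero_ne_one, if_false, discToHalfPlane]
    congr 2
    simp only [add_zero, sub_zero, div_one, mul_one]
    rw [hx, hy, mul_comm Complex.I, Complex.re_add_im]
  set W : ℝ → ℂ := fun θ => limUnder (𝓝[>] (0 : ℝ)) fun ε => Φ ε (circleMap 0 1 θ) with hW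
  have hae' : ∀ᵐ θ : ℝ, θ ∈ Set.Ioo 0 (2 * Real.pi) →
      Tendsto (fun ε => Φ ε (circleMap 0 1 θ)) (𝓝[>] (0 : ℝ)) (𝓝 (W θ)) ∧ ‖W θ‖ ≤ K := by
    filter_upwards [ae_tan_comp hae x y hz.ne'] with θ hθ hθm
    obtain ⟨w, hw, hwK⟩ := hθ hθm
    obtain ⟨h1, h2⟩ := discToHalfPlane_circleMap x y hθm
    have h3 : Tendsto (fun ε => Φ ε (circleMap 0 1 θ)) (𝓝[>] (0 : ℝ)) (𝓝 w) := by
      refine hw.congr fun ε => ?_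
      rw [hΦ]
      simp only [if_neg h1, h2]
    have h4 : W θ = w := h3.limUnder_eq
    rw [h4]
    exact ⟨h3, hwK⟩
  have hIoo : ∀ᵐ θ : ℝ, θ ∈ Set.uIoc 0 (2 * Real.pi) → θ ∈ Set.Ioo 0 (2 * Real.pi) := by
    have : ∀ᵐ θ : ℝ, θ ≠ 2 * Real.pi := by
      rw [ae_iff]
      simp
    filter_upwards [this] with θ hθ hθm
    rw [Set.uIoc_of_le (by positivity)] at hθm
    exact ⟨hθm.1, lt_of_le_of_ne hθm.2 hθ⟩
  -- The a priori bound B dominates the integrands, so vertical limits at almost every boundary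
  -- point suffice to let ε ↓ 0. The constant K then enters through the limit only.
  have hlim : Tendsto (fun ε => ∫ θ in (0 : ℝ)..2 * Real.pi, Φ ε (circleMap 0 1 θ)) (𝓝[>] (0 : ℝ))
      (𝓝 (∫ θ in (0 : ℝ)..2 * Real.pi, W θ)) := by
    refine intervalIntegral.tendsto_integral_filter_of_dominated_convergence (fun _ => B) ?_ ?_
      intervalIntegrable_const ?_
    · filter_upwards [self_mem_nhdsWithin] with ε (hε : 0 < ε)
      have : Continuous fun θ => Φ ε (circleMap 0 1 θ) :=
        (hcont ε hε).comp_continuous (continuous_circleMap 0 1) fun θ => by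
          simp
      exact this.aestronglyMeasurable
    · filter_upwards [self_mem_nhdsWithin] with ε (hε : 0 < ε)
      refine Eventually.of_forall fun θ _ => ?_
      by_cases h1 : circleMap 0 1 θ = 1
      · simp [hΦ, h1, hB0]
      · simp only [hΦ, if_neg h1]
        exact hB _ (him _ (by simp) h1 ε hε)
    · filter_upwards [hae', hIoo] with θ h1 h2 h3
      exact (h1 (h2 h3)).1
  have hlimF : Tendsto (fun ε : ℝ => F (z + ε * Complex.I)) (𝓝[>] (0 : ℝ)) (𝓝 (F z)) := by
    have h1 : ContinuousAt F z := (hd.differentiableAt (hopen.mem_nhds hz)).continuousAt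
    have h2 : Continuous fun ε : ℝ => z + ε * Complex.I := by fun_prop
    have h3 := h2.tendsto 0
    simp only [Complex.ofReal_zero, zero_mul, add_zero] at h3
    exact (h1.tendsto.comp h3).mono_left nhdsWithin_le_nhds
  have hFz : F z = (2 * Real.pi)⁻¹ • ∫ θ in (0 : ℝ)..2 * Real.pi, W θ := by
    refine tendsto_nhds_unique hlimF ((hlim.const_smul ((2 * Real.pi)⁻¹)).congr' ?_)
    filter_upwards [self_mem_nhdsWithin] with ε (hε : 0 < ε)
    exact hmean ε hε
  have hnorm : ‖∫ θ in (0 : ℝ)..2 * Real.pi, W θ‖ ≤ K * |2 * Real.pi - 0| := by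
    refine intervalIntegral.norm_integral_le_of_norm_le_const_ae ?_
    filter_upwards [hae', hIoo] with θ h1 h2 h3
    exact (h1 (h2 h3)).2
  have hpi : 0 < 2 * Real.pi := by positivity
  rw [hFz, norm_smul, Real.norm_of_nonneg (by positivity)]
  rw [sub_zero, abs_of_pos hpi] at hnorm
  calc (2 * Real.pi)⁻¹ * ‖∫ θ in (0 : ℝ)..2 * Real.pi, W θ‖
      ≤ (2 * Real.pi)⁻¹ * (K * (2 * Real.pi)) := by gcongr
    _ = K := by field_simp

/-! ### The Stieltjes transform -/

/-- The Stieltjes transform `∫ (z - ν)⁻¹ dρ(ν)`. -/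
def stieltjes (ρ : Measure ℝ) (z : ℂ) : ℂ := ∫ ν, (z - (ν : ℂ))⁻¹ ∂ρ

theorem sub_ofReal_ne_zero {z : ℂ} (hz : z.im ≠ 0) (ν : ℝ) : z - (ν : ℂ) ≠ 0 := by
  intro h
  have := congrArg Complex.im h
  simp at this
  exact hz this

theorem norm_inv_sub_le {z : ℂ} (hz : z.im ≠ 0) (ν : ℝ) : ‖(z - (ν : ℂ))⁻¹‖ ≤ |z.im|⁻¹ := by
  rw [norm_inv]
  have h1 : |z.im| ≤ ‖z - (ν : ℂ)‖ := by
    have := Complex.abs_im_le_norm (z - (ν : ℂ))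
    simpa using this
  exact inv_anti₀ (abs_pos.2 hz) h1

theorem continuous_inv_sub {z : ℂ} (hz : z.im ≠ 0) : Continuous fun ν : ℝ => (z - (ν : ℂ))⁻¹ :=
  Continuous.inv₀ (by fun_prop) (sub_ofReal_ne_zero hz)

theorem norm_exp_I_mul (s ν : ℝ) : ‖Complex.exp (Complex.I * s * ν)‖ = 1 := by
  rw [Complex.norm_exp]
  simp

section Stieltjes

variable (ρ : Measure ℝ)

theorem stieltjes_conj (z : ℂ) : stieltjes ρ (conj z) = conj (stieltjes ρ z) := by
  rw [stieltjes, stieltjes, ← integral_conj]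
  congr 1
  ext ν
  simp

variable [IsFiniteMeasure ρ]

theorem integrable_inv_sub {z : ℂ} (hz : z.im ≠ 0) :
    Integrable (fun ν : ℝ => (z - (ν : ℂ))⁻¹) ρ :=
  Integrable.mono' (integrable_const |z.im|⁻¹) (continuous_inv_sub hz).aestronglyMeasurable
    (Eventually.of_forall (norm_inv_sub_le hz))

theorem stieltjes_im {z : ℂ} (hz : z.im ≠ 0) :
    (stieltjes ρ z).im = ∫ ν, -z.im / Complex.normSq (z - (ν : ℂ)) ∂ρ := by
  have h := (Complex.imCLM.integral_comp_comm (integrable_inv_sub ρ hz)).symm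
  rw [stieltjes]
  refine h.trans (integral_congr_ae (Eventually.of_forall fun ν => ?_))
  simp [Complex.inv_im]

theorem stieltjes_im_nonneg {z : ℂ} (hz : z.im < 0) : 0 ≤ (stieltjes ρ z).im := by
  rw [stieltjes_im ρ hz.ne]
  exact integral_nonneg fun ν => div_nonneg (by linarith) (Complex.normSq_nonneg _)

theorem differentiableAt_stieltjes {z : ℂ} (hz : z.im ≠ 0) :
    DifferentiableAt ℂ (stieltjes ρ) z := by
  have hpos : 0 < |z.im| / 2 := by positivity
  have him : ∀ w ∈ Metric.ball z (|z.im| / 2), |z.im| / 2 ≤ |w.im| := by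
    intro w hw
    rw [Metric.mem_ball, dist_eq_norm] at hw
    have h1 := Complex.abs_im_le_norm (w - z)
    rw [Complex.sub_im] at h1
    have h2 := abs_sub_abs_le_abs_sub z.im w.im
    rw [abs_sub_comm] at h2
    linarith
  have hne : ∀ w ∈ Metric.ball z (|z.im| / 2), w.im ≠ 0 := fun w hw h => by
    have := him w hw
    rw [h, abs_zero] at this
    linarith
  refine (hasDerivAt_integral_of_dominated_loc_of_deriv_le (μ := ρ)
    (F := fun w ν => (w - (ν : ℂ))⁻¹) (F' := fun w ν => -1 / (w - (ν : ℂ)) ^ 2)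
    (bound := fun _ => ((|z.im| / 2)⁻¹) ^ 2) (Metric.ball_mem_nhds z hpos) ?_
    (integrable_inv_sub ρ hz) ?_ ?_ (integrable_const _) ?_).2.differentiableAt
  · filter_upwards [Metric.ball_mem_nhds z hpos] with w hw
    exact (continuous_inv_sub (hne w hw)).aestronglyMeasurable
  · refine Continuous.aestronglyMeasurable ?_
    exact Continuous.div continuous_const (by fun_prop) fun ν => pow_ne_zero 2
      (sub_ofReal_ne_zero hz ν)
  · refine Eventually.of_forall fun ν w hw => ?_
    have h1 := norm_inv_sub_le (hne w hw) ν
    rw [norm_div, norm_neg, norm_one, norm_pow, one_div, ← inv_pow, ← norm_inv]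
    gcongr
    exact h1.trans (inv_anti₀ hpos (him w hw))
  · refine Eventually.of_forall fun ν w hw => ?_
    have h1 : HasDerivAt (fun w : ℂ => w - (ν : ℂ)) 1 w := (hasDerivAt_id w).sub_const _
    exact h1.inv (sub_ofReal_ne_zero (hne w hw) ν)

theorem measurable_stieltjes_line {ε : ℝ} (hε : ε ≠ 0) :
    Continuous fun ν : ℝ => stieltjes ρ (ν - ε * Complex.I) := by
  rw [continuous_iff_continuousAt]
  intro ν
  have h1 : ContinuousAt (stieltjes ρ) (ν - ε * Complex.I) :=
    (differentiableAt_stieltjes ρ (by simpa using hε)).continuousAt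
  exact ContinuousAt.comp (f := fun ν : ℝ => (ν : ℂ) - ε * Complex.I) h1 (by fun_prop)

/-! ### The Fourier transform of the measure -/

/-- `κ(s) = ∫ e^{isν} dρ(ν)`. -/
def correlation (s : ℝ) : ℂ := ∫ ν, Complex.exp (Complex.I * s * ν) ∂ρ

theorem continuous_correlation : Continuous (correlation ρ) := by
  unfold correlation
  refine continuous_of_dominated (bound := fun _ => 1) (fun s => ?_) (fun s => ?_)
    (integrable_const _) ?_
  · exact Continuous.aestronglyMeasurable (by fun_prop)
  · exact Eventually.of_forall fun ν => (norm_exp_I_mul s ν).le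
  · exact Eventually.of_forall fun ν => by fun_prop

theorem norm_correlation_le (s : ℝ) : ‖correlation ρ s‖ ≤ ρ.real Set.univ := by
  unfold correlation
  have := norm_integral_le_of_norm_le_const (μ := ρ) (C := 1)
    (Eventually.of_forall fun ν => (norm_exp_I_mul s ν).le)
  simpa using this

/-- Fubini and ∫_0^∞ e^{-is(z-ν)} ds = -i/(z - ν), which converges because Im z < 0. -/
theorem lap_correlation {z : ℂ} (hz : z.im < 0) :
    lap (correlation ρ) z = -Complex.I * stieltjes ρ z := by
  unfold lap correlation
  have h1 : ∀ s : ℝ, (∫ ν, Complex.exp (Complex.I * s * ν) ∂ρ) * Complex.exp (-(Complex.I * s * z))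
      = ∫ ν, Complex.exp ((-(Complex.I * (z - (ν : ℂ)))) * s) ∂ρ := by
    intro s
    rw [← integral_mul_const]
    congr 1
    ext ν
    rw [← Complex.exp_add]
    congr 1
    ring
  simp only [h1]
  rw [integral_integral_swap]
  · rw [stieltjes, ← integral_const_mul]
    congr 1
    ext ν
    have hne := sub_ofReal_ne_zero hz.ne ν
    rw [integral_exp_mul_complex_Ioi (by simpa using hz)]
    simp only [Complex.ofReal_zero, mul_zero, Complex.exp_zero]
    have hI := Complex.I_ne_zero
    rw [div_eq_iff (neg_ne_zero.2 (mul_ne_zero hI hne))]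
    field_simp
    rw [Complex.I_sq]
  · have hc : Continuous fun p : ℝ × ℝ => Complex.exp ((-(Complex.I * (z - (p.2 : ℂ)))) * p.1) := by
      fun_prop
    have hi : Integrable (fun s : ℝ => Real.exp (z.im * s)) (volume.restrict (Set.Ioi 0)) :=
      integrableOn_exp_mul_Ioi hz 0
    have h2 : Integrable (fun p : ℝ × ℝ => Real.exp (z.im * p.1) * (1 : ℝ))
        ((volume.restrict (Set.Ioi 0)).prod ρ) := hi.mul_prod (integrable_const (1 : ℝ))
    refine Integrable.mono' h2 hc.aestronglyMeasurable (Eventually.of_forall fun p => ?_)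
    simp only [Function.uncurry]
    rw [Complex.norm_exp, mul_one]
    refine le_of_eq ?_
    congr 1
    simp

/-- A bounded Stieltjes transform is bounded in `L²` along horizontal lines. -/
theorem lintegral_lap_correlation_le {C : ℝ} (hC : ∀ z : ℂ, z.im < 0 → ‖stieltjes ρ z‖ ≤ C)
    {ε : ℝ} (hε : 0 < ε) :
    ∫⁻ ν : ℝ, ‖lap (correlation ρ) (ν - ε * Complex.I)‖ₑ ^ 2
      ≤ ENNReal.ofReal (2 * Real.pi * (C * ρ.real Set.univ)) := by
  have hcc := continuous_correlation ρ
  have hcb := norm_correlation_le ρ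
  simp only [lap_eq_ft]
  rw [plancherel_ft (integrable_damped hcc hcb hε) (memLp_damped hcc hcb hε),
    ENNReal.ofReal_mul (p := 2 * Real.pi) (by positivity)]
  refine mul_le_mul' le_rfl ?_
  have hintegrable : Integrable fun s => ‖damped (correlation ρ) ε s‖ ^ 2 :=
    (memLp_two_iff_integrable_sq_norm (integrable_damped hcc hcb hε).1).1 (memLp_damped hcc hcb hε)
  have h1 : ∫⁻ s, ‖damped (correlation ρ) ε s‖ₑ ^ 2
      = ENNReal.ofReal (∫ s, ‖damped (correlation ρ) ε s‖ ^ 2) := by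
    rw [ofReal_integral_eq_lintegral_ofReal hintegrable (Eventually.of_forall fun s => by positivity)]
    refine lintegral_congr fun s => ?_
    rw [ENNReal.ofReal_pow (norm_nonneg _), ofReal_norm]
  rw [h1]
  refine ENNReal.ofReal_le_ofReal ?_
  set z : ℝ → ℂ := fun x => x - (2 * ε : ℝ) * Complex.I with hz
  have hzim : ∀ x, (z x).im < 0 := fun x => by simp [hz, hε]
  -- As the conjugate of κ(s) is ∫ e^{-isx} dρ(x), the squared norm of the damped correlation is the
  -- ρ-integral of its Laplace transform on the line at depth 2ε. A supremum bound on the Stieltjes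
  -- transform thus becomes an L² bound.
  have h2 : ((∫ s, ‖damped (correlation ρ) ε s‖ ^ 2 : ℝ) : ℂ)
      = ∫ x, lap (correlation ρ) (z x) ∂ρ := by
    have h3 : ∀ s, ((‖damped (correlation ρ) ε s‖ ^ 2 : ℝ) : ℂ)
        = (Set.Ioi (0 : ℝ)).indicator (fun s => ∫ x, correlation ρ s *
          Complex.exp (-(Complex.I * s * z x)) ∂ρ) s := by
      intro s
      unfold damped
      by_cases hs : s ∈ Set.Ioi (0 : ℝ)
      · rw [Set.indicator_of_mem hs, Set.indicator_of_mem hs, integral_const_mul]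
        have h4 : ∫ x, Complex.exp (-(Complex.I * s * z x)) ∂ρ
            = conj (correlation ρ s) * ((Real.exp (-(ε * s)) : ℂ)) ^ 2 := by
          rw [correlation, ← integral_conj, ← integral_mul_const]
          congr 1
          ext x
          rw [← Complex.exp_conj, Complex.ofReal_exp, ← Complex.exp_nat_mul, ← Complex.exp_add]
          congr 1
          simp only [hz, map_mul, Complex.conj_I, Complex.conj_ofReal]
          push_cast
          linear_combination (2 * ε * s : ℂ) * Complex.I_sq
        rw [h4, norm_mul, mul_pow, Complex.norm_real, Real.norm_of_nonneg (Real.exp_pos _).le]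
        push_cast
        rw [← mul_assoc, Complex.mul_conj, Complex.normSq_eq_norm_sq]
        push_cast
        rfl
      · rw [Set.indicator_of_notMem hs, Set.indicator_of_notMem hs]
        simp
    rw [← integral_complex_ofReal]
    simp only [h3]
    rw [integral_indicator measurableSet_Ioi]
    unfold lap
    rw [integral_integral_swap]
    have hc : Continuous fun p : ℝ × ℝ =>
        correlation ρ p.1 * Complex.exp (-(Complex.I * p.1 * z p.2)) := by
      have : Continuous fun p : ℝ × ℝ => correlation ρ p.1 := hcc.comp continuous_fst
      fun_prop
    have hi : Integrable (fun s : ℝ => ρ.real Set.univ * Real.exp (-(2 * ε) * s))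
        (volume.restrict (Set.Ioi 0)) :=
      (integrableOn_exp_mul_Ioi (by linarith) 0).const_mul _
    have h5 := hi.mul_prod (integrable_const (μ := ρ) (1 : ℝ))
    refine Integrable.mono' h5 hc.aestronglyMeasurable (Eventually.of_forall fun p => ?_)
    simp only [Function.uncurry]
    rw [norm_mul, norm_exp_neg_I_mul, mul_one]
    have h6 : p.1 * (z p.2).im = -(2 * ε) * p.1 := by simp [hz]; ring
    rw [h6]
    gcongr
    exact hcb p.1
  have h3 : ‖∫ x, lap (correlation ρ) (z x) ∂ρ‖ ≤ C * ρ.real Set.univ := by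
    refine norm_integral_le_of_norm_le_const (Eventually.of_forall fun x => ?_)
    rw [lap_correlation ρ (hzim x), norm_mul, norm_neg, Complex.norm_I, one_mul]
    exact hC _ (hzim x)
  rw [← h2, Complex.norm_real] at h3
  exact (le_abs_self _).trans h3

/-! ### Stieltjes inversion -/

theorem integral_poisson_rescale (φ : ℝ → ℝ) (x : ℝ) {ε : ℝ} (hε : 0 < ε) :
    ∫ ν : ℝ, φ ν * (ε / ((ν - x) ^ 2 + ε ^ 2)) = ∫ y : ℝ, φ (x + ε * y) * (1 + y ^ 2)⁻¹ := by
  have h1 := integral_add_left_eq_self (μ := (volume : Measure ℝ))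
    (fun ν => φ ν * (ε / ((ν - x) ^ 2 + ε ^ 2))) x
  have h2 := Measure.integral_comp_mul_left
    (fun w => φ (x + w) * (ε / ((x + w - x) ^ 2 + ε ^ 2))) ε
  rw [abs_of_pos (inv_pos.2 hε), h1] at h2
  have h3 : ∫ ν : ℝ, φ ν * (ε / ((ν - x) ^ 2 + ε ^ 2))
      = ε • (ε⁻¹ • ∫ ν : ℝ, φ ν * (ε / ((ν - x) ^ 2 + ε ^ 2))) := by
    rw [smul_smul, mul_inv_cancel₀ hε.ne', one_smul]
  rw [h3, ← h2, ← integral_smul]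
  congr 1
  ext y
  have : 1 + y ^ 2 ≠ 0 := by positivity
  rw [smul_eq_mul]
  have h4 : (x + ε * y - x) ^ 2 + ε ^ 2 = ε ^ 2 * (1 + y ^ 2) := by ring
  rw [h4]
  field_simp

/-- The Poisson kernel is an approximate identity of mass π; after rescaling, the smoothed functions
converge boundedly, and ρ is finite. -/
theorem tendsto_integral_poisson (φ : CompactlySupportedContinuousMap ℝ ℝ) :
    Tendsto (fun ε : ℝ => ∫ x, (∫ ν : ℝ, φ ν * (ε / ((ν - x) ^ 2 + ε ^ 2))) ∂ρ) (𝓝[>] 0)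
      (𝓝 (∫ x, Real.pi * φ x ∂ρ)) := by
  obtain ⟨C, hC⟩ := φ.hasCompactSupport.exists_bound_of_continuous φ.continuous
  have hC0 : 0 ≤ C := (norm_nonneg _).trans (hC 0)
  have hintegrable : Integrable fun y : ℝ => C * (1 + y ^ 2)⁻¹ := integrable_inv_one_add_sq.const_mul C
  have hc2 : ∀ ε : ℝ, Continuous fun x : ℝ => ∫ y : ℝ, φ (x + ε * y) * (1 + y ^ 2)⁻¹ := by
    intro ε
    have hbd : ∀ x y : ℝ, ‖φ (x + ε * y) * (1 + y ^ 2)⁻¹‖ ≤ C * (1 + y ^ 2)⁻¹ := by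
      intro x y
      rw [norm_mul, Real.norm_of_nonneg (show 0 ≤ (1 + y ^ 2)⁻¹ by positivity)]
      gcongr
      exact hC _
    refine continuous_of_dominated (fun x => ?_) (fun x => Eventually.of_forall (hbd x)) hintegrable ?_
    · have hc := φ.continuous
      exact AEStronglyMeasurable.mul (Continuous.aestronglyMeasurable (by fun_prop))
        integrable_inv_one_add_sq.1
    · exact Eventually.of_forall fun y =>
        (φ.continuous.comp (by fun_prop : Continuous fun x : ℝ => x + ε * y)).mul continuous_const
  have hb2 : ∀ ε x : ℝ, ‖∫ y : ℝ, φ (x + ε * y) * (1 + y ^ 2)⁻¹‖ ≤ C * Real.pi := by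
    intro ε x
    refine (norm_integral_le_of_norm_le hintegrable (Eventually.of_forall fun y => ?_)).trans ?_
    · rw [norm_mul, Real.norm_of_nonneg (show 0 ≤ (1 + y ^ 2)⁻¹ by positivity)]
      gcongr
      exact hC _
    · rw [integral_const_mul, integral_univ_inv_one_add_sq]
  have hmain : Tendsto (fun ε : ℝ => ∫ x, (∫ y : ℝ, φ (x + ε * y) * (1 + y ^ 2)⁻¹) ∂ρ) (𝓝[>] 0)
      (𝓝 (∫ x, Real.pi * φ x ∂ρ)) := by
    refine tendsto_integral_filter_of_dominated_convergence (fun _ => C * Real.pi)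
      (Eventually.of_forall fun ε => (hc2 ε).aestronglyMeasurable)
      (Eventually.of_forall fun ε => Eventually.of_forall (hb2 ε)) (integrable_const _)
      (Eventually.of_forall fun x => ?_)
    have h1 : Real.pi * φ x = ∫ y : ℝ, φ x * (1 + y ^ 2)⁻¹ := by
      rw [integral_const_mul, integral_univ_inv_one_add_sq, mul_comm]
    rw [h1]
    refine tendsto_integral_filter_of_dominated_convergence (fun y => C * (1 + y ^ 2)⁻¹)
      (Eventually.of_forall fun ε => ?_) (Eventually.of_forall fun ε => Eventually.of_forall
        fun y => ?_) hintegrable (Eventually.of_forall fun y => ?_)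
    · have hc := φ.continuous
      exact AEStronglyMeasurable.mul (Continuous.aestronglyMeasurable (by fun_prop))
        integrable_inv_one_add_sq.1
    · rw [norm_mul, Real.norm_of_nonneg (show 0 ≤ (1 + y ^ 2)⁻¹ by positivity)]
      gcongr
      exact hC _
    · refine Tendsto.mul_const _ ?_
      have h2 : Continuous fun ε : ℝ => φ (x + ε * y) :=
        φ.continuous.comp (by fun_prop)
      have h3 := h2.tendsto 0
      simp only [zero_mul, add_zero] at h3
      exact h3.mono_left nhdsWithin_le_nhds
  refine hmain.congr' ?_
  filter_upwards [self_mem_nhdsWithin] with ε (hε : 0 < ε)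
  simp only [integral_poisson_rescale φ _ hε]

/-- Stieltjes inversion: if the Stieltjes transform is bounded, the measure is absolutely
continuous, with density given by the imaginary part of the boundary values. -/
theorem eq_withDensity_of_stieltjes {C : ℝ} (hC : ∀ z : ℂ, z.im < 0 → ‖stieltjes ρ z‖ ≤ C)
    {Gm : ℝ → ℂ} (hGm : Measurable Gm) {e : ℕ → ℝ} (he : Tendsto e atTop (𝓝[>] 0))
    (hlim : ∀ᵐ ν : ℝ, Tendsto (fun n => stieltjes ρ (ν - e n * Complex.I)) atTop (𝓝 (Gm ν))) :
    (∀ᵐ ν : ℝ, ‖Gm ν‖ ≤ C ∧ 0 ≤ (Gm ν).im) ∧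
      ρ = volume.withDensity fun ν => ENNReal.ofReal ((Gm ν).im / Real.pi) := by
  have hepos : ∀ᶠ n in atTop, 0 < e n := (tendsto_nhdsWithin_iff.1 he).2
  have him : ∀ n, 0 < e n → ∀ ν : ℝ, ((ν : ℂ) - e n * Complex.I).im < 0 := by
    intro n hn ν
    simpa using hn
  have hbound : ∀ᵐ ν : ℝ, ‖Gm ν‖ ≤ C ∧ 0 ≤ (Gm ν).im := by
    filter_upwards [hlim] with ν hν
    constructor
    · refine le_of_tendsto hν.norm ?_
      filter_upwards [hepos] with n hn
      exact hC _ (him n hn ν)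
    · refine ge_of_tendsto ((Complex.continuous_im.tendsto _).comp hν) ?_
      filter_upwards [hepos] with n hn
      exact stieltjes_im_nonneg ρ (him n hn ν)
  refine ⟨hbound, ?_⟩
  have hdm : Measurable fun ν => ENNReal.ofReal ((Gm ν).im / Real.pi) :=
    ((Complex.measurable_im.comp hGm).div_const _).ennreal_ofReal
  have hlf : IsLocallyFiniteMeasure
      (volume.withDensity fun ν => ENNReal.ofReal ((Gm ν).im / Real.pi)) := by
    refine ⟨fun x => ⟨Metric.ball x 1, Metric.ball_mem_nhds x one_pos, ?_⟩⟩
    rw [withDensity_apply _ measurableSet_ball]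
    calc ∫⁻ ν in Metric.ball x 1, ENNReal.ofReal ((Gm ν).im / Real.pi)
        ≤ ∫⁻ _ in Metric.ball x 1, ENNReal.ofReal (C / Real.pi) := by
          refine lintegral_mono_ae (ae_restrict_of_ae ?_)
          filter_upwards [hbound] with ν hν
          gcongr
          exact (Complex.abs_im_le_norm _).trans' (le_abs_self _) |>.trans hν.1
      _ < ∞ := by
          rw [setLIntegral_const]
          exact ENNReal.mul_lt_top ENNReal.ofReal_lt_top measure_ball_lt_top
  -- The integral of φ Im S(ν - iε), S the Stieltjes transform, is computed in two ways. Domination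
  -- by C gives the limit ∫ φ Im Gm, while Fubini and the Poisson kernel give π ∫ φ dρ. The bound C
  -- is what excludes a singular part.
  refine Measure.ext_of_integral_eq_on_compactlySupported fun φ => ?_
  obtain ⟨A, hA⟩ := φ.hasCompactSupport.exists_bound_of_continuous φ.continuous
  have hφi : Integrable φ := φ.continuous.integrable_of_hasCompactSupport φ.hasCompactSupport
  have h1 : Tendsto (fun n => ∫ ν : ℝ, φ ν * (stieltjes ρ (ν - e n * Complex.I)).im) atTop
      (𝓝 (∫ ν, φ ν * (Gm ν).im)) := by
    refine tendsto_integral_filter_of_dominated_convergence (fun ν => |φ ν| * C) ?_ ?_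
      (hφi.abs.mul_const C) ?_
    · filter_upwards [hepos] with n hn
      have := measurable_stieltjes_line ρ hn.ne'
      have hc := φ.continuous
      exact Continuous.aestronglyMeasurable
        (φ.continuous.mul (Complex.continuous_im.comp this))
    · filter_upwards [hepos] with n hn
      refine Eventually.of_forall fun ν => ?_
      rw [norm_mul, Real.norm_eq_abs]
      gcongr
      exact (Complex.abs_im_le_norm _).trans (hC _ (him n hn ν))
    · filter_upwards [hlim] with ν hν
      exact ((Complex.continuous_im.tendsto _).comp hν).const_mul _
  have h2 : ∀ ε : ℝ, 0 < ε → ∫ ν : ℝ, φ ν * (stieltjes ρ (ν - ε * Complex.I)).im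
      = ∫ x, (∫ ν : ℝ, φ ν * (ε / ((ν - x) ^ 2 + ε ^ 2))) ∂ρ := by
    intro ε hε
    have h3 : ∀ ν : ℝ, φ ν * (stieltjes ρ (ν - ε * Complex.I)).im
        = ∫ x, φ ν * (ε / ((ν - x) ^ 2 + ε ^ 2)) ∂ρ := by
      intro ν
      rw [stieltjes_im ρ (by simpa using hε.ne'), integral_const_mul]
      congr 2
      ext x
      congr 1
      · simp
      · simp [Complex.normSq_apply]
        ring
    simp only [h3]
    rw [integral_integral_swap]
    have hc : Continuous fun p : ℝ × ℝ => φ p.1 * (ε / ((p.1 - p.2) ^ 2 + ε ^ 2)) := by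
      have h4 : Continuous fun p : ℝ × ℝ => φ p.1 := φ.continuous.comp continuous_fst
      refine h4.mul (Continuous.div continuous_const (by fun_prop) fun p => ?_)
      positivity
    have h5 := (hφi.abs.mul_const (1 / ε)).mul_prod (integrable_const (μ := ρ) (1 : ℝ))
    refine Integrable.mono' h5 hc.aestronglyMeasurable (Eventually.of_forall fun p => ?_)
    simp only [Function.uncurry]
    rw [norm_mul, Real.norm_eq_abs, mul_one, Real.norm_of_nonneg (by positivity)]
    refine mul_le_mul_of_nonneg_left ?_ (abs_nonneg _)
    rw [div_le_div_iff₀ (by positivity) hε]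
    nlinarith [sq_nonneg (p.1 - p.2)]
  have h4 := (tendsto_integral_poisson ρ φ).comp he
  have h5 : ∫ ν, φ ν * (Gm ν).im = ∫ x, Real.pi * φ x ∂ρ := by
    refine tendsto_nhds_unique h1 (h4.congr' ?_)
    filter_upwards [hepos] with n hn
    exact (h2 _ hn).symm
  rw [integral_withDensity_eq_integral_toReal_smul hdm (Eventually.of_forall fun _ =>
    ENNReal.ofReal_lt_top)]
  rw [integral_const_mul] at h5
  have h6 : ∫ ν, (ENNReal.ofReal ((Gm ν).im / Real.pi)).toReal • φ ν
      = Real.pi⁻¹ * ∫ ν, φ ν * (Gm ν).im := by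
    rw [← integral_const_mul]
    refine integral_congr_ae ?_
    filter_upwards [hbound] with ν hν
    rw [ENNReal.toReal_ofReal (div_nonneg hν.2 Real.pi_pos.le), smul_eq_mul]
    ring
  rw [h6, h5, ← mul_assoc, inv_mul_cancel₀ Real.pi_ne_zero, one_mul]

end Stieltjes

/-! ### Weak solutions of the inhomogeneous Schrödinger equation -/

section Duhamel

variable {H : Type*} [NormedAddCommGroup H] [InnerProductSpace ℂ H]

/-- `ψ` is a weak solution of `ψ' = i h ψ + i c(t) g`. -/
structure IsWeakSolution (h : H →ₗ.[ℂ] H) (c : ℝ → ℂ) (g : H) (ψ : ℝ → H) : Prop where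
  continuous : Continuous ψ
  hasDerivAt : ∀ (x : h.domain) (t : ℝ), HasDerivAt (fun t => inner ℂ (x : H) (ψ t))
    (Complex.I * inner ℂ (h x) (ψ t) + Complex.I * c t * inner ℂ (x : H) g) t

/-- A product rule in which φ is norm differentiable but ψ only weakly so. The slope of ⟨φ,ψ⟩ is
⟨slope φ, ψ(r)⟩ plus the slope of ⟨φ(s),ψ⟩, and norm continuity of ψ takes care of the first term.
Since φ solves the homogeneous equation, the terms with h cancel and only the source remains. -/
theorem IsWeakSolution.inner_eq {h : H →ₗ.[ℂ] H} {c : ℝ → ℂ} {g : H} {ψ : ℝ → H}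
    (hψ : IsWeakSolution h c g ψ) (hc : Continuous c) {φ : ℝ → H} (hφ : ∀ s, φ s ∈ h.domain)
    (hder : ∀ s, HasDerivAt φ (Complex.I • h ⟨φ s, hφ s⟩) s) (t : ℝ) :
    inner ℂ (φ t) (ψ t)
      = inner ℂ (φ 0) (ψ 0) + ∫ s in (0 : ℝ)..t, Complex.I * c s * inner ℂ (φ s) g := by
  have hφc : Continuous φ := continuous_iff_continuousAt.2 fun s => (hder s).continuousAt
  have hk : ∀ s, HasDerivAt (fun s => inner ℂ (φ s) (ψ s))
      (Complex.I * c s * inner ℂ (φ s) g) s := by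
    intro s
    have h1 := hψ.hasDerivAt ⟨φ s, hφ s⟩ s
    rw [hasDerivAt_iff_tendsto_slope] at h1 ⊢
    have h2 := (hder s)
    rw [hasDerivAt_iff_tendsto_slope] at h2
    have h3 : Tendsto (fun r => inner ℂ (slope φ s r) (ψ r)) (𝓝[≠] s)
        (𝓝 (inner ℂ (Complex.I • h ⟨φ s, hφ s⟩) (ψ s))) :=
      h2.inner ((hψ.continuous.tendsto s).mono_left nhdsWithin_le_nhds)
    have h4 := h3.add h1
    have h5 : inner ℂ (Complex.I • h ⟨φ s, hφ s⟩) (ψ s)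
        + (Complex.I * inner ℂ (h ⟨φ s, hφ s⟩) (ψ s) + Complex.I * c s * inner ℂ (φ s) g)
        = Complex.I * c s * inner ℂ (φ s) g := by
      rw [inner_smul_left, Complex.conj_I]
      ring
    rw [h5] at h4
    refine h4.congr fun r => ?_
    simp only [slope_def_module]
    rw [← Complex.coe_smul, ← Complex.coe_smul, ← Complex.coe_smul, inner_smul_left,
      Complex.conj_ofReal, inner_sub_left, smul_eq_mul, smul_eq_mul]
    ring
  have hcont : Continuous fun s => Complex.I * c s * inner ℂ (φ s) g := by
    have : Continuous fun s => inner ℂ (φ s) g := hφc.inner continuous_const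
    fun_prop
  have := intervalIntegral.integral_eq_sub_of_hasDerivAt (fun s _ => hk s)
    (hcont.intervalIntegrable 0 t)
  rw [this]
  ring

end Duhamel

/-! ### The reservoirs on `ℝ^d` -/

section Euclidean

variable {d : ℕ}

/-- The kinetic energy `|p|²/2`. -/
def energy (p : EuclideanSpace ℝ (Fin d)) : ℝ := ‖p‖ ^ 2 / 2

theorem continuous_energy : Continuous (energy (d := d)) := by
  unfold energy
  fun_prop

theorem energy_nonneg (p : EuclideanSpace ℝ (Fin d)) : 0 ≤ energy p := by
  unfold energy
  positivity

theorem inner_L2_eq (φ ψ : L2 d) : inner ℂ φ ψ = ∫ p, conj (φ p) * ψ p := by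
  rw [L2.inner_def]
  congr 1
  ext p
  rw [RCLike.inner_apply, mul_comm]

theorem memLp_bdd_mul {m : EuclideanSpace ℝ (Fin d) → ℂ} {w : EuclideanSpace ℝ (Fin d) → ℂ}
    (hm : AEStronglyMeasurable m) (hw : MemLp w 2) {C : ℝ}
    (hC : ∀ᵐ p, ‖m p * w p‖ ≤ C * ‖w p‖) : MemLp (fun p => m p * w p) 2 :=
  hw.of_le_mul (hm.mul hw.1) hC

theorem kinetic_coeFn (ψ : (kinetic d).domain) :
    (kinetic d ψ : EuclideanSpace ℝ (Fin d) → ℂ) =ᵐ[volume]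
      fun p => (energy p : ℂ) * (ψ : L2 d) p :=
  MemLp.coeFn_toLp (kineticDomain_memLp ψ)

theorem kinetic_symmetric (x y : (kinetic d).domain) :
    inner ℂ (kinetic d x) (y : L2 d) = inner ℂ (x : L2 d) (kinetic d y) := by
  rw [inner_L2_eq, inner_L2_eq]
  refine integral_congr_ae ?_
  filter_upwards [kinetic_coeFn x, kinetic_coeFn y] with p hx hy
  rw [hx, hy, map_mul, Complex.conj_ofReal]
  ring

theorem lintegral_L2_lt_top (ψ : L2 d) : ∫⁻ p, ‖ψ p‖ₑ ^ 2 < ∞ := by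
  have h := (Lp.memLp ψ).2
  rw [eLpNorm_lt_top_iff_lintegral_rpow_enorm_lt_top (by norm_num) (by norm_num)] at h
  simpa using h

theorem measurable_enorm_sq_L2 (ψ : L2 d) : Measurable fun p => ‖ψ p‖ₑ ^ 2 :=
  (Lp.stronglyMeasurable ψ).measurable.enorm.pow_const 2

instance isFiniteMeasure_kineticMeasure (ψ : L2 d) : IsFiniteMeasure (kineticMeasure d ψ) := by
  have : IsFiniteMeasure ((volume : Measure (EuclideanSpace ℝ (Fin d))).withDensity
      fun p => ‖ψ p‖ₑ ^ 2) := isFiniteMeasure_withDensity (lintegral_L2_lt_top ψ).ne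
  unfold kineticMeasure
  infer_instance

theorem kineticMeasure_eq (ψ : L2 d) : kineticMeasure d ψ
    = ((volume : Measure (EuclideanSpace ℝ (Fin d))).withDensity fun p => ‖ψ p‖ₑ ^ 2).map
      energy := rfl

/-- The spectral measure of a function of the Hamiltonian applied to `g`. -/
theorem kineticMeasure_of_ae_eq {g ψ : L2 d} {u : ℝ → ℂ} (hu : Measurable u)
    (h : ∀ᵐ p, ψ p = u (energy p) * g p) :
    kineticMeasure d ψ = (kineticMeasure d g).withDensity fun ν => ‖u ν‖ₑ ^ 2 := by
  have hE : Measurable (energy (d := d)) := continuous_energy.measurable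
  have hum : Measurable fun ν => ‖u ν‖ₑ ^ 2 := hu.enorm.pow_const 2
  have huE : Measurable fun p : EuclideanSpace ℝ (Fin d) => ‖u (energy p)‖ₑ ^ 2 := hum.comp hE
  ext S hS
  rw [withDensity_apply _ hS, kineticMeasure_eq, kineticMeasure_eq, Measure.map_apply hE hS,
    setLIntegral_map hS hum hE, withDensity_apply _ (hE hS),
    setLIntegral_withDensity_eq_setLIntegral_mul _ (measurable_enorm_sq_L2 g) huE (hE hS)]
  refine lintegral_congr_ae (ae_restrict_of_ae ?_)
  filter_upwards [h] with p hp
  rw [hp, enorm_mul, mul_pow, mul_comm]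
  rfl

theorem integral_kineticMeasure (g : L2 d) {u : ℝ → ℂ} (hu : Measurable u) :
    ∫ ν, u ν ∂(kineticMeasure d g) = ∫ p, conj (g p) * (u (energy p) * g p) := by
  have hE : Measurable (energy (d := d)) := continuous_energy.measurable
  rw [kineticMeasure_eq, integral_map hE.aemeasurable hu.aestronglyMeasurable,
    integral_withDensity_eq_integral_toReal_smul (measurable_enorm_sq_L2 g)
      (Eventually.of_forall fun p => ENNReal.pow_lt_top enorm_lt_top)]
  congr 1
  ext p
  rw [Complex.real_smul, ENNReal.toReal_pow, toReal_enorm, mul_left_comm, mul_comm (conj (g p)),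
    Complex.mul_conj, Complex.normSq_eq_norm_sq]
  push_cast
  ring

/-- The solution is division by z - |p|²/2, a bounded multiplier off the real axis. It lies in the
maximal domain because |p|²/2 times it equals z times it minus g. -/
theorem kinetic_resolvent (g : L2 d) {z : ℂ} (hz : z.im ≠ 0) :
    ∃ x : (kinetic d).domain, z • (x : L2 d) - kinetic d x = g ∧
      inner ℂ g (x : L2 d) = stieltjes (kineticMeasure d g) z := by
  have hcr : Continuous fun p : EuclideanSpace ℝ (Fin d) => (z - (energy p : ℂ))⁻¹ :=
    (continuous_inv_sub hz).comp continuous_energy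
  have hm : MemLp (fun p => (z - (energy p : ℂ))⁻¹ * g p) 2 :=
    memLp_bdd_mul hcr.aestronglyMeasurable (Lp.memLp g) (C := |z.im|⁻¹)
      (Eventually.of_forall fun p => by
        rw [norm_mul]
        gcongr
        exact norm_inv_sub_le hz _)
  have hx := hm.coeFn_toLp
  have hm2 : MemLp (fun p => (energy p : ℂ) * (hm.toLp _) p) 2 := by
    have h1 : MemLp (fun p => z * ((z - (energy p : ℂ))⁻¹ * g p) - g p) 2 :=
      (hm.const_mul z).sub (Lp.memLp g)
    refine (memLp_congr_ae ?_).1 h1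
    filter_upwards [hx] with p hp
    have := sub_ofReal_ne_zero hz (energy p)
    rw [hp]
    field_simp
    ring
  refine ⟨⟨hm.toLp _, hm2⟩, ?_, ?_⟩
  · apply Lp.ext
    filter_upwards [hx, Lp.coeFn_sub (z • hm.toLp _) (kinetic d ⟨hm.toLp _, hm2⟩),
      Lp.coeFn_smul z (hm.toLp _), kinetic_coeFn ⟨hm.toLp _, hm2⟩] with p h1 h2 h3 h4
    rw [h2, Pi.sub_apply, h3, Pi.smul_apply, h4, h1, smul_eq_mul]
    have := sub_ofReal_ne_zero hz (energy p)
    field_simp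
  · rw [inner_L2_eq, stieltjes, integral_kineticMeasure g (continuous_inv_sub hz).measurable]
    refine integral_congr_ae ?_
    filter_upwards [hx] with p hp
    rw [hp]

theorem integrable_sq_kineticMeasure {g : L2 d} (hg : g ∈ (kinetic d).domain) :
    Integrable (fun ν : ℝ => ν ^ 2) (kineticMeasure d g) := by
  have hE : Measurable (energy (d := d)) := continuous_energy.measurable
  have h1 : MemLp (fun p => (energy p : ℂ) * g p) 2 := hg
  rw [kineticMeasure_eq, integrable_map_measure (by fun_prop) hE.aemeasurable,
    integrable_withDensity_iff_integrable_smul' (measurable_enorm_sq_L2 g)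
      (Eventually.of_forall fun p => ENNReal.pow_lt_top enorm_lt_top)]
  have h2 := (memLp_two_iff_integrable_sq_norm h1.1).1 h1
  refine h2.congr (Eventually.of_forall fun p => ?_)
  simp only [Function.comp_apply, smul_eq_mul]
  rw [ENNReal.toReal_pow, toReal_enorm, norm_mul, mul_pow, Complex.norm_real, Real.norm_eq_abs,
    sq_abs]
  ring

/-- Makes limits along this filter unique, so that `limUnder` in the weight returns the essential
limit: every neighbourhood of the origin has positive volume. -/
theorem neBot_nhds_zero_inf_ae :
    NeBot (𝓝 (0 : EuclideanSpace ℝ (Fin d)) ⊓ ae (volume : Measure (EuclideanSpace ℝ (Fin d)))) := by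
  rw [inf_neBot_iff]
  intro s hs t ht
  by_contra hne
  rw [Set.not_nonempty_iff_eq_empty] at hne
  have h1 : 0 < volume s := MeasureTheory.Measure.measure_pos_of_mem_nhds volume hs
  have h2 : volume (s ∩ t) = volume s := by
    refine measure_congr ?_
    filter_upwards [ht] with p hp
    simp only [eq_iff_iff]
    exact ⟨fun h => h.1, fun h => ⟨h, hp⟩⟩
  rw [hne, measure_empty] at h2
  exact h1.ne h2

theorem tendsto_of_ae_eq_mul {g ψ : L2 d} {u : ℝ → ℂ} (hu : Continuous u)
    (h : ∀ᵐ p, ψ p = u (energy p) * g p) {a : ℂ}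
    (ha : Tendsto (fun p => g p) (𝓝 0 ⊓ ae volume) (𝓝 a)) :
    Tendsto (fun p => ψ p) (𝓝 0 ⊓ ae volume) (𝓝 (u 0 * a)) := by
  have h1 : Tendsto (fun p : EuclideanSpace ℝ (Fin d) => u (energy p)) (𝓝 0 ⊓ ae volume)
      (𝓝 (u 0)) := by
    have h2 := (hu.comp (continuous_energy (d := d))).tendsto 0
    have h3 : energy (0 : EuclideanSpace ℝ (Fin d)) = 0 := by simp [energy]
    rw [Function.comp_apply, h3] at h2
    exact h2.mono_left inf_le_left
  refine (h1.mul ha).congr' ?_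
  filter_upwards [h.filter_mono inf_le_right] with p hp
  rw [hp]

end Euclidean

/-- The solution `e^{itν}(a + bν + i∫_0^t c(s)e^{-isν}ds)` of the inhomogeneous Schrödinger
equation in the spectral representation. -/
def orbitFn (a b : ℂ) (c : ℝ → ℂ) (t ν : ℝ) : ℂ :=
  Complex.exp (Complex.I * t * ν) * (a + b * ν + Complex.I * partialFt c t ν)

theorem continuous_orbitFn (a b : ℂ) {c : ℝ → ℂ} (hc : Continuous c) (t : ℝ) :
    Continuous (orbitFn a b c t) := by
  have h1 : Continuous fun ν => partialFt c t ν :=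
    (continuous_partialFt hc).comp (f := fun ν : ℝ => (t, ν)) (by fun_prop)
  unfold orbitFn
  fun_prop

theorem norm_orbitFn (a b : ℂ) (c : ℝ → ℂ) (t ν : ℝ) :
    ‖orbitFn a b c t ν‖ = ‖a + b * ν + Complex.I * partialFt c t ν‖ := by
  rw [orbitFn, norm_mul, norm_exp_I_mul, one_mul]

section Euclidean

variable {d : ℕ}

theorem memLp_phase (w : L2 d) (s : ℝ) :
    MemLp (fun p => Complex.exp (Complex.I * s * energy p) * w p) 2 := by
  have hc : Continuous fun p : EuclideanSpace ℝ (Fin d) =>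
      Complex.exp (Complex.I * s * energy p) := by
    have := continuous_energy (d := d)
    fun_prop
  refine memLp_bdd_mul hc.aestronglyMeasurable (Lp.memLp w) (C := 1)
    (Eventually.of_forall fun p => ?_)
  rw [norm_mul, norm_exp_I_mul]

/-- `e^{is|p|²/2} w`. -/
def phase (w : L2 d) (s : ℝ) : L2 d := (memLp_phase w s).toLp _

theorem phase_coeFn (w : L2 d) (s : ℝ) :
    (phase w s : EuclideanSpace ℝ (Fin d) → ℂ) =ᵐ[volume]
      fun p => Complex.exp (Complex.I * s * energy p) * w p := (memLp_phase w s).coeFn_toLp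

theorem phase_mem_domain {w : L2 d} {R : ℝ} (hw : ∀ᵐ p, R < energy p → w p = 0) (s : ℝ) :
    phase w s ∈ (kinetic d).domain := by
  have h1 : MemLp (fun p => (energy p : ℂ) * phase w s p) 2 := by
    have hc : Continuous fun p : EuclideanSpace ℝ (Fin d) => (energy p : ℂ) := by
      have := continuous_energy (d := d)
      fun_prop
    refine memLp_bdd_mul hc.aestronglyMeasurable (Lp.memLp (phase w s)) (C := R) ?_
    filter_upwards [hw, phase_coeFn w s] with p hp hp'
    by_cases h : R < energy p
    · rw [hp', hp h]
      simp
    · rw [norm_mul, Complex.norm_real, Real.norm_of_nonneg (energy_nonneg p)]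
      gcongr
      exact not_lt.1 h
  exact h1

/-- The energy cut-off makes the free evolution norm differentiable: for |h| < 1/R the pointwise
remainder satisfies |e^x - 1 - x| ≤ |x|² ≤ R²h², so the error in norm is O(h²). -/
theorem hasDerivAt_phase {w : L2 d} {R : ℝ} (hR : 0 < R) (hw : ∀ᵐ p, R < energy p → w p = 0)
    (s : ℝ) :
    HasDerivAt (phase w) (Complex.I • kinetic d ⟨phase w s, phase_mem_domain hw s⟩) s := by
  rw [hasDerivAt_iff_isLittleO_nhds_zero]
  refine Asymptotics.IsBigO.trans_isLittleO (g := fun h : ℝ => h ^ 2) ?_ ?_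
  · refine Asymptotics.IsBigO.of_bound (R ^ 2 * ‖w‖) ?_
    have hev : ∀ᶠ h : ℝ in 𝓝 0, |h| < 1 / R := by
      have : Tendsto (fun h : ℝ => |h|) (𝓝 0) (𝓝 0) := by simpa using (continuous_abs.tendsto (0 : ℝ))
      exact this.eventually (gt_mem_nhds (by positivity))
    filter_upwards [hev] with h hh
    have key : ‖phase w (s + h) - phase w s
        - h • (Complex.I • kinetic d ⟨phase w s, phase_mem_domain hw s⟩)‖
        ≤ (R ^ 2 * h ^ 2) * ‖w‖ := by
      refine Lp.norm_le_mul_norm_of_ae_le_mul ?_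
      filter_upwards [hw, phase_coeFn w s, phase_coeFn w (s + h),
        kinetic_coeFn ⟨phase w s, phase_mem_domain hw s⟩,
        Lp.coeFn_sub (phase w (s + h) - phase w s)
          (h • (Complex.I • kinetic d ⟨phase w s, phase_mem_domain hw s⟩)),
        Lp.coeFn_sub (phase w (s + h)) (phase w s),
        Lp.coeFn_smul h (Complex.I • kinetic d ⟨phase w s, phase_mem_domain hw s⟩),
        Lp.coeFn_smul Complex.I (kinetic d ⟨phase w s, phase_mem_domain hw s⟩)]
        with p h0 h1 h2 h3 h4 h5 h6 h7
      rw [h4, Pi.sub_apply, h5, Pi.sub_apply, h6, Pi.smul_apply, h7, Pi.smul_apply, h3, h1, h2]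
      by_cases hE : R < energy p
      · rw [h0 hE]
        simp
      · have hER := not_lt.1 hE
        set x : ℂ := Complex.I * h * energy p with hx
        have hxn : ‖x‖ = |h| * energy p := by
          rw [hx, norm_mul, norm_mul, Complex.norm_I, Complex.norm_real, Complex.norm_real,
            Real.norm_eq_abs, Real.norm_of_nonneg (energy_nonneg p), one_mul]
        have hx1 : ‖x‖ ≤ 1 := by
          rw [hxn]
          calc |h| * energy p ≤ (1 / R) * R := by
                gcongr
                exact energy_nonneg p
            _ = 1 := by field_simp
        have e1 : Complex.exp (Complex.I * ((s + h : ℝ) : ℂ) * energy p) * w p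
            - Complex.exp (Complex.I * s * energy p) * w p
            - h • (Complex.I • ((energy p : ℂ) * (Complex.exp (Complex.I * s * energy p) * w p)))
            = Complex.exp (Complex.I * s * energy p) * ((Complex.exp x - 1 - x) * w p) := by
          have : Complex.exp (Complex.I * ((s + h : ℝ) : ℂ) * energy p)
              = Complex.exp (Complex.I * s * energy p) * Complex.exp x := by
            rw [← Complex.exp_add, hx]
            congr 1
            push_cast
            ring
          rw [this, Complex.real_smul, smul_eq_mul, hx]
          ring
        rw [e1, norm_mul, norm_exp_I_mul, one_mul, norm_mul]
        gcongr
        refine (Complex.norm_exp_sub_one_sub_id_le hx1).trans ?_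
        rw [hxn, mul_pow, sq_abs, mul_comm]
        gcongr
        exact energy_nonneg p
    refine key.trans (le_of_eq ?_)
    rw [Real.norm_of_nonneg (by positivity)]
    ring
  · have := Asymptotics.isLittleO_pow_id (𝕜 := ℝ) (n := 2) (by norm_num)
    simpa using this

/-- The solution of the inhomogeneous Schrödinger equation with source along `g` and initial value
`a g + b h g`. -/
theorem kinetic_solution {g : L2 d} (hg : g ∈ (kinetic d).domain) {c : ℝ → ℂ} (hc : Continuous c)
    {ψ : ℝ → L2 d} (hψ : IsWeakSolution (kinetic d) c g ψ) {a b : ℂ}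
    (h0 : ψ 0 = a • g + b • kinetic d ⟨g, hg⟩) {t : ℝ} (ht : 0 ≤ t) :
    ∀ᵐ p, ψ t p = orbitFn a b c t (energy p) * g p := by
  -- For each cut-off R let v be the difference between ψ(t) and the claimed formula on energies at
  -- most R. Testing the weak equation with a free solution of bounded energy that equals v at time
  -- t evaluates ⟨v, ψ(t)⟩ by the claimed formula, so ⟨v, v⟩ = 0.
  have hfin : ∀ n : ℕ, ∀ᵐ p, energy p ≤ (n + 1 : ℝ) → ψ t p = orbitFn a b c t (energy p) * g p := by
    intro n
    set R : ℝ := n + 1 with hR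
    have hRpos : 0 < R := by positivity
    have hS : MeasurableSet {p : EuclideanSpace ℝ (Fin d) | energy p ≤ R} :=
      (isClosed_le continuous_energy continuous_const).measurableSet
    have hoc : Continuous fun p : EuclideanSpace ℝ (Fin d) => orbitFn a b c t (energy p) :=
      (continuous_orbitFn a b hc t).comp continuous_energy
    obtain ⟨C, hC⟩ : ∃ C, ∀ ν ∈ Set.Icc 0 R, ‖orbitFn a b c t ν‖ ≤ C :=
      isCompact_Icc.exists_bound_of_continuousOn (continuous_orbitFn a b hc t).continuousOn
    set D : EuclideanSpace ℝ (Fin d) → ℂ := fun p =>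
      ψ t p - {p | energy p ≤ R}.indicator (fun p => orbitFn a b c t (energy p)) p * g p with hD
    have hDm : MemLp D 2 := by
      refine (Lp.memLp (ψ t)).sub (memLp_bdd_mul
        (hoc.aestronglyMeasurable.indicator hS) (Lp.memLp g) (C := C)
        (Eventually.of_forall fun p => ?_))
      by_cases hp : energy p ≤ R
      · rw [Set.indicator_of_mem (by exact hp), norm_mul]
        gcongr
        exact hC _ ⟨energy_nonneg p, hp⟩
      · rw [Set.indicator_of_notMem (by exact hp)]
        simp only [zero_mul, norm_zero]
        have : 0 ≤ C := (norm_nonneg _).trans (hC 0 ⟨le_rfl, hRpos.le⟩)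
        positivity
    have hDm' : MemLp ({p | energy p ≤ R}.indicator D) 2 := hDm.indicator hS
    set v : L2 d := hDm'.toLp _ with hv
    have hvc := hDm'.coeFn_toLp
    -- Evolving v backwards by t gives the initial value of the free solution that ends at v.
    set w : L2 d := phase v (-t) with hw
    have hwz : ∀ᵐ p, R < energy p → w p = 0 := by
      filter_upwards [phase_coeFn v (-t), hvc] with p h1 h2 h3
      rw [hw, h1, h2, Set.indicator_of_notMem (by exact not_le.2 h3), mul_zero]
    have hintegrable := hψ.inner_eq hc (phase_mem_domain hwz) (hasDerivAt_phase hRpos hwz) t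
    have hpt : phase w t = v := by
      apply Lp.ext
      filter_upwards [phase_coeFn w t, phase_coeFn v (-t)] with p h1 h2
      rw [h1, hw, h2, ← mul_assoc, ← Complex.exp_add]
      have : Complex.I * (t : ℂ) * energy p + Complex.I * ((-t : ℝ) : ℂ) * energy p = 0 := by
        push_cast
        ring
      rw [this, Complex.exp_zero, one_mul]
    have hp0 : phase w 0 = w := by
      apply Lp.ext
      filter_upwards [phase_coeFn w 0] with p h1
      rw [h1]
      simp
    have hgw : Integrable fun p => conj (w p) * g p := by
      have := L2.integrable_inner (𝕜 := ℂ) w g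
      refine this.congr (Eventually.of_forall fun p => ?_)
      simp [RCLike.inner_apply, mul_comm]
    have hI : ∫ s in (0 : ℝ)..t, Complex.I * c s * inner ℂ (phase w s) g
        = ∫ p, conj (w p) * (Complex.I * partialFt c t (energy p) * g p) := by
      have e1 : ∀ s : ℝ, Complex.I * c s * inner ℂ (phase w s) g
          = ∫ p, Complex.I * (c s * Complex.exp (-(Complex.I * s * energy p)))
            * (conj (w p) * g p) := by
        intro s
        rw [inner_L2_eq, ← integral_const_mul]
        refine integral_congr_ae ?_
        filter_upwards [phase_coeFn w s] with p hp
        rw [hp, map_mul, ← Complex.exp_conj]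
        have : conj (Complex.I * (s : ℂ) * energy p) = -(Complex.I * s * energy p) := by
          simp
        rw [this]
        ring
      simp only [e1]
      rw [intervalIntegral.integral_of_le ht, integral_integral_swap]
      · refine integral_congr_ae (Eventually.of_forall fun p => ?_)
        dsimp only
        rw [integral_mul_const, integral_const_mul, ← intervalIntegral.integral_of_le ht, partialFt]
        ring
      · obtain ⟨B, hB⟩ : ∃ B, ∀ s ∈ Set.Icc 0 t, ‖c s‖ ≤ B :=
          isCompact_Icc.exists_bound_of_continuousOn hc.continuousOn
        have hprod : Integrable (fun q : ℝ × EuclideanSpace ℝ (Fin d) =>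
            B * ‖conj (w q.2) * g q.2‖) ((volume.restrict (Set.Ioc 0 t)).prod volume) :=
          (integrable_const (μ := volume.restrict (Set.Ioc 0 t)) B).mul_prod hgw.norm
        refine Integrable.mono' hprod ?_ ?_
        · have hc1 : Continuous fun q : ℝ × EuclideanSpace ℝ (Fin d) =>
              Complex.I * (c q.1 * Complex.exp (-(Complex.I * q.1 * energy q.2))) := by
            have h1 := continuous_energy (d := d)
            have h2 : Continuous fun q : ℝ × EuclideanSpace ℝ (Fin d) => energy q.2 :=
              h1.comp continuous_snd
            fun_prop
          exact hc1.aestronglyMeasurable.mul hgw.1.comp_snd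
        · have hmem : ∀ᵐ q : ℝ × EuclideanSpace ℝ (Fin d)
              ∂((volume.restrict (Set.Ioc 0 t)).prod volume), q.1 ∈ Set.Ioc 0 t :=
            Measure.quasiMeasurePreserving_fst.ae (ae_restrict_mem measurableSet_Ioc)
          filter_upwards [hmem] with q hq
          simp only [Function.uncurry]
          rw [norm_mul, norm_mul, norm_mul, Complex.norm_I, norm_exp_neg_I_mul, Complex.ofReal_im,
            mul_zero, Real.exp_zero, mul_one, one_mul]
          gcongr
          exact hB _ ⟨hq.1.le, hq.2⟩
    have hkw : Integrable fun p => conj (w p) * ((a + b * energy p) * g p) := by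
      have := L2.integrable_inner (𝕜 := ℂ) w (ψ 0)
      refine this.congr ?_
      rw [h0]
      filter_upwards [Lp.coeFn_add (a • g) (b • kinetic d ⟨g, hg⟩), Lp.coeFn_smul a g,
        Lp.coeFn_smul b (kinetic d ⟨g, hg⟩), kinetic_coeFn ⟨g, hg⟩] with p h1 h2 h3 h4
      rw [h1, Pi.add_apply, h2, h3, Pi.smul_apply, Pi.smul_apply, h4, RCLike.inner_apply]
      simp only [smul_eq_mul]
      ring
    have h0' : inner ℂ w (ψ 0) = ∫ p, conj (w p) * ((a + b * energy p) * g p) := by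
      rw [inner_L2_eq, h0]
      refine integral_congr_ae ?_
      filter_upwards [Lp.coeFn_add (a • g) (b • kinetic d ⟨g, hg⟩), Lp.coeFn_smul a g,
        Lp.coeFn_smul b (kinetic d ⟨g, hg⟩), kinetic_coeFn ⟨g, hg⟩] with p h1 h2 h3 h4
      rw [h1, Pi.add_apply, h2, h3, Pi.smul_apply, Pi.smul_apply, h4]
      simp only [smul_eq_mul]
      ring
    have hiw : Integrable fun p => conj (w p) * (Complex.I * partialFt c t (energy p) * g p) := by
      obtain ⟨C', hC'⟩ : ∃ C, ∀ ν ∈ Set.Icc 0 R, ‖Complex.I * partialFt c t ν‖ ≤ C := by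
        refine isCompact_Icc.exists_bound_of_continuousOn (Continuous.continuousOn ?_)
        have h1 : Continuous fun ν => partialFt c t ν :=
          (continuous_partialFt hc).comp (f := fun ν : ℝ => (t, ν)) (by fun_prop)
        fun_prop
      have hcc : Continuous fun p : EuclideanSpace ℝ (Fin d) =>
          Complex.I * partialFt c t (energy p) := by
        have h1 : Continuous fun ν => partialFt c t ν :=
          (continuous_partialFt hc).comp (f := fun ν : ℝ => (t, ν)) (by fun_prop)
        exact continuous_const.mul (h1.comp continuous_energy)
      have h2 : AEStronglyMeasurable fun p => (Complex.I * partialFt c t (energy p))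
          * (conj (w p) * g p) := hcc.aestronglyMeasurable.mul hgw.1
      have h3 : Integrable fun p => (Complex.I * partialFt c t (energy p))
          * (conj (w p) * g p) := by
        refine Integrable.mono' (hgw.norm.const_mul C') h2 ?_
        filter_upwards [hwz] with p hp
        by_cases hpR : R < energy p
        · rw [hp hpR]
          simp
        · rw [norm_mul]
          gcongr
          exact hC' _ ⟨energy_nonneg p, not_lt.1 hpR⟩
      refine h3.congr (Eventually.of_forall fun p => ?_)
      ring
    rw [hpt, hp0, hI, h0', ← integral_add hkw hiw] at hintegrable
    have hzero : inner ℂ v v = 0 := by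
      have e2 : inner ℂ v (ψ t) = ∫ p, conj (v p) * (orbitFn a b c t (energy p) * g p) := by
        rw [hintegrable]
        refine integral_congr_ae ?_
        filter_upwards [phase_coeFn v (-t)] with p h1
        rw [hw, h1, map_mul, ← Complex.exp_conj]
        have : conj (Complex.I * ((-t : ℝ) : ℂ) * energy p) = Complex.I * t * energy p := by
          simp
        rw [this, orbitFn]
        ring
      have e3 : inner ℂ v v = ∫ p, conj (v p) * D p := by
        rw [inner_L2_eq]
        refine integral_congr_ae ?_
        filter_upwards [hvc] with p h1
        rw [hv, h1]
        by_cases hp : energy p ≤ R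
        · rw [Set.indicator_of_mem (by exact hp)]
        · rw [Set.indicator_of_notMem (by exact hp)]
          simp
      have hi1 : Integrable fun p => conj (v p) * ψ t p := by
        refine (L2.integrable_inner (𝕜 := ℂ) v (ψ t)).congr (Eventually.of_forall fun p => ?_)
        simp [RCLike.inner_apply, mul_comm]
      have hi2 : Integrable fun p => conj (v p) * D p := by
        refine (L2.integrable_inner (𝕜 := ℂ) v (hDm.toLp D)).congr ?_
        filter_upwards [hDm.coeFn_toLp] with p hp
        rw [hp, RCLike.inner_apply, mul_comm]
      have e4 : (∫ p, conj (v p) * ψ t p) - ∫ p, conj (v p) * D p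
          = ∫ p, conj (v p) * (orbitFn a b c t (energy p) * g p) := by
        rw [← integral_sub hi1 hi2]
        refine integral_congr_ae ?_
        filter_upwards [hvc] with p h1
        rw [hD]
        by_cases hp : energy p ≤ R
        · simp only [Set.indicator_of_mem (show p ∈ {p | energy p ≤ R} from hp)]
          ring
        · have : v p = 0 := by
            rw [hv, h1, Set.indicator_of_notMem (by exact hp)]
          rw [this]
          simp
      rw [e3]
      rw [← e2, inner_L2_eq] at e4
      linear_combination (-1 : ℂ) * e4
    rw [inner_self_eq_zero] at hzero
    have hv0 : ∀ᵐ p, v p = 0 := by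
      rw [hzero]
      filter_upwards [Lp.coeFn_zero ℂ 2 (volume : Measure (EuclideanSpace ℝ (Fin d)))] with p hp
      rw [hp, Pi.zero_apply]
    filter_upwards [hv0, hvc] with p h1 h2 hp
    rw [hv, h2, Set.indicator_of_mem (by exact hp)] at h1
    simp only [hD, Set.indicator_of_mem (show p ∈ {p | energy p ≤ R} from hp)] at h1
    exact sub_eq_zero.1 h1
  filter_upwards [ae_all_iff.2 hfin] with p hp
  obtain ⟨n, hn⟩ := exists_nat_gt (energy p)
  exact hp n (by linarith)

end Euclidean

/-! ### Functional calculus of a bounded self-adjoint operator -/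

section BoundedCalculus

variable {H : Type*} [NormedAddCommGroup H] [InnerProductSpace ℂ H] [CompleteSpace H]

/-- `u(T)` for a complex function `u` on the real line. -/
def functionOf (T : H →L[ℂ] H) (u : ℝ → ℂ) : H →L[ℂ] H := cfc (fun z : ℂ => u z.re) T

variable {T : H →L[ℂ] H}

theorem functionOf_add (T : H →L[ℂ] H) {u w : ℝ → ℂ} (hu : Continuous u) (hw : Continuous w) :
    functionOf T (fun x => u x + w x) = functionOf T u + functionOf T w :=
  cfc_add T _ _ (by fun_prop) (by fun_prop)

theorem functionOf_mul (T : H →L[ℂ] H) {u w : ℝ → ℂ} (hu : Continuous u) (hw : Continuous w) :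
    functionOf T (fun x => u x * w x) = functionOf T u * functionOf T w :=
  cfc_mul _ _ T (by fun_prop) (by fun_prop)

theorem functionOf_const_mul (T : H →L[ℂ] H) (c : ℂ) {u : ℝ → ℂ} (hu : Continuous u) :
    functionOf T (fun x => c * u x) = c • functionOf T u :=
  cfc_const_mul c _ T (by fun_prop)

theorem functionOf_conj (T : H →L[ℂ] H) (u : ℝ → ℂ) :
    functionOf T (fun x => conj (u x)) = star (functionOf T u) :=
  cfc_star (fun z : ℂ => u z.re) T

theorem functionOf_ofReal (hT : IsSelfAdjoint T) (f : ℝ → ℝ) :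
    functionOf T (fun x => (f x : ℂ)) = cfc f T :=
  (cfc_real_eq_complex f hT).symm

theorem functionOf_one (hT : IsSelfAdjoint T) : functionOf T (fun _ => 1) = 1 := by
  have := hT.isStarNormal
  exact cfc_const_one ℂ T

theorem functionOf_id (hT : IsSelfAdjoint T) : functionOf T (fun x => (x : ℂ)) = T := by
  rw [functionOf_ofReal hT (fun x => x)]
  exact cfc_id' ℝ T

theorem functionOf_re_add_im (hT : IsSelfAdjoint T) {u : ℝ → ℂ} (hu : Continuous u) :
    functionOf T u = cfc (fun x => (u x).re) T + Complex.I • cfc (fun x => (u x).im) T := by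
  rw [← functionOf_ofReal hT, ← functionOf_ofReal hT, ← functionOf_const_mul T _ (by fun_prop),
    ← functionOf_add T (by fun_prop) (by fun_prop)]
  congr 1
  ext x
  rw [mul_comm, Complex.re_add_im]

/-- The measure representing `u ↦ ⟪ψ, u(T) ψ⟫`. -/
def boundedMeasure (T : H →L[ℂ] H) (ψ : H) : Measure ℝ :=
  RealRMK.rieszMeasure (spectralFunctional T ψ)

instance regular_boundedMeasure (T : H →L[ℂ] H) (ψ : H) : (boundedMeasure T ψ).Regular :=
  RealRMK.regular_rieszMeasure _

theorem integral_boundedMeasure_compactlySupported (T : H →L[ℂ] H) (ψ : H)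
    (f : CompactlySupportedContinuousMap ℝ ℝ) :
    ∫ ν, f ν ∂(boundedMeasure T ψ) = (inner ℂ ψ (cfc (f : ℝ → ℝ) T ψ)).re :=
  RealRMK.integral_rieszMeasure _ f

theorem abs_le_of_mem_spectrum {T : H →L[ℂ] H} {x : ℝ} (hx : x ∈ spectrum ℝ T) :
    |x| ≤ ‖T‖ := by
  have : Nontrivial H := by
    by_contra h
    rw [not_nontrivial_iff_subsingleton] at h
    have : Subsingleton (H →L[ℂ] H) := inferInstance
    exact hx (isUnit_of_subsingleton _)
  simpa using spectrum.norm_le_norm_of_mem hx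

/-- The bumps max(0, min(|x| - ‖T‖, n - |x|)) vanish on the spectrum, so the functional calculus
annihilates them; they are positive precisely where ‖T‖ < |x| < n. -/
theorem boundedMeasure_compl_Icc (T : H →L[ℂ] H) (ψ : H) :
    boundedMeasure T ψ (Set.Icc (-‖T‖) ‖T‖)ᶜ = 0 := by
  have key : ∀ n : ℕ, boundedMeasure T ψ {x : ℝ | ‖T‖ < |x| ∧ |x| < n} = 0 := by
    intro n
    let f : CompactlySupportedContinuousMap ℝ ℝ :=
      { toFun := fun x => max 0 (min (|x| - ‖T‖) (n - |x|))
        continuous_toFun := by fun_prop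
        hasCompactSupport' := by
          refine HasCompactSupport.intro (isCompact_Icc (a := -(n : ℝ)) (b := n)) fun x hx => ?_
          have : (n : ℝ) < |x| := by
            by_contra h
            exact hx (abs_le.1 (not_lt.1 h))
          exact max_eq_left ((min_le_right _ _).trans (by linarith)) }
    have hf : ∀ x, f x = max 0 (min (|x| - ‖T‖) (n - |x|)) := fun x => rfl
    have h0 : cfc (f : ℝ → ℝ) T = 0 := by
      rw [← cfc_zero ℝ T]
      refine cfc_congr fun x hx => ?_
      rw [hf]
      exact max_eq_left ((min_le_left _ _).trans
        (by linarith [abs_le_of_mem_spectrum hx]))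
    have h1 := integral_boundedMeasure_compactlySupported T ψ f
    have hfc : Continuous fun x => f x := f.continuous
    have hfn : 0 ≤ fun x => f x := fun x => by
      exact le_max_left _ _
    rw [h0, _root_.zero_apply, inner_zero_right, Complex.zero_re,
      integral_eq_zero_iff_of_nonneg hfn
        (hfc.integrable_of_hasCompactSupport f.hasCompactSupport)] at h1
    refine measure_mono_null ?_ (ae_iff.1 h1)
    intro x hx
    rw [Set.mem_ofPred_eq] at hx ⊢
    change ¬ f x = 0
    rw [hf]
    refine (lt_max_of_lt_right (lt_min ?_ ?_)).ne' <;> linarith [hx.1, hx.2]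
  refine measure_mono_null ?_ (measure_iUnion_null key)
  intro x hx
  obtain ⟨n, hn⟩ := exists_nat_gt |x|
  refine Set.mem_iUnion.2 ⟨n, ?_, hn⟩
  by_contra h
  exact hx (abs_le.1 (not_lt.1 h))

theorem ae_boundedMeasure_abs_le (T : H →L[ℂ] H) (ψ : H) :
    ∀ᵐ x ∂(boundedMeasure T ψ), |x| ≤ ‖T‖ := by
  rw [ae_iff]
  refine measure_mono_null ?_ (boundedMeasure_compl_Icc T ψ)
  intro x hx h
  exact hx (abs_le.2 h)

theorem isFiniteMeasure_boundedMeasure (T : H →L[ℂ] H) (ψ : H) :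
    IsFiniteMeasure (boundedMeasure T ψ) := by
  refine ⟨?_⟩
  rw [← measure_add_measure_compl (measurableSet_Icc (a := -‖T‖) (b := ‖T‖)),
    boundedMeasure_compl_Icc T ψ, add_zero]
  exact isCompact_Icc.measure_lt_top

theorem integrable_boundedMeasure (T : H →L[ℂ] H) (ψ : H) {E : Type*}
    [NormedAddCommGroup E] [SecondCountableTopologyEither ℝ E] {u : ℝ → E} (hu : Continuous u) :
    Integrable u (boundedMeasure T ψ) := by
  have := isFiniteMeasure_boundedMeasure T ψ
  obtain ⟨C, hC⟩ : ∃ C, ∀ ν ∈ Set.Icc (-‖T‖) ‖T‖, ‖u ν‖ ≤ C :=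
    isCompact_Icc.exists_bound_of_continuousOn hu.continuousOn
  refine (integrable_const C).mono' hu.aestronglyMeasurable ?_
  filter_upwards [ae_boundedMeasure_abs_le T ψ] with x hx
  exact hC x (abs_le.1 hx)

/-- The Riesz measure represents only compactly supported functions. A cut-off equal to 1 on [-‖T‖,
‖T‖] changes neither side, since both the measure and the spectrum live there. -/
theorem integral_boundedMeasure_real (T : H →L[ℂ] H) (ψ : H) {f : ℝ → ℝ}
    (hf : Continuous f) :
    ∫ ν, f ν ∂(boundedMeasure T ψ) = (inner ℂ ψ (cfc f T ψ)).re := by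
  let F : CompactlySupportedContinuousMap ℝ ℝ :=
    { toFun := fun x => f x * max 0 (min 1 (‖T‖ + 1 - |x|))
      continuous_toFun := by fun_prop
      hasCompactSupport' := by
        refine HasCompactSupport.intro
          (isCompact_Icc (a := -(‖T‖ + 1)) (b := ‖T‖ + 1)) fun x hx => ?_
        have : ‖T‖ + 1 < |x| := by
          by_contra h
          exact hx (abs_le.1 (not_lt.1 h))
        rw [max_eq_left ((min_le_right _ _).trans (by linarith)), mul_zero] }
  have hF : ∀ x, |x| ≤ ‖T‖ → F x = f x := by
    intro x hx
    change f x * max 0 (min 1 (‖T‖ + 1 - |x|)) = f x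
    rw [min_eq_left (by linarith), max_eq_right zero_le_one, mul_one]
  have h1 := integral_boundedMeasure_compactlySupported T ψ F
  have h2 : cfc (F : ℝ → ℝ) T = cfc f T :=
    cfc_congr fun x hx => hF x (abs_le_of_mem_spectrum hx)
  rw [h2] at h1
  rw [← h1]
  refine integral_congr_ae ?_
  filter_upwards [ae_boundedMeasure_abs_le T ψ] with x hx
  exact (hF x hx).symm

theorem integral_boundedMeasure (hT : IsSelfAdjoint T) (ψ : H) {u : ℝ → ℂ} (hu : Continuous u) :
    ∫ ν, u ν ∂(boundedMeasure T ψ) = inner ℂ ψ (functionOf T u ψ) := by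
  have hreal : ∀ f : ℝ → ℝ, Continuous f →
      inner ℂ ψ (cfc f T ψ) = ((∫ ν, f ν ∂(boundedMeasure T ψ) : ℝ) : ℂ) := by
    intro f hf
    rw [integral_boundedMeasure_real T ψ hf]
    have h1 : IsSelfAdjoint (cfc f T) := cfc_predicate f T
    have h2 : (cfc f T : H →L[ℂ] H).IsSymmetric :=
      ContinuousLinearMap.isSelfAdjoint_iff_isSymmetric.1 h1
    have h3 := h2.conj_inner_sym ψ ψ
    have h4 : inner ℂ ((cfc f T : H →L[ℂ] H) ψ) ψ = inner ℂ ψ ((cfc f T : H →L[ℂ] H) ψ) := h2 ψ ψ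
    apply Complex.ext
    · rw [Complex.ofReal_re]
    · rw [Complex.ofReal_im]
      have h5 := congrArg Complex.im (inner_conj_symm ((cfc f T : H →L[ℂ] H) ψ) ψ)
      rw [Complex.conj_im, h4] at h5
      linarith
  rw [functionOf_re_add_im hT hu, add_apply, smul_apply, inner_add_right,
    inner_smul_right, hreal _ (by fun_prop), hreal _ (by fun_prop),
    ← integral_re_add_im (integrable_boundedMeasure T ψ hu), mul_comm]
  rfl

/-- For f in C_c, ⟨u(T)ψ, f(T)u(T)ψ⟩ = ⟨ψ, (|u|²f)(T)ψ⟩, and such f determine the two finite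
measures. -/
theorem boundedMeasure_functionOf (hT : IsSelfAdjoint T) (ψ : H) {u : ℝ → ℂ}
    (hu : Continuous u) :
    boundedMeasure T (functionOf T u ψ)
      = (boundedMeasure T ψ).withDensity fun ν => ‖u ν‖ₑ ^ 2 := by
  have := isFiniteMeasure_boundedMeasure T ψ
  have hum : Measurable fun ν => ‖u ν‖ₑ ^ 2 := hu.measurable.enorm.pow_const 2
  have hnorm : ∀ ν, (‖u ν‖ₑ ^ 2).toReal = ‖u ν‖ ^ 2 := fun ν => by
    rw [ENNReal.toReal_pow, toReal_enorm]
  have hfin : IsFiniteMeasure ((boundedMeasure T ψ).withDensity fun ν => ‖u ν‖ₑ ^ 2) := by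
    refine isFiniteMeasure_withDensity ?_
    have h1 := (integrable_boundedMeasure T ψ
      (show Continuous fun ν => ‖u ν‖ ^ 2 from hu.norm.pow 2)).lintegral_lt_top
    refine ne_of_lt (lt_of_eq_of_lt (lintegral_congr fun ν => ?_) h1)
    rw [ENNReal.ofReal_pow (norm_nonneg _), ofReal_norm]
  refine Measure.ext_of_integral_eq_on_compactlySupported fun f => ?_
  have hfc : Continuous fun x => f x := f.continuous
  rw [integral_withDensity_eq_integral_toReal_smul hum
    (Eventually.of_forall fun ν => ENNReal.pow_lt_top enorm_lt_top),
    integral_boundedMeasure_real T _ hfc]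
  have h1 : ∫ ν, (‖u ν‖ₑ ^ 2).toReal • f ν ∂(boundedMeasure T ψ)
      = ∫ ν, ‖u ν‖ ^ 2 * f ν ∂(boundedMeasure T ψ) := by
    simp only [hnorm, smul_eq_mul]
  rw [h1, integral_boundedMeasure_real T ψ (by fun_prop), ← functionOf_ofReal hT,
    ← functionOf_ofReal hT]
  have h2 : functionOf T (fun x => ((‖u x‖ ^ 2 * f x : ℝ) : ℂ))
      = star (functionOf T u) * (functionOf T (fun x => (f x : ℂ)) * functionOf T u) := by
    rw [← functionOf_conj, ← functionOf_mul T (by fun_prop) hu,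
      ← functionOf_mul T (by fun_prop) (by fun_prop)]
    congr 1
    ext x
    have h3 : conj (u x) * ((f x : ℂ) * u x) = (u x * conj (u x)) * f x := by ring
    rw [h3, Complex.mul_conj, Complex.normSq_eq_norm_sq]
    push_cast
    ring
  rw [h2, ContinuousLinearMap.star_eq_adjoint, mul_apply_eq_comp,
    ContinuousLinearMap.adjoint_inner_right]
  rfl

theorem bounded_resolvent (hT : IsSelfAdjoint T) (g : H) {z : ℂ} (hz : z.im ≠ 0) :
    ∃ x : H, z • x - T x = g ∧ inner ℂ g x = stieltjes (boundedMeasure T g) z := by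
  have hc := continuous_inv_sub hz
  refine ⟨functionOf T (fun ν => (z - (ν : ℂ))⁻¹) g, ?_, ?_⟩
  · have h1 : functionOf T (fun x => (z * 1 + (-1) * (x : ℂ)) * (z - (x : ℂ))⁻¹)
        = (z • 1 - T) * functionOf T (fun ν => (z - (ν : ℂ))⁻¹) := by
      rw [functionOf_mul T (by fun_prop) hc, functionOf_add T (by fun_prop) (by fun_prop),
        functionOf_const_mul T _ (by fun_prop), functionOf_const_mul T _ (by fun_prop),
        functionOf_one hT, functionOf_id hT, neg_one_smul, sub_eq_add_neg]
    have h2 : (fun x : ℝ => (z * 1 + (-1) * (x : ℂ)) * (z - (x : ℂ))⁻¹) = fun _ => 1 := by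
      ext x
      have := sub_ofReal_ne_zero hz x
      field_simp
      ring
    rw [h2, functionOf_one hT] at h1
    have h3 := congrArg (fun S : H →L[ℂ] H => S g) h1
    simpa using h3.symm
  · rw [stieltjes, integral_boundedMeasure hT g hc]

end BoundedCalculus

/-! ### The exponential group of a bounded operator and Duhamel's formula -/

section BoundedDuhamel

variable {E : Type*} [NormedAddCommGroup E] [NormedSpace ℂ E]

/-- The group `e^{itT}` of a bounded operator. -/
def expGroup (T : E →L[ℂ] E) (t : ℝ) : E →L[ℂ] E := NormedSpace.exp ((Complex.I * t) • T)

theorem expGroup_eq (T : E →L[ℂ] E) (t : ℝ) :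
    expGroup T t = NormedSpace.exp (t • (Complex.I • T)) := by
  rw [expGroup, ← Complex.coe_smul, smul_smul, mul_comm]

theorem expGroup_zero (T : E →L[ℂ] E) : expGroup T 0 = 1 := by
  simp [expGroup]

variable [CompleteSpace E]

theorem hasDerivAt_expGroup (T : E →L[ℂ] E) (t : ℝ) (x : E) :
    HasDerivAt (fun s => expGroup T s x) (Complex.I • T (expGroup T t x)) t := by
  have h1 := hasDerivAt_exp_smul_const' (𝕂 := ℝ) (Complex.I • T) t
  have h2 := ((ContinuousLinearMap.apply ℂ E x).hasFDerivAt.restrictScalars ℝ).comp_hasDerivAt t h1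
  simp only [← expGroup_eq] at h2
  exact h2

theorem continuous_expGroup (T : E →L[ℂ] E) (x : E) : Continuous fun t => expGroup T t x :=
  continuous_iff_continuousAt.2 fun t => (hasDerivAt_expGroup T t x).continuousAt

theorem continuous_expGroup_norm (T : E →L[ℂ] E) : Continuous (expGroup T) := by
  have h := fun t => (hasDerivAt_exp_smul_const' (𝕂 := ℝ) (Complex.I • T) t).continuousAt
  simp only [← expGroup_eq] at h
  exact continuous_iff_continuousAt.2 h

theorem expGroup_add (T : E →L[ℂ] E) (s t : ℝ) :
    expGroup T (s + t) = expGroup T s * expGroup T t := by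
  let := NormedAlgebra.restrictScalars ℚ ℂ (E →L[ℂ] E)
  rw [expGroup_eq, expGroup_eq, expGroup_eq, add_smul, NormedSpace.exp_add_of_commute]
  exact ((Commute.refl _).smul_left _).smul_right _

theorem hasSum_expGroup (T : E →L[ℂ] E) (t : ℝ) (x : E) :
    HasSum (fun n : ℕ => (((n.factorial : ℂ)⁻¹ * (Complex.I * t) ^ n)) • (T ^ n) x)
      (expGroup T t x) := by
  have h1 := NormedSpace.exp_series_hasSum_exp' (𝕂 := ℂ) ((Complex.I * (t : ℂ)) • T)
  have h2 := h1.mapL (ContinuousLinearMap.apply ℂ E x)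
  refine h2.congr_fun fun n => ?_
  simp [smul_pow, smul_smul]

/-- The solution of `x' = i T x + i c(t) g`. -/
def duhamel (T : E →L[ℂ] E) (c : ℝ → ℂ) (g x : E) (t : ℝ) : E :=
  expGroup T t x + ∫ s in (0 : ℝ)..t, (Complex.I * c s) • expGroup T (t - s) g

theorem continuous_duhamel_integrand (T : E →L[ℂ] E) {c : ℝ → ℂ} (hc : Continuous c) (g : E)
    (t : ℝ) : Continuous fun s : ℝ => (Complex.I * c s) • expGroup T (t - s) g := by
  have := (continuous_expGroup T g).comp (continuous_const.sub continuous_id : Continuous fun s => t - s)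
  exact (continuous_const.mul hc).smul this

/-- Reads Duhamel's formula through a bounded map. It is stated on Banach spaces because it is used
on ℓ¹(V), with evaluations and the total sum, as well as on ℓ²(V). -/
theorem apply_duhamel {F : Type*} [NormedAddCommGroup F] [NormedSpace ℂ F] [CompleteSpace F]
    (L : E →L[ℂ] F) (T : E →L[ℂ] E) {c : ℝ → ℂ} (hc : Continuous c) (g x : E) (t : ℝ) :
    L (duhamel T c g x t)
      = L (expGroup T t x) + ∫ s in (0 : ℝ)..t, (Complex.I * c s) • L (expGroup T (t - s) g) := by
  rw [duhamel, map_add, ← L.intervalIntegral_comp_comm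
    ((continuous_duhamel_integrand T hc g t).intervalIntegrable 0 t)]
  simp only [map_smul]

end BoundedDuhamel

section BoundedSolution

variable {H : Type*} [NormedAddCommGroup H] [InnerProductSpace ℂ H] [CompleteSpace H]
  {T : H →L[ℂ] H}

theorem star_expGroup (hT : IsSelfAdjoint T) (t : ℝ) : star (expGroup T t) = expGroup T (-t) := by
  rw [expGroup, expGroup, NormedSpace.star_exp, star_smul, hT.star_eq]
  congr 2
  simp

theorem inner_expGroup (hT : IsSelfAdjoint T) (t : ℝ) (x y : H) :
    inner ℂ (expGroup T t x) y = inner ℂ x (expGroup T (-t) y) := by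
  rw [← star_expGroup hT, ContinuousLinearMap.star_eq_adjoint,
    ContinuousLinearMap.adjoint_inner_right]

/-- Uniqueness of weak solutions: test with s ↦ e^{i(s-t)T}x, which equals x at time t; every vector
is in the domain. -/
theorem IsWeakSolution.eq_duhamel (hT : IsSelfAdjoint T) {c : ℝ → ℂ} (hc : Continuous c) {g : H}
    {ψ : ℝ → H} (hψ : IsWeakSolution ((T : H →ₗ[ℂ] H).toPMap ⊤) c g ψ) (t : ℝ) :
    ψ t = duhamel T c g (ψ 0) t := by
  refine ext_inner_left ℂ fun x => ?_
  have h1 := hψ.inner_eq hc (φ := fun s => expGroup T s (expGroup T (-t) x))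
    (fun s => Submodule.mem_top) (fun s => hasDerivAt_expGroup T s _) t
  have h2 : ∀ s, expGroup T s (expGroup T (-t) x) = expGroup T (s - t) x := by
    intro s
    rw [sub_eq_add_neg, expGroup_add]
    rfl
  simp only [h2, sub_self, inner_expGroup hT, neg_neg, neg_sub, expGroup_zero,
    one_apply_eq_self] at h1
  rw [h1]
  have h3 := apply_duhamel (innerSL ℂ x) T hc g (ψ 0) t
  simp only [innerSL_apply_apply, smul_eq_mul] at h3
  rw [h3]

/-- `functionOf` evaluates at Re z, which is z on the real spectrum of a self-adjoint operator. -/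
theorem functionOf_exp (hT : IsSelfAdjoint T) (t : ℝ) :
    functionOf T (fun ν => Complex.exp (Complex.I * t * ν)) = expGroup T t := by
  have hn := hT.isStarNormal
  have hn' : IsStarNormal ((Complex.I * (t : ℂ)) • T) := inferInstance
  rw [expGroup, ← CFC.complex_exp_eq_normedSpace_exp (p := IsStarNormal) hn',
    ← cfc_comp_smul (Complex.I * (t : ℂ)) _ T, functionOf]
  refine cfc_congr fun z hz => ?_
  have hz' : z = z.re := hT.mem_spectrum_eq_re hz
  simp only [smul_eq_mul]
  rw [← hz']

/-- The source term is a superposition over s in (0,t] of the exponentials e^{i(t-s)ν} with bounded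
coefficients, so the functional calculus may be interchanged with the time integral. -/
theorem functionOf_orbitFn (hT : IsSelfAdjoint T) {c : ℝ → ℂ} (hc : Continuous c) (a b : ℂ)
    {t : ℝ} (ht : 0 ≤ t) (g : H) :
    functionOf T (orbitFn a b c t) g = duhamel T c g (a • g + b • T g) t := by
  have hn := hT.isStarNormal
  have hI : functionOf T (fun ν => ∫ s in (0 : ℝ)..t, Complex.I * c s * Complex.exp
      (Complex.I * ((t - s : ℝ) : ℂ) * ν)) g
      = ∫ s in (0 : ℝ)..t, (Complex.I * c s) • expGroup T (t - s) g := by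
    obtain ⟨B, hB⟩ : ∃ B, ∀ s ∈ Set.Icc 0 t, ‖c s‖ ≤ B :=
      isCompact_Icc.exists_bound_of_continuousOn hc.continuousOn
    rw [functionOf, intervalIntegral.integral_of_le ht]
    simp only [intervalIntegral.integral_of_le ht]
    rw [cfc_setIntegral (μ := volume) measurableSet_Ioc (fun (s : ℝ) (z : ℂ) => Complex.I * c s *
      Complex.exp (Complex.I * ((t - s : ℝ) : ℂ) * (z.re : ℂ))) (fun _ => B) T]
    · have h1 : ∀ s : ℝ, cfc (fun z : ℂ => Complex.I * c s *
          Complex.exp (Complex.I * ((t - s : ℝ) : ℂ) * (z.re : ℂ))) T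
          = (Complex.I * c s) • expGroup T (t - s) := by
        intro s
        rw [← functionOf_exp hT]
        exact functionOf_const_mul T (Complex.I * c s)
          (u := fun ν : ℝ => Complex.exp (Complex.I * ((t - s : ℝ) : ℂ) * ν)) (by fun_prop)
      simp only [h1]
      have hcont : Continuous fun s : ℝ => (Complex.I * c s) • expGroup T (t - s) :=
        (continuous_const.mul hc).smul ((continuous_expGroup_norm T).comp (by fun_prop))
      rw [ContinuousLinearMap.integral_apply
        ((hcont.integrableOn_Icc (a := 0) (b := t)).mono_set Set.Ioc_subset_Icc_self)]
      rfl
    · apply Continuous.continuousOn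
      simp only [Function.uncurry_def]
      fun_prop
    · refine (ae_restrict_mem measurableSet_Ioc).mono fun s hs z _ => ?_
      rw [norm_mul, norm_mul, Complex.norm_I, one_mul, norm_exp_I_mul, mul_one]
      exact hB s ⟨hs.1.le, hs.2⟩
    · exact (integrable_const B).2
  have hsplit : orbitFn a b c t = fun ν : ℝ => Complex.exp (Complex.I * t * ν) * (a * 1 + b * ν)
      + ∫ s in (0 : ℝ)..t, Complex.I * c s * Complex.exp (Complex.I * ((t - s : ℝ) : ℂ) * ν) := by
    ext ν
    rw [orbitFn, partialFt, mul_add, mul_one, ← mul_assoc, ← intervalIntegral.integral_const_mul]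
    congr 1
    refine intervalIntegral.integral_congr fun s _ => ?_
    have : Complex.exp (Complex.I * ((t - s : ℝ) : ℂ) * ν)
        = Complex.exp (Complex.I * t * ν) * Complex.exp (-(Complex.I * s * ν)) := by
      rw [← Complex.exp_add]
      congr 1
      push_cast
      ring
    rw [this]
    ring
  have hc2 : Continuous fun ν : ℝ => ∫ s in (0 : ℝ)..t, Complex.I * c s * Complex.exp
      (Complex.I * ((t - s : ℝ) : ℂ) * ν) := by
    refine intervalIntegral.continuous_parametric_intervalIntegral_of_continuous' ?_ 0 t
    simp only [Function.uncurry_def]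
    fun_prop
  rw [hsplit, functionOf_add T (by fun_prop) hc2, add_apply, hI, duhamel,
    functionOf_mul T (by fun_prop) (by fun_prop), functionOf_add T (by fun_prop) (by fun_prop),
    functionOf_const_mul T _ (by fun_prop), functionOf_const_mul T _ (by fun_prop),
    functionOf_one hT, functionOf_id hT, functionOf_exp hT]
  rfl

theorem bounded_solution (hT : IsSelfAdjoint T) {c : ℝ → ℂ} (hc : Continuous c) {g : H}
    {ψ : ℝ → H} (hψ : IsWeakSolution ((T : H →ₗ[ℂ] H).toPMap ⊤) c g ψ) {a b : ℂ}
    (h0 : ψ 0 = a • g + b • T g) {t : ℝ} (ht : 0 ≤ t) :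
    ψ t = functionOf T (orbitFn a b c t) g := by
  rw [functionOf_orbitFn hT hc a b ht, ← h0, hψ.eq_duhamel hT hc]

end BoundedSolution

/-! ### Graph reservoirs and the invariance of the Perron-Frobenius weight -/

namespace GraphData

variable (X : GraphData)

theorem adj_apply (ψ : ell2 X.V) (x : X.V) : X.adj ψ x = ∑ y ∈ X.G.neighborFinset x, ψ y := rfl

theorem ham_apply (ψ : ell2 X.V) (x : X.V) :
    X.ham ψ x = ‖X.adj‖ * ψ x - ∑ y ∈ X.G.neighborFinset x, ψ y := rfl

theorem isSelfAdjoint_adj : IsSelfAdjoint X.adj := by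
  classical
  rw [IsSelfAdjoint, ContinuousLinearMap.star_eq_adjoint]
  have hent : ∀ (x y : X.V) (a : ℂ), X.adj (lp.single 2 y a) x = if X.G.Adj x y then a else 0 := by
    intro x y a
    rw [adj_apply]
    simp only [lp.single_apply, Pi.single_apply]
    rw [Finset.sum_ite_eq']
    simp only [SimpleGraph.mem_neighborFinset]
  refine lp.ext_continuousLinearMap (by norm_num) fun y => ?_
  ext1
  ext x
  rw [ContinuousLinearMap.comp_apply, ContinuousLinearMap.comp_apply,
    lp.singleContinuousLinearMap_apply, hent]
  have h1 := lp.inner_single_left (𝕜 := ℂ) x (1 : ℂ)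
    (ContinuousLinearMap.adjoint X.adj (lp.single 2 y (1 : ℂ)))
  rw [ContinuousLinearMap.adjoint_inner_right, lp.inner_single_right, hent] at h1
  simp only [RCLike.inner_apply, map_one, mul_one, one_mul] at h1
  rw [← h1, SimpleGraph.adj_comm]
  split_ifs <;> simp

theorem isSelfAdjoint_ham : IsSelfAdjoint X.ham := by
  refine IsSelfAdjoint.sub ?_ X.isSelfAdjoint_adj
  rw [IsSelfAdjoint, star_smul]
  congr 1
  · simp
  · exact star_one _

/-- Self-adjointness identifies the spectral radius with the norm. The weight v is therefore a
generalized eigenfunction of the Hamiltonian at energy exactly 0. -/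
theorem spectralRadius_adj : (spectralRadius ℂ X.adj).toReal = ‖X.adj‖ := by
  rw [X.isSelfAdjoint_adj.spectralRadius_eq_nnnorm]
  rfl

theorem sum_weight (x : X.V) : ∑ y ∈ X.G.neighborFinset x, X.v y = ‖X.adj‖ * X.v x := by
  rw [X.v_eigen, ← X.spectralRadius_adj]
  rfl

/-- `ℓ¹(V)`. -/
abbrev ell1 : Type := lp (fun _ : X.V => ℂ) 1

/-- A Schur test with the Perron-Frobenius weight. Summing over x first leaves, for each y, at most
∑_{x∼y} v(x)/v(y) = ‖A‖. -/
theorem weightedAdj_sum_le (φ : X.ell1) (s : Finset X.V) :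
    ∑ x ∈ s, ‖∑ y ∈ X.G.neighborFinset x, ((X.v x / X.v y : ℝ) : ℂ) * φ y‖ ^ (1 : ℝ≥0∞).toReal
      ≤ (‖X.adj‖ * ‖φ‖) ^ (1 : ℝ≥0∞).toReal := by
  classical
  simp only [ENNReal.toReal_one, Real.rpow_one]
  have hv := X.v_pos
  calc ∑ x ∈ s, ‖∑ y ∈ X.G.neighborFinset x, ((X.v x / X.v y : ℝ) : ℂ) * φ y‖
      ≤ ∑ x ∈ s, ∑ y ∈ X.G.neighborFinset x, X.v x / X.v y * ‖φ y‖ := by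
        refine Finset.sum_le_sum fun x _ => (norm_sum_le _ _).trans (le_of_eq ?_)
        refine Finset.sum_congr rfl fun y _ => ?_
        rw [norm_mul, Complex.norm_real, Real.norm_of_nonneg (div_pos (hv x) (hv y)).le]
    _ = ∑ y ∈ s.biUnion (fun x => X.G.neighborFinset x),
          ∑ x ∈ s.filter (fun x => X.G.Adj y x), X.v x / X.v y * ‖φ y‖ := by
        refine Finset.sum_comm' ?_
        intro x y
        simp only [SimpleGraph.mem_neighborFinset, Finset.mem_filter, Finset.mem_biUnion]
        constructor
        · rintro ⟨hx, hxy⟩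
          exact ⟨⟨hx, hxy.symm⟩, x, hx, hxy⟩
        · rintro ⟨⟨hx, hxy⟩, -⟩
          exact ⟨hx, hxy.symm⟩
    _ ≤ ∑ y ∈ s.biUnion (fun x => X.G.neighborFinset x), ‖X.adj‖ * ‖φ y‖ := by
        refine Finset.sum_le_sum fun y _ => ?_
        rw [← Finset.sum_mul, ← Finset.sum_div]
        gcongr
        rw [div_le_iff₀ (hv y), ← X.sum_weight]
        refine Finset.sum_le_sum_of_subset_of_nonneg ?_ fun x _ _ => (hv x).le
        intro x hx
        simpa using (Finset.mem_filter.1 hx).2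
    _ ≤ ‖X.adj‖ * ‖φ‖ := by
        rw [← Finset.mul_sum]
        gcongr
        have := lp.sum_rpow_le_norm_rpow (p := 1) (by norm_num) φ
          (s.biUnion (fun x => X.G.neighborFinset x))
        simpa using this

/-- The adjacency operator transported to `ℓ¹(V)` by `ψ ↦ v ψ`. -/
def weightedAdj : X.ell1 →L[ℂ] X.ell1 :=
  LinearMap.mkContinuousOfExistsBound
    { toFun := fun φ => ⟨fun x => ∑ y ∈ X.G.neighborFinset x, ((X.v x / X.v y : ℝ) : ℂ) * φ y,
        memℓp_gen' (X.weightedAdj_sum_le φ)⟩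
      map_add' := by
        intro a b
        ext x
        change ∑ y ∈ X.G.neighborFinset x, ((X.v x / X.v y : ℝ) : ℂ) * (a y + b y) = _
        simp only [mul_add, Finset.sum_add_distrib]
        rfl
      map_smul' := by
        intro c a
        ext x
        change ∑ y ∈ X.G.neighborFinset x, ((X.v x / X.v y : ℝ) : ℂ) * (c * a y)
          = c * ∑ y ∈ X.G.neighborFinset x, ((X.v x / X.v y : ℝ) : ℂ) * a y
        rw [Finset.mul_sum]
        exact Finset.sum_congr rfl fun y _ => by ring }
    ⟨‖X.adj‖, fun φ => lp.norm_le_of_forall_sum_le (by norm_num) (by positivity)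
      (X.weightedAdj_sum_le φ)⟩

/-- The Hamiltonian transported to `ℓ¹(V)` by `ψ ↦ v ψ`. -/
def weightedHam : X.ell1 →L[ℂ] X.ell1 :=
  (‖X.adj‖ : ℂ) • ContinuousLinearMap.id ℂ X.ell1 - X.weightedAdj

theorem weightedHam_apply (φ : X.ell1) (x : X.V) :
    X.weightedHam φ x
      = ‖X.adj‖ * φ x - ∑ y ∈ X.G.neighborFinset x, ((X.v x / X.v y : ℝ) : ℂ) * φ y := rfl

theorem weightedHam_eq {φ : X.ell1} {ψ : ell2 X.V} (h : ∀ x, φ x = X.v x * ψ x) (x : X.V) :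
    X.weightedHam φ x = X.v x * X.ham ψ x := by
  rw [weightedHam_apply, ham_apply, mul_sub, Finset.mul_sum, h]
  congr 1
  · ring
  · refine Finset.sum_congr rfl fun y _ => ?_
    rw [h]
    have := (X.v_pos y).ne'
    have : (X.v y : ℂ) ≠ 0 := by exact_mod_cast this
    push_cast
    field_simp

/-- The identity ⟨v, hψ⟩ = 0, given a meaning on ℓ¹. It suffices to check unit vectors, where the
column sum at y is ‖A‖ - ∑_{x∼y} v(x)/v(y) = 0. -/
theorem tsum_weightedHam (φ : X.ell1) : lp.tsumCLM ℂ X.V ℂ (X.weightedHam φ) = 0 := by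
  classical
  have h0 : (lp.tsumCLM ℂ X.V ℂ).comp X.weightedHam = 0 := by
    refine lp.ext_continuousLinearMap (by norm_num) fun y => ?_
    ext1
    rw [ContinuousLinearMap.comp_apply, ContinuousLinearMap.comp_apply,
      lp.singleContinuousLinearMap_apply]
    change ∑' x, X.weightedHam (lp.single 1 y (1 : ℂ)) x = 0
    have h1 : ∀ x, X.weightedHam (lp.single 1 y (1 : ℂ)) x
        = (if x = y then (‖X.adj‖ : ℂ) else 0)
          - if x ∈ X.G.neighborFinset y then ((X.v x / X.v y : ℝ) : ℂ) else 0 := by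
      intro x
      rw [weightedHam_apply]
      simp only [lp.single_apply, Pi.single_apply, mul_ite, mul_one, mul_zero]
      rw [Finset.sum_ite_eq']
      simp only [SimpleGraph.mem_neighborFinset, SimpleGraph.adj_comm]
    simp only [h1]
    rw [Summable.tsum_sub, tsum_ite_eq, tsum_eq_sum (s := X.G.neighborFinset y)]
    · rw [Finset.sum_congr rfl fun x hx => if_pos hx, ← Complex.ofReal_sum, ← Finset.sum_div,
        X.sum_weight, mul_div_cancel_right₀ _ (X.v_pos y).ne', sub_self]
    · intro x hx
      rw [if_neg hx]
    · exact (hasSum_ite_eq y _).summable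
    · exact summable_of_ne_finset_zero (s := X.G.neighborFinset y) fun x hx => if_neg hx
  exact congrArg (fun L : X.ell1 →L[ℂ] ℂ => L φ) h0

theorem weightedHam_pow_eq {φ : X.ell1} {ψ : ell2 X.V} (h : ∀ x, φ x = X.v x * ψ x) (n : ℕ) :
    ∀ x, (X.weightedHam ^ n) φ x = X.v x * (X.ham ^ n) ψ x := by
  induction n with
  | zero => exact h
  | succ n ih =>
    intro x
    rw [pow_succ', pow_succ', mul_apply_eq_comp, mul_apply_eq_comp]
    exact X.weightedHam_eq ih x

/-- The two power series agree term by term at each vertex, although one converges in ℓ¹ and the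
other in ℓ². -/
theorem expGroup_weightedHam_eq {φ : X.ell1} {ψ : ell2 X.V} (h : ∀ x, φ x = X.v x * ψ x)
    (t : ℝ) (x : X.V) :
    expGroup X.weightedHam t φ x = X.v x * expGroup X.ham t ψ x := by
  have h1 := (hasSum_expGroup X.weightedHam t φ).mapL (lp.evalCLM ℂ (fun _ : X.V => ℂ) 1 x)
  have h2 := ((hasSum_expGroup X.ham t ψ).mapL
    (lp.evalCLM ℂ (fun _ : X.V => ℂ) 2 x)).mul_left (X.v x : ℂ)
  refine h1.unique (h2.congr_fun fun n => ?_)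
  rw [map_smul, map_smul]
  have := X.weightedHam_pow_eq h n x
  change _ • (X.weightedHam ^ n) φ x = _ * (_ • (X.ham ^ n) ψ x)
  rw [this, smul_eq_mul, smul_eq_mul]
  ring

theorem tsum_expGroup_weightedHam (φ : X.ell1) (t : ℝ) :
    lp.tsumCLM ℂ X.V ℂ (expGroup X.weightedHam t φ) = lp.tsumCLM ℂ X.V ℂ φ := by
  have h1 := (hasSum_expGroup X.weightedHam t φ).mapL (lp.tsumCLM ℂ X.V ℂ)
  refine h1.unique ?_
  have h2 := hasSum_single (f := fun n : ℕ => lp.tsumCLM ℂ X.V ℂ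
    (((n.factorial : ℂ)⁻¹ * (Complex.I * t) ^ n) • (X.weightedHam ^ n) φ)) 0 ?_
  · simpa using h2
  · intro n hn
    obtain ⟨m, rfl⟩ := Nat.exists_eq_succ_of_ne_zero hn
    rw [map_smul, pow_succ' X.weightedHam, mul_apply_eq_comp, X.tsum_weightedHam, smul_zero]

theorem exists_ell1 {ψ : ell2 X.V} (h : Summable fun x => X.v x * ‖ψ x‖) :
    ∃ φ : X.ell1, ∀ x, φ x = X.v x * ψ x := by
  refine ⟨⟨fun x => X.v x * ψ x, ?_⟩, fun x => rfl⟩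
  refine memℓp_gen ?_
  simp only [ENNReal.toReal_one, Real.rpow_one]
  refine h.congr fun x => ?_
  rw [norm_mul, Complex.norm_real, Real.norm_of_nonneg (X.v_pos x).le]

theorem summable_ham {ψ : ell2 X.V} (h : Summable fun x => X.v x * ‖ψ x‖) :
    Summable fun x => X.v x * ‖X.ham ψ x‖ := by
  obtain ⟨φ, hφ⟩ := X.exists_ell1 h
  have h1 := (lp.memℓp (X.weightedHam φ)).summable (by norm_num)
  simp only [ENNReal.toReal_one, Real.rpow_one] at h1
  refine h1.congr fun x => ?_
  rw [X.weightedHam_eq hφ, norm_mul, Complex.norm_real, Real.norm_of_nonneg (X.v_pos x).le]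

/-- The weight is unbounded on ℓ². Multiplication by v moves Duhamel's formula to ℓ¹, where the
total sum is bounded and invariant under the group. The b-term drops out since ⟨v, hg⟩ = 0, and the
source contributes its plain time integral, the truncated Fourier integral at zero energy. -/
theorem weight_solution {g : ell2 X.V} (hg : Summable fun x => X.v x * ‖g x‖) {c : ℝ → ℂ}
    (hc : Continuous c) (a b : ℂ) (t : ℝ) :
    ∑' x, (X.v x : ℂ) * duhamel X.ham c g (a • g + b • X.ham g) t x
      = (a + Complex.I * partialFt c t 0) * ∑' x, (X.v x : ℂ) * g x := by
  obtain ⟨φ, hφ⟩ := X.exists_ell1 hg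
  have hφ' : ∀ x, (a • φ + b • X.weightedHam φ) x = X.v x * (a • g + b • X.ham g) x := by
    intro x
    change a * φ x + b * X.weightedHam φ x = X.v x * (a * g x + b * X.ham g x)
    rw [X.weightedHam_eq hφ, hφ]
    ring
  have h1 : ∀ x, duhamel X.weightedHam c φ (a • φ + b • X.weightedHam φ) t x
      = X.v x * duhamel X.ham c g (a • g + b • X.ham g) t x := by
    intro x
    have e1 := apply_duhamel (lp.evalCLM ℂ (fun _ : X.V => ℂ) 1 x) X.weightedHam hc φ
      (a • φ + b • X.weightedHam φ) t
    have e2 := apply_duhamel (lp.evalCLM ℂ (fun _ : X.V => ℂ) 2 x) X.ham hc g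
      (a • g + b • X.ham g) t
    change duhamel X.weightedHam c φ (a • φ + b • X.weightedHam φ) t x
      = expGroup X.weightedHam t (a • φ + b • X.weightedHam φ) x
        + ∫ s in (0 : ℝ)..t, (Complex.I * c s) • expGroup X.weightedHam (t - s) φ x at e1
    change duhamel X.ham c g (a • g + b • X.ham g) t x
      = expGroup X.ham t (a • g + b • X.ham g) x
        + ∫ s in (0 : ℝ)..t, (Complex.I * c s) • expGroup X.ham (t - s) g x at e2
    rw [e1, e2, X.expGroup_weightedHam_eq hφ', mul_add, ← intervalIntegral.integral_const_mul]
    simp only [X.expGroup_weightedHam_eq hφ, smul_eq_mul]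
    congr 2
    ext s
    ring
  have h2 := apply_duhamel (lp.tsumCLM ℂ X.V ℂ) X.weightedHam hc φ
    (a • φ + b • X.weightedHam φ) t
  simp only [X.tsum_expGroup_weightedHam, map_add, map_smul, X.tsum_weightedHam] at h2
  have h3 : lp.tsumCLM ℂ X.V ℂ (duhamel X.weightedHam c φ (a • φ + b • X.weightedHam φ) t)
      = ∑' x, (X.v x : ℂ) * duhamel X.ham c g (a • g + b • X.ham g) t x := tsum_congr h1
  have h4 : lp.tsumCLM ℂ X.V ℂ φ = ∑' x, (X.v x : ℂ) * g x := tsum_congr hφ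
  rw [← h3, h2, h4, partialFt]
  simp only [smul_eq_mul, Complex.ofReal_zero, mul_zero, neg_zero, Complex.exp_zero, mul_one,
    add_zero]
  rw [intervalIntegral.integral_mul_const, intervalIntegral.integral_const_mul]
  ring

end GraphData

/-! ### Properties common to the two kinds of reservoirs -/

namespace Reservoir

instance isFiniteMeasure_specMeasure : (R : Reservoir) → (ψ : R.Space) →
    IsFiniteMeasure (R.specMeasure ψ)
  | euclidean _ _, ψ => isFiniteMeasure_kineticMeasure ψ
  | graph X, ψ => isFiniteMeasure_boundedMeasure X.ham ψ

theorem ham_symmetric : (R : Reservoir) → (x y : R.ham.domain) →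
    inner ℂ (R.ham x) (y : R.Space) = inner ℂ (x : R.Space) (R.ham y)
  | euclidean _ _, x, y => kinetic_symmetric x y
  | graph X, ⟨x, _⟩, ⟨y, _⟩ =>
    ContinuousLinearMap.isSelfAdjoint_iff_isSymmetric.1 X.isSelfAdjoint_ham x y

theorem resolvent : (R : Reservoir) → (g : R.Space) → {z : ℂ} → z.im ≠ 0 →
    ∃ x : R.ham.domain, z • (x : R.Space) - R.ham x = g ∧
      inner ℂ g (x : R.Space) = stieltjes (R.specMeasure g) z
  | euclidean _ _, g, _, hz => kinetic_resolvent g hz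
  | graph X, g, _, hz => by
    obtain ⟨x, hx⟩ := bounded_resolvent X.isSelfAdjoint_ham g hz
    exact ⟨⟨x, Submodule.mem_top (R := ℂ) (M := ell2 X.V)⟩, hx⟩

theorem integrable_sq : (R : Reservoir) → {g : R.Space} → g ∈ R.ham.domain →
    Integrable (fun ν : ℝ => ν ^ 2) (R.specMeasure g)
  | euclidean _ _, _, hg => integrable_sq_kineticMeasure hg
  | graph X, g, _ => integrable_boundedMeasure X.ham g (by fun_prop)

theorem withDensity_orbitFn (ρ : Measure ℝ) (a b : ℂ) (c : ℝ → ℂ) (t : ℝ) :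
    ρ.withDensity (fun ν => ‖orbitFn a b c t ν‖ₑ ^ 2)
      = ρ.withDensity fun ν => ‖a + b * ν + Complex.I * partialFt c t ν‖ₑ ^ 2 := by
  congr 1
  ext ν
  rw [← ofReal_norm, norm_orbitFn, ofReal_norm]

/-- A reservoir enters the Gaussian exponent only through this measure, in which the unimodular
factor e^{itν} disappears. What is left of the dynamics is the truncated Fourier integral of the
source. -/
theorem specMeasure_solution : (R : Reservoir) → {g : R.Space} → (hg : g ∈ R.ham.domain) →
    {c : ℝ → ℂ} → Continuous c → {ψ : ℝ → R.Space} → IsWeakSolution R.ham c g ψ → {a b : ℂ} →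
    ψ 0 = a • g + b • R.ham ⟨g, hg⟩ → {t : ℝ} → 0 ≤ t →
    R.specMeasure (ψ t) = (R.specMeasure g).withDensity
      fun ν => ‖a + b * ν + Complex.I * partialFt c t ν‖ₑ ^ 2
  | euclidean d _, g, hg, c, hc, ψ, hψ, a, b, h0, t, ht => by
    rw [← withDensity_orbitFn]
    exact kineticMeasure_of_ae_eq (continuous_orbitFn a b hc t).measurable
      (kinetic_solution (d := d) hg hc hψ h0 ht)
  | graph X, g, hg, c, hc, ψ, hψ, a, b, h0, t, ht => by
    rw [← withDensity_orbitFn]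
    have h1 := bounded_solution X.isSelfAdjoint_ham hc hψ h0 ht
    have h2 := boundedMeasure_functionOf X.isSelfAdjoint_ham g (continuous_orbitFn a b hc t)
    rw [← h1] at h2
    exact h2

theorem weight_euclidean {d : ℕ} (hd : 3 ≤ d) {ψ : L2 d} {a : ℂ}
    (h : Tendsto (fun p => ψ p) (𝓝 0 ⊓ ae volume) (𝓝 a)) :
    (euclidean d hd).weight ψ = a := by
  have := neBot_nhds_zero_inf_ae (d := d)
  exact h.limUnder_eq

/-- The weight reads the spectral representation at zero energy, where the term bν vanishes. On ℝ^d
this is continuity of `orbitFn` at ν = 0; on a graph it is invariance of the weighted sum. -/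
theorem weight_solution : (R : Reservoir) → {g : R.Space} → (hg : g ∈ R.ham.domain) →
    g ∈ R.weightDomain → {c : ℝ → ℂ} → Continuous c → {ψ : ℝ → R.Space} →
    IsWeakSolution R.ham c g ψ → {a b : ℂ} → ψ 0 = a • g + b • R.ham ⟨g, hg⟩ →
    {t : ℝ} → 0 ≤ t → R.weight (ψ t) = (a + Complex.I * partialFt c t 0) * R.weight g
  | euclidean d hd, g, hg, hw, c, hc, ψ, hψ, a, b, h0, t, ht => by
    obtain ⟨w, hw⟩ := hw
    have h1 := tendsto_of_ae_eq_mul (continuous_orbitFn a b hc t)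
      (kinetic_solution (d := d) hg hc hψ h0 ht) hw
    rw [weight_euclidean hd h1, weight_euclidean hd hw, orbitFn]
    simp
  | graph X, g, hg, hw, c, hc, ψ, hψ, a, b, h0, t, ht => by
    have h1 := IsWeakSolution.eq_duhamel X.isSelfAdjoint_ham hc hψ t
    have h2 := X.weight_solution hw hc a b t
    change ∑' x, (X.v x : ℂ) * (show ell2 X.V from ψ t) x = _
    rw [h1, h0]
    exact h2

theorem specMeasure_comb : (R : Reservoir) → {g : R.Space} → (hg : g ∈ R.ham.domain) →
    (a b : ℂ) → R.specMeasure (a • g + b • R.ham ⟨g, hg⟩)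
      = (R.specMeasure g).withDensity fun ν => ‖a + b * ν‖ₑ ^ 2
  | euclidean d _, g, hg, a, b => by
    refine kineticMeasure_of_ae_eq (d := d) (u := fun ν => a + b * ν) (by fun_prop) ?_
    filter_upwards [Lp.coeFn_add (a • (show L2 d from g)) (b • kinetic d ⟨g, hg⟩),
      Lp.coeFn_smul a (show L2 d from g), Lp.coeFn_smul b (kinetic d ⟨g, hg⟩),
      kinetic_coeFn (d := d) ⟨g, hg⟩] with p h1 h2 h3 h4
    refine h1.trans ?_
    rw [Pi.add_apply, h2, h3, Pi.smul_apply, Pi.smul_apply, h4]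
    simp only [smul_eq_mul]
    ring
  | graph X, g, hg, a, b => by
    have h2 := boundedMeasure_functionOf X.isSelfAdjoint_ham (show ell2 X.V from g)
      (u := fun ν => a * 1 + b * ν) (by fun_prop)
    rw [functionOf_add X.ham (by fun_prop) (by fun_prop),
      functionOf_const_mul X.ham _ (by fun_prop), functionOf_const_mul X.ham _ (by fun_prop),
      functionOf_one X.isSelfAdjoint_ham, functionOf_id X.isSelfAdjoint_ham] at h2
    simp only [mul_one] at h2
    exact h2

theorem comb_mem_weightDomain : (R : Reservoir) → {g : R.Space} → (hg : g ∈ R.ham.domain) →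
    g ∈ R.weightDomain → (a b : ℂ) → a • g + b • R.ham ⟨g, hg⟩ ∈ R.weightDomain
  | euclidean d _, g, hg, hw, a, b => by
    obtain ⟨w, hw⟩ := hw
    refine ⟨_, tendsto_of_ae_eq_mul (d := d) (u := fun ν => a + b * ν) (by fun_prop) ?_ hw⟩
    filter_upwards [Lp.coeFn_add (a • (show L2 d from g)) (b • kinetic d ⟨g, hg⟩),
      Lp.coeFn_smul a (show L2 d from g), Lp.coeFn_smul b (kinetic d ⟨g, hg⟩),
      kinetic_coeFn (d := d) ⟨g, hg⟩] with p h1 h2 h3 h4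
    refine h1.trans ?_
    rw [Pi.add_apply, h2, h3, Pi.smul_apply, Pi.smul_apply, h4]
    simp only [smul_eq_mul]
    ring
  | graph X, g, hg, hw, a, b => by
    have h1 := X.summable_ham hw
    have h2 : Summable fun x => ‖a‖ * (X.v x * ‖(show ell2 X.V from g) x‖)
        + ‖b‖ * (X.v x * ‖X.ham g x‖) := (Summable.mul_left _ hw).add (h1.mul_left _)
    change Summable fun x => X.v x * ‖(a • (show ell2 X.V from g) + b • X.ham g) x‖
    refine h2.of_nonneg_of_le (fun x => mul_nonneg (X.v_pos x).le (norm_nonneg _)) fun x => ?_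
    calc X.v x * ‖(a • (show ell2 X.V from g) + b • X.ham g) x‖
        ≤ X.v x * (‖a‖ * ‖(show ell2 X.V from g) x‖ + ‖b‖ * ‖X.ham g x‖) := by
          refine mul_le_mul_of_nonneg_left ?_ (X.v_pos x).le
          refine (norm_add_le _ _).trans (le_of_eq ?_)
          rw [← norm_mul, ← norm_mul]
          rfl
      _ = _ := by ring

end Reservoir

/-! ### Measures in the domain of the Bose weight -/

section Bose

variable {ρ : Measure ℝ} {β : ℝ}

theorem ae_pos_of_bose (h : ∫⁻ ν, (ENNReal.ofReal (Real.exp (β * ν) - 1))⁻¹ ∂ρ < ∞)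
    (hβ : 0 < β) : ∀ᵐ ν ∂ρ, 0 < ν := by
  have hm : Measurable fun ν : ℝ => (ENNReal.ofReal (Real.exp (β * ν) - 1))⁻¹ := by fun_prop
  filter_upwards [ae_lt_top hm h.ne] with ν hν
  by_contra hneg
  have : Real.exp (β * ν) ≤ 1 := Real.exp_le_one_iff.2
    (mul_nonpos_of_nonneg_of_nonpos hβ.le (not_lt.1 hneg))
  rw [ENNReal.ofReal_of_nonpos (by linarith), ENNReal.inv_zero] at hν
  exact lt_irrefl _ hν

theorem integrable_bose (h : ∫⁻ ν, (ENNReal.ofReal (Real.exp (β * ν) - 1))⁻¹ ∂ρ < ∞)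
    (hβ : 0 < β) : Integrable (fun ν : ℝ => (Real.exp (β * ν) - 1)⁻¹) ρ := by
  refine ⟨by fun_prop, ?_⟩
  refine lt_of_eq_of_lt (lintegral_congr_ae ?_) h
  filter_upwards [ae_pos_of_bose h hβ] with ν hν
  have : 0 < Real.exp (β * ν) - 1 := by
    have := Real.add_one_lt_exp (mul_pos hβ hν).ne'
    nlinarith [mul_pos hβ hν]
  rw [← ofReal_norm, Real.norm_of_nonneg (by positivity), ENNReal.ofReal_inv_of_pos this]

/-- With x = βν this is e^x - 1 ≤ x e^x, that is 1 - x ≤ e^{-x}. It turns the Bose domain condition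
into a finite moment of ν⁻¹, needed at zero energy. -/
theorem inv_le_bose (hβ : 0 < β) {ν : ℝ} (hν : 0 < ν) :
    ν⁻¹ ≤ β * ((Real.exp (β * ν) - 1)⁻¹ + 1) := by
  have hx : 0 < β * ν := mul_pos hβ hν
  set x := β * ν with hxdef
  have he : 0 < Real.exp x - 1 := by linarith [Real.add_one_lt_exp hx.ne']
  have h2 : 1 - x ≤ Real.exp (-x) := by linarith [Real.add_one_le_exp (-x)]
  have h3 : Real.exp (-x) * Real.exp x = 1 := by rw [← Real.exp_add]; simp
  have h1 : Real.exp x - 1 ≤ x * Real.exp x := by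
    nlinarith [Real.exp_pos x, mul_le_mul_of_nonneg_right h2 (Real.exp_pos x).le]
  have h4 : (Real.exp x - 1)⁻¹ + 1 = Real.exp x / (Real.exp x - 1) := by
    field_simp
    ring
  rw [h4, ← mul_div_assoc, le_div_iff₀ he, inv_mul_le_iff₀ hν]
  calc Real.exp x - 1 ≤ x * Real.exp x := h1
    _ = ν * (β * Real.exp x) := by rw [hxdef]; ring

theorem integrable_inv_of_bose [IsFiniteMeasure ρ]
    (h : ∫⁻ ν, (ENNReal.ofReal (Real.exp (β * ν) - 1))⁻¹ ∂ρ < ∞) (hβ : 0 < β) :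
    Integrable (fun ν : ℝ => ν⁻¹) ρ := by
  refine (((integrable_bose h hβ).add (integrable_const 1)).const_mul β).mono' (by fun_prop) ?_
  filter_upwards [ae_pos_of_bose h hβ] with ν hν
  rw [Real.norm_of_nonneg (by positivity)]
  exact inv_le_bose hβ hν

theorem planck_nonneg (hβ : 0 < β) {μ : ℝ} (hμ : μ ≤ 0) {ν : ℝ} (hν : 0 < ν) :
    0 ≤ planck β μ ν := by
  unfold planck
  have : 0 ≤ β * (ν - μ) := mul_nonneg hβ.le (by linarith)
  have := Real.one_le_exp this
  exact inv_nonneg.2 (by linarith)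

theorem planck_le (hβ : 0 < β) {μ : ℝ} (hμ : μ ≤ 0) {ν : ℝ} (hν : 0 < ν) :
    planck β μ ν ≤ (Real.exp (β * ν) - 1)⁻¹ := by
  unfold planck
  have h1 : β * ν ≤ β * (ν - μ) := mul_le_mul_of_nonneg_left (by linarith) hβ.le
  have h2 := Real.exp_le_exp.2 h1
  have h3 := Real.add_one_lt_exp (mul_pos hβ hν).ne'
  have h4 := mul_pos hβ hν
  exact inv_anti₀ (by linarith) (by linarith)

theorem measurable_planck (β μ : ℝ) : Measurable (planck β μ) := by
  unfold planck
  fun_prop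

theorem integrable_planck (h : ∫⁻ ν, (ENNReal.ofReal (Real.exp (β * ν) - 1))⁻¹ ∂ρ < ∞)
    (hβ : 0 < β) {μ : ℝ} (hμ : μ ≤ 0) : Integrable (planck β μ) ρ := by
  refine (integrable_bose h hβ).mono' (measurable_planck β μ).aestronglyMeasurable ?_
  filter_upwards [ae_pos_of_bose h hβ] with ν hν
  rw [Real.norm_of_nonneg (planck_nonneg hβ hμ hν)]
  exact planck_le hβ hμ hν

theorem bose_le_inv (hβ : 0 < β) {ν : ℝ} (hν : 0 < ν) : (Real.exp (β * ν) - 1)⁻¹ ≤ (β * ν)⁻¹ :=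
  inv_anti₀ (mul_pos hβ hν) (by linarith [Real.add_one_le_exp (β * ν)])

/-- `‖a + bν‖² N` is integrable if `N` and `ν²` are. -/
theorem bose_comb [IsFiniteMeasure ρ]
    (h : ∫⁻ ν, (ENNReal.ofReal (Real.exp (β * ν) - 1))⁻¹ ∂ρ < ∞) (hβ : 0 < β)
    (hsq : Integrable (fun ν : ℝ => ν ^ 2) ρ) (a b : ℂ) :
    ∫⁻ ν, (ENNReal.ofReal (Real.exp (β * ν) - 1))⁻¹
      ∂(ρ.withDensity fun ν => ‖a + b * ν‖ₑ ^ 2) < ∞ := by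
  have hm : Measurable fun ν : ℝ => (ENNReal.ofReal (Real.exp (β * ν) - 1))⁻¹ := by fun_prop
  rw [lintegral_withDensity_eq_lintegral_mul _ (by fun_prop) hm]
  have hintegrable : Integrable (fun ν : ℝ => 2 * (‖a‖ ^ 2 * (Real.exp (β * ν) - 1)⁻¹)
      + 2 * (‖b‖ ^ 2 * (β⁻¹ * (1 + ν ^ 2)))) ρ :=
    (((integrable_bose h hβ).const_mul _).const_mul _).add
      (((((integrable_const 1).add hsq).const_mul _).const_mul _).const_mul _)
  refine lt_of_le_of_lt (lintegral_mono_ae ?_) hintegrable.lintegral_lt_top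
  filter_upwards [ae_pos_of_bose h hβ] with ν hν
  have hx := mul_pos hβ hν
  have he : 0 < Real.exp (β * ν) - 1 := by linarith [Real.add_one_lt_exp hx.ne']
  rw [Pi.mul_apply, ← ENNReal.ofReal_inv_of_pos he, ← ofReal_norm,
    ← ENNReal.ofReal_pow (norm_nonneg _), ← ENNReal.ofReal_mul (by positivity)]
  refine ENNReal.ofReal_le_ofReal ?_
  have h1 : ‖a + b * ν‖ ^ 2 ≤ 2 * ‖a‖ ^ 2 + 2 * ‖b‖ ^ 2 * ν ^ 2 := by
    have h2 : ‖a + b * ν‖ ≤ ‖a‖ + ‖b‖ * ν := by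
      refine (norm_add_le _ _).trans (le_of_eq ?_)
      rw [norm_mul, Complex.norm_real, Real.norm_of_nonneg hν.le]
    calc ‖a + b * ν‖ ^ 2 ≤ (‖a‖ + ‖b‖ * ν) ^ 2 := by gcongr
      _ ≤ _ := by nlinarith [sq_nonneg (‖a‖ - ‖b‖ * ν)]
  -- One power of ν cancels the Bose singularity, and the other is bounded by 1 + ν².
  have h3 : ν ^ 2 * (Real.exp (β * ν) - 1)⁻¹ ≤ β⁻¹ * (1 + ν ^ 2) := by
    calc ν ^ 2 * (Real.exp (β * ν) - 1)⁻¹ ≤ ν ^ 2 * (β * ν)⁻¹ := by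
          refine mul_le_mul_of_nonneg_left (bose_le_inv hβ hν) (sq_nonneg ν)
      _ = β⁻¹ * ν := by field_simp
      _ ≤ β⁻¹ * (1 + ν ^ 2) := by
          gcongr
          nlinarith [sq_nonneg (ν - 1)]
  calc ‖a + b * ν‖ ^ 2 * (Real.exp (β * ν) - 1)⁻¹
      ≤ (2 * ‖a‖ ^ 2 + 2 * ‖b‖ ^ 2 * ν ^ 2) * (Real.exp (β * ν) - 1)⁻¹ := by gcongr
    _ = 2 * (‖a‖ ^ 2 * (Real.exp (β * ν) - 1)⁻¹)
        + 2 * (‖b‖ ^ 2 * (ν ^ 2 * (Real.exp (β * ν) - 1)⁻¹)) := by ring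
    _ ≤ _ := by gcongr

end Bose

/-- The Stieltjes transform has a nontangential limit at the left end of the support. -/
theorem tendsto_stieltjes_zero {ρ : Measure ℝ} (hpos : ∀ᵐ ν ∂ρ, 0 < ν)
    (hintegrable : Integrable (fun ν : ℝ => ν⁻¹) ρ) (y : ℝ) :
    Tendsto (fun T : ℝ => stieltjes ρ (((T⁻¹ : ℝ) : ℂ) * (y - Complex.I))) atTop
      (𝓝 (-((∫ ν, ν⁻¹ ∂ρ : ℝ) : ℂ))) := by
  have hlim : -((∫ ν, ν⁻¹ ∂ρ : ℝ) : ℂ) = ∫ ν, (-(ν : ℂ)⁻¹) ∂ρ := by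
    rw [integral_neg, ← integral_complex_ofReal]
    simp
  rw [hlim]
  refine tendsto_integral_filter_of_dominated_convergence
    (fun ν => Real.sqrt (1 + y ^ 2) * ν⁻¹) ?_ ?_ (hintegrable.const_mul _) ?_
  · filter_upwards [eventually_gt_atTop (0 : ℝ)] with T hT
    refine (continuous_inv_sub ?_).aestronglyMeasurable
    simp
    exact hT.ne'
  · filter_upwards with T
    filter_upwards [hpos] with ν hν
    rw [norm_inv]
    set τ := T⁻¹
    -- The right-hand side equals ν² + (τ(1 + y²) - yν)². Hence √(1 + y²)/ν dominates the kernel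
    -- along the whole ray.
    have h1 : ν ^ 2 ≤ (1 + y ^ 2) * ‖(τ : ℂ) * (y - Complex.I) - ν‖ ^ 2 := by
      rw [← Complex.normSq_eq_norm_sq, Complex.normSq_apply]
      simp
      nlinarith [sq_nonneg (τ * (1 + y ^ 2) - y * ν)]
    have h2 : ν ≤ Real.sqrt (1 + y ^ 2) * ‖(τ : ℂ) * (y - Complex.I) - ν‖ := by
      refine le_of_sq_le_sq ?_ (by positivity)
      rw [mul_pow, Real.sq_sqrt (by positivity)]
      exact h1
    have h3 : 0 < ‖(τ : ℂ) * (y - Complex.I) - ν‖ := by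
      by_contra hn
      have h0 := le_antisymm (not_lt.1 hn) (norm_nonneg _)
      rw [h0, mul_zero] at h2
      linarith
    rw [inv_le_iff_one_le_mul₀ h3, mul_right_comm, ← div_eq_mul_inv, one_le_div hν]
    exact h2
  · filter_upwards [hpos] with ν hν
    have h1 : Tendsto (fun T : ℝ => ((T⁻¹ : ℝ) : ℂ) * (y - Complex.I) - ν) atTop
        (𝓝 (((0 : ℝ) : ℂ) * (y - Complex.I) - ν)) := by
      refine Tendsto.sub (Tendsto.mul ?_ tendsto_const_nhds) tendsto_const_nhds
      exact (Complex.continuous_ofReal.tendsto 0).comp tendsto_inv_atTop_zero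
    have h2 := h1.inv₀ (by simpa using hν.ne')
    simpa [inv_neg] using h2

/-! ### Lower bounds for η and its behaviour at zero energy -/

namespace Model

variable {N : ℕ} (M : Model N)

instance isFiniteMeasure_formMeasure (k : Fin N) : IsFiniteMeasure (M.formMeasure k) :=
  (M.res k).isFiniteMeasure_specMeasure (M.g k)

theorem eta_eq (z : ℂ) : M.eta z
    = z - M.Ω - (M.coupling : ℂ) ^ 2 * ∑ k, stieltjes (M.formMeasure k) z := rfl

/-- Condition (A) concerns solutions of the resolvent equation; `resolvent` provides one at every
nonreal z, and its matrix element is the Stieltjes transform. -/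
theorem exists_norm_stieltjes_le (hA : M.CondA) :
    ∃ C : ℝ, 0 < C ∧ ∀ k, ∀ z : ℂ, z.im ≠ 0 → ‖stieltjes (M.formMeasure k) z‖ ≤ C := by
  choose C hC using hA
  refine ⟨1 + ∑ k, |C k|, by positivity, fun k z hz => ?_⟩
  obtain ⟨x, hx, hx'⟩ := (M.res k).resolvent (M.g k) hz
  have h1 := hC k z hz x hx
  rw [hx'] at h1
  refine h1.trans ((le_abs_self _).trans ?_)
  have := Finset.single_le_sum (f := fun k => |C k|) (fun i _ => abs_nonneg (C i))
    (Finset.mem_univ k)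
  linarith

theorem eta_conj (z : ℂ) : M.eta (conj z) = conj (M.eta z) := by
  simp only [eta_eq, stieltjes_conj, map_sub, map_mul, map_pow, Complex.conj_ofReal, map_sum]

/-- The Stieltjes transforms have imaginary part of sign opposite to Im z, so subtracting them moves
η further from the real axis. In particular η has no zeros off the axis. -/
theorem eta_im_le {z : ℂ} (hz : z.im < 0) : (M.eta z).im ≤ z.im := by
  have h1 : 0 ≤ (∑ k, stieltjes (M.formMeasure k) z).im := by
    rw [Complex.im_sum]
    exact Finset.sum_nonneg fun k _ => stieltjes_im_nonneg _ hz
  have h2 : (M.eta z).im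
      = z.im - M.coupling ^ 2 * (∑ k, stieltjes (M.formMeasure k) z).im := by
    rw [eta_eq, ← Complex.ofReal_pow, Complex.sub_im, Complex.sub_im, Complex.ofReal_im,
      Complex.im_ofReal_mul, sub_zero]
  rw [h2]
  nlinarith [mul_nonneg (sq_nonneg M.coupling) h1]

theorem le_eta_im {z : ℂ} (hz : 0 < z.im) : z.im ≤ (M.eta z).im := by
  have h := M.eta_im_le (z := conj z) (by simpa using hz)
  rw [eta_conj, Complex.conj_im, Complex.conj_im] at h
  linarith

theorem differentiableAt_eta {z : ℂ} (hz : z.im ≠ 0) : DifferentiableAt ℂ M.eta z := by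
  have h1 : ∀ k, DifferentiableAt ℂ (stieltjes (M.formMeasure k)) z := fun k =>
    differentiableAt_stieltjes _ hz
  have h2 : DifferentiableAt ℂ (fun z => ∑ k, stieltjes (M.formMeasure k) z) z :=
    DifferentiableAt.fun_sum fun k _ => h1 k
  exact (differentiableAt_id.sub_const _).sub (h2.const_mul _)

theorem exists_norm_sub_le_norm_eta (hA : M.CondA) :
    ∃ K : ℝ, 0 < K ∧ ∀ z : ℂ, z.im ≠ 0 → ‖z‖ - K ≤ ‖M.eta z‖ := by
  obtain ⟨C, hC, h⟩ := M.exists_norm_stieltjes_le hA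
  have hΩ := M.Ω_pos
  refine ⟨M.Ω + M.coupling ^ 2 * (N * C), by positivity, fun z hz => ?_⟩
  have h1 : ‖(M.coupling : ℂ) ^ 2 * ∑ k, stieltjes (M.formMeasure k) z‖
      ≤ M.coupling ^ 2 * (N * C) := by
    rw [norm_mul, norm_pow, Complex.norm_real, Real.norm_of_nonneg M.coupling_pos.le]
    gcongr
    refine (norm_sum_le _ _).trans ((Finset.sum_le_sum fun k _ => h k z hz).trans ?_)
    simp
  have h2 : z = M.eta z + (M.Ω + (M.coupling : ℂ) ^ 2 * ∑ k, stieltjes (M.formMeasure k) z) := by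
    rw [eta_eq]
    ring
  have h3 : ‖z‖ ≤ ‖M.eta z‖
      + (‖(M.Ω : ℂ)‖ + ‖(M.coupling : ℂ) ^ 2 * ∑ k, stieltjes (M.formMeasure k) z‖) := by
    conv_lhs => rw [h2]
    refine (norm_add_le _ _).trans ?_
    gcongr
    exact norm_add_le _ _
  rw [Complex.norm_real, Real.norm_of_nonneg hΩ.le] at h3
  linarith

/-- `1/η` is bounded off the real axis. -/
theorem exists_le_norm_eta (hA : M.CondA) (hB : M.CondB) :
    ∃ c : ℝ, 0 < c ∧ (∀ z : ℂ, z.im ≠ 0 → c ≤ ‖M.eta z‖) := by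
  obtain ⟨c, hc, hae⟩ := hB
  obtain ⟨K, hK, hKη⟩ := M.exists_norm_sub_le_norm_eta hA
  have hup : ∀ z : ℂ, 0 < z.im → c ≤ ‖M.eta z‖ := by
    intro z hz
    -- The maximum principle needs a bounded function, and 1/η is not known to be bounded at this
    -- stage. Since Im η > 0 in the upper half plane, 1/(η + iδ) is bounded by 1/δ; the shift is
    -- removed at the end.
    have key : ∀ δ : ℝ, 0 < δ → c ≤ ‖M.eta z + δ * Complex.I‖ := by
      intro δ hδ
      have him : ∀ w : ℂ, 0 < w.im → δ ≤ (M.eta w + δ * Complex.I).im := by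
        intro w hw
        have := M.le_eta_im hw
        simp
        linarith
      have hne : ∀ w : ℂ, 0 < w.im → δ ≤ ‖M.eta w + δ * Complex.I‖ := fun w hw =>
        (him w hw).trans ((le_abs_self _).trans (Complex.abs_im_le_norm _))
      have hne0 : ∀ w : ℂ, 0 < w.im → M.eta w + δ * Complex.I ≠ 0 := fun w hw h => by
        have := hne w hw
        rw [h, norm_zero] at this
        linarith
      have h1 : ‖(M.eta z + δ * Complex.I)⁻¹‖ ≤ c⁻¹ := by
        refine norm_le_of_ae_boundary (F := fun w => (M.eta w + δ * Complex.I)⁻¹) (B := δ⁻¹)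
          ?_ ?_ ?_ ?_ hz
        · intro w hw
          exact (((M.differentiableAt_eta (ne_of_gt hw)).add_const _).inv
            (hne0 w hw)).differentiableWithinAt
        · intro w hw
          rw [norm_inv]
          exact inv_anti₀ hδ (hne w hw)
        · refine (tendsto_inv₀_cobounded (α := ℂ)).comp ?_
          rw [← tendsto_norm_atTop_iff_cobounded]
          refine tendsto_atTop_mono' _ (f₁ := fun w : ℂ => ‖w‖ - (K + δ)) ?_ ?_
          · have : ∀ᶠ w in Bornology.cobounded ℂ ⊓ 𝓟 {z : ℂ | 0 < z.im}, 0 < w.im :=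
              (mem_inf_of_right (mem_principal_self _))
            filter_upwards [this] with w hw
            have e1 := hKη w (ne_of_gt hw)
            have e2 : ‖M.eta w‖ ≤ ‖M.eta w + δ * Complex.I‖ + δ := by
              have := norm_sub_le (M.eta w + δ * Complex.I) (δ * Complex.I)
              rw [add_sub_cancel_right, norm_mul, Complex.norm_I, mul_one, Complex.norm_real,
                Real.norm_of_nonneg hδ.le] at this
              exact this
            linarith
          · exact (tendsto_atTop_add_const_right _ _
              ((tendsto_norm_cobounded_atTop (E := ℂ)).mono_left inf_le_left))
        · filter_upwards [hae] with x hx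
          obtain ⟨w, hw, hcw⟩ := hx
          have hw0 : 0 ≤ w.im := by
            refine ge_of_tendsto ((Complex.continuous_im.tendsto w).comp hw) ?_
            filter_upwards [self_mem_nhdsWithin] with ε hε
            have hε' : 0 < ((x : ℂ) + ε * Complex.I).im := by simpa using hε
            exact hε'.le.trans (M.le_eta_im hε')
          -- The boundary value has Im w ≥ 0, so adding iδ does not decrease its modulus.
          have hcw' : c ≤ ‖w + δ * Complex.I‖ := by
            refine hcw.trans ?_
            rw [Complex.norm_def, Complex.norm_def]
            refine Real.sqrt_le_sqrt ?_
            rw [Complex.normSq_apply, Complex.normSq_apply]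
            simp
            nlinarith
          have hne' : w + δ * Complex.I ≠ 0 := fun h => by
            rw [h, norm_zero] at hcw'
            linarith
          refine ⟨(w + δ * Complex.I)⁻¹, (hw.add_const _).inv₀ hne', ?_⟩
          rw [norm_inv]
          exact inv_anti₀ hc hcw'
      rw [norm_inv] at h1
      exact (inv_le_inv₀ (hδ.trans_le (hne z hz)) hc).1 h1
    have hlim : Tendsto (fun δ : ℝ => ‖M.eta z + δ * Complex.I‖) (𝓝[>] 0) (𝓝 ‖M.eta z‖) := by
      have : Continuous fun δ : ℝ => ‖M.eta z + δ * Complex.I‖ := by fun_prop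
      have h0 := this.tendsto 0
      simp only [Complex.ofReal_zero, zero_mul, add_zero] at h0
      exact h0.mono_left nhdsWithin_le_nhds
    refine ge_of_tendsto hlim ?_
    filter_upwards [self_mem_nhdsWithin] with δ hδ
    exact key δ hδ
  refine ⟨c, hc, fun z hz => ?_⟩
  rcases lt_or_gt_of_ne hz with h | h
  · have h1 := hup (conj z) (by simpa using h)
    rw [eta_conj, RCLike.norm_conj] at h1
    exact h1
  · exact hup z h

/-- Combines |η| ≥ |z| - K, which exceeds (1 + |z|)/2 once |z| ≥ 2K + 1, with the uniform bound on
the remaining disc. The growth makes 1/η square integrable along horizontal lines. -/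
theorem exists_mul_le_norm_eta (hA : M.CondA) (hB : M.CondB) :
    ∃ c : ℝ, 0 < c ∧ (∀ z : ℂ, z.im ≠ 0 → c * (1 + ‖z‖) ≤ ‖M.eta z‖) := by
  obtain ⟨c, hc, h⟩ := M.exists_le_norm_eta hA hB
  obtain ⟨K, hK, hKη⟩ := M.exists_norm_sub_le_norm_eta hA
  refine ⟨min (1 / 2) (c / (2 * K + 2)), by positivity, fun z hz => ?_⟩
  by_cases hz' : 2 * K + 1 ≤ ‖z‖
  · calc min (1 / 2) (c / (2 * K + 2)) * (1 + ‖z‖) ≤ 1 / 2 * (1 + ‖z‖) := by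
          gcongr
          exact min_le_left _ _
      _ ≤ ‖z‖ - K := by linarith
      _ ≤ _ := hKη z hz
  · calc min (1 / 2) (c / (2 * K + 2)) * (1 + ‖z‖) ≤ c / (2 * K + 2) * (2 * K + 2) := by
          refine mul_le_mul (min_le_right _ _) ?_ (by positivity) (by positivity)
          linarith [not_le.1 hz']
      _ = c := by field_simp
      _ ≤ _ := h z hz

/-- Condition (B) concerns limits from above; the symmetry of η under conjugation transfers them to
the lower side. -/
theorem ae_tendsto_etaMinus (hB : M.CondB) :
    ∀ᵐ x : ℝ, Tendsto (fun ε : ℝ => M.eta (x - ε * Complex.I)) (𝓝[>] 0) (𝓝 (M.etaMinus x)) := by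
  obtain ⟨c, hc, hae⟩ := hB
  filter_upwards [hae] with x hx
  obtain ⟨w, hw, hcw⟩ := hx
  have h1 : Tendsto (fun ε : ℝ => M.eta (x - ε * Complex.I)) (𝓝[>] 0) (𝓝 (conj w)) := by
    refine ((Complex.continuous_conj.tendsto w).comp hw).congr fun ε => ?_
    rw [Function.comp_apply, ← eta_conj]
    congr 1
    simp [sub_eq_add_neg]
  rw [etaMinus, h1.limUnder_eq]
  exact h1

theorem le_norm_etaMinus {c : ℝ} (hc : ∀ z : ℂ, z.im ≠ 0 → c * (1 + ‖z‖) ≤ ‖M.eta z‖) {x : ℝ}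
    (hx : Tendsto (fun ε : ℝ => M.eta (x - ε * Complex.I)) (𝓝[>] 0) (𝓝 (M.etaMinus x))) :
    c * (1 + |x|) ≤ ‖M.etaMinus x‖ := by
  have h1 : Tendsto (fun ε : ℝ => c * (1 + ‖(x : ℂ) - ε * Complex.I‖)) (𝓝[>] 0)
      (𝓝 (c * (1 + |x|))) := by
    have : Continuous fun ε : ℝ => c * (1 + ‖(x : ℂ) - ε * Complex.I‖) := by fun_prop
    have h0 := this.tendsto 0
    simp only [Complex.ofReal_zero, zero_mul, sub_zero, Complex.norm_real, Real.norm_eq_abs] at h0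
    exact h0.mono_left nhdsWithin_le_nhds
  refine le_of_tendsto_of_tendsto h1 hx.norm ?_
  filter_upwards [self_mem_nhdsWithin] with ε hε
  exact hc _ (by simpa using ne_of_gt hε)

theorem bose_form (hD : M.CondD) (k : Fin N) :
    ∫⁻ ν, (ENNReal.ofReal (Real.exp (M.β k * ν) - 1))⁻¹ ∂(M.formMeasure k) < ∞ := (hD k).2

theorem ae_formMeasure_pos (hD : M.CondD) (k : Fin N) : ∀ᵐ ν ∂(M.formMeasure k), 0 < ν :=
  ae_pos_of_bose (M.bose_form hD k) (M.β_pos k)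

/-- The moment `∫ ν⁻¹ d⟪g_k, E_k(ν) g_k⟫`. -/
def invMoment (k : Fin N) : ℝ := ∫ ν, ν⁻¹ ∂(M.formMeasure k)

/-- The value of `η` at the bottom of the spectra. -/
def etaZero : ℝ := -M.Ω + M.coupling ^ 2 * ∑ k, M.invMoment k

theorem tendsto_form_zero (hD : M.CondD) (k : Fin N) (y : ℝ) :
    Tendsto (fun T : ℝ => stieltjes (M.formMeasure k) (((T⁻¹ : ℝ) : ℂ) * (y - Complex.I))) atTop
      (𝓝 (-(M.invMoment k : ℂ))) :=
  tendsto_stieltjes_zero (M.ae_formMeasure_pos hD k)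
    (integrable_inv_of_bose (M.bose_form hD k) (M.β_pos k)) y

theorem tendsto_inv_mul_atTop (w : ℂ) :
    Tendsto (fun T : ℝ => ((T⁻¹ : ℝ) : ℂ) * w) atTop (𝓝 0) := by
  have h1 := ((Complex.continuous_ofReal.tendsto 0).comp tendsto_inv_atTop_zero).mul_const w
  simpa using h1

theorem tendsto_eta_zero (hD : M.CondD) (y : ℝ) :
    Tendsto (fun T : ℝ => M.eta (((T⁻¹ : ℝ) : ℂ) * (y - Complex.I))) atTop
      (𝓝 (M.etaZero : ℂ)) := by
  have h1 := ((tendsto_inv_mul_atTop (y - Complex.I)).sub_const (M.Ω : ℂ)).sub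
    ((tendsto_finsetSum Finset.univ fun k _ => M.tendsto_form_zero hD k y).const_mul
      ((M.coupling : ℂ) ^ 2))
  convert! h1 using 2
  rw [etaZero]
  push_cast
  rw [Finset.sum_neg_distrib]
  ring

/-- An almost-everywhere condition says nothing about the single point 0; the uniform lower bound
off the axis does, since it passes to the nontangential limit. -/
theorem etaZero_ne_zero (hA : M.CondA) (hB : M.CondB) (hD : M.CondD) : M.etaZero ≠ 0 := by
  obtain ⟨c, hc, h⟩ := M.exists_le_norm_eta hA hB
  have h1 : c ≤ ‖(M.etaZero : ℂ)‖ := by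
    refine ge_of_tendsto (M.tendsto_eta_zero hD 0).norm ?_
    filter_upwards [eventually_gt_atTop (0 : ℝ)] with T hT
    refine h _ ?_
    simp
    exact hT.ne'
  intro h0
  rw [h0] at h1
  simp at h1
  linarith

end Model

/-! ### Unitary groups -/

section UnitaryGroup

variable {H : Type*} [NormedAddCommGroup H] [InnerProductSpace ℂ H] {h : H →ₗ.[ℂ] H}
  {U : ℝ → H →L[ℂ] H}

theorem IsUnitaryGroupOf.inner_map_map (hU : IsUnitaryGroupOf h U) (t : ℝ) (x y : H) :
    inner ℂ (U t x) (U t y) = inner ℂ x y :=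
  LinearIsometry.inner_map_map ⟨(U t : H →ₗ[ℂ] H), hU.norm_map t⟩ x y

theorem IsUnitaryGroupOf.inner_apply (hU : IsUnitaryGroupOf h U) (t : ℝ) (x y : H) :
    inner ℂ x (U t y) = inner ℂ (U (-t) x) y := by
  rw [← hU.inner_map_map (-t) x]
  congr 1
  have h1 := hU.add (-t) t
  rw [neg_add_cancel, hU.zero] at h1
  exact (congrArg (fun S : H →L[ℂ] H => S y) h1).symm

theorem IsUnitaryGroupOf.hasDerivAt_apply (hU : IsUnitaryGroupOf h U) (x : h.domain) (t : ℝ) :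
    HasDerivAt (fun s => U s (x : H)) (U t (Complex.I • h x)) t := by
  have h1 : HasDerivAt (fun s => U (s - t) (x : H)) (Complex.I • h x) t := by
    have h2 := hU.hasDerivAt x
    rw [← sub_self t] at h2
    exact HasDerivAt.comp_sub_const t t h2
  have h2 := ((U t).hasFDerivAt.restrictScalars ℝ).comp_hasDerivAt t h1
  refine h2.congr_of_eventuallyEq (Eventually.of_forall fun s => ?_)
  have h3 := hU.add t (s - t)
  rw [add_sub_cancel] at h3
  exact congrArg (fun S : H →L[ℂ] H => S (x : H)) h3

/-- Moving the group onto x in the domain gives weak differentiability of the orbit of every y, in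
the domain or not. -/
theorem IsUnitaryGroupOf.hasDerivAt_inner (hU : IsUnitaryGroupOf h U) (x : h.domain) (y : H)
    (t : ℝ) :
    HasDerivAt (fun t => inner ℂ (x : H) (U t y)) (Complex.I * inner ℂ (h x) (U t y)) t := by
  simp only [hU.inner_apply]
  have h1 : HasDerivAt (fun s => U (-s) (x : H)) (-(U (-t) (Complex.I • h x))) t := by
    have h2 := (hU.hasDerivAt_apply x (-t)).scomp t (hasDerivAt_neg t)
    rw [neg_one_smul] at h2
    exact h2
  have h3 := h1.inner ℂ (hasDerivAt_const t y)
  have h4 : inner ℂ (U (-t) (x : H)) (0 : H) + inner ℂ (-(U (-t) (Complex.I • h x))) y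
      = Complex.I * inner ℂ (U (-t) (h x)) y := by
    rw [inner_zero_right, zero_add, map_smul, inner_neg_left, inner_smul_left, Complex.conj_I]
    ring
  rw [h4] at h3
  exact h3

theorem IsUnitaryGroupOf.norm_inner_le (hU : IsUnitaryGroupOf h U) (x y : H) (t : ℝ) :
    ‖inner ℂ x (U t y)‖ ≤ ‖x‖ * ‖y‖ := by
  rw [← hU.norm_map t y]
  exact norm_inner_le_norm _ _

theorem IsUnitaryGroupOf.continuous_inner (hU : IsUnitaryGroupOf h U) (x y : H) :
    Continuous fun t => inner ℂ x (U t y) :=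
  continuous_const.inner (hU.continuous y)

/-- The Laplace transform of the group is the resolvent. -/
theorem IsUnitaryGroupOf.lap_inner (hU : IsUnitaryGroupOf h U) (x : h.domain) (y : H) {z : ℂ}
    (hz : z.im < 0) :
    lap (fun t => inner ℂ (conj z • (x : H) - h x) (U t y)) z
      = -Complex.I * inner ℂ (x : H) y := by
  have hexp : ∀ s : ℝ, HasDerivAt (fun s : ℝ => Complex.exp (-(Complex.I * s * z)))
      (Complex.exp (-(Complex.I * s * z)) * (-(Complex.I * z))) s := by
    intro s
    have h1 : HasDerivAt (fun s : ℝ => -(Complex.I * (s : ℂ) * z)) (-(Complex.I * z)) s := by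
      have := ((Complex.ofRealCLM.hasDerivAt (x := s)).const_mul Complex.I).mul_const z
      have h2 := this.neg
      simp only [Complex.ofRealCLM_apply, Complex.ofReal_one, mul_one] at h2
      exact h2
    exact h1.cexp
  have hder : ∀ s : ℝ, HasDerivAt
      (fun s : ℝ => inner ℂ (x : H) (U s y) * Complex.exp (-(Complex.I * s * z)))
      (-Complex.I * (inner ℂ (conj z • (x : H) - h x) (U s y)
        * Complex.exp (-(Complex.I * s * z)))) s := by
    intro s
    have h1 := (hU.hasDerivAt_inner x y s).mul (hexp s)
    convert! h1 using 1
    rw [inner_sub_left, inner_smul_left, Complex.conj_conj]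
    ring
  have hintegrable := integrableOn_lap (hU.continuous_inner (conj z • (x : H) - h x) y)
    (fun s => hU.norm_inner_le _ _ s) hz
  have hlim : Tendsto (fun s : ℝ => inner ℂ (x : H) (U s y) * Complex.exp (-(Complex.I * s * z)))
      atTop (𝓝 0) := by
    rw [tendsto_zero_iff_norm_tendsto_zero]
    refine squeeze_zero (fun s => norm_nonneg _)
      (g := fun s => (‖(x : H)‖ * ‖y‖) * Real.exp (s * z.im)) (fun s => ?_) ?_
    · rw [norm_mul, norm_exp_neg_I_mul]
      gcongr
      exact hU.norm_inner_le _ _ s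
    · have h1 : Tendsto (fun s : ℝ => s * z.im) atTop atBot :=
        tendsto_id.atTop_mul_const_of_neg hz
      simpa using (Real.tendsto_exp_atBot.comp h1).const_mul (‖(x : H)‖ * ‖y‖)
  have hmain := integral_Ioi_of_hasDerivAt_of_tendsto' (a := 0) (fun s _ => hder s)
    (hintegrable.const_mul _) hlim
  rw [integral_const_mul] at hmain
  simp only [Complex.ofReal_zero, mul_zero, zero_mul, neg_zero, Complex.exp_zero, mul_one, hU.zero,
    ContinuousLinearMap.id_apply, zero_sub] at hmain
  have h2 : -Complex.I * lap (fun t => inner ℂ (conj z • (x : H) - h x) (U t y)) z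
      = -inner ℂ (x : H) y := hmain
  have h3 : Complex.I * Complex.I = -1 := Complex.I_mul_I
  linear_combination Complex.I * h2
    + lap (fun t => inner ℂ (conj z • (x : H) - h x) (U t y)) z * h3

end UnitaryGroup

/-! ### The components of the coupled evolution -/

namespace Model

variable {N : ℕ} (M : Model N)

theorem inner_eq (f f' : M.Space) : inner ℂ f f'
    = conj (M.fst f) * M.fst f' + ∑ k, inner ℂ (M.comp f k) (M.comp f' k) := by
  rw [WithLp.prod_inner_apply, PiLp.inner_apply, RCLike.inner_apply, mul_comm]
  rfl

theorem fst_vec (c : ℂ) (ψ : (k : Fin N) → (M.res k).Space) : M.fst (M.vec c ψ) = c := rfl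

theorem comp_vec (c : ℂ) (ψ : (k : Fin N) → (M.res k).Space) (k : Fin N) :
    M.comp (M.vec c ψ) k = ψ k := rfl

theorem fst_eq_inner (f : M.Space) : M.fst f = inner ℂ (M.atom 1) f := by
  rw [inner_eq, atom, fst_vec, map_one, one_mul]
  simp [comp_vec]

theorem ham_apply (f : M.ham.domain) : M.ham f = M.vec
    (M.Ω * M.fst f + M.coupling * ∑ k, inner ℂ (M.g k) (M.comp f k))
    (fun k => (M.res k).ham ⟨M.comp f k, f.2 k⟩ + ((M.coupling : ℂ) * M.fst f) • M.g k) := rfl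

theorem inner_single (k : Fin N) (x : (M.res k).Space) (f : M.Space) :
    inner ℂ (M.single k x) f = inner ℂ x (M.comp f k) := by
  rw [inner_eq, single, fst_vec, map_zero, zero_mul, zero_add, Finset.sum_eq_single k]
  · rw [comp_vec, Pi.single_eq_same]
  · intro j _ hj
    rw [comp_vec, Pi.single_eq_of_ne hj, inner_zero_left]
  · simp

theorem single_mem_domain (k : Fin N) (x : (M.res k).ham.domain) :
    M.single k (x : (M.res k).Space) ∈ M.ham.domain := by
  intro j
  rw [single, comp_vec]
  by_cases hj : j = k
  · subst hj
    rw [Pi.single_eq_same]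
    exact x.2
  · rw [Pi.single_eq_of_ne hj]
    exact (M.res j).ham.domain.zero_mem

theorem inner_ham_single (k : Fin N) (x : (M.res k).ham.domain) (f : M.Space) :
    inner ℂ (M.ham ⟨M.single k (x : (M.res k).Space), M.single_mem_domain k x⟩) f
      = inner ℂ ((M.res k).ham x) (M.comp f k)
        + M.coupling * M.fst f * inner ℂ (x : (M.res k).Space) (M.g k) := by
  rw [ham_apply, inner_eq, fst_vec]
  simp only [comp_vec]
  have h1 : M.fst (M.single k (x : (M.res k).Space)) = 0 := rfl
  have h2 : ∀ j, j ≠ k → M.comp (M.single k (x : (M.res k).Space)) j = 0 := by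
    intro j hj
    rw [single, comp_vec, Pi.single_eq_of_ne hj]
  have h3 : M.comp (M.single k (x : (M.res k).Space)) k = x := by
    rw [single, comp_vec, Pi.single_eq_same]
  simp only [h1, mul_zero, zero_smul, add_zero, zero_add]
  rw [Finset.sum_eq_single k (fun j _ hj => by rw [h2 j hj, inner_zero_right]) (by simp), h3,
    Finset.sum_eq_single k]
  · have h4 : (⟨M.comp (M.single k (x : (M.res k).Space)) k, M.single_mem_domain k x k⟩ :
        (M.res k).ham.domain) = x := Subtype.ext h3
    rw [h4, map_mul, Complex.conj_ofReal, inner_conj_symm]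
    ring
  · intro j _ hj
    have h4 : (⟨M.comp (M.single k (x : (M.res k).Space)) j, M.single_mem_domain k x j⟩ :
        (M.res j).ham.domain) = 0 := Subtype.ext (h2 j hj)
    rw [h4, LinearPMap.map_zero, inner_zero_left]
  · simp

variable {M} {U : ℝ → M.Space →L[ℂ] M.Space}

theorem continuous_fst (hU : IsUnitaryGroupOf M.ham U) (f : M.Space) :
    Continuous fun t => M.fst (U t f) := by
  simp only [fst_eq_inner]
  exact hU.continuous_inner _ f

theorem exists_norm_fst_le (hU : IsUnitaryGroupOf M.ham U) (f : M.Space) :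
    ∃ B, ∀ t, ‖M.fst (U t f)‖ ≤ B := by
  simp only [fst_eq_inner]
  exact ⟨_, fun t => hU.norm_inner_le _ f t⟩

/-- Pairing the evolution with vectors supported in one reservoir isolates that component; the
particle amplitude appears as its source. -/
theorem isWeakSolution_comp (hU : IsUnitaryGroupOf M.ham U) (f : M.Space) (k : Fin N) :
    IsWeakSolution (M.res k).ham (fun t => (M.coupling : ℂ) * M.fst (U t f)) (M.g k)
      fun t => M.comp (U t f) k := by
  refine ⟨?_, fun x t => ?_⟩
  · have h1 : Continuous fun f : M.Space => M.comp f k := by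
      unfold comp
      fun_prop
    exact h1.comp (hU.continuous f)
  · have h1 := hU.hasDerivAt_inner ⟨M.single k (x : (M.res k).Space), M.single_mem_domain k x⟩ f t
    rw [inner_ham_single] at h1
    simp only [inner_single] at h1
    convert! h1 using 1
    ring

end Model

theorem IsBoundaryValue.congr_ae {c u w : ℝ → ℂ} (hu : IsBoundaryValue c u) (hw : Measurable w)
    (h : ∀ᵐ ν, u ν = w ν) : IsBoundaryValue c w := by
  refine ⟨hw.stronglyMeasurable, hu.memLp, fun a ha ha2 => ?_⟩
  rw [← hu.plancherel a ha ha2]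
  refine lintegral_congr_ae ?_
  filter_upwards [h] with ν hν
  rw [hν]

theorem enorm_lap_correlation (ρ : Measure ℝ) [IsFiniteMeasure ρ] {z : ℂ} (hz : z.im < 0) :
    ‖lap (correlation ρ) z‖ₑ = ‖stieltjes ρ z‖ₑ := by
  rw [lap_correlation ρ hz, ← ofReal_norm, ← ofReal_norm, norm_mul, norm_neg, Complex.norm_I,
    one_mul]

theorem sub_ofReal_mul_I_im (ν ε : ℝ) : ((ν : ℂ) - ε * Complex.I).im = -ε := by simp

/-- The Laplace transform of the correlation function is -i times the Stieltjes transform, so the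
boundary value sought is i times that of the former. -/
theorem exists_boundary_stieltjes (ρ : Measure ℝ) [IsFiniteMeasure ρ] {C : ℝ}
    (hC : ∀ z : ℂ, z.im < 0 → ‖stieltjes ρ z‖ ≤ C) :
    ∃ G : ℝ → ℂ, Measurable G ∧ Tendsto (fun ε : ℝ => ∫⁻ ν : ℝ,
      ‖stieltjes ρ (ν - ε * Complex.I) - G ν‖ₑ ^ 2) (𝓝[>] 0) (𝓝 0) := by
  obtain ⟨u, hu⟩ := exists_isBoundaryValue (continuous_correlation ρ) (norm_correlation_le ρ)
    ENNReal.ofReal_ne_top fun ε hε => lintegral_lap_correlation_le ρ hC hε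
  refine ⟨fun ν => Complex.I * u ν, hu.stronglyMeasurable.measurable.const_mul _, ?_⟩
  refine (hu.tendsto_lap (continuous_correlation ρ) (norm_correlation_le ρ)).congr' ?_
  filter_upwards [self_mem_nhdsWithin] with ε (hε : 0 < ε)
  refine lintegral_congr fun ν => ?_
  rw [lap_correlation ρ (by rw [sub_ofReal_mul_I_im]; linarith)]
  have : -Complex.I * stieltjes ρ (ν - ε * Complex.I) - u ν
      = -Complex.I * (stieltjes ρ (ν - ε * Complex.I) - Complex.I * u ν) := by
    linear_combination (-u ν) * Complex.I_mul_I
  rw [this, ← ofReal_norm, ← ofReal_norm, norm_mul, norm_neg, Complex.norm_I, one_mul]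

/-! ### The Laplace transform of the particle amplitude -/

namespace Model

variable {N : ℕ}

/-- The parameters `(c, a, b)` of the vectors `(c, (a_k g_k + b_k h_{0,k} g_k)_k)`. -/
abbrev Param (N : ℕ) : Type := ℂ × (Fin N → ℂ) × (Fin N → ℂ)

variable (M : Model N)

/-- The vector `(c, (a_k g_k + b_k h_{0,k} g_k)_k)`. -/
def testVec : Param N →ₗ[ℂ] M.Space where
  toFun p := M.vec p.1 fun k => p.2.1 k • M.g k + p.2.2 k • (M.res k).ham ⟨M.g k, M.g_mem k⟩
  map_add' p q := by
    change _ = M.vec (p.1 + q.1) _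
    congr 1
    funext k
    simp only [Prod.snd_add, Prod.fst_add, Pi.add_apply, add_smul]
    change _ = (p.2.1 k • M.g k + p.2.2 k • (M.res k).ham ⟨M.g k, M.g_mem k⟩)
      + (q.2.1 k • M.g k + q.2.2 k • (M.res k).ham ⟨M.g k, M.g_mem k⟩)
    abel
  map_smul' c p := by
    change _ = M.vec (c * p.1) _
    congr 1
    funext k
    simp only [Prod.smul_snd, Prod.smul_fst, Pi.smul_apply, smul_eq_mul, mul_smul]
    change _ = c • (p.2.1 k • M.g k + p.2.2 k • (M.res k).ham ⟨M.g k, M.g_mem k⟩)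
    rw [smul_add]

theorem testVec_mem_testSpace (hD : M.CondD) (p : Param N) : M.testVec p ∈ M.testSpace := by
  intro k
  refine ⟨(M.res k).comb_mem_weightDomain (M.g_mem k) (hD k).1 _ _, ?_⟩
  have h1 := bose_comb (M.bose_form hD k) (M.β_pos k) ((M.res k).integrable_sq (M.g_mem k))
    (p.2.1 k) (p.2.2 k)
  have h2 := (M.res k).specMeasure_comb (M.g_mem k) (p.2.1 k) (p.2.2 k)
  change ∫⁻ ν, (ENNReal.ofReal (Real.exp (M.β k * ν) - 1))⁻¹ ∂((M.res k).specMeasure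
    (p.2.1 k • M.g k + p.2.2 k • (M.res k).ham ⟨M.g k, M.g_mem k⟩)) < ∞
  rw [h2]
  exact h1

/-- The numerator of the Laplace transform of the amplitude of the particle, as a function of the
values `G_k` of the Stieltjes transforms at `z`. -/
def amp (p : Param N) (z : ℂ) (G : Fin N → ℂ) : ℂ :=
  p.1 + M.coupling * ∑ j, (p.2.1 j * G j + p.2.2 j * (z * G j - (‖M.g j‖ : ℂ) ^ 2))

/-- The amplitude is ⟨(1), U(t)f⟩, so its Laplace transform is -i⟨φ, f⟩ with φ the resolvent of h at
z̄ applied to (1). Eliminating the reservoirs (a Schur complement) gives φ explicitly: 1/η(z̄) in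
the first entry, λ/η(z̄) times (z̄ - h_{0,k})⁻¹ g_k in the k-th reservoir. -/
theorem lap_fst {U : ℝ → M.Space →L[ℂ] M.Space} (hU : IsUnitaryGroupOf M.ham U) (p : Param N)
    {z : ℂ} (hz : z.im < 0) :
    lap (fun t => M.fst (U t (M.testVec p))) z
      = -Complex.I * (M.amp p z (fun j => stieltjes (M.formMeasure j) z) / M.eta z) := by
  have hz' : (conj z).im ≠ 0 := by simpa using hz.ne
  choose x hx hG using fun k => (M.res k).resolvent (M.g k) hz'
  have hη : M.eta (conj z) ≠ 0 := by
    intro h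
    have h1 := M.le_eta_im (z := conj z) (by simpa using hz)
    rw [h] at h1
    simp at h1
    linarith
  set α : ℂ := (M.eta (conj z))⁻¹ with hα
  set φ : M.Space := M.vec α fun k => (α * M.coupling) • (x k : (M.res k).Space) with hφ
  have hφd : φ ∈ M.ham.domain := fun k => (M.res k).ham.domain.smul_mem _ (x k).2
  have hres : conj z • φ - M.ham ⟨φ, hφd⟩ = M.atom 1 := by
    rw [ham_apply]
    have e1 : conj z * α - (M.Ω * α + M.coupling
        * ∑ k, inner ℂ (M.g k) ((α * M.coupling) • (x k : (M.res k).Space))) = 1 := by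
      have e2 : ∀ k, inner ℂ (M.g k) ((α * M.coupling) • (x k : (M.res k).Space))
          = (α * M.coupling) * stieltjes (M.formMeasure k) (conj z) := by
        intro k
        rw [inner_smul_right, hG k]
        rfl
      simp only [e2]
      rw [← Finset.mul_sum]
      have e3 : α * M.eta (conj z) = 1 := inv_mul_cancel₀ hη
      rw [eta_eq] at e3
      linear_combination e3
    have e4 : (fun k => conj z • ((α * M.coupling) • (x k : (M.res k).Space))
        - ((M.res k).ham ⟨(α * M.coupling) • (x k : (M.res k).Space), hφd k⟩
          + ((M.coupling : ℂ) * α) • M.g k)) = fun _ => 0 := by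
      funext k
      have e5 : (M.res k).ham ⟨(α * M.coupling) • (x k : (M.res k).Space), hφd k⟩
          = (α * M.coupling) • (M.res k).ham (x k) := (M.res k).ham.map_smul _ (x k)
      rw [e5, ← hx k, smul_sub, smul_comm (conj z), mul_comm (M.coupling : ℂ)]
      abel
    change M.vec (conj z * α - (M.Ω * α + M.coupling
        * ∑ k, inner ℂ (M.g k) ((α * M.coupling) • (x k : (M.res k).Space))))
      (fun k => conj z • ((α * M.coupling) • (x k : (M.res k).Space))
        - ((M.res k).ham ⟨(α * M.coupling) • (x k : (M.res k).Space), hφd k⟩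
          + ((M.coupling : ℂ) * α) • M.g k)) = M.vec 1 0
    rw [e1, e4]
    rfl
  have h1 := hU.lap_inner ⟨φ, hφd⟩ (M.testVec p) hz
  simp only [hres, ← fst_eq_inner] at h1
  rw [h1]
  congr 1
  rw [inner_eq]
  have hαc : conj α = (M.eta z)⁻¹ := by
    rw [hα, map_inv₀, ← eta_conj, Complex.conj_conj]
  have hin : ∀ k, inner ℂ (M.comp φ k) (M.comp (M.testVec p) k)
      = (M.eta z)⁻¹ * M.coupling * (p.2.1 k * stieltjes (M.formMeasure k) z
        + p.2.2 k * (z * stieltjes (M.formMeasure k) z - (‖M.g k‖ : ℂ) ^ 2)) := by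
    intro k
    have e1 : inner ℂ (x k : (M.res k).Space) (M.g k) = stieltjes (M.formMeasure k) z := by
      rw [← inner_conj_symm, hG k, ← stieltjes_conj, Complex.conj_conj]
      rfl
    have e2 : inner ℂ (x k : (M.res k).Space) ((M.res k).ham ⟨M.g k, M.g_mem k⟩)
        = z * stieltjes (M.formMeasure k) z - (‖M.g k‖ : ℂ) ^ 2 := by
      -- With h on the resolvent vector, h x = z̄x - g; this is the origin of the constant ‖g‖² in
      -- `amp`.
      rw [← (M.res k).ham_symmetric]
      have e3 : (M.res k).ham (x k) = conj z • (x k : (M.res k).Space) - M.g k := by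
        rw [← hx k]
        abel
      rw [e3, inner_sub_left, inner_smul_left, Complex.conj_conj, e1, inner_self_eq_norm_sq_to_K]
      rfl
    change inner ℂ ((α * M.coupling) • (x k : (M.res k).Space))
      (p.2.1 k • M.g k + p.2.2 k • (M.res k).ham ⟨M.g k, M.g_mem k⟩) = _
    rw [inner_smul_left, inner_add_right, inner_smul_right, inner_smul_right, e1, e2, map_mul, hαc,
      Complex.conj_ofReal]
  simp only [hin]
  rw [← Finset.mul_sum, amp]
  change conj α * p.1 + _ = _
  rw [hαc, div_eq_mul_inv]
  ring

/-- Separates a constant from a term of size (1 + |z|) times Stieltjes transforms. After division by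
η the first decays like 1/(1 + |z|) and the second is controlled by the Stieltjes transforms alone;
both are square integrable along horizontal lines. -/
theorem norm_amp_le (p : Param N) (z : ℂ) (G : Fin N → ℂ) :
    ‖M.amp p z G‖ ≤ (‖p.1‖ + M.coupling * ∑ j, ‖p.2.2 j‖ * ‖M.g j‖ ^ 2)
      + (1 + ‖z‖) * (M.coupling * ∑ j, (‖p.2.1 j‖ + ‖p.2.2 j‖) * ‖G j‖) := by
  have hl := M.coupling_pos
  have h1 : ‖∑ j, (p.2.1 j * G j + p.2.2 j * (z * G j - (‖M.g j‖ : ℂ) ^ 2))‖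
      ≤ ∑ j, (‖p.2.2 j‖ * ‖M.g j‖ ^ 2 + (1 + ‖z‖) * ((‖p.2.1 j‖ + ‖p.2.2 j‖) * ‖G j‖)) := by
    refine (norm_sum_le _ _).trans (Finset.sum_le_sum fun j _ => ?_)
    have e1 : ‖z * G j - (‖M.g j‖ : ℂ) ^ 2‖ ≤ ‖z‖ * ‖G j‖ + ‖M.g j‖ ^ 2 := by
      refine (norm_sub_le _ _).trans (le_of_eq ?_)
      rw [norm_mul, norm_pow, Complex.norm_real, norm_norm]
    calc ‖p.2.1 j * G j + p.2.2 j * (z * G j - (‖M.g j‖ : ℂ) ^ 2)‖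
        ≤ ‖p.2.1 j‖ * ‖G j‖ + ‖p.2.2 j‖ * (‖z‖ * ‖G j‖ + ‖M.g j‖ ^ 2) := by
          refine (norm_add_le _ _).trans ?_
          rw [norm_mul, norm_mul]
          gcongr
      _ ≤ _ := by
          have := mul_nonneg (mul_nonneg (norm_nonneg z) (norm_nonneg (p.2.1 j)))
            (norm_nonneg (G j))
          have := mul_nonneg (norm_nonneg (p.2.2 j)) (norm_nonneg (G j))
          nlinarith
  have h2 : ∑ j, (‖p.2.2 j‖ * ‖M.g j‖ ^ 2 + (1 + ‖z‖) * ((‖p.2.1 j‖ + ‖p.2.2 j‖) * ‖G j‖))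
      = ∑ j, ‖p.2.2 j‖ * ‖M.g j‖ ^ 2
        + (1 + ‖z‖) * ∑ j, (‖p.2.1 j‖ + ‖p.2.2 j‖) * ‖G j‖ := by
    rw [Finset.sum_add_distrib, ← Finset.mul_sum]
  rw [h2] at h1
  calc ‖M.amp p z G‖ ≤ ‖p.1‖ + M.coupling
        * ‖∑ j, (p.2.1 j * G j + p.2.2 j * (z * G j - (‖M.g j‖ : ℂ) ^ 2))‖ := by
        refine (norm_add_le _ _).trans ?_
        rw [norm_mul, Complex.norm_real, Real.norm_of_nonneg hl.le]
    _ ≤ ‖p.1‖ + M.coupling * (∑ j, ‖p.2.2 j‖ * ‖M.g j‖ ^ 2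
        + (1 + ‖z‖) * ∑ j, (‖p.2.1 j‖ + ‖p.2.2 j‖) * ‖G j‖) := by gcongr
    _ = _ := by ring

end Model

theorem tendsto_sub_mul_I (ν : ℝ) {e : ℕ → ℝ} (he : Tendsto e atTop (𝓝[>] 0)) :
    Tendsto (fun n => (ν : ℂ) - e n * Complex.I) atTop (𝓝 ν) := by
  have hc : Continuous fun ε : ℝ => (ν : ℂ) - ε * Complex.I := by fun_prop
  have h1 := hc.tendsto 0
  simp only [Complex.ofReal_zero, zero_mul, sub_zero] at h1
  exact h1.comp (he.mono_right nhdsWithin_le_nhds)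

/-! ### Boundary values on the real axis -/

namespace Model

variable {N : ℕ} (M : Model N)

/-- `ν - Ω - λ² ∑ G_k(ν)`. -/
def boundaryEta (G : Fin N → ℝ → ℂ) (ν : ℝ) : ℂ :=
  ν - M.Ω - (M.coupling : ℂ) ^ 2 * ∑ k, G k ν

/-- The `G_k` are the boundary values, from below, of the Stieltjes transforms of the form
measures. -/
structure IsFormBoundary (G : Fin N → ℝ → ℂ) : Prop where
  measurable : ∀ k, Measurable (G k)
  tendsto : ∀ k, Tendsto (fun ε : ℝ => ∫⁻ ν : ℝ,
    ‖stieltjes (M.formMeasure k) (ν - ε * Complex.I) - G k ν‖ₑ ^ 2) (𝓝[>] 0) (𝓝 0)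
  formMeasure_eq : ∀ k, M.formMeasure k
    = volume.withDensity fun ν => ENNReal.ofReal ((G k ν).im / Real.pi)
  im_nonneg : ∀ᵐ ν : ℝ, ∀ k, 0 ≤ (G k ν).im
  norm_le : ∃ C : ℝ, ∀ᵐ ν : ℝ, ∀ k, ‖G k ν‖ ≤ C
  le_norm_eta : ∃ c : ℝ, 0 < c ∧ ∀ᵐ ν : ℝ, c * (1 + |ν|) ≤ ‖M.boundaryEta G ν‖

/-- The L² boundary values come from Plancherel. Along one sequence of heights they are also limits
almost everywhere for all k together; this feeds Stieltjes inversion and identifies `boundaryEta`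
with η₋, which inherits the lower bound. -/
theorem exists_isFormBoundary (hA : M.CondA) (hB : M.CondB) : ∃ G, M.IsFormBoundary G := by
  obtain ⟨C, hC, hCG⟩ := M.exists_norm_stieltjes_le hA
  obtain ⟨c, hc, hcη⟩ := M.exists_mul_le_norm_eta hA hB
  have hCG' : ∀ k, ∀ z : ℂ, z.im < 0 → ‖stieltjes (M.formMeasure k) z‖ ≤ C :=
    fun k z hz => hCG k z hz.ne
  choose G hGm hG using fun k => exists_boundary_stieltjes (M.formMeasure k) (hCG' k)
  have hmeas : ∀ k, ∀ᶠ ε : ℝ in 𝓝[>] (0 : ℝ),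
      Measurable fun ν : ℝ => stieltjes (M.formMeasure k) (ν - ε * Complex.I) := by
    intro k
    filter_upwards [self_mem_nhdsWithin] with ε hε
    exact (measurable_stieltjes_line _ (ne_of_gt hε)).measurable
  obtain ⟨e, he, hlim⟩ := exists_seq_tendsto_ae_of_lintegral hmeas hGm hG
  have hden := fun k => eq_withDensity_of_stieltjes (M.formMeasure k)
    (hCG' k) (hGm k) he (hlim.mono fun ν h => h k)
  have heta : ∀ᵐ ν : ℝ, M.etaMinus ν = M.boundaryEta G ν := by
    filter_upwards [hlim, M.ae_tendsto_etaMinus hB] with ν h1 h2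
    refine tendsto_nhds_unique (h2.comp he) ?_
    have h3 := tendsto_sub_mul_I ν he
    exact (h3.sub_const _).sub ((tendsto_finsetSum Finset.univ fun k _ => h1 k).const_mul _)
  refine ⟨G, hGm, hG, fun k => (hden k).2, ae_all_iff.2 fun k => (hden k).1.mono fun ν h => h.2,
    ⟨C, ae_all_iff.2 fun k => (hden k).1.mono fun ν h => h.1⟩, c, hc, ?_⟩
  filter_upwards [heta, M.ae_tendsto_etaMinus hB] with ν h1 h2
  rw [← h1]
  exact M.le_norm_etaMinus hcη h2

/-- The boundary value of the Laplace transform of the amplitude of the particle. -/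
def boundaryAmp (G : Fin N → ℝ → ℂ) (p : Param N) (ν : ℝ) : ℂ :=
  -Complex.I * (M.amp p ν (fun j => G j ν) / M.boundaryEta G ν)

variable {M}

theorem IsFormBoundary.measurable_boundaryEta {G : Fin N → ℝ → ℂ} (hG : M.IsFormBoundary G) :
    Measurable (M.boundaryEta G) := by
  unfold boundaryEta
  have h1 : Measurable fun ν => ∑ k, G k ν := Finset.measurable_fun_sum _ fun k _ => hG.measurable k
  fun_prop

theorem IsFormBoundary.measurable_boundaryAmp {G : Fin N → ℝ → ℂ} (hG : M.IsFormBoundary G)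
    (p : Param N) : Measurable (M.boundaryAmp G p) := by
  have h1 : Measurable fun ν : ℝ => M.amp p ν (fun j => G j ν) := by
    unfold amp
    have h2 : Measurable fun ν : ℝ =>
        ∑ j, (p.2.1 j * G j ν + p.2.2 j * ((ν : ℂ) * G j ν - (‖M.g j‖ : ℂ) ^ 2)) := by
      refine Finset.measurable_fun_sum _ fun k _ => ?_
      have := hG.measurable k
      fun_prop
    fun_prop
  exact (h1.div hG.measurable_boundaryEta).const_mul _

/-- A bound on the Laplace transform of the amplitude of the particle. -/
theorem exists_norm_lap_fst_le (hA : M.CondA) (hB : M.CondB) {U : ℝ → M.Space →L[ℂ] M.Space}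
    (hU : IsUnitaryGroupOf M.ham U) (p : Param N) :
    ∃ (D : ℝ) (E : Fin N → ℝ), 0 ≤ D ∧ (∀ j, 0 ≤ E j) ∧ ∀ z : ℂ, z.im < 0 →
      ‖lap (fun t => M.fst (U t (M.testVec p))) z‖
        ≤ D / (1 + ‖z‖) + ∑ j, E j * ‖stieltjes (M.formMeasure j) z‖ := by
  obtain ⟨c, hc, hcη⟩ := M.exists_mul_le_norm_eta hA hB
  have hl := M.coupling_pos
  refine ⟨(‖p.1‖ + M.coupling * ∑ j, ‖p.2.2 j‖ * ‖M.g j‖ ^ 2) / c,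
    fun j => M.coupling * (‖p.2.1 j‖ + ‖p.2.2 j‖) / c, by positivity, fun j => by positivity,
    fun z hz => ?_⟩
  rw [M.lap_fst hU p hz, norm_mul, norm_neg, Complex.norm_I, one_mul, norm_div]
  have h1 := M.norm_amp_le p z fun j => stieltjes (M.formMeasure j) z
  have h2 := hcη z hz.ne
  have hpos : 0 < c * (1 + ‖z‖) := by positivity
  calc ‖M.amp p z fun j => stieltjes (M.formMeasure j) z‖ / ‖M.eta z‖
      ≤ ((‖p.1‖ + M.coupling * ∑ j, ‖p.2.2 j‖ * ‖M.g j‖ ^ 2)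
        + (1 + ‖z‖) * (M.coupling * ∑ j, (‖p.2.1 j‖ + ‖p.2.2 j‖)
          * ‖stieltjes (M.formMeasure j) z‖)) / (c * (1 + ‖z‖)) := by gcongr
    _ = _ := by
        rw [add_div, div_div]
        congr 1
        rw [mul_comm c, mul_div_mul_left _ _ (by positivity), Finset.mul_sum, Finset.sum_div]
        refine Finset.sum_congr rfl fun j _ => ?_
        ring

theorem exists_norm_lap_fst_le_const (hA : M.CondA) (hB : M.CondB)
    {U : ℝ → M.Space →L[ℂ] M.Space} (hU : IsUnitaryGroupOf M.ham U) (p : Param N) :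
    ∃ K : ℝ, ∀ z : ℂ, z.im < 0 → ‖lap (fun t => M.fst (U t (M.testVec p))) z‖ ≤ K := by
  obtain ⟨C, hC, hCG⟩ := M.exists_norm_stieltjes_le hA
  obtain ⟨D, E, hD, hE, h⟩ := exists_norm_lap_fst_le hA hB hU p
  refine ⟨D + ∑ j, E j * C, fun z hz => (h z hz).trans ?_⟩
  gcongr with j
  · refine div_le_self hD ?_
    linarith [norm_nonneg z]
  · exact hE j
  · exact hCG j z hz.ne

theorem continuousOn_lap_fst {U : ℝ → M.Space →L[ℂ] M.Space} (hU : IsUnitaryGroupOf M.ham U)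
    (p : Param N) :
    ContinuousOn (lap fun t => M.fst (U t (M.testVec p))) {z | z.im < 0} := by
  have h1 : ContinuousOn (fun z => -Complex.I *
      (M.amp p z (fun j => stieltjes (M.formMeasure j) z) / M.eta z)) {z | z.im < 0} := by
    have hs : ∀ j, ContinuousOn (fun z => stieltjes (M.formMeasure j) z) {z | z.im < 0} :=
      fun j z hz => (differentiableAt_stieltjes _ (ne_of_lt hz)).continuousAt.continuousWithinAt
    refine continuousOn_const.mul (ContinuousOn.div ?_ ?_ ?_)
    · unfold amp
      refine continuousOn_const.add (continuousOn_const.mul (continuousOn_finsetSum _ fun j _ => ?_))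
      exact (continuousOn_const.mul (hs j)).add (continuousOn_const.mul
        ((continuousOn_id.mul (hs j)).sub continuousOn_const))
    · intro z hz
      exact (M.differentiableAt_eta (ne_of_lt hz)).continuousAt.continuousWithinAt
    · intro z (hz : z.im < 0) h
      have := M.eta_im_le hz
      rw [h, Complex.zero_im] at this
      linarith
  exact h1.congr fun z hz => M.lap_fst hU p hz

/-- The decaying part of the pointwise bound is compared with 1/(1 + ν²). The Stieltjes part is
covered by `lintegral_lap_correlation_le`, uniformly in the height. -/
theorem exists_lintegral_lap_fst_le (hA : M.CondA) (hB : M.CondB)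
    {U : ℝ → M.Space →L[ℂ] M.Space} (hU : IsUnitaryGroupOf M.ham U) (p : Param N) :
    ∃ D : ℝ≥0∞, D ≠ ∞ ∧ ∀ ε : ℝ, 0 < ε →
      ∫⁻ ν : ℝ, ‖lap (fun t => M.fst (U t (M.testVec p))) (ν - ε * Complex.I)‖ₑ ^ 2 ≤ D := by
  obtain ⟨C, hC, hCG⟩ := M.exists_norm_stieltjes_le hA
  obtain ⟨D, E, hD, hE, h⟩ := exists_norm_lap_fst_le hA hB hU p
  refine ⟨ENNReal.ofReal (2 * D ^ 2) * (∫⁻ ν : ℝ, ENNReal.ofReal ((1 + ν ^ 2)⁻¹))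
    + ∑ j, ENNReal.ofReal (2 * (N * E j ^ 2))
      * ENNReal.ofReal (2 * Real.pi * (C * (M.formMeasure j).real Set.univ)), ?_, ?_⟩
  · refine ENNReal.add_ne_top.2 ⟨ENNReal.mul_ne_top ENNReal.ofReal_ne_top ?_, ?_⟩
    · exact integrable_inv_one_add_sq.lintegral_lt_top.ne
    · exact ENNReal.sum_ne_top.2 fun j _ =>
        ENNReal.mul_ne_top ENNReal.ofReal_ne_top ENNReal.ofReal_ne_top
  · intro ε hε
    have hz : ∀ ν : ℝ, ((ν : ℂ) - ε * Complex.I).im < 0 := fun ν => by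
      rw [sub_ofReal_mul_I_im]
      linarith
    have hG : ∀ j, ∫⁻ ν : ℝ, ‖stieltjes (M.formMeasure j) (ν - ε * Complex.I)‖ₑ ^ 2
        ≤ ENNReal.ofReal (2 * Real.pi * (C * (M.formMeasure j).real Set.univ)) := by
      intro j
      have h1 := lintegral_lap_correlation_le (M.formMeasure j) (fun z hz => hCG j z hz.ne) hε
      simp only [enorm_lap_correlation _ (hz _)] at h1
      exact h1
    have hGm : ∀ j, Measurable fun ν : ℝ =>
        ‖stieltjes (M.formMeasure j) (ν - ε * Complex.I)‖ₑ ^ 2 := fun j =>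
      (measurable_stieltjes_line (M.formMeasure j) hε.ne').measurable.enorm.pow_const 2
    have hpt : ∀ ν : ℝ, ‖lap (fun t => M.fst (U t (M.testVec p))) (ν - ε * Complex.I)‖ₑ ^ 2
        ≤ ENNReal.ofReal (2 * D ^ 2) * ENNReal.ofReal ((1 + ν ^ 2)⁻¹)
          + ∑ j, ENNReal.ofReal (2 * (N * E j ^ 2))
            * ‖stieltjes (M.formMeasure j) (ν - ε * Complex.I)‖ₑ ^ 2 := by
      intro ν
      set z : ℂ := (ν : ℂ) - ε * Complex.I with hzdef
      have h1 : ‖lap (fun t => M.fst (U t (M.testVec p))) z‖ ^ 2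
          ≤ 2 * D ^ 2 * (1 + ν ^ 2)⁻¹
            + ∑ j, 2 * (N * E j ^ 2) * ‖stieltjes (M.formMeasure j) z‖ ^ 2 := by
        have h2 : ‖lap (fun t => M.fst (U t (M.testVec p))) z‖ ^ 2
            ≤ (D / (1 + ‖z‖) + ∑ j, E j * ‖stieltjes (M.formMeasure j) z‖) ^ 2 := by
          gcongr
          exact h z (hz ν)
        have h3 : (∑ j, E j * ‖stieltjes (M.formMeasure j) z‖) ^ 2
            ≤ N * ∑ j, (E j * ‖stieltjes (M.formMeasure j) z‖) ^ 2 := by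
          have := sq_sum_le_card_mul_sum_sq (s := (Finset.univ : Finset (Fin N)))
            (f := fun j => E j * ‖stieltjes (M.formMeasure j) z‖)
          simpa using this
        have h4 : (D / (1 + ‖z‖)) ^ 2 ≤ D ^ 2 * (1 + ν ^ 2)⁻¹ := by
          rw [div_pow, div_eq_mul_inv]
          have hre : |ν| ≤ ‖z‖ := by
            have := Complex.abs_re_le_norm z
            simpa [hzdef] using this
          have h5 : ν ^ 2 ≤ ‖z‖ ^ 2 := by
            rw [← sq_abs]
            gcongr
          refine mul_le_mul_of_nonneg_left (inv_anti₀ (by positivity) ?_) (sq_nonneg D)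
          nlinarith [norm_nonneg z]
        calc ‖lap (fun t => M.fst (U t (M.testVec p))) z‖ ^ 2 ≤ _ := h2
          _ ≤ 2 * (D / (1 + ‖z‖)) ^ 2
              + 2 * (∑ j, E j * ‖stieltjes (M.formMeasure j) z‖) ^ 2 := by
              nlinarith [sq_nonneg (D / (1 + ‖z‖) - ∑ j, E j * ‖stieltjes (M.formMeasure j) z‖)]
          _ ≤ 2 * (D ^ 2 * (1 + ν ^ 2)⁻¹)
              + 2 * (N * ∑ j, (E j * ‖stieltjes (M.formMeasure j) z‖) ^ 2) := by gcongr
          _ = _ := by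
              rw [Finset.mul_sum, Finset.mul_sum]
              congr 1
              · ring
              · exact Finset.sum_congr rfl fun j _ => by ring
      rw [← ofReal_norm, ← ENNReal.ofReal_pow (norm_nonneg _)]
      refine (ENNReal.ofReal_le_ofReal h1).trans (le_of_eq ?_)
      rw [ENNReal.ofReal_add (by positivity)
        (Finset.sum_nonneg fun j _ => by positivity), ENNReal.ofReal_mul (p := 2 * D ^ 2)
        (by positivity), ENNReal.ofReal_sum_of_nonneg fun j _ => by positivity]
      congr 1
      refine Finset.sum_congr rfl fun j _ => ?_
      rw [ENNReal.ofReal_mul (p := 2 * (N * E j ^ 2)) (by positivity),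
        ENNReal.ofReal_pow (norm_nonneg _), ofReal_norm]
    refine (lintegral_mono hpt).trans ?_
    rw [lintegral_add_left (by fun_prop), lintegral_const_mul _ (by fun_prop),
      lintegral_finsetSum _ fun j _ => (hGm j).const_mul _]
    refine add_le_add le_rfl (Finset.sum_le_sum fun j _ => ?_)
    rw [lintegral_const_mul _ (hGm j)]
    exact mul_le_mul' le_rfl (hG j)

/-- The boundary value produced by Plancherel is abstract. It is identified along a sequence serving
at once the amplitude (index `none`) and every Stieltjes transform (index `some k`), where the
explicit quotient converges almost everywhere. -/
theorem IsFormBoundary.isBoundaryValue_fst {G : Fin N → ℝ → ℂ} (hG : M.IsFormBoundary G)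
    (hA : M.CondA) (hB : M.CondB) {U : ℝ → M.Space →L[ℂ] M.Space}
    (hU : IsUnitaryGroupOf M.ham U) (p : Param N) :
    IsBoundaryValue (fun t => M.fst (U t (M.testVec p))) (M.boundaryAmp G p) := by
  obtain ⟨D, hD, h⟩ := exists_lintegral_lap_fst_le hA hB hU p
  have hcont := continuous_fst hU (M.testVec p)
  obtain ⟨B, hBd⟩ := exists_norm_fst_le hU (M.testVec p)
  obtain ⟨u, hu⟩ := exists_isBoundaryValue hcont hBd hD h
  refine hu.congr_ae (hG.measurable_boundaryAmp p) ?_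
  have hlapm : ∀ ε : ℝ, 0 < ε → Measurable fun ν : ℝ =>
      lap (fun t => M.fst (U t (M.testVec p))) (ν - ε * Complex.I) := by
    intro ε hε
    refine Continuous.measurable ((continuousOn_lap_fst hU p).comp_continuous (by fun_prop) ?_)
    intro ν
    change ((ν : ℂ) - ε * Complex.I).im < 0
    rw [sub_ofReal_mul_I_im]
    linarith
  obtain ⟨e, he, hlim⟩ := exists_seq_tendsto_ae_of_lintegral (ι := Option (Fin N))
    (F := fun i ε ν => i.elim (lap (fun t => M.fst (U t (M.testVec p))) (ν - ε * Complex.I))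
      fun k => stieltjes (M.formMeasure k) (ν - ε * Complex.I))
    (u := fun i ν => i.elim (u ν) fun k => G k ν)
    (by
      rintro (_ | k)
      · filter_upwards [self_mem_nhdsWithin] with ε hε
        exact hlapm ε hε
      · filter_upwards [self_mem_nhdsWithin] with ε hε
        exact (measurable_stieltjes_line _ (ne_of_gt hε)).measurable)
    (by
      rintro (_ | k)
      · exact hu.stronglyMeasurable.measurable
      · exact hG.measurable k)
    (by
      rintro (_ | k)
      · exact hu.tendsto_lap hcont hBd
      · exact hG.tendsto k)
  obtain ⟨c, hc, hcη⟩ := hG.le_norm_eta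
  filter_upwards [hlim, hcη] with ν h1 h2
  have hepos : ∀ᶠ n in atTop, 0 < e n := (tendsto_nhdsWithin_iff.1 he).2
  have hz := tendsto_sub_mul_I ν he
  have hs : ∀ j, Tendsto (fun n => stieltjes (M.formMeasure j) (ν - e n * Complex.I)) atTop
      (𝓝 (G j ν)) := fun j => h1 (some j)
  have hη : Tendsto (fun n => M.eta (ν - e n * Complex.I)) atTop (𝓝 (M.boundaryEta G ν)) :=
    (hz.sub_const _).sub ((tendsto_finsetSum Finset.univ fun k _ => hs k).const_mul _)
  have hη0 : M.boundaryEta G ν ≠ 0 := by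
    intro h0
    rw [h0, norm_zero] at h2
    have : 0 < c * (1 + |ν|) := by positivity
    linarith
  have hamp : Tendsto (fun n => M.amp p (ν - e n * Complex.I)
      (fun j => stieltjes (M.formMeasure j) (ν - e n * Complex.I))) atTop
      (𝓝 (M.amp p ν fun j => G j ν)) :=
    tendsto_const_nhds.add ((tendsto_finsetSum Finset.univ fun j _ =>
      ((hs j).const_mul _).add (((hz.mul (hs j)).sub_const _).const_mul _)).const_mul _)
  refine tendsto_nhds_unique (h1 none) ?_
  refine ((hamp.div hη hη0).const_mul (-Complex.I)).congr' ?_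
  filter_upwards [hepos] with n hn
  exact (M.lap_fst hU p (by rw [sub_ofReal_mul_I_im]; linarith)).symm

theorem IsFormBoundary.exists_norm_boundaryAmp_le {G : Fin N → ℝ → ℂ} (hG : M.IsFormBoundary G)
    (p : Param N) : ∃ K : ℝ, ∀ᵐ ν, ‖M.boundaryAmp G p ν‖ ≤ K := by
  obtain ⟨C, hC⟩ := hG.norm_le
  obtain ⟨c, hc, hcη⟩ := hG.le_norm_eta
  have hl := M.coupling_pos
  set A := ‖p.1‖ + M.coupling * ∑ j, ‖p.2.2 j‖ * ‖M.g j‖ ^ 2 with hAdef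
  set A' := M.coupling * ∑ j, (‖p.2.1 j‖ + ‖p.2.2 j‖) * C with hA'def
  have hA : 0 ≤ A := by positivity
  refine ⟨(A + A') / c, ?_⟩
  filter_upwards [hC, hcη] with ν h1 h2
  rw [boundaryAmp, norm_mul, norm_neg, Complex.norm_I, one_mul, norm_div]
  have h3 := M.norm_amp_le p ν fun j => G j ν
  rw [Complex.norm_real, Real.norm_eq_abs] at h3
  have h4 : M.coupling * ∑ j, (‖p.2.1 j‖ + ‖p.2.2 j‖) * ‖G j ν‖ ≤ A' := by
    rw [hA'def]
    gcongr with j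
    exact h1 j
  have h5 : ‖M.amp p ν fun j => G j ν‖ ≤ (1 + |ν|) * (A + A') := by
    calc _ ≤ A + (1 + |ν|) * (M.coupling * ∑ j, (‖p.2.1 j‖ + ‖p.2.2 j‖) * ‖G j ν‖) := h3
      _ ≤ A + (1 + |ν|) * A' := by gcongr
      _ ≤ _ := by nlinarith [abs_nonneg ν]
  have hpos : 0 < c * (1 + |ν|) := by positivity
  calc ‖M.amp p ν fun j => G j ν‖ / ‖M.boundaryEta G ν‖
      ≤ ((1 + |ν|) * (A + A')) / (c * (1 + |ν|)) := by
        refine div_le_div₀ ((norm_nonneg _).trans h5) h5 hpos h2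
    _ = (A + A') / c := by field_simp

/-- The nontangential limit at `0` of the Laplace transform of the amplitude of the particle. -/
def zeroAmp (M : Model N) (p : Param N) : ℂ :=
  -Complex.I * (M.amp p 0 (fun j => -(M.invMoment j : ℂ)) / M.etaZero)

/-- The limit at the one energy seen by the condensates. All rays are needed because the
Abel-Plancherel estimate averages over y. -/
theorem tendsto_lap_fst_zero (hA : M.CondA) (hB : M.CondB) (hD : M.CondD)
    {U : ℝ → M.Space →L[ℂ] M.Space} (hU : IsUnitaryGroupOf M.ham U) (p : Param N) (y : ℝ) :
    Tendsto (fun T : ℝ => lap (fun t => M.fst (U t (M.testVec p)))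
      (((T⁻¹ : ℝ) : ℂ) * (y - Complex.I))) atTop (𝓝 (M.zeroAmp p)) := by
  have hz := tendsto_inv_mul_atTop (y - Complex.I)
  have hs := fun j => M.tendsto_form_zero hD j y
  have hη := M.tendsto_eta_zero hD y
  have hη0 : (M.etaZero : ℂ) ≠ 0 := by exact_mod_cast M.etaZero_ne_zero hA hB hD
  have hamp : Tendsto (fun T : ℝ => M.amp p (((T⁻¹ : ℝ) : ℂ) * (y - Complex.I))
      (fun j => stieltjes (M.formMeasure j) (((T⁻¹ : ℝ) : ℂ) * (y - Complex.I)))) atTop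
      (𝓝 (M.amp p 0 fun j => -(M.invMoment j : ℂ))) :=
    tendsto_const_nhds.add ((tendsto_finsetSum Finset.univ fun j _ =>
      ((hs j).const_mul _).add (((hz.mul (hs j)).sub_const _).const_mul _)).const_mul _)
  refine ((hamp.div hη hη0).const_mul (-Complex.I)).congr' ?_
  filter_upwards [eventually_gt_atTop (0 : ℝ)] with T hT
  refine (M.lap_fst hU p ?_).symm
  simp
  exact hT

end Model

/-! ### From convergence in quadratic mean to Cesàro limits -/

theorem MeanZero.of_sq {q : ℝ → ℝ≥0∞} (hm : Measurable q) (h : MeanZero fun t => q t ^ 2) :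
    MeanZero q := by
  refine meanZero_of_forall_pos fun δ hδ => ?_
  -- q ≤ q²/δ + δ, according to whether q exceeds δ.
  refine ⟨fun t => δ⁻¹ * q t ^ 2, fun _ => δ, (hm.pow_const 2).const_mul _, fun t _ => ?_,
    h.const_mul (ENNReal.inv_ne_top.2 hδ.ne'), fun T hT => mean_const_le hT δ⟩
  dsimp only
  rcases eq_or_ne δ ∞ with h2 | h2
  · rw [h2, add_top]
    exact le_top
  rcases le_total (q t) δ with h1 | h1
  · exact h1.trans le_add_self
  · refine le_add_right ?_
    calc q t = δ⁻¹ * (δ * q t) := by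
          rw [← mul_assoc, ENNReal.inv_mul_cancel hδ.ne' h2, one_mul]
      _ ≤ δ⁻¹ * (q t * q t) := mul_le_mul' le_rfl (mul_le_mul' h1 le_rfl)
      _ = _ := by rw [sq]

theorem meanZero_of_lintegral_ne_top {q : ℝ → ℝ≥0∞} (h : ∫⁻ t in Set.Ioi 0, q t ≠ ∞) :
    MeanZero q := by
  have h1 : Tendsto (fun T : ℝ => (ENNReal.ofReal T)⁻¹ * ∫⁻ t in Set.Ioi 0, q t) atTop (𝓝 0) := by
    have h2 : Tendsto (fun T : ℝ => (ENNReal.ofReal T)⁻¹) atTop (𝓝 0) := by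
      have := tendsto_inv_iff.2 ENNReal.tendsto_ofReal_atTop
      rwa [ENNReal.inv_top] at this
    have := ENNReal.Tendsto.mul_const (b := ∫⁻ t in Set.Ioi 0, q t) h2 (Or.inr h)
    rwa [zero_mul] at this
  refine tendsto_of_tendsto_of_tendsto_of_le_of_le tendsto_const_nhds h1 (fun _ => zero_le)
    fun T => ?_
  exact mul_le_mul' le_rfl (lintegral_mono_set Set.Ioc_subset_Ioi_self)

/-- Where |c(t)| < r continuity of χ makes the error small; elsewhere the error is at most K ≤
(K/r²)|c(t)|², as in Chebyshev's inequality. The constant K exists because the orbit stays in a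
compact disc. -/
theorem meanZero_comp_sub {χ : ℂ → ℂ} (hχ : Continuous χ) {c : ℝ → ℂ} (hc : Continuous c) {B : ℝ}
    (hB : ∀ t, ‖c t‖ ≤ B) (h : MeanZero fun t => ‖c t‖ₑ ^ 2) :
    MeanZero fun t => ‖χ (c t) - χ 0‖ₑ := by
  obtain ⟨K, hK⟩ : ∃ K, ∀ x ∈ Metric.closedBall (0 : ℂ) B, ‖χ x - χ 0‖ ≤ K :=
    (isCompact_closedBall (0 : ℂ) B).exists_bound_of_continuousOn
      (hχ.sub continuous_const).continuousOn
  refine meanZero_of_forall_pos fun δ hδ => ?_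
  have h1 : Tendsto (fun x => ‖χ x - χ 0‖ₑ) (𝓝 0) (𝓝 0) := by
    have := ((hχ.sub continuous_const).enorm (f := fun x => χ x - χ 0)).tendsto 0
    simpa using this
  obtain ⟨r, hr, hr'⟩ := Metric.eventually_nhds_iff.1 ((ENNReal.tendsto_nhds_zero.1 h1) δ hδ)
  refine ⟨fun t => ENNReal.ofReal (K / r ^ 2) * ‖c t‖ₑ ^ 2, fun _ => δ,
    (hc.measurable.enorm.pow_const 2).const_mul _, fun t _ => ?_,
    h.const_mul ENNReal.ofReal_ne_top, fun T hT => mean_const_le hT δ⟩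
  have hKt : ‖χ (c t) - χ 0‖ ≤ K := hK _ (by simpa using hB t)
  have hK0 : 0 ≤ K := (norm_nonneg _).trans hKt
  by_cases hlt : ‖c t‖ < r
  · exact (hr' (by simpa using hlt)).trans le_add_self
  · refine le_add_right ?_
    dsimp only
    rw [← ofReal_norm, ← ofReal_norm, ← ENNReal.ofReal_pow (norm_nonneg _),
      ← ENNReal.ofReal_mul (by positivity)]
    refine ENNReal.ofReal_le_ofReal (hKt.trans ?_)
    have h2 : r ^ 2 ≤ ‖c t‖ ^ 2 := by
      gcongr
      exact not_lt.1 hlt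
    rw [div_mul_eq_mul_div, le_div_iff₀ (by positivity)]
    gcongr

/-- Young's inequality with a free parameter: δ‖v‖² is a small fixed error, while ‖d - v‖² will tend
to zero in the mean. -/
theorem abs_normSq_sub_le (d v : ℂ) {δ : ℝ} (hδ : 0 < δ) :
    |‖d‖ ^ 2 - ‖v‖ ^ 2| ≤ (1 + δ⁻¹) * ‖d - v‖ ^ 2 + δ * ‖v‖ ^ 2 := by
  set x := ‖d - v‖
  have h1 : |‖d‖ - ‖v‖| ≤ x := abs_norm_sub_norm_le d v
  have h2 : ‖d‖ + ‖v‖ ≤ x + 2 * ‖v‖ := by linarith [(abs_le.1 h1).2]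
  have h3 : |‖d‖ ^ 2 - ‖v‖ ^ 2| ≤ x * (x + 2 * ‖v‖) := by
    rw [sq_sub_sq, mul_comm, abs_mul, abs_of_nonneg (by positivity : 0 ≤ ‖d‖ + ‖v‖)]
    gcongr
  have h4 : 2 * x * ‖v‖ ≤ δ⁻¹ * x ^ 2 + δ * ‖v‖ ^ 2 := by
    have h5 : 0 ≤ δ⁻¹ * (x - δ * ‖v‖) ^ 2 := by positivity
    have h6 : δ⁻¹ * (x - δ * ‖v‖) ^ 2 = δ⁻¹ * x ^ 2 + δ * ‖v‖ ^ 2 - 2 * x * ‖v‖ := by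
      field_simp
      ring
    linarith
  nlinarith

theorem meanZero_integral_normSq_sub {m : Measure ℝ} [IsFiniteMeasure m] {d : ℝ → ℝ → ℂ}
    {v : ℝ → ℂ} (hvm : Measurable v) (hv : MemLp v 2 m) (hd : ∀ t, 0 < t → MemLp (d t) 2 m)
    (hdm : Measurable (Function.uncurry d))
    (h : MeanZero fun t => ∫⁻ ν, ‖d t ν - v ν‖ₑ ^ 2 ∂m) :
    MeanZero fun t => ‖(∫ ν, ‖d t ν‖ ^ 2 ∂m) - ∫ ν, ‖v ν‖ ^ 2 ∂m‖ₑ := by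
  have hdv : Measurable fun p : ℝ × ℝ => ‖d p.1 p.2 - v p.2‖ₑ ^ 2 :=
    ((hdm.sub (hvm.comp measurable_snd)).enorm).pow_const 2
  have hV : ∫⁻ ν, ‖v ν‖ₑ ^ 2 ∂m ≠ ∞ := by
    have h1 := hv.2
    rw [eLpNorm_lt_top_iff_lintegral_rpow_enorm_lt_top (by norm_num) (by norm_num)] at h1
    simpa using h1.ne
  refine meanZero_of_forall_pos fun δ' hδ' => ?_
  obtain ⟨δ, hδ, hδV⟩ : ∃ δ : ℝ, 0 < δ ∧ ENNReal.ofReal δ * (∫⁻ ν, ‖v ν‖ₑ ^ 2 ∂m) ≤ δ' := by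
    have h1 : Tendsto (fun δ : ℝ => ENNReal.ofReal δ * ∫⁻ ν, ‖v ν‖ₑ ^ 2 ∂m) (𝓝[>] 0) (𝓝 0) := by
      have h2 : Tendsto ENNReal.ofReal (𝓝[>] 0) (𝓝 0) := by
        have := (ENNReal.continuous_ofReal.tendsto 0).mono_left
          (nhdsWithin_le_nhds (s := Set.Ioi 0))
        simpa using this
      have := ENNReal.Tendsto.mul_const (b := ∫⁻ ν, ‖v ν‖ₑ ^ 2 ∂m) h2 (Or.inr hV)
      rwa [zero_mul] at this
    have h3 := ((ENNReal.tendsto_nhds_zero.1 h1) δ' hδ').and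
      (self_mem_nhdsWithin : Set.Ioi (0 : ℝ) ∈ 𝓝[>] 0)
    obtain ⟨δ, hδ⟩ := h3.exists
    exact ⟨δ, hδ.2, hδ.1⟩
  refine ⟨fun t => ENNReal.ofReal (1 + δ⁻¹) * ∫⁻ ν, ‖d t ν - v ν‖ₑ ^ 2 ∂m,
    fun _ => ENNReal.ofReal δ * ∫⁻ ν, ‖v ν‖ₑ ^ 2 ∂m, ?_, fun t ht => ?_,
    h.const_mul ENNReal.ofReal_ne_top, fun T hT => (mean_const_le hT _).trans hδV⟩
  · exact (Measurable.lintegral_prod_right' hdv).const_mul _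
  · have hdi := (hd t ht).integrable_norm_pow (by norm_num)
    have hvi := hv.integrable_norm_pow (by norm_num)
    dsimp only at hdi hvi ⊢
    have hm1 : Measurable fun ν => ‖d t ν - v ν‖ₑ ^ 2 :=
      Measurable.of_uncurry_left (f := fun t ν => ‖d t ν - v ν‖ₑ ^ 2) hdv
    have hm2 : Measurable fun ν => ‖v ν‖ₑ ^ 2 := hvm.enorm.pow_const 2
    rw [← integral_sub hdi hvi, ← lintegral_const_mul _ hm1, ← lintegral_const_mul _ hm2,
      ← lintegral_add_left (hm1.const_mul _)]
    refine (enorm_integral_le_lintegral_enorm _).trans (lintegral_mono fun ν => ?_)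
    have h1 := ENNReal.ofReal_le_ofReal (abs_normSq_sub_le (d t ν) (v ν) hδ)
    rw [ENNReal.ofReal_add (by positivity) (by positivity),
      ENNReal.ofReal_mul (p := 1 + δ⁻¹) (by positivity), ENNReal.ofReal_mul hδ.le,
      ENNReal.ofReal_pow (norm_nonneg _), ENNReal.ofReal_pow (norm_nonneg _), ofReal_norm,
      ofReal_norm] at h1
    rw [← ofReal_norm, Real.norm_eq_abs]
    exact h1

theorem tendsto_mean_of_meanZero {Φ : ℝ → ℂ} {L : ℂ}
    (hΦ : ∀ T, IntegrableOn Φ (Set.Ioc 0 T)) (h : MeanZero fun t => ‖Φ t - L‖ₑ) :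
    Tendsto (fun T : ℝ => (T : ℂ)⁻¹ * ∫ t in (0 : ℝ)..T, Φ t) atTop (𝓝 L) := by
  rw [tendsto_iff_edist_tendsto_0]
  refine tendsto_of_tendsto_of_tendsto_of_le_of_le' tendsto_const_nhds h
    (Eventually.of_forall fun _ => zero_le) ?_
  filter_upwards [eventually_gt_atTop (0 : ℝ)] with T hT
  have hT' : (T : ℂ) ≠ 0 := by exact_mod_cast hT.ne'
  have h1 : (T : ℂ)⁻¹ * (∫ t in (0 : ℝ)..T, Φ t) - L
      = (T : ℂ)⁻¹ * ∫ t in Set.Ioc 0 T, (Φ t - L) := by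
    rw [intervalIntegral.integral_of_le hT.le, integral_sub (hΦ T) (by simp), integral_const,
      mul_sub]
    congr 1
    simp only [measureReal_restrict_apply_univ, Real.volume_real_Ioc_of_le hT.le, sub_zero,
      Complex.real_smul]
    rw [← mul_assoc, inv_mul_cancel₀ hT', one_mul]
  rw [edist_eq_enorm_sub, h1, enorm_mul]
  refine mul_le_mul' (le_of_eq ?_) (enorm_integral_le_lintegral_enorm _)
  rw [← ofReal_norm, norm_inv, Complex.norm_real, Real.norm_of_nonneg hT.le,
    ENNReal.ofReal_inv_of_pos hT]

theorem abs_exp_neg_sub_le {x y : ℝ} (hx : 0 ≤ x) (hy : 0 ≤ y) :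
    |Real.exp (-x) - Real.exp (-y)| ≤ |x - y| := by
  wlog h : x ≤ y generalizing x y
  · rw [abs_sub_comm, abs_sub_comm x]
    exact this hy hx (le_of_not_ge h)
  have h1 : Real.exp (-y) ≤ Real.exp (-x) := Real.exp_le_exp.2 (by linarith)
  rw [abs_of_nonneg (by linarith), abs_of_nonpos (by linarith)]
  have h2 : Real.exp (-y) = Real.exp (-x) * Real.exp (-(y - x)) := by
    rw [← Real.exp_add]
    congr 1
    ring
  have h3 : 1 - (y - x) ≤ Real.exp (-(y - x)) := by linarith [Real.add_one_le_exp (-(y - x))]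
  have h4 : Real.exp (-x) ≤ 1 := Real.exp_le_one_iff.2 (by linarith)
  rw [h2]
  nlinarith [Real.exp_pos (-x)]

theorem norm_phase_sub_le (x y : ℝ) :
    ‖Complex.exp (Complex.I * x) - Complex.exp (Complex.I * y)‖ ≤ |x - y| := by
  have h1 : Complex.exp (Complex.I * x) - Complex.exp (Complex.I * y)
      = Complex.exp (Complex.I * y) * (Complex.exp (Complex.I * ((x - y : ℝ) : ℂ)) - 1) := by
    rw [mul_sub, ← Complex.exp_add, mul_one]
    congr 2
    push_cast
    ring
  rw [h1, norm_mul, mul_comm Complex.I (y : ℂ), Complex.norm_exp_ofReal_mul_I, one_mul]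
  exact Real.norm_exp_I_mul_ofReal_sub_one_le

/-- A telescoping sum: nonnegative exponents keep the Gaussian factors at most 1, and exponentials
and phases are Lipschitz, so the three errors add up. -/
theorem norm_gaussian_sub_le (a : ℂ) {q Q θ θ' : ℝ} (hq : 0 ≤ q) (hQ : 0 ≤ Q) :
    ‖a * (Complex.exp (-(1 / 2 : ℂ) * q) * Complex.exp (Complex.I * θ))
      - Complex.exp (-(1 / 2 : ℂ) * Q) * Complex.exp (Complex.I * θ')‖
      ≤ ‖a - 1‖ + (|q - Q| + |θ - θ'|) := by
  have hr : ∀ q : ℝ, Complex.exp (-(1 / 2 : ℂ) * q) = ((Real.exp (-(q / 2)) : ℝ) : ℂ) := by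
    intro q
    rw [Complex.ofReal_exp]
    congr 1
    push_cast
    ring
  have hn : ∀ q : ℝ, 0 ≤ q → ‖Complex.exp (-(1 / 2 : ℂ) * q)‖ ≤ 1 := by
    intro q hq
    rw [hr, Complex.norm_real, Real.norm_of_nonneg (Real.exp_pos _).le]
    exact Real.exp_le_one_iff.2 (by linarith)
  have hp : ∀ θ : ℝ, ‖Complex.exp (Complex.I * θ)‖ = 1 := by
    intro θ
    rw [mul_comm, Complex.norm_exp_ofReal_mul_I]
  have e1 : a * (Complex.exp (-(1 / 2 : ℂ) * q) * Complex.exp (Complex.I * θ))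
      - Complex.exp (-(1 / 2 : ℂ) * Q) * Complex.exp (Complex.I * θ')
      = (a - 1) * (Complex.exp (-(1 / 2 : ℂ) * q) * Complex.exp (Complex.I * θ))
        + ((Complex.exp (-(1 / 2 : ℂ) * q) - Complex.exp (-(1 / 2 : ℂ) * Q))
          * Complex.exp (Complex.I * θ)
        + Complex.exp (-(1 / 2 : ℂ) * Q)
          * (Complex.exp (Complex.I * θ) - Complex.exp (Complex.I * θ'))) := by ring
  rw [e1]
  refine (norm_add_le _ _).trans (add_le_add ?_ ((norm_add_le _ _).trans (add_le_add ?_ ?_)))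
  · rw [norm_mul, norm_mul, hp, mul_one]
    exact mul_le_of_le_one_right (norm_nonneg _) (hn q hq)
  · rw [norm_mul, hp, mul_one, hr, hr, ← Complex.ofReal_sub, Complex.norm_real, Real.norm_eq_abs]
    refine (abs_exp_neg_sub_le (by linarith) (by linarith)).trans ?_
    rw [← sub_div, abs_div, abs_two]
    linarith [abs_nonneg (q - Q)]
  · rw [norm_mul]
    calc _ ≤ 1 * |θ - θ'| := by
          gcongr
          · exact hn Q hQ
          · exact norm_phase_sub_le θ θ'
      _ = _ := one_mul _

theorem partialFt_const_mul (a : ℂ) (c : ℝ → ℂ) (t ν : ℝ) :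
    partialFt (fun s => a * c s) t ν = a * partialFt c t ν := by
  rw [partialFt, partialFt, ← intervalIntegral.integral_const_mul]
  simp only [mul_assoc]

/-! ### The time-averaged state on the test vectors -/

namespace Model

variable {N : ℕ} (M : Model N)

/-- The measure `(𝒩_k(ν) + 1/2) d⟪g_k, E_k(ν) g_k⟫`. -/
def bathMeasure (k : Fin N) : Measure ℝ :=
  (M.formMeasure k).withDensity fun ν => ENNReal.ofReal (planck (M.β k) (M.μ k) ν + 1 / 2)

theorem measurable_bathDensity (k : Fin N) :
    Measurable fun ν => ENNReal.ofReal (planck (M.β k) (M.μ k) ν + 1 / 2) :=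
  ((measurable_planck _ _).add_const _).ennreal_ofReal

theorem isFiniteMeasure_bathMeasure (hD : M.CondD) (k : Fin N) :
    IsFiniteMeasure (M.bathMeasure k) := by
  refine isFiniteMeasure_withDensity ?_
  have h1 := (integrable_planck (M.bose_form hD k) (M.β_pos k) (M.μ_nonpos k)).add
    (integrable_const (1 / 2))
  exact h1.lintegral_lt_top.ne

theorem memLp_affine_bathMeasure (hD : M.CondD) (k : Fin N) (a b : ℂ) :
    MemLp (fun ν : ℝ => a + b * ν) 2 (M.bathMeasure k) := by
  refine ⟨by fun_prop, ?_⟩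
  rw [eLpNorm_lt_top_iff_lintegral_rpow_enorm_lt_top (by norm_num) (by norm_num)]
  simp only [ENNReal.toReal_ofNat, ENNReal.rpow_ofNat]
  have hm : Measurable fun ν : ℝ => ‖a + b * ν‖ₑ ^ 2 := by fun_prop
  have hm' : Measurable fun ν : ℝ => (ENNReal.ofReal (Real.exp (M.β k * ν) - 1))⁻¹ := by fun_prop
  have h1 := bose_comb (M.bose_form hD k) (M.β_pos k) ((M.res k).integrable_sq (M.g_mem k)) a b
  have h2 : ∫⁻ ν : ℝ, ‖a + b * ν‖ₑ ^ 2 ∂(M.formMeasure k) < ∞ := by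
    have h3 := (M.res k).specMeasure_comb (M.g_mem k) a b
    have h4 := (M.res k).isFiniteMeasure_specMeasure
      (a • M.g k + b • (M.res k).ham ⟨M.g k, M.g_mem k⟩)
    have h5 := h4.measure_univ_lt_top
    rw [h3, withDensity_apply _ MeasurableSet.univ, setLIntegral_univ] at h5
    exact h5
  rw [lintegral_withDensity_eq_lintegral_mul _ hm hm'] at h1
  rw [bathMeasure, lintegral_withDensity_eq_lintegral_mul _ (M.measurable_bathDensity k) hm]
  have h3 : ∫⁻ ν : ℝ, (‖a + b * ν‖ₑ ^ 2 * (ENNReal.ofReal (Real.exp (M.β k * ν) - 1))⁻¹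
      + ‖a + b * ν‖ₑ ^ 2) ∂(M.formMeasure k) < ∞ := by
    rw [lintegral_add_right _ hm]
    exact ENNReal.add_lt_top.2 ⟨h1, h2⟩
  refine lt_of_le_of_lt (lintegral_mono_ae ?_) h3
  filter_upwards [M.ae_formMeasure_pos hD k] with ν hν
  have hx := mul_pos (M.β_pos k) hν
  have he : 0 < Real.exp (M.β k * ν) - 1 := by linarith [Real.add_one_lt_exp hx.ne']
  have h4 : ENNReal.ofReal (planck (M.β k) (M.μ k) ν + 1 / 2)
      ≤ (ENNReal.ofReal (Real.exp (M.β k * ν) - 1))⁻¹ + 1 := by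
    rw [← ENNReal.ofReal_inv_of_pos he, ← ENNReal.ofReal_one,
      ← ENNReal.ofReal_add (by positivity) zero_le_one]
    refine ENNReal.ofReal_le_ofReal ?_
    linarith [planck_le (M.β_pos k) (M.μ_nonpos k) hν]
  rw [Pi.mul_apply, mul_comm]
  refine (mul_le_mul' le_rfl h4).trans (le_of_eq ?_)
  rw [mul_add, mul_one]

theorem integral_bathMeasure (hD : M.CondD) (k : Fin N) {E : Type*} [NormedAddCommGroup E]
    [NormedSpace ℝ E] (f : ℝ → E) :
    ∫ ν, f ν ∂(M.bathMeasure k)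
      = ∫ ν, (planck (M.β k) (M.μ k) ν + 1 / 2) • f ν ∂(M.formMeasure k) := by
  rw [bathMeasure, integral_withDensity_eq_integral_toReal_smul (M.measurable_bathDensity k)
    (Eventually.of_forall fun ν => ENNReal.ofReal_lt_top)]
  refine integral_congr_ae ?_
  filter_upwards [M.ae_formMeasure_pos hD k] with ν hν
  rw [ENNReal.toReal_ofReal]
  linarith [planck_nonneg (M.β_pos k) (M.μ_nonpos k) hν]

theorem integral_planck_withDensity (hD : M.CondD) (k : Fin N) {u : ℝ → ℂ} (hu : Measurable u) :
    ∫ ν, (planck (M.β k) (M.μ k) ν + 1 / 2) ∂((M.formMeasure k).withDensity fun ν => ‖u ν‖ₑ ^ 2)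
      = ∫ ν, ‖u ν‖ ^ 2 ∂(M.bathMeasure k) := by
  rw [M.integral_bathMeasure hD, integral_withDensity_eq_integral_toReal_smul
    (hu.enorm.pow_const 2) (Eventually.of_forall fun ν => ENNReal.pow_lt_top enorm_lt_top)]
  congr 1
  ext ν
  rw [ENNReal.toReal_pow, toReal_enorm, smul_eq_mul, smul_eq_mul, mul_comm]

/-- The `k`-th component at time `t`, in the interaction picture and divided by `g_k`, in the
spectral representation. -/
def orbitVec (c : ℝ → ℂ) (p : Param N) (k : Fin N) (t ν : ℝ) : ℂ :=
  p.2.1 k + p.2.2 k * ν + Complex.I * (M.coupling * partialFt c t ν)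

/-- The limit of `orbitVec` at large times. -/
def boundaryVec (G : Fin N → ℝ → ℂ) (p : Param N) (k : Fin N) (ν : ℝ) : ℂ :=
  p.2.1 k + p.2.2 k * ν + Complex.I * (M.coupling * M.boundaryAmp G p ν)

/-- The phase of the condensates at time `t`. -/
def orbitPhase (p : Param N) (w : ℂ) : ℝ :=
  ∑ k, M.Θ k ((p.2.1 k + Complex.I * (M.coupling * w)) * (M.res k).weight (M.g k))

variable {M}

theorem continuous_orbitVec {c : ℝ → ℂ} (hc : Continuous c) (p : Param N) (k : Fin N) :
    Continuous (Function.uncurry (M.orbitVec c p k)) := by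
  have := continuous_partialFt hc
  unfold orbitVec Function.uncurry
  fun_prop

/-- The evolved vector enters the product state only through its particle entry, the spectral
measures of its components and their weights, all known in closed form for t ≥ 0. -/
theorem initialState_orbit (hD : M.CondD) {U : ℝ → M.Space →L[ℂ] M.Space}
    (hU : IsUnitaryGroupOf M.ham U) (p : Param N) {t : ℝ} (ht : 0 ≤ t) :
    M.initialState (U t (M.testVec p)) = M.χ (M.fst (U t (M.testVec p))) *
      (Complex.exp (-(1 / 2 : ℂ) * ((∑ k, ∫ ν,
          ‖M.orbitVec (fun t => M.fst (U t (M.testVec p))) p k t ν‖ ^ 2 ∂(M.bathMeasure k) : ℝ) : ℂ))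
        * Complex.exp (Complex.I * (M.orbitPhase p
          (partialFt (fun t => M.fst (U t (M.testVec p))) t 0) : ℝ))) := by
  set c := fun t => M.fst (U t (M.testVec p)) with hcdef
  have hc : Continuous c := continuous_fst hU (M.testVec p)
  have hlc : Continuous fun t => (M.coupling : ℂ) * c t := continuous_const.mul hc
  rw [initialState, Finset.prod_mul_distrib, ← Complex.exp_sum, ← Complex.exp_sum,
    ← Finset.mul_sum, ← Finset.mul_sum, orbitPhase]
  have h0 : ∀ k, M.comp (U 0 (M.testVec p)) k
      = p.2.1 k • M.g k + p.2.2 k • (M.res k).ham ⟨M.g k, M.g_mem k⟩ := by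
    intro k
    rw [hU.zero]
    rfl
  congr 2
  · congr 2
    rw [Complex.ofReal_sum]
    refine Finset.sum_congr rfl fun k _ => ?_
    have h1 := (M.res k).specMeasure_solution (M.g_mem k) hlc
      (isWeakSolution_comp hU (M.testVec p) k) (h0 k) ht
    simp only [partialFt_const_mul] at h1
    rw [h1]
    have h2 := M.integral_planck_withDensity hD k (u := M.orbitVec c p k t)
      (Measurable.of_uncurry_left (continuous_orbitVec hc p k).measurable)
    rw [← h2]
    rfl
  · congr 2
    rw [Complex.ofReal_sum]
    refine Finset.sum_congr rfl fun k _ => ?_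
    have h1 := (M.res k).weight_solution (M.g_mem k) (hD k).1 hlc
      (isWeakSolution_comp hU (M.testVec p) k) (h0 k) ht
    rw [partialFt_const_mul] at h1
    rw [h1]

theorem memLp_bathMeasure_of_bounded (hD : M.CondD) (k : Fin N) {u : ℝ → ℂ} (hu : Measurable u)
    {K : ℝ} (hK : ∀ᵐ ν ∂(M.bathMeasure k), ‖u ν‖ ≤ K) : MemLp u 2 (M.bathMeasure k) := by
  have := M.isFiniteMeasure_bathMeasure hD k
  exact MemLp.of_bound hu.aestronglyMeasurable K hK

namespace IsFormBoundary

variable {G : Fin N → ℝ → ℂ}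

/-- Exhibits the Lebesgue density that serves as W in the weighted mean convergence: integrable
because the measure is finite, though possibly unbounded near zero energy. -/
theorem bathMeasure_eq (hG : M.IsFormBoundary G) (k : Fin N) : M.bathMeasure k
    = volume.withDensity ((fun ν => ENNReal.ofReal ((G k ν).im / Real.pi))
      * fun ν => ENNReal.ofReal (planck (M.β k) (M.μ k) ν + 1 / 2)) := by
  have hm : Measurable fun ν => ENNReal.ofReal ((G k ν).im / Real.pi) := by
    have := hG.measurable k
    fun_prop
  rw [withDensity_mul _ hm (M.measurable_bathDensity k), ← hG.formMeasure_eq k]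
  rfl

theorem bathMeasure_absolutelyContinuous (hG : M.IsFormBoundary G) (k : Fin N) :
    M.bathMeasure k ≪ volume := by
  rw [hG.bathMeasure_eq k]
  exact withDensity_absolutelyContinuous _ _

theorem measurable_boundaryVec (hG : M.IsFormBoundary G) (p : Param N) (k : Fin N) :
    Measurable (M.boundaryVec G p k) := by
  have := hG.measurable_boundaryAmp p
  unfold boundaryVec
  fun_prop

theorem memLp_boundaryVec (hG : M.IsFormBoundary G) (hD : M.CondD) (p : Param N) (k : Fin N) :
    MemLp (M.boundaryVec G p k) 2 (M.bathMeasure k) := by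
  obtain ⟨K, hK⟩ := hG.exists_norm_boundaryAmp_le p
  have h1 : MemLp (M.boundaryAmp G p) 2 (M.bathMeasure k) :=
    memLp_bathMeasure_of_bounded hD k (hG.measurable_boundaryAmp p)
      ((hG.bathMeasure_absolutelyContinuous k).ae_le hK)
  exact (M.memLp_affine_bathMeasure hD k _ _).add ((h1.const_mul _).const_mul _)

/-- The difference between the component at time t and its limit is iλ times the error of the
truncated Fourier integral, so weighted mean convergence applies; squared norms then follow by
Young's inequality. -/
theorem meanZero_orbitVec (hG : M.IsFormBoundary G) (hA : M.CondA) (hB : M.CondB) (hD : M.CondD)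
    {U : ℝ → M.Space →L[ℂ] M.Space} (hU : IsUnitaryGroupOf M.ham U) (p : Param N) (k : Fin N) :
    MeanZero fun t => ‖(∫ ν, ‖M.orbitVec (fun t => M.fst (U t (M.testVec p))) p k t ν‖ ^ 2
      ∂(M.bathMeasure k)) - ∫ ν, ‖M.boundaryVec G p k ν‖ ^ 2 ∂(M.bathMeasure k)‖ₑ := by
  have hfin := M.isFiniteMeasure_bathMeasure hD k
  set c := fun t => M.fst (U t (M.testVec p)) with hcdef
  have hc : Continuous c := continuous_fst hU (M.testVec p)
  obtain ⟨B, hBc⟩ := exists_norm_fst_le hU (M.testVec p)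
  obtain ⟨K₁, hK₁⟩ := exists_norm_lap_fst_le_const hA hB hU p
  obtain ⟨K₂, hK₂⟩ := hG.exists_norm_boundaryAmp_le p
  have hcont := continuous_orbitVec (M := M) hc p k
  refine meanZero_integral_normSq_sub (hG.measurable_boundaryVec p k)
    (hG.memLp_boundaryVec hD p k) (fun t ht => ?_) hcont.measurable ?_
  · have h1 : MemLp (fun ν => partialFt c t ν) 2 (M.bathMeasure k) :=
      memLp_bathMeasure_of_bounded hD k (Measurable.of_uncurry_left (f := partialFt c)
        (continuous_partialFt hc).measurable)
        (Eventually.of_forall fun ν => norm_partialFt_le hBc ht.le ν)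
    exact (M.memLp_affine_bathMeasure hD k _ _).add ((h1.const_mul _).const_mul _)
  · have hWm : Measurable ((fun ν => ENNReal.ofReal ((G k ν).im / Real.pi))
        * fun ν => ENNReal.ofReal (planck (M.β k) (M.μ k) ν + 1 / 2)) := by
      refine Measurable.mul ?_ (M.measurable_bathDensity k)
      have := hG.measurable k
      fun_prop
    have hWi : ∫⁻ ν, ((fun ν => ENNReal.ofReal ((G k ν).im / Real.pi))
        * fun ν => ENNReal.ofReal (planck (M.β k) (M.μ k) ν + 1 / 2)) ν ≠ ∞ := by
      have h1 := hfin.measure_univ_lt_top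
      rw [hG.bathMeasure_eq k, withDensity_apply _ MeasurableSet.univ, setLIntegral_univ] at h1
      exact h1.ne
    have h1 := meanZero_lintegral_partialFt_sub (hG.isBoundaryValue_fst hA hB hU p) hc hBc
      (K := max K₁ K₂) (fun z hz => (hK₁ z hz).trans (le_max_left _ _))
      (hK₂.mono fun ν h => h.trans (le_max_right _ _)) hWm hWi
    rw [← hG.bathMeasure_eq k] at h1
    refine (h1.const_mul (a := ‖(M.coupling : ℂ)‖ₑ ^ 2)
      (ENNReal.pow_lt_top enorm_lt_top).ne).mono fun t _ => le_of_eq ?_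
    have hm : Measurable fun ν => ‖partialFt c t ν - M.boundaryAmp G p ν‖ₑ ^ 2 := by
      have e1 : Measurable (partialFt c t) := Measurable.of_uncurry_left (f := partialFt c)
        (continuous_partialFt hc).measurable
      exact ((e1.sub (hG.measurable_boundaryAmp p)).enorm).pow_const 2
    rw [← lintegral_const_mul _ hm]
    refine lintegral_congr fun ν => ?_
    have e2 : M.orbitVec c p k t ν - M.boundaryVec G p k ν
        = Complex.I * (M.coupling * (partialFt c t ν - M.boundaryAmp G p ν)) := by
      rw [orbitVec, boundaryVec]
      ring
    rw [e2, enorm_mul, enorm_mul, mul_pow, mul_pow]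
    have e3 : ‖Complex.I‖ₑ = 1 := by
      rw [← ofReal_norm, Complex.norm_I, ENNReal.ofReal_one]
    rw [e3, one_pow, one_mul]

end IsFormBoundary

theorem meanZero_fst {c u : ℝ → ℂ} (hu : IsBoundaryValue c u) : MeanZero fun t => ‖c t‖ₑ ^ 2 := by
  refine meanZero_of_lintegral_ne_top ?_
  have h1 := (lintegral_enorm_sq_lt_top hu.memLp).ne
  rw [← lintegral_indicator measurableSet_Ioi]
  refine ne_top_of_le_ne_top h1 (lintegral_mono fun t => ?_)
  by_cases ht : t ∈ Set.Ioi (0 : ℝ)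
  · rw [Set.indicator_of_mem ht, Set.indicator_of_mem ht]
  · rw [Set.indicator_of_notMem ht]
    exact zero_le

theorem exists_abs_orbitPhase_sub_le (M : Model N) (p : Param N) :
    ∃ K : ℝ, 0 ≤ K ∧ ∀ w w', |M.orbitPhase p w - M.orbitPhase p w'| ≤ K * ‖w - w'‖ := by
  let L : Fin N → ℂ →L[ℝ] ℝ := fun k => LinearMap.toContinuousLinearMap (M.Θ k)
  refine ⟨∑ k, ‖L k‖ * (M.coupling * ‖(M.res k).weight (M.g k)‖), ?_, fun w w' => ?_⟩
  · exact Finset.sum_nonneg fun k _ =>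
      mul_nonneg (norm_nonneg _) (mul_nonneg M.coupling_pos.le (norm_nonneg _))
  · rw [orbitPhase, orbitPhase, ← Finset.sum_sub_distrib, Finset.sum_mul]
    refine (Finset.abs_sum_le_sum_abs _ _).trans (Finset.sum_le_sum fun k _ => ?_)
    rw [← map_sub, ← sub_mul, add_sub_add_left_eq_sub, ← mul_sub, ← mul_sub]
    have h1 := (L k).le_opNorm (Complex.I * (M.coupling * (w - w')) * (M.res k).weight (M.g k))
    rw [norm_mul, norm_mul, norm_mul, Complex.norm_I, one_mul, Complex.norm_real,
      Real.norm_of_nonneg M.coupling_pos.le] at h1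
    refine h1.trans (le_of_eq ?_)
    ring

/-- The limit of the evolved initial state. -/
theorem IsFormBoundary.ness_testVec {G : Fin N → ℝ → ℂ} (hG : M.IsFormBoundary G)
    (hA : M.CondA) (hB : M.CondB) (hD : M.CondD) {U : ℝ → M.Space →L[ℂ] M.Space}
    (hU : IsUnitaryGroupOf M.ham U) {ω : M.Space → ℂ} (hω : M.IsNESS U ω) (p : Param N) :
    ω (M.testVec p) = Complex.exp (-(1 / 2 : ℂ) * ((∑ k, ∫ ν,
          ‖M.boundaryVec G p k ν‖ ^ 2 ∂(M.bathMeasure k) : ℝ) : ℂ))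
        * Complex.exp (Complex.I * (M.orbitPhase p (M.zeroAmp p) : ℝ)) := by
  -- The full limit T → ∞ is shown to exist, so every limit point takes the same value here.
  obtain ⟨F, hF, hFT, hlim⟩ := hω
  refine tendsto_nhds_unique (hlim _ (M.testVec_mem_testSpace hD p)) (Tendsto.mono_left ?_ hFT)
  have hfin := fun k => M.isFiniteMeasure_bathMeasure hD k
  set c := fun t => M.fst (U t (M.testVec p)) with hcdef
  have hc : Continuous c := continuous_fst hU (M.testVec p)
  obtain ⟨B, hBc⟩ := exists_norm_fst_le hU (M.testVec p)
  obtain ⟨K₁, hK₁⟩ := exists_norm_lap_fst_le_const hA hB hU p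
  obtain ⟨K, hK, hKθ⟩ := exists_abs_orbitPhase_sub_le M p
  set q : ℝ → ℝ := fun t => ∑ k, ∫ ν, ‖M.orbitVec c p k t ν‖ ^ 2 ∂(M.bathMeasure k) with hq
  set θ : ℝ → ℝ := fun t => M.orbitPhase p (partialFt c t 0) with hθ
  set Φ : ℝ → ℂ := fun t => M.χ (c t) * (Complex.exp (-(1 / 2 : ℂ) * (q t : ℂ))
    * Complex.exp (Complex.I * (θ t : ℂ))) with hΦ
  have hqm' : ∀ k, Measurable fun t => ∫ ν, ‖M.orbitVec c p k t ν‖ ^ 2 ∂(M.bathMeasure k) := by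
    intro k
    have h1 : StronglyMeasurable (Function.uncurry fun t ν => ‖M.orbitVec c p k t ν‖ ^ 2) :=
      ((continuous_orbitVec (M := M) hc p k).norm.pow 2).stronglyMeasurable
    have := hfin k
    exact h1.integral_prod_right.measurable
  have hqm : Measurable q := Finset.measurable_fun_sum _ fun k _ => hqm' k
  have hpc : Continuous fun t => partialFt c t 0 :=
    (continuous_partialFt hc).comp (f := fun t : ℝ => (t, (0 : ℝ))) (by fun_prop)
  have hθc : Continuous θ := by
    refine continuous_finsetSum _ fun k _ => ?_
    have h1 : Continuous (M.Θ k) := LinearMap.continuous_of_finiteDimensional _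
    exact h1.comp (by fun_prop)
  have hq0 : ∀ t, 0 ≤ q t := fun t => Finset.sum_nonneg fun k _ =>
    integral_nonneg fun ν => by positivity
  have hχc := M.χ_regular
  have hΦm : Measurable Φ := by
    refine (hχc.comp hc).measurable.mul (Measurable.mul ?_ ?_)
    · fun_prop
    · have := hθc.measurable
      fun_prop
  obtain ⟨Kχ, hKχ⟩ : ∃ K, ∀ x ∈ Metric.closedBall (0 : ℂ) B, ‖M.χ x‖ ≤ K :=
    (isCompact_closedBall (0 : ℂ) B).exists_bound_of_continuousOn hχc.continuousOn
  have hΦb : ∀ t, ‖Φ t‖ ≤ Kχ := by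
    intro t
    have h1 : ‖M.χ (c t)‖ ≤ Kχ := hKχ _ (by simpa using hBc t)
    have h2 : ‖Complex.exp (-(1 / 2 : ℂ) * (q t : ℂ))‖ ≤ 1 := by
      rw [Complex.norm_exp, Real.exp_le_one_iff]
      have := hq0 t
      simp
      linarith
    have h3 : ‖Complex.exp (Complex.I * (θ t : ℂ))‖ = 1 := by
      rw [mul_comm, Complex.norm_exp_ofReal_mul_I]
    rw [hΦ]
    dsimp only
    rw [norm_mul, norm_mul, h3, mul_one]
    exact (mul_le_of_le_one_right (norm_nonneg _) h2).trans h1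
  have hΦi : ∀ T, IntegrableOn Φ (Set.Ioc 0 T) := fun T =>
    (integrable_const Kχ).mono' hΦm.aestronglyMeasurable (Eventually.of_forall hΦb)
  set Q : ℝ := ∑ k, ∫ ν, ‖M.boundaryVec G p k ν‖ ^ 2 ∂(M.bathMeasure k) with hQ
  have hQ0 : 0 ≤ Q := Finset.sum_nonneg fun k _ => integral_nonneg fun ν => by positivity
  have hmean : MeanZero fun t => ‖Φ t - Complex.exp (-(1 / 2 : ℂ) * (Q : ℂ))
      * Complex.exp (Complex.I * (M.orbitPhase p (M.zeroAmp p) : ℝ))‖ₑ := by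
    have m1 : MeanZero fun t => ‖M.χ (c t) - 1‖ₑ := by
      have := meanZero_comp_sub hχc hc hBc (meanZero_fst (hG.isBoundaryValue_fst hA hB hU p))
      rwa [M.χ_state.1] at this
    have m2 : MeanZero fun t => ∑ k, ‖(∫ ν, ‖M.orbitVec c p k t ν‖ ^ 2 ∂(M.bathMeasure k))
        - ∫ ν, ‖M.boundaryVec G p k ν‖ ^ 2 ∂(M.bathMeasure k)‖ₑ :=
      MeanZero.sum _ (fun k _ => hG.meanZero_orbitVec hA hB hD hU p k)
        fun k => ((hqm' k).sub_const _).enorm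
    -- The single point ν = 0 is invisible to L² convergence. The pointwise mean convergence is
    -- used, and the phase depends on this integral in a Lipschitz way.
    have m3 : MeanZero fun t => ‖partialFt c t 0 - M.zeroAmp p‖ₑ := by
      refine MeanZero.of_sq ((hpc.sub continuous_const).measurable.enorm) ?_
      refine meanZero_partialFt_sub hc hBc hK₁ (continuousOn_lap_fst hU p) 0 _ fun y => ?_
      have := tendsto_lap_fst_zero hA hB hD hU p y
      simpa using this
    have hme1 : Measurable fun t => ‖M.χ (c t) - 1‖ₑ :=
      ((hχc.comp hc).sub continuous_const).measurable.enorm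
    have hme2 : Measurable fun t => ∑ k, ‖(∫ ν, ‖M.orbitVec c p k t ν‖ ^ 2 ∂(M.bathMeasure k))
        - ∫ ν, ‖M.boundaryVec G p k ν‖ ^ 2 ∂(M.bathMeasure k)‖ₑ :=
      Finset.measurable_fun_sum _ fun k _ => ((hqm' k).sub_const _).enorm
    refine (m1.add (m2.add (m3.const_mul (a := ENNReal.ofReal K) ENNReal.ofReal_ne_top) hme2)
      hme1).mono fun t _ => ?_
    have h1 := norm_gaussian_sub_le (M.χ (c t)) (θ := θ t)
      (θ' := M.orbitPhase p (M.zeroAmp p)) (hq0 t) hQ0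
    have h2 := ENNReal.ofReal_le_ofReal h1
    rw [ofReal_norm, ENNReal.ofReal_add (norm_nonneg _) (by positivity), ofReal_norm,
      ENNReal.ofReal_add (abs_nonneg _) (abs_nonneg _)] at h2
    refine h2.trans (add_le_add le_rfl (add_le_add ?_ ?_))
    · have h3 : |q t - Q| ≤ ∑ k, |(∫ ν, ‖M.orbitVec c p k t ν‖ ^ 2 ∂(M.bathMeasure k))
          - ∫ ν, ‖M.boundaryVec G p k ν‖ ^ 2 ∂(M.bathMeasure k)| := by
        rw [hq, hQ]
        dsimp only
        rw [← Finset.sum_sub_distrib]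
        exact Finset.abs_sum_le_sum_abs _ _
      refine (ENNReal.ofReal_le_ofReal h3).trans (le_of_eq ?_)
      rw [ENNReal.ofReal_sum_of_nonneg fun k _ => abs_nonneg _]
      refine Finset.sum_congr rfl fun k _ => ?_
      rw [← ofReal_norm, Real.norm_eq_abs]
    · refine (ENNReal.ofReal_le_ofReal (hKθ _ _)).trans (le_of_eq ?_)
      rw [ENNReal.ofReal_mul hK, ofReal_norm]
  have hmain := tendsto_mean_of_meanZero hΦi hmean
  refine hmain.congr' ?_
  filter_upwards [eventually_gt_atTop (0 : ℝ)] with T hT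
  congr 1
  rw [intervalIntegral.integral_of_le hT.le, intervalIntegral.integral_of_le hT.le]
  refine setIntegral_congr_fun measurableSet_Ioc fun t ht => ?_
  exact (initialState_orbit hD hU p ht.1.le).symm

end Model

/-! ### Two-point functions of Gaussian functionals -/

section Gaussian

variable {H : Type*} [NormedAddCommGroup H] [InnerProductSpace ℂ H]

/-- With the Weyl phase -i s t Im⟨f,g⟩/2 included, the exponent is a polynomial in s and t vanishing
at the origin. The mixed derivative there is its st-coefficient plus the product (iφ)(iφ') of the
linear ones. -/
theorem hasFieldCorrelation_of_gaussian {ω : H → ℂ} {f g : H} {Q R Q' φ φ' : ℝ}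
    (h : ∀ s t : ℝ, ω ((s : ℂ) • f + (t : ℂ) • g)
      = Complex.exp (-(1 / 2 : ℂ) * ((s ^ 2 * Q + 2 * (s * t) * R + t ^ 2 * Q' : ℝ) : ℂ))
        * Complex.exp (Complex.I * ((s * φ + t * φ' : ℝ) : ℂ))) :
    HasFieldCorrelation ω f g (R + Complex.I * ((inner ℂ f g : ℂ).im : ℂ) / 2 + φ * φ') := by
  set κ : ℝ := (inner ℂ f g : ℂ).im with hκ
  have hpair : ∀ s t : ℝ, weylPair ω ((s : ℂ) • f) ((t : ℂ) • g)
      = Complex.exp (-(1 / 2 : ℂ) * (s ^ 2 * Q) + Complex.I * (s * φ)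
        + (t * (-(Complex.I * s * κ / 2) - s * R + Complex.I * φ')
          + t ^ 2 * (-(1 / 2 : ℂ) * Q'))) := by
    intro s t
    rw [weylPair, h, ← Complex.exp_add, ← Complex.exp_add, inner_smul_left, inner_smul_right,
      Complex.conj_ofReal, ← mul_assoc, ← Complex.ofReal_mul, Complex.im_ofReal_mul, ← hκ]
    congr 1
    push_cast
    ring
  refine ⟨fun s => Complex.exp (-(1 / 2 : ℂ) * (s ^ 2 * Q) + Complex.I * (s * φ))
    * (-(Complex.I * s * κ / 2) - s * R + Complex.I * φ'), fun s => ?_, ?_⟩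
  · simp only [hpair]
    have h1 : HasDerivAt (fun t : ℝ => -(1 / 2 : ℂ) * (s ^ 2 * Q) + Complex.I * (s * φ)
        + ((t : ℂ) * (-(Complex.I * s * κ / 2) - s * R + Complex.I * φ')
          + (t : ℂ) ^ 2 * (-(1 / 2 : ℂ) * Q')))
        (1 * (-(Complex.I * s * κ / 2) - s * R + Complex.I * φ')
          + ((2 : ℕ) * (((0 : ℝ) : ℂ)) ^ (2 - 1) * 1) * (-(1 / 2 : ℂ) * Q')) 0 := by
      have hid : HasDerivAt (fun t : ℝ => (t : ℂ)) 1 0 := Complex.ofRealCLM.hasDerivAt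
      exact ((hid.mul_const _).add ((hid.pow 2).mul_const _)).const_add _
    convert! h1.cexp using 1
    simp
  · have hid : HasDerivAt (fun t : ℝ => (t : ℂ)) 1 0 := Complex.ofRealCLM.hasDerivAt
    have h1 : HasDerivAt (fun s : ℝ => -(1 / 2 : ℂ) * ((s : ℂ) ^ 2 * Q)
        + Complex.I * ((s : ℂ) * φ))
        (-(1 / 2 : ℂ) * (((2 : ℕ) * (((0 : ℝ) : ℂ)) ^ (2 - 1) * 1) * Q)
          + Complex.I * (1 * φ)) 0 :=
      (((hid.pow 2).mul_const _).const_mul _).add ((hid.mul_const _).const_mul _)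
    have h2 : HasDerivAt (fun s : ℝ => -(Complex.I * (s : ℂ) * κ / 2) - (s : ℂ) * R
        + Complex.I * φ') (-(Complex.I * 1 * κ / 2) - 1 * R) 0 :=
      (((((hid.const_mul _).mul_const _).div_const _).neg).sub (hid.mul_const _)).add_const _
    convert! h1.cexp.mul h2 using 1
    simp
    linear_combination (φ * φ') * (-Complex.I_mul_I)

/-- A Gaussian functional on the complex span of two vectors: the correlation of an annihilation
and a creation operator. -/
theorem hasAnnihilationCreation_of_gaussian {P : Type*} [AddCommGroup P] [Module ℂ P]
    (ι : P →ₗ[ℂ] H) {ω : H → ℂ} (S : P → P → ℂ) (φ : P →ₗ[ℝ] ℝ)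
    (hl : ∀ p q, S (Complex.I • p) q = -Complex.I * S p q)
    (hr : ∀ p q, S p (Complex.I • q) = Complex.I * S p q)
    (h : ∀ p q (s t : ℝ), ω (ι ((s : ℂ) • p + (t : ℂ) • q))
      = Complex.exp (-(1 / 2 : ℂ)
          * ((s ^ 2 * (S p p).re + 2 * (s * t) * (S p q).re + t ^ 2 * (S q q).re : ℝ) : ℂ))
        * Complex.exp (Complex.I * ((s * φ p + t * φ q : ℝ) : ℂ))) (p q : P) :
    HasAnnihilationCreation ω (ι p) (ι q) (S p q + inner ℂ (ι p) (ι q) / 2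
      + (φ p + Complex.I * φ (Complex.I • p)) * (φ q - Complex.I * φ (Complex.I • q)) / 2) := by
  have hc : ∀ p q, HasFieldCorrelation ω (ι p) (ι q)
      ((S p q).re + Complex.I * ((inner ℂ (ι p) (ι q) : ℂ).im : ℂ) / 2 + φ p * φ q) := by
    intro p q
    refine hasFieldCorrelation_of_gaussian (Q := (S p p).re) (Q' := (S q q).re) fun s t => ?_
    rw [← h p q s t, map_add, map_smul, map_smul]
  have h1 := hc p q
  have h2 := hc p (Complex.I • q)
  have h3 := hc (Complex.I • p) q
  have h4 := hc (Complex.I • p) (Complex.I • q)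
  rw [map_smul] at h2 h3 h4
  rw [map_smul] at h4
  refine ⟨_, _, _, _, h1, h2, h3, h4, ?_⟩
  rw [hl, hr, hl, hr, inner_smul_left, inner_smul_right, inner_smul_left,
    inner_smul_right, Complex.conj_I]
  set B : ℂ := inner ℂ (ι p) (ι q)
  have e1 : (Complex.I * S p q).re = -(S p q).im := by simp
  have e2 : (-Complex.I * S p q).re = (S p q).im := by simp
  have e3 : (-Complex.I * (Complex.I * S p q)).re = (S p q).re := by simp
  have e4 : (Complex.I * B).im = B.re := by simp
  have e5 : (-Complex.I * B).im = -B.re := by simp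
  have e6 : (-Complex.I * (Complex.I * B)).im = B.im := by simp
  rw [e1, e2, e3, e4, e5, e6]
  have eS := Complex.re_add_im (S p q)
  have eB := Complex.re_add_im B
  push_cast
  linear_combination -eS - eB / 2
    + (B.re / 2 - φ (Complex.I • p) * φ (Complex.I • q) / 2) * Complex.I_mul_I

end Gaussian

/-! ### Two-point function and currents of a NESS -/

namespace Model

variable {N : ℕ} (M : Model N)

theorem amp_comb (a b : ℂ) (p q : Param N) (z : ℂ) (G : Fin N → ℂ) :
    M.amp (a • p + b • q) z G = a * M.amp p z G + b * M.amp q z G := by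
  have h : ∀ x y u : ℂ, ∀ f g : Fin N → ℂ, a * (x + u * ∑ j, f j) + b * (y + u * ∑ j, g j)
      = (a * x + b * y) + u * ∑ j, (a * f j + b * g j) := by
    intro x y u f g
    rw [Finset.sum_add_distrib, ← Finset.mul_sum, ← Finset.mul_sum]
    ring
  rw [amp, amp, amp, h]
  congr 2
  refine Finset.sum_congr rfl fun j _ => ?_
  simp only [Prod.snd_add, Prod.fst_add, Prod.smul_snd, Prod.smul_fst, Pi.add_apply, Pi.smul_apply,
    smul_eq_mul]
  ring

theorem boundaryVec_comb (G : Fin N → ℝ → ℂ) (a b : ℂ) (p q : Param N) (k : Fin N) (ν : ℝ) :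
    M.boundaryVec G (a • p + b • q) k ν
      = a * M.boundaryVec G p k ν + b * M.boundaryVec G q k ν := by
  simp only [boundaryVec, boundaryAmp, amp_comb, Prod.snd_add, Prod.fst_add, Prod.smul_snd,
    Prod.smul_fst, Pi.add_apply, Pi.smul_apply, smul_eq_mul]
  ring

theorem boundaryVec_smul (G : Fin N → ℝ → ℂ) (a : ℂ) (p : Param N) (k : Fin N) (ν : ℝ) :
    M.boundaryVec G (a • p) k ν = a * M.boundaryVec G p k ν := by
  simpa using M.boundaryVec_comb G a 0 p 0 k ν

/-- The value at zero energy of the component of a vector in the `k`-th reservoir, as a multiple of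
the form factor, after an infinite time. -/
def zeroVec (p : Param N) (k : Fin N) : ℂ :=
  p.2.1 k + Complex.I * (M.coupling * M.zeroAmp p)

theorem zeroVec_comb (a b : ℂ) (p q : Param N) (k : Fin N) :
    M.zeroVec (a • p + b • q) k = a * M.zeroVec p k + b * M.zeroVec q k := by
  simp only [zeroVec, zeroAmp, amp_comb, Prod.snd_add, Prod.fst_add, Prod.smul_snd,
    Prod.smul_fst, Pi.add_apply, Pi.smul_apply, smul_eq_mul]
  ring

theorem zeroVec_smul (a : ℂ) (p : Param N) (k : Fin N) :
    M.zeroVec (a • p) k = a * M.zeroVec p k := by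
  simpa using M.zeroVec_comb a 0 p 0 k

/-- The phase of the condensates in a NESS. -/
def condensatePhase : Param N →ₗ[ℝ] ℝ where
  toFun p := M.orbitPhase p (M.zeroAmp p)
  map_add' p q := by
    change ∑ k, M.Θ k (M.zeroVec (p + q) k * _)
      = ∑ k, M.Θ k (M.zeroVec p k * _) + ∑ k, M.Θ k (M.zeroVec q k * _)
    rw [← Finset.sum_add_distrib]
    refine Finset.sum_congr rfl fun k _ => ?_
    have h := M.zeroVec_comb 1 1 p q k
    rw [one_smul, one_smul] at h
    rw [h, ← map_add]
    congr 1
    ring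
  map_smul' r p := by
    change ∑ k, M.Θ k (M.zeroVec ((r : ℂ) • p) k * _) = r * ∑ k, M.Θ k (M.zeroVec p k * _)
    rw [Finset.mul_sum]
    refine Finset.sum_congr rfl fun k _ => ?_
    rw [M.zeroVec_smul, mul_assoc, ← smul_eq_mul r, ← map_smul]
    rfl

/-- The complex linear form whose real part is the phase of the condensates. -/
def condensateForm (p : Param N) : ℂ :=
  M.condensatePhase p - Complex.I * M.condensatePhase (Complex.I • p)

/-- The contribution of the `k`-th condensate. -/
def condensateCoeff (k : Fin N) : ℂ :=
  M.Θ k ((M.res k).weight (M.g k)) - Complex.I * M.Θ k (Complex.I * (M.res k).weight (M.g k))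

/-- The Θ_k are only real linear, so coefficients can be pulled out when they are real. This is the
case for the vectors in the currents, by `zeroVec_atomParam` and `zeroVec_fluxParam`. -/
theorem condensateForm_of_real {p : Param N} {r : Fin N → ℝ} (h : ∀ k, M.zeroVec p k = r k) :
    M.condensateForm p = ∑ k, r k * M.condensateCoeff k := by
  have h1 : M.condensatePhase p = ∑ k, r k * M.Θ k ((M.res k).weight (M.g k)) := by
    change ∑ k, M.Θ k (M.zeroVec p k * _) = _
    refine Finset.sum_congr rfl fun k _ => ?_
    rw [h, ← smul_eq_mul (r k), ← map_smul]
    rfl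
  have h2 : M.condensatePhase (Complex.I • p)
      = ∑ k, r k * M.Θ k (Complex.I * (M.res k).weight (M.g k)) := by
    change ∑ k, M.Θ k (M.zeroVec (Complex.I • p) k * _) = _
    refine Finset.sum_congr rfl fun k _ => ?_
    rw [zeroVec_smul, h, ← smul_eq_mul (r k), ← map_smul, mul_comm Complex.I, mul_assoc]
    rfl
  rw [condensateForm, h1, h2]
  push_cast
  rw [Finset.mul_sum, ← Finset.sum_sub_distrib]
  refine Finset.sum_congr rfl fun k _ => ?_
  rw [condensateCoeff]
  ring

theorem conj_condensateForm (p : Param N) : conj (M.condensateForm p)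
    = M.condensatePhase p + Complex.I * M.condensatePhase (Complex.I • p) := by
  rw [condensateForm, map_sub, map_mul, Complex.conj_ofReal, Complex.conj_ofReal, Complex.conj_I]
  ring

theorem mu_mul_condensateCoeff (k : Fin N) : (M.μ k : ℂ) * M.condensateCoeff k = 0 := by
  rcases (M.μ_nonpos k).lt_or_eq with h | h
  · simp [condensateCoeff, M.Θ_eq_zero k h]
  · simp [h]

/-- The sesquilinear form of the two-point function of a NESS. -/
def boundaryForm (G : Fin N → ℝ → ℂ) (p q : Param N) : ℂ :=
  ∑ k, ∫ ν, conj (M.boundaryVec G p k ν) * M.boundaryVec G q k ν ∂(M.bathMeasure k)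

theorem boundaryForm_smul_left (G : Fin N → ℝ → ℂ) (a : ℂ) (p q : Param N) :
    M.boundaryForm G (a • p) q = conj a * M.boundaryForm G p q := by
  simp only [boundaryForm, boundaryVec_smul, map_mul, mul_assoc, integral_const_mul,
    Finset.mul_sum]

theorem boundaryForm_smul_right (G : Fin N → ℝ → ℂ) (a : ℂ) (p q : Param N) :
    M.boundaryForm G p (a • q) = a * M.boundaryForm G p q := by
  simp only [boundaryForm, boundaryVec_smul, mul_left_comm _ a, integral_const_mul,
    Finset.mul_sum]

theorem conj_boundaryForm (G : Fin N → ℝ → ℂ) (p q : Param N) :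
    conj (M.boundaryForm G p q) = M.boundaryForm G q p := by
  simp only [boundaryForm, map_sum, ← integral_conj, map_mul, Complex.conj_conj]
  simp only [mul_comm]

variable {M}

theorem IsFormBoundary.integrable_conj_mul {G : Fin N → ℝ → ℂ} (hG : M.IsFormBoundary G)
    (hD : M.CondD) (p q : Param N) (k : Fin N) :
    Integrable (fun ν => conj (M.boundaryVec G p k ν) * M.boundaryVec G q k ν)
      (M.bathMeasure k) :=
  (hG.memLp_boundaryVec hD p k).star.integrable_mul (hG.memLp_boundaryVec hD q k)

theorem IsFormBoundary.re_boundaryForm {G : Fin N → ℝ → ℂ} (hG : M.IsFormBoundary G)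
    (hD : M.CondD) (p q : Param N) : (M.boundaryForm G p q).re
      = ∑ k, ∫ ν, (conj (M.boundaryVec G p k ν) * M.boundaryVec G q k ν).re
        ∂(M.bathMeasure k) := by
  rw [boundaryForm, Complex.re_sum]
  refine Finset.sum_congr rfl fun k _ => ?_
  exact (integral_re (hG.integrable_conj_mul hD p q k)).symm

theorem IsFormBoundary.sum_integral_sq {G : Fin N → ℝ → ℂ} (hG : M.IsFormBoundary G)
    (hD : M.CondD) (p q : Param N) (s t : ℝ) :
    ∑ k, ∫ ν, ‖M.boundaryVec G ((s : ℂ) • p + (t : ℂ) • q) k ν‖ ^ 2 ∂(M.bathMeasure k)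
      = s ^ 2 * (M.boundaryForm G p p).re + 2 * (s * t) * (M.boundaryForm G p q).re
        + t ^ 2 * (M.boundaryForm G q q).re := by
  rw [hG.re_boundaryForm hD, hG.re_boundaryForm hD, hG.re_boundaryForm hD, Finset.mul_sum,
    Finset.mul_sum, Finset.mul_sum, ← Finset.sum_add_distrib, ← Finset.sum_add_distrib]
  refine Finset.sum_congr rfl fun k _ => ?_
  have hpp := (hG.integrable_conj_mul hD p p k).re.const_mul (s ^ 2)
  have hpq := (hG.integrable_conj_mul hD p q k).re.const_mul (2 * (s * t))
  have hqq := (hG.integrable_conj_mul hD q q k).re.const_mul (t ^ 2)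
  simp only [RCLike.re_to_complex] at hpp hpq hqq
  rw [← integral_const_mul, ← integral_const_mul, ← integral_const_mul,
    ← integral_add hpp hpq]
  refine Eq.trans ?_ (integral_add (hpp.add hpq) hqq)
  refine integral_congr_ae (Eventually.of_forall fun ν => ?_)
  simp only [boundaryVec_comb, ← Complex.normSq_eq_norm_sq, Complex.normSq_apply]
  simp
  ring

/-- The parameters form a complex vector space, so all four field correlations involve vectors on
which the NESS is known. The three terms are the thermal form (with its 1/2), the Weyl commutator
and the condensates. -/
theorem IsFormBoundary.hasAnnihilationCreation {G : Fin N → ℝ → ℂ} (hG : M.IsFormBoundary G)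
    (hA : M.CondA) (hB : M.CondB) (hD : M.CondD) {U : ℝ → M.Space →L[ℂ] M.Space}
    (hU : IsUnitaryGroupOf M.ham U) {ω : M.Space → ℂ} (hω : M.IsNESS U ω) (p q : Param N) :
    HasAnnihilationCreation ω (M.testVec p) (M.testVec q) (M.boundaryForm G p q
      + inner ℂ (M.testVec p) (M.testVec q) / 2
      + conj (M.condensateForm p) * M.condensateForm q / 2) := by
  rw [conj_condensateForm]
  refine hasAnnihilationCreation_of_gaussian M.testVec (M.boundaryForm G) M.condensatePhase
    (fun p q => ?_) (fun p q => ?_) (fun p q s t => ?_) p q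
  · rw [boundaryForm_smul_left, Complex.conj_I]
  · rw [boundaryForm_smul_right]
  · rw [hG.ness_testVec hA hB hD hU hω, hG.sum_integral_sq hD]
    congr 3
    have h := M.condensatePhase.map_add ((s : ℝ) • p) ((t : ℝ) • q)
    rw [map_smul, map_smul] at h
    exact_mod_cast h

/-- The vectors (1) and (ξ) are orthogonal, so the commutator terms vanish. The two correlations are
then conjugate to each other, and iλ(A - Ā) = -2λ Im A. -/
theorem IsFormBoundary.hasCurrent {G : Fin N → ℝ → ℂ} (hG : M.IsFormBoundary G)
    (hA : M.CondA) (hB : M.CondB) (hD : M.CondD) {U : ℝ → M.Space →L[ℂ] M.Space}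
    (hU : IsUnitaryGroupOf M.ham U) {ω : M.Space → ℂ} (hω : M.IsNESS U ω) {p q : Param N}
    {l : Fin N} {ξ : (M.res l).Space} (hp : M.testVec p = M.atom 1)
    (hq : M.testVec q = M.single l ξ) :
    M.HasCurrent ω l ξ ((-(2 * M.coupling * (M.boundaryForm G p q
      + conj (M.condensateForm p) * M.condensateForm q / 2).im) : ℝ) : ℂ) := by
  have h0 : inner ℂ (M.atom 1) (M.single l ξ) = 0 := by
    rw [inner_eq]
    simp [atom, single, fst_vec, comp_vec]
  have h0' : inner ℂ (M.single l ξ) (M.atom 1) = 0 := by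
    rw [← inner_conj_symm, h0, map_zero]
  have h1 := hG.hasAnnihilationCreation hA hB hD hU hω p q
  have h2 := hG.hasAnnihilationCreation hA hB hD hU hω q p
  rw [hp, hq, h0, zero_div, add_zero] at h1
  rw [hp, hq, h0', zero_div, add_zero] at h2
  refine ⟨_, _, h1, h2, ?_⟩
  set A := M.boundaryForm G p q + conj (M.condensateForm p) * M.condensateForm q / 2 with hAdef
  have h3 : M.boundaryForm G q p + conj (M.condensateForm q) * M.condensateForm p / 2 = conj A := by
    rw [hAdef, map_add, conj_boundaryForm, map_div₀, map_mul, Complex.conj_conj, map_ofNat,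
      mul_comm (M.condensateForm p)]
  rw [h3]
  have h4 := Complex.sub_conj A
  push_cast at h4 ⊢
  linear_combination (-Complex.I * M.coupling) * h4
    + (-2 * M.coupling * A.im) * Complex.I_mul_I

end Model

/-! ### Elementary inequalities for the entropy flux -/

theorem planck_sub_mul_nonneg {β β' μ μ' : ℝ} (hβ : 0 < β) (hβ' : 0 < β') (hμ : μ ≤ 0)
    (hμ' : μ' ≤ 0) {ν : ℝ} (hν : 0 < ν) :
    0 ≤ (β' * (ν - μ') - β * (ν - μ)) * (planck β μ ν - planck β' μ' ν) := by
  have hx : 0 < β * (ν - μ) := mul_pos hβ (by linarith)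
  have hx' : 0 < β' * (ν - μ') := mul_pos hβ' (by linarith)
  have h1 := Real.one_lt_exp_iff.2 hx
  have h1' := Real.one_lt_exp_iff.2 hx'
  unfold planck
  -- 1/(e^x - 1) decreases in x > 0, so the two factors have the same sign.
  rcases le_total (β * (ν - μ)) (β' * (ν - μ')) with h | h
  · refine mul_nonneg (by linarith) (sub_nonneg.2 (inv_anti₀ (by linarith) ?_))
    linarith [Real.exp_le_exp.2 h]
  · refine mul_nonneg_of_nonpos_of_nonpos (by linarith) (sub_nonpos.2 (inv_anti₀ (by linarith) ?_))
    linarith [Real.exp_le_exp.2 h]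

theorem planck_sub_mul_pos {β β' μ μ' : ℝ} (hβ : 0 < β) (hβ' : 0 < β') (hμ : μ ≤ 0)
    (hμ' : μ' ≤ 0) {ν : ℝ} (hν : 0 < ν) (hne : β * (ν - μ) ≠ β' * (ν - μ')) :
    0 < (β' * (ν - μ') - β * (ν - μ)) * (planck β μ ν - planck β' μ' ν) := by
  refine (planck_sub_mul_nonneg hβ hβ' hμ hμ' hν).lt_of_ne' (mul_ne_zero ?_ ?_)
  · exact sub_ne_zero.2 hne.symm
  · intro h
    have h1 := inv_injective (sub_eq_zero.1 h)
    exact hne (Real.exp_injective (sub_left_injective h1))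

/-- Two different affine functions meet at most once. If β = β' then μ ≠ μ' and, as β > 0, they do
not meet at all. -/
theorem setOf_weightedEnergy_eq_subsingleton {β β' μ μ' : ℝ} (hβ : 0 < β)
    (hne : β ≠ β' ∨ μ ≠ μ') : {ν : ℝ | β * (ν - μ) = β' * (ν - μ')}.Subsingleton := by
  intro x hx y hy
  simp only [Set.mem_ofPred_eq] at hx hy
  have h1 : (β - β') * (x - y) = 0 := by linear_combination hx - hy
  rcases mul_eq_zero.1 h1 with h | h
  · have hβ' : β' = β := by linarith
    subst hβ'
    have := mul_left_cancel₀ hβ.ne' hx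
    rcases hne with hne | hne
    · exact absurd rfl hne
    · exact absurd (by linarith) hne
  · linarith

/-- Symmetrization of the sum over pairs of reservoirs of the entropy fluxes. -/
theorem sum_flux_eq {ι : Type*} [Fintype ι] (x r n : ι → ℝ) [DecidableEq ι] :
    ∑ l, ∑ k, x l * ((if k = l then -∑ j, r j else 0) + r l) * (r k * n k)
      = (1 / 2) * ∑ l, ∑ k, r l * r k * ((x l - x k) * (n k - n l)) := by
  -- The diagonal term -∑ r_j replaces n_k by n_k - n_l. Averaging with the sum in which l and k are
  -- exchanged then produces x_l - x_k.
  have h1 : ∀ l, ∑ k, x l * ((if k = l then -∑ j, r j else 0) + r l) * (r k * n k)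
      = ∑ k, x l * r l * r k * (n k - n l) := by
    intro l
    have : ∀ k, x l * ((if k = l then -∑ j, r j else 0) + r l) * (r k * n k)
        = (if k = l then -(x l * (∑ j, r j) * (r k * n k)) else 0)
          + x l * r l * (r k * n k) := by
      intro k
      split_ifs <;> ring
    simp only [this]
    rw [Finset.sum_add_distrib, Finset.sum_ite_eq' Finset.univ l, if_pos (Finset.mem_univ _),
      Finset.mul_sum, Finset.sum_mul, ← Finset.sum_neg_distrib, ← Finset.sum_add_distrib]
    exact Finset.sum_congr rfl fun k _ => by ring
  have h2 : ∑ l, ∑ k, x l * r l * r k * (n k - n l)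
      = ∑ l, ∑ k, x k * r k * r l * (n l - n k) := Finset.sum_comm
  have h3 : ∑ l, ∑ k, r l * r k * ((x l - x k) * (n k - n l))
      = ∑ l, ∑ k, x l * r l * r k * (n k - n l) + ∑ l, ∑ k, x k * r k * r l * (n l - n k) := by
    simp only [← Finset.sum_add_distrib]
    exact Finset.sum_congr rfl fun l _ => Finset.sum_congr rfl fun k _ => by ring
  simp only [h1]
  rw [h3, ← h2]
  ring

/-! ### Explicit fluxes and the cancellation of the condensates -/

namespace Model

variable {N : ℕ}

/-- The parameters of the vector `(1, 0, …, 0)`. -/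
def atomParam : Param N := (1, 0, 0)

/-- The parameters of the vector `(a g_l + b h_{0,l} g_l)` in the `l`-th reservoir. -/
def fluxParam (l : Fin N) (a b : ℂ) : Param N := (0, Pi.single l a, Pi.single l b)

theorem fluxParam_eq (l : Fin N) (a b : ℂ) :
    fluxParam l a b = a • fluxParam l 1 0 + b • fluxParam l 0 1 := by
  simp [fluxParam, ← Pi.single_smul]

variable (M : Model N)

theorem testVec_atomParam : M.testVec atomParam = M.atom 1 := by
  change M.vec _ _ = M.vec _ _
  congr 1
  funext k
  simp [atomParam]

theorem testVec_fluxParam (l : Fin N) (a b : ℂ) : M.testVec (fluxParam l a b)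
    = M.single l (a • M.g l + b • (M.res l).ham ⟨M.g l, M.g_mem l⟩) := by
  change M.vec _ _ = M.vec _ _
  congr 1
  funext k
  rcases eq_or_ne k l with rfl | h
  · simp [fluxParam]
  · simp [fluxParam, h]

theorem amp_atomParam (z : ℂ) (G : Fin N → ℂ) : M.amp atomParam z G = 1 := by
  simp [amp, atomParam]

theorem amp_fluxParam (l : Fin N) (a b z : ℂ) (G : Fin N → ℂ) : M.amp (fluxParam l a b) z G
    = M.coupling * (a * G l + b * (z * G l - (‖M.g l‖ : ℂ) ^ 2)) := by
  rw [amp, Finset.sum_eq_single l]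
  · simp [fluxParam]
  · intro j _ hj
    simp [fluxParam, hj]
  · simp

/-- At zero energy η and the Stieltjes transforms have real limits, so the coefficient is real: the
factor i cancels the -i of the Laplace transform. -/
theorem zeroVec_atomParam (k : Fin N) :
    M.zeroVec atomParam k = ((M.coupling / M.etaZero : ℝ) : ℂ) := by
  rw [zeroVec, zeroAmp, amp_atomParam]
  simp only [atomParam, Pi.zero_apply]
  push_cast
  linear_combination (-(M.coupling : ℂ) / M.etaZero) * Complex.I_mul_I

theorem zeroVec_fluxParam (l : Fin N) (a b : ℝ) (k : Fin N) : M.zeroVec (fluxParam l a b) k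
    = (((if k = l then a else 0)
      - M.coupling ^ 2 * (a * M.invMoment l + b * ‖M.g l‖ ^ 2) / M.etaZero : ℝ) : ℂ) := by
  have h : (Pi.single l (a : ℂ) : Fin N → ℂ) k = ((if k = l then a else 0 : ℝ) : ℂ) := by
    rw [Pi.single_apply]
    split_ifs <;> simp
  rw [zeroVec, zeroAmp, amp_fluxParam]
  simp only [fluxParam]
  rw [h]
  push_cast
  linear_combination ((M.coupling : ℂ) ^ 2 * (a * M.invMoment l + b * ‖M.g l‖ ^ 2) / M.etaZero)
    * Complex.I_mul_I

/-- With τ the sum of the condensate coefficients, the form at (1) is a real multiple of τ. The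
energy flux vector is also a real multiple of τ, since ν g_l vanishes at zero energy. The particle
flux vector has an extra l-th coefficient, which μ_l annihilates. What is left is a real multiple of
|τ|²: condensates may carry particle currents, but no entropy. -/
theorem im_condensate (l : Fin N) :
    (conj (M.condensateForm atomParam) * (M.condensateForm (fluxParam l 0 1)
      - M.μ l * M.condensateForm (fluxParam l 1 0))).im = 0 := by
  have h0 := M.condensateForm_of_real M.zeroVec_atomParam
  have h1 := M.condensateForm_of_real (M.zeroVec_fluxParam l 1 0)
  have h2 := M.condensateForm_of_real (M.zeroVec_fluxParam l 0 1)
  have hs : ∀ (a y : ℝ), ∑ k, (((if k = l then a else 0) - y : ℝ) : ℂ) * M.condensateCoeff k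
      = a * M.condensateCoeff l - y * ∑ k, M.condensateCoeff k := by
    intro a y
    rw [Finset.mul_sum]
    have : ∀ k, (((if k = l then a else 0) - y : ℝ) : ℂ) * M.condensateCoeff k
        = (if k = l then a * M.condensateCoeff k else 0) - y * M.condensateCoeff k := by
      intro k
      split_ifs <;> push_cast <;> ring
    simp only [this]
    rw [Finset.sum_sub_distrib, Finset.sum_ite_eq' Finset.univ l, if_pos (Finset.mem_univ _)]
  rw [hs] at h1 h2
  rw [← Finset.mul_sum] at h0
  simp only [Complex.ofReal_one, Complex.ofReal_zero] at h1 h2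
  set τ := ∑ k, M.condensateCoeff k
  have hμ := M.mu_mul_condensateCoeff l
  rw [h0, h1, h2, map_mul, Complex.conj_ofReal]
  generalize M.coupling ^ 2 * (0 * M.invMoment l + 1 * ‖M.g l‖ ^ 2) / M.etaZero = y
  generalize M.coupling ^ 2 * (1 * M.invMoment l + 0 * ‖M.g l‖ ^ 2) / M.etaZero = y'
  generalize M.coupling / M.etaZero = x
  have : (x : ℂ) * conj τ * (0 * M.condensateCoeff l - y * τ
      - M.μ l * (1 * M.condensateCoeff l - y' * τ))
      = ((x * (M.μ l * y' - y) * Complex.normSq τ : ℝ) : ℂ) := by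
    have := Complex.mul_conj τ
    push_cast
    linear_combination (-(x : ℂ) * conj τ) * hμ + (x * (M.μ l * y' - y)) * this
  rw [this, Complex.ofReal_im]

theorem boundaryVec_atomParam (G : Fin N → ℝ → ℂ) (k : Fin N) (ν : ℝ) :
    M.boundaryVec G atomParam k ν = M.coupling / M.boundaryEta G ν := by
  rw [boundaryVec, boundaryAmp, amp_atomParam]
  simp only [atomParam, Pi.zero_apply]
  linear_combination (-(M.coupling : ℂ) / M.boundaryEta G ν) * Complex.I_mul_I

theorem boundaryVec_fluxParam (G : Fin N → ℝ → ℂ) (l : Fin N) (a : ℂ) (k : Fin N) (ν : ℝ) :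
    M.boundaryVec G (fluxParam l (-a) 1) k ν = (if k = l then ν - a else 0)
      + M.coupling ^ 2 * ((ν - a) * G l ν - (‖M.g l‖ : ℂ) ^ 2) / M.boundaryEta G ν := by
  have h : ∀ c : ℂ, (Pi.single l c : Fin N → ℂ) k = if k = l then c else 0 := fun c => by
    rw [Pi.single_apply]
  rw [boundaryVec, boundaryAmp, amp_fluxParam]
  simp only [fluxParam, h]
  have h2 : (if k = l then -a else 0) + (if k = l then (1 : ℂ) else 0) * ν
      = if k = l then ν - a else 0 := by
    split_ifs <;> ring
  rw [h2]
  linear_combination (-(M.coupling : ℂ) ^ 2 * ((ν - a) * G l ν - (‖M.g l‖ : ℂ) ^ 2)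
    / M.boundaryEta G ν) * Complex.I_mul_I

theorem im_boundaryEta (G : Fin N → ℝ → ℂ) (ν : ℝ) :
    (M.boundaryEta G ν).im = -(M.coupling ^ 2 * ∑ k, (G k ν).im) := by
  have h : ((M.coupling : ℂ) ^ 2 * ∑ k, G k ν).im = M.coupling ^ 2 * ∑ k, (G k ν).im := by
    rw [← Complex.ofReal_pow, Complex.im_ofReal_mul, Complex.im_sum]
  rw [boundaryEta, Complex.sub_im, h]
  simp

/-- Multiplying by the conjugate of λ/η leaves a real prefactor times the imaginary part of (ν -
a)(δ_{kl} η + λ² G_l), because ‖g_l‖² is real. Then Im η = -λ² ∑ Im G_j, which is conservation of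
flux. -/
theorem im_flux (G : Fin N → ℝ → ℂ) (l k : Fin N) (a : ℝ) {ν : ℝ} (h0 : M.boundaryEta G ν ≠ 0) :
    (conj (M.boundaryVec G atomParam k ν) * M.boundaryVec G (fluxParam l (-a) 1) k ν).im
      = M.coupling ^ 3 / ‖M.boundaryEta G ν‖ ^ 2 * ((ν - a)
        * ((if k = l then -∑ j, (G j ν).im else 0) + (G l ν).im)) := by
  rw [boundaryVec_atomParam, boundaryVec_fluxParam]
  have hi := M.im_boundaryEta G ν
  set η := M.boundaryEta G ν
  have hn : (Complex.normSq η : ℂ) ≠ 0 := by exact_mod_cast (Complex.normSq_pos.2 h0).ne'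
  have hc : conj ((M.coupling : ℂ) / η) = M.coupling * η / Complex.normSq η := by
    have hc0 : conj η ≠ 0 := by simpa using h0
    rw [map_div₀, Complex.conj_ofReal, ← Complex.mul_conj]
    field_simp
  have h1 : conj ((M.coupling : ℂ) / η) * ((if k = l then (ν : ℂ) - a else 0)
      + M.coupling ^ 2 * ((ν - a) * G l ν - (‖M.g l‖ : ℂ) ^ 2) / η)
      = ((M.coupling / Complex.normSq η : ℝ) : ℂ) * (((if k = l then ν - a else 0 : ℝ) : ℂ) * η
        + ((M.coupling ^ 2 : ℝ) : ℂ) * (((ν - a : ℝ) : ℂ) * G l ν - ((‖M.g l‖ ^ 2 : ℝ) : ℂ))) := by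
    rw [hc]
    split_ifs <;> push_cast <;> field_simp
  rw [h1, Complex.im_ofReal_mul, Complex.add_im, Complex.im_ofReal_mul, Complex.im_ofReal_mul,
    Complex.sub_im, Complex.im_ofReal_mul, Complex.ofReal_im, hi, ← Complex.normSq_eq_norm_sq]
  split_ifs <;> ring

end Model

/-! ### The symmetrized entropy production rate -/

namespace Model

variable {N : ℕ} (M : Model N)

/-- The density of the measure `bathMeasure` with respect to the Lebesgue measure. -/
def bathWeight (G : Fin N → ℝ → ℂ) (k : Fin N) (ν : ℝ) : ℝ :=
  (G k ν).im / Real.pi * (planck (M.β k) (M.μ k) ν + 1 / 2)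

/-- The entropy production rate per unit of energy, up to a factor. -/
def entropyDensity (G : Fin N → ℝ → ℂ) (ν : ℝ) : ℝ :=
  M.coupling ^ 3 / ‖M.boundaryEta G ν‖ ^ 2 / Real.pi * ((1 / 2) * ∑ l, ∑ k,
    (G l ν).im * (G k ν).im * ((M.β l * (ν - M.μ l) - M.β k * (ν - M.μ k))
      * (planck (M.β k) (M.μ k) ν - planck (M.β l) (M.μ l) ν)))

variable {M}

namespace IsFormBoundary

/-- The Bose integrand is infinite at ν ≤ 0, so the form measures and hence their densities live on
positive energies, where the Planck weights are nonnegative. -/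
theorem ae_pos_of_im_ne_zero {G : Fin N → ℝ → ℂ} (hG : M.IsFormBoundary G) (hD : M.CondD) :
    ∀ᵐ ν : ℝ, ∀ k, 0 ≤ (G k ν).im ∧ ((G k ν).im ≠ 0 → 0 < ν) := by
  rw [ae_all_iff]
  intro k
  have h1 := M.ae_formMeasure_pos hD k
  have hm : Measurable fun ν => ENNReal.ofReal ((G k ν).im / Real.pi) := by
    have := hG.measurable k
    fun_prop
  rw [hG.formMeasure_eq k, ae_withDensity_iff hm] at h1
  filter_upwards [h1, hG.im_nonneg] with ν h hr
  refine ⟨hr k, fun h0 => h ?_⟩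
  have : 0 < (G k ν).im / Real.pi := div_pos ((hr k).lt_of_ne' h0) Real.pi_pos
  simpa using this

theorem bathWeight_nonneg {G : Fin N → ℝ → ℂ} {ν : ℝ} {k : Fin N}
    (h : 0 ≤ (G k ν).im ∧ ((G k ν).im ≠ 0 → 0 < ν)) : 0 ≤ M.bathWeight G k ν := by
  unfold bathWeight
  rcases eq_or_ne (G k ν).im 0 with h0 | h0
  · simp [h0]
  · have := planck_nonneg (M.β_pos k) (M.μ_nonpos k) (h.2 h0)
    have := Real.pi_pos
    have := h.1
    positivity

theorem measurable_bathWeight {G : Fin N → ℝ → ℂ} (hG : M.IsFormBoundary G) (k : Fin N) :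
    Measurable (M.bathWeight G k) := by
  have := hG.measurable k
  have := measurable_planck (M.β k) (M.μ k)
  unfold bathWeight
  fun_prop

theorem bathMeasure_eq_bathWeight {G : Fin N → ℝ → ℂ} (hG : M.IsFormBoundary G) (k : Fin N) :
    M.bathMeasure k = volume.withDensity fun ν => ENNReal.ofReal (M.bathWeight G k ν) := by
  rw [hG.bathMeasure_eq]
  refine withDensity_congr_ae ?_
  filter_upwards [hG.im_nonneg] with ν hr
  rw [bathWeight, ENNReal.ofReal_mul (div_nonneg (hr k) Real.pi_pos.le)]
  rfl

theorem integral_bathMeasure {G : Fin N → ℝ → ℂ} (hG : M.IsFormBoundary G) (hD : M.CondD)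
    (k : Fin N) (f : ℝ → ℝ) :
    ∫ ν, f ν ∂(M.bathMeasure k) = ∫ ν, M.bathWeight G k ν * f ν := by
  rw [hG.bathMeasure_eq_bathWeight, integral_withDensity_eq_integral_toReal_smul
    (hG.measurable_bathWeight k).ennreal_ofReal (ae_of_all _ fun _ => ENNReal.ofReal_lt_top)]
  refine integral_congr_ae ?_
  filter_upwards [hG.ae_pos_of_im_ne_zero hD] with ν h
  rw [ENNReal.toReal_ofReal (bathWeight_nonneg (h k)), smul_eq_mul]

theorem integrable_bathWeight_mul {G : Fin N → ℝ → ℂ} (hG : M.IsFormBoundary G) (hD : M.CondD)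
    (k : Fin N) {f : ℝ → ℝ} (hf : Integrable f (M.bathMeasure k)) :
    Integrable fun ν => M.bathWeight G k ν * f ν := by
  rw [hG.bathMeasure_eq_bathWeight, integrable_withDensity_iff_integrable_smul'
    (hG.measurable_bathWeight k).ennreal_ofReal (ae_of_all _ fun _ => ENNReal.ofReal_lt_top)] at hf
  refine hf.congr ?_
  filter_upwards [hG.ae_pos_of_im_ne_zero hD] with ν h
  rw [ENNReal.toReal_ofReal (bathWeight_nonneg (h k)), smul_eq_mul]

theorem ae_boundaryEta_ne_zero {G : Fin N → ℝ → ℂ} (hG : M.IsFormBoundary G) :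
    ∀ᵐ ν : ℝ, M.boundaryEta G ν ≠ 0 := by
  obtain ⟨c, hc, h⟩ := hG.le_norm_eta
  filter_upwards [h] with ν hν
  rw [← norm_pos_iff]
  exact (mul_pos hc (by positivity)).trans_le hν

theorem boundaryForm_fluxParam {G : Fin N → ℝ → ℂ} (hG : M.IsFormBoundary G) (hD : M.CondD)
    (p : Param N) (l : Fin N) (a : ℂ) : M.boundaryForm G p (fluxParam l (-a) 1)
      = M.boundaryForm G p (fluxParam l 0 1) - a * M.boundaryForm G p (fluxParam l 1 0) := by
  rw [fluxParam_eq]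
  simp only [boundaryForm, boundaryVec_comb]
  rw [Finset.mul_sum, ← Finset.sum_sub_distrib]
  refine Finset.sum_congr rfl fun k _ => ?_
  rw [← integral_const_mul, ← integral_sub (hG.integrable_conj_mul hD _ _ k)
    ((hG.integrable_conj_mul hD _ _ k).const_mul a)]
  refine integral_congr_ae (Eventually.of_forall fun ν => ?_)
  dsimp only
  ring

/-- All fluxes are written as integrals against Lebesgue measure, so that `sum_flux_eq` can be
applied at each energy. The vacuum contribution 1/2 cancels in the differences. -/
theorem integral_entropyDensity {G : Fin N → ℝ → ℂ} (hG : M.IsFormBoundary G) (hD : M.CondD) :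
    Integrable (M.entropyDensity G) ∧ ∑ l, M.β l
      * (M.boundaryForm G atomParam (fluxParam l (-(M.μ l : ℂ)) 1)).im
      = ∫ ν, M.entropyDensity G ν := by
  set F : Fin N → Fin N → ℝ → ℝ := fun l k ν => (conj (M.boundaryVec G atomParam k ν)
    * M.boundaryVec G (fluxParam l (-(M.μ l : ℂ)) 1) k ν).im with hF
  have hFi : ∀ l k, Integrable (F l k) (M.bathMeasure k) := fun l k =>
    (hG.integrable_conj_mul hD atomParam (fluxParam l (-(M.μ l : ℂ)) 1) k).im
  have hi : ∀ l k, Integrable fun ν => M.β l * (M.bathWeight G k ν * F l k ν) := fun l k =>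
    (hG.integrable_bathWeight_mul hD k (hFi l k)).const_mul _
  have hsum : Integrable fun ν => ∑ l, ∑ k, M.β l * (M.bathWeight G k ν * F l k ν) :=
    integrable_finsetSum _ fun l _ => integrable_finsetSum _ fun k _ => hi l k
  have hae : (fun ν => ∑ l, ∑ k, M.β l * (M.bathWeight G k ν * F l k ν))
      =ᵐ[volume] M.entropyDensity G := by
    filter_upwards [hG.ae_boundaryEta_ne_zero] with ν h0
    have h1 := sum_flux_eq (fun l => M.β l * (ν - M.μ l)) (fun l => (G l ν).im)
      (fun l => planck (M.β l) (M.μ l) ν + 1 / 2)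
    simp only [add_sub_add_right_eq_sub] at h1
    rw [entropyDensity, ← h1, Finset.mul_sum]
    refine Finset.sum_congr rfl fun l _ => ?_
    rw [Finset.mul_sum]
    refine Finset.sum_congr rfl fun k _ => ?_
    simp only [hF]
    rw [M.im_flux G l k (M.μ l) h0, bathWeight]
    ring
  refine ⟨hsum.congr hae, ?_⟩
  rw [← integral_congr_ae hae, integral_finsetSum _ fun l _ =>
    integrable_finsetSum _ fun k _ => hi l k]
  refine Finset.sum_congr rfl fun l _ => ?_
  rw [integral_finsetSum _ fun k _ => hi l k, boundaryForm, Complex.im_sum, Finset.mul_sum]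
  refine Finset.sum_congr rfl fun k _ => ?_
  rw [integral_const_mul, ← hG.integral_bathMeasure hD]
  congr 1
  exact (integral_im (hG.integrable_conj_mul hD atomParam
    (fluxParam l (-(M.μ l : ℂ)) 1) k)).symm

/-- Monotonicity of the Planck weights requires ν > 0, which holds wherever Im G_k does not vanish;
elsewhere the term is zero. -/
theorem pairFlux_nonneg {G : Fin N → ℝ → ℂ} {ν : ℝ}
    (h : ∀ k, 0 ≤ (G k ν).im ∧ ((G k ν).im ≠ 0 → 0 < ν)) (l k : Fin N) :
    0 ≤ (G l ν).im * (G k ν).im * ((M.β l * (ν - M.μ l) - M.β k * (ν - M.μ k))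
      * (planck (M.β k) (M.μ k) ν - planck (M.β l) (M.μ l) ν)) := by
  rcases eq_or_ne (G k ν).im 0 with h0 | h0
  · simp [h0]
  · exact mul_nonneg (mul_nonneg (h l).1 (h k).1) (planck_sub_mul_nonneg (M.β_pos k) (M.β_pos l)
      (M.μ_nonpos k) (M.μ_nonpos l) ((h k).2 h0))

theorem formDensity_eq {G : Fin N → ℝ → ℂ} (hG : M.IsFormBoundary G) :
    ∀ᵐ ν : ℝ, ∀ k, M.formDensity k ν = (G k ν).im / Real.pi := by
  rw [ae_all_iff]
  intro k
  have hm : Measurable fun ν => ENNReal.ofReal ((G k ν).im / Real.pi) := by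
    have := hG.measurable k
    fun_prop
  have h := Measure.rnDeriv_withDensity volume hm
  rw [← hG.formMeasure_eq k] at h
  filter_upwards [h, hG.im_nonneg] with ν hν hr
  rw [formDensity, hν, ENNReal.toReal_ofReal (div_nonneg (hr k) Real.pi_pos.le)]

/-- Up to a null set, which contains the at most one energy where the two x coincide, the channel
set lies in the support of the nonnegative density: there the (l, k) term is positive. Comparison in
outer measure avoids any question of measurability of the channel set. -/
theorem integral_entropyDensity_pos {G : Fin N → ℝ → ℂ} (hG : M.IsFormBoundary G) (hD : M.CondD)
    {k l : Fin N} (hopen : M.OpenChannel k l) (hne : M.β k ≠ M.β l ∨ M.μ k ≠ M.μ l) :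
    0 < ∫ ν, M.entropyDensity G ν := by
  have hl := M.coupling_pos
  have hpi := Real.pi_pos
  have hnn : 0 ≤ᵐ[volume] M.entropyDensity G := by
    filter_upwards [hG.ae_pos_of_im_ne_zero hD] with ν h
    refine mul_nonneg (by positivity) (mul_nonneg (by norm_num) ?_)
    exact Finset.sum_nonneg fun l _ => Finset.sum_nonneg fun k _ => pairFlux_nonneg h l k
  rw [integral_pos_iff_support_of_nonneg_ae hnn (hG.integral_entropyDensity hD).1]
  refine lt_of_lt_of_le hopen (measure_mono_ae ?_)
  have hcross : ∀ᵐ ν : ℝ, M.β k * (ν - M.μ k) ≠ M.β l * (ν - M.μ l) := by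
    have := (setOf_weightedEnergy_eq_subsingleton (M.β_pos k) hne).measure_zero (volume : Measure ℝ)
    rw [ae_iff]
    simpa using this
  filter_upwards [hG.ae_pos_of_im_ne_zero hD, hG.formDensity_eq, hcross,
    hG.ae_boundaryEta_ne_zero] with ν h hd hc h0 hν
  have hpos : 0 < 1 / ‖M.etaMinus ν‖ ^ 2 * M.formDensity k ν * M.formDensity l ν := hν.2
  rw [hd, hd] at hpos
  have hk : (G k ν).im ≠ 0 := by
    intro hz
    simp [hz] at hpos
  have hl' : (G l ν).im ≠ 0 := by
    intro hz
    simp [hz] at hpos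
  have hk0 := (h k).1.lt_of_ne' hk
  have hl0 := (h l).1.lt_of_ne' hl'
  have hη : 0 < ‖M.boundaryEta G ν‖ := norm_pos_iff.2 h0
  have hs : 0 < ∑ l, ∑ k, (G l ν).im * (G k ν).im
      * ((M.β l * (ν - M.μ l) - M.β k * (ν - M.μ k))
        * (planck (M.β k) (M.μ k) ν - planck (M.β l) (M.μ l) ν)) := by
    refine Finset.sum_pos' (fun l _ => Finset.sum_nonneg fun k _ => pairFlux_nonneg h l k)
      ⟨l, Finset.mem_univ l, Finset.sum_pos' (fun k _ => pairFlux_nonneg h l k)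
        ⟨k, Finset.mem_univ k, ?_⟩⟩
    exact mul_pos (mul_pos hl0 hk0) (planck_sub_mul_pos (M.β_pos k) (M.β_pos l)
      (M.μ_nonpos k) (M.μ_nonpos l) ((h k).2 hk) hc)
  have : 0 < M.entropyDensity G ν := by
    unfold entropyDensity
    positivity
  exact this.ne'

/-- By linearity E_l - μ_l J_l corresponds to the vector (h_{0,l} - μ_l)g_l. The condensate part is
removed by `im_condensate`, and the minus sign of σ cancels the one in the currents -2λ Im A. -/
theorem hasEntropyProduction {G : Fin N → ℝ → ℂ} (hG : M.IsFormBoundary G)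
    (hA : M.CondA) (hB : M.CondB) (hD : M.CondD) {U : ℝ → M.Space →L[ℂ] M.Space}
    (hU : IsUnitaryGroupOf M.ham U) {ω : M.Space → ℂ} (hω : M.IsNESS U ω) :
    M.HasEntropyProduction ω (2 * M.coupling * ∫ ν, M.entropyDensity G ν) := by
  have hJ : ∀ l, M.testVec (fluxParam l 1 0) = M.single l (M.g l) := fun l => by
    rw [testVec_fluxParam, one_smul, zero_smul, add_zero]
  have hE : ∀ l, M.testVec (fluxParam l 0 1)
      = M.single l ((M.res l).ham ⟨M.g l, M.g_mem l⟩) := fun l => by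
    rw [testVec_fluxParam, one_smul, zero_smul, zero_add]
  refine ⟨_, _, fun l => hG.hasCurrent hA hB hD hU hω M.testVec_atomParam (hJ l),
    fun l => hG.hasCurrent hA hB hD hU hω M.testVec_atomParam (hE l), ?_⟩
  rw [← (hG.integral_entropyDensity hD).2]
  norm_cast
  rw [Finset.mul_sum, ← Finset.sum_neg_distrib]
  refine Finset.sum_congr rfl fun l _ => ?_
  have h1 := M.im_condensate l
  rw [mul_sub, mul_left_comm, Complex.sub_im, Complex.im_ofReal_mul] at h1
  rw [Complex.ofReal_neg, hG.boundaryForm_fluxParam hD, Complex.sub_im, Complex.im_ofReal_mul, Complex.add_im,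
    Complex.add_im, Complex.div_ofNat_im, Complex.div_ofNat_im]
  linear_combination (-M.coupling * M.β l) * h1

end IsFormBoundary

end Model

end Josephson

end

theorem mainTheorem3 {N : ℕ} (M : Josephson.Model N)
    (hA : M.CondA) (hB : M.CondB) (hD : M.CondD)
    (U : ℝ → M.Space →L[ℂ] M.Space) (hU : Josephson.IsUnitaryGroupOf M.ham U)
    (ω : M.Space → ℂ) (hω : M.IsNESS U ω)
    (k l : Fin N) (hopen : M.OpenChannel k l) (hne : M.β k ≠ M.β l ∨ M.μ k ≠ M.μ l) :
    ∃ e : ℝ, M.HasEntropyProduction ω e ∧ 0 < e := by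
  obtain ⟨G, hG⟩ := M.exists_isFormBoundary hA hB
  exact ⟨_, hG.hasEntropyProduction hA hB hD hU hω,
    mul_pos (mul_pos two_pos M.coupling_pos) (hG.integral_entropyDensity_pos hD hopen hne)⟩
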